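/- **Proposition 3.8.** Let $m>1$, $1<p<N$ with $N\in\mathbb N$, $m(p-1)>1$, $1<s_0\le s<\infty$, $\mathcal S_p>0$ and $\mathcal C_p>0$. There is a constant $C>0$, depending only on $N,p,m,s_0,s,\mathcal S_p,\mathcal C_p$, such that for every $q>m(p-1)$ there is $\varepsilon_1>0$, depending only on these parameters and on $q$, for which the following holds. Let $(M,g)$ be a complete, non-compact (connected, smooth) Riemannian manifold of dimension $N$ and of infinite volume, with Riemannian measure $\mu$, on which the Sobolev and the Poincaré inequality hold with the constants $\mathcal S_p$, $\mathcal C_p$: $$\|v\|_{L^{pN/(N-p)}(M)}\le \frac1{\mathcal S_p}\|\nabla v\|_{L^p(M)},\qquad \|v\|_{L^p(M)}\le\frac1{\mathcal C_p}\|\nabla v\|_{L^p(M)}\qquad\text{for all } v\in C_c^\infty(M).$$ Let $B_R$ be a geodesic ball of radius $R>0$ in $M$, let $\varepsilon>0$, $k>0$, and let $T_k(\sigma)=\max\{-k,\min\{\sigma,k\}\}$. Let $u_0\in L^\infty(B_R)$, $u_0\ge 0$, and let $u\ge0$ be a weak solution of $$u_t=\Delta_p u^m+\varepsilon\Delta u+T_k(u^q)\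 \text{ in } B_R\times(0,\infty),\qquad u=0\ \text{ on }\partial B_R\times(0,\infty),\qquad u=u_0\ \text{ in } B_R\times\{0\},$$ that is, $u\in L^\infty(B_R\times(0,\infty))$, and for every $T>0$ one has $u^m\in L^p((0,T);W^{1,p}_0(B_R))$, $u\in L^2((0,T);W^{1,2}_0(B_R))$ and $$-\int_0^T\!\!\int_{B_R}u\,\varphi_t\,d\mu\,dt+\int_0^T\!\!\int_{B_R}|\nabla u^m|^{p-2}\langle\nabla u^m,\nabla\varphi\rangle\,d\mu\,dt+\varepsilon\int_0^T\!\!\int_{B_R}\langle\nabla u,\nabla\varphi\rangle\,d\mu\,dt=\int_0^T\!\!\int_{B_R}T_k(u^q)\,\varphi\,d\mu\,dt+\int_{B_R}u_0(x)\,\varphi(x,0)\,d\mu$$ for every $\varphi\in C_c^\infty(B_R\times[0,T])$ with $\varphi(\cdot,T)=0$. Suppose in addition that $u\in C([0,T];L^r(B_R))$ for all $r\in(1,\infty)$ and all $T>0$. If $$\|u_0\|_{L^{qN/p}(B_R)}<\varepsilon_1,$$ then $$\|u(t)\|_{L^s(B_R)}\le C\,t^{-\gamma_s}\,\|u_0\|_{L^{s_0}(B_R)}^{s_0/s}\quad\text{for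 all } t>0,\qquad \gamma_s=\frac{s_0}{m(p-1)-1}\left(\frac1{s_0}-\frac1s\right).$$ -/

import Mathlib

open MeasureTheory Set Filter Topology Bundle
open scoped Manifold ContDiff ENNReal

/-!
Throughout, `M` is an `N`-dimensional smooth manifold modelled on `EuclideanSpace ℝ (Fin N)`, whose
tangent spaces carry inner products (`RiemannianBundle`).
-/

noncomputable section

namespace Leibenson

/-- Countably many chart domains cover a second countable manifold. -/
theorem exists_chart_cover (N : ℕ) (M : Type*) [TopologicalSpace M]
    [ChartedSpace (EuclideanSpace ℝ (Fin N)) M] [SecondCountableTopology M] [Nonempty M] :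
    ∃ c : ℕ → M, (⋃ n, (chartAt (EuclideanSpace ℝ (Fin N)) (c n)).source) = univ := by
  obtain ⟨S, hS, hU⟩ := TopologicalSpace.countable_cover_nhds
    (fun x : M => chart_source_mem_nhds (EuclideanSpace ℝ (Fin N)) x)
  have hne : S.Nonempty := by
    rcases S.eq_empty_or_nonempty with h | h
    · subst h
      simp only [mem_empty_iff_false, iUnion_of_empty, iUnion_empty] at hU
      exact absurd hU.symm univ_nonempty.ne_empty
    · exact h
  obtain ⟨c, rfl⟩ := hS.exists_eq_range hne
  exact ⟨c, by simpa using hU⟩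

/-- The truncation `T_k(σ)`, which is `k` for `σ ≥ k`, `σ` for `|σ| < k`, `-k` for `σ ≤ -k`. -/
def truncation (k σ : ℝ) : ℝ := max (-k) (min σ k)

/-- The coordinate field `∂ᵢ = D(e⁻¹)(y) eᵢ` of the chart `e = chartAt c`, at a point `y` of the
target of the chart. -/
def coordField {N : ℕ} {M : Type*} [TopologicalSpace M]
    [ChartedSpace (EuclideanSpace ℝ (Fin N)) M] (c : M) (i : Fin N)
    (y : EuclideanSpace ℝ (Fin N)) :
    TangentSpace (𝓡 N) ((chartAt (EuclideanSpace ℝ (Fin N)) c).symm y) :=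
  let ei : TangentSpace (𝓡 N) y := EuclideanSpace.basisFun (Fin N) ℝ i
  mfderiv (𝓡 N) (𝓡 N) (chartAt (EuclideanSpace ℝ (Fin N)) c).symm y ei

section Riemannian

variable {N : ℕ} {M : Type*} [MetricSpace M] [ChartedSpace (EuclideanSpace ℝ (Fin N)) M]
  [RiemannianBundle (fun x : M => TangentSpace (𝓡 N) x)]

/-- The density `√(det g)` of the metric in the chart at `c`, at a point `y` of the target of the
chart: `g` is the Gram matrix of the coordinate fields at `y`. -/
def sqrtDetMetric (c : M) (y : EuclideanSpace ℝ (Fin N)) : ℝ :=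
  Real.sqrt (Matrix.gram ℝ fun i : Fin N => coordField c i y).det

/-- The Riemannian volume of the domain of the chart at `c`: the measure `√(det g) dy` on the target
of the chart, carried over to `M` (a measure on `M` which vanishes off the chart domain). -/
def chartVolume [MeasurableSpace M] (c : M) : Measure M :=
  Measure.map (chartAt (EuclideanSpace ℝ (Fin N)) c).symm
    ((volume.restrict (chartAt (EuclideanSpace ℝ (Fin N)) c).target).withDensity
      fun y => ENNReal.ofReal (sqrtDetMetric c y))

variable (N M) in
/-- The Riemannian measure of `M`: the measure which is `√(det g) dy` in every chart. It is put
together from a countable cover of `M` by domains of charts, cut into disjoint pieces. -/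
def riemannianMeasure [SecondCountableTopology M] [Nonempty M] [MeasurableSpace M] : Measure M :=
  let c : ℕ → M := (exists_chart_cover N M).choose
  Measure.sum fun n => (chartVolume (N := N) (c n)).restrict
    ((chartAt (EuclideanSpace ℝ (Fin N)) (c n)).source \
      ⋃ k < n, (chartAt (EuclideanSpace ℝ (Fin N)) (c k)).source)

/-- The Riemannian gradient of `v` at `x`: `⟨∇v(x), ξ⟩ = dv(x)ξ` for all tangent vectors `ξ`. -/
def grad (v : M → ℝ) (x : M) : TangentSpace (𝓡 N) x :=
  haveI : FiniteDimensional ℝ (TangentSpace (𝓡 N) x) :=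
    inferInstanceAs (FiniteDimensional ℝ (EuclideanSpace ℝ (Fin N)))
  haveI : CompleteSpace (TangentSpace (𝓡 N) x) := FiniteDimensional.complete ℝ _
  (InnerProductSpace.toDual ℝ (TangentSpace (𝓡 N) x)).symm
    (mfderiv (𝓡 N) 𝓘(ℝ, ℝ) v x)

variable (N) in
/-- `v ∈ C_c^∞(B)`: `v` is smooth on `M` and its support is compact and contained in `B`. -/
def IsTestFunction (B : Set M) (v : M → ℝ) : Prop :=
  ContMDiff (𝓡 N) 𝓘(ℝ, ℝ) ∞ v ∧ HasCompactSupport v ∧ tsupport v ⊆ B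

variable (N) in
/-- The functions on `B × [0, T]` (with time as the first variable) which are restrictions of smooth
functions with compact support in `ℝ × B`, i.e. `C_c^∞(B × [0, T])`, and vanish at time `T`. -/
def IsSpaceTimeTestFunction (B : Set M) (T : ℝ) (φ : ℝ × M → ℝ) : Prop :=
  ContMDiff (𝓘(ℝ, ℝ).prod (𝓡 N)) 𝓘(ℝ, ℝ) ∞ φ ∧ HasCompactSupport φ ∧
    tsupport φ ⊆ univ ×ˢ B ∧ ∀ x ∈ B, φ (T, x) = 0

variable [IsManifold (𝓡 N) ∞ M] [SecondCountableTopology M] [Nonempty M] [MeasurableSpace M]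

variable (N M) in
/-- The Sobolev inequality `‖v‖_{L^{p*}(M)} ≤ S⁻¹ ‖∇v‖_{L^p(M)}` for all `v ∈ C_c^∞(M)`, where
`p* = pN / (N - p)`. -/
def SobolevInequality (p S : ℝ) : Prop :=
  ∀ v : M → ℝ, IsTestFunction N univ v →
    eLpNorm v (ENNReal.ofReal (p * N / (N - p))) (riemannianMeasure N M) ≤
      ENNReal.ofReal (1 / S) *
        eLpNorm (fun x => ‖grad (N := N) v x‖) (ENNReal.ofReal p) (riemannianMeasure N M)

variable (N M) in
/-- The Poincaré inequality `‖v‖_{L^p(M)} ≤ C⁻¹ ‖∇v‖_{L^p(M)}` for all `v ∈ C_c^∞(M)`. -/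
def PoincareInequality (p C : ℝ) : Prop :=
  ∀ v : M → ℝ, IsTestFunction N univ v →
    eLpNorm v (ENNReal.ofReal p) (riemannianMeasure N M) ≤
      ENNReal.ofReal (1 / C) *
        eLpNorm (fun x => ‖grad (N := N) v x‖) (ENNReal.ofReal p) (riemannianMeasure N M)

/-- A (Borel) measurable time-dependent vector field on `M`. -/
def MeasurableField (G : ℝ → ∀ x : M, TangentSpace (𝓡 N) x) : Prop :=
  @Measurable (ℝ × M) (TangentBundle (𝓡 N) M) _ (borel _) fun z => ⟨z.2, G z.1 z.2⟩

/-- `w ∈ W₀^{1,p}(B)` with gradient `G`: the pair `(w, G)` is the limit in `L^p(B)` of `(φₙ, ∇φₙ)`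
for a sequence of `φₙ ∈ C_c^∞(B)`. To be used for measurable `w` and `G`. -/
def IsSobolevZero (p : ℝ) (B : Set M) (w : M → ℝ) (G : ∀ x : M, TangentSpace (𝓡 N) x) : Prop :=
  ∃ φ : ℕ → M → ℝ, (∀ n, IsTestFunction N B (φ n)) ∧
    Tendsto (fun n => ∫⁻ x in B, ‖φ n x - w x‖ₑ ^ p ∂(riemannianMeasure N M)) atTop (𝓝 0) ∧
    Tendsto (fun n => ∫⁻ x in B, ‖grad (N := N) (φ n) x - G x‖ₑ ^ p ∂(riemannianMeasure N M))
      atTop (𝓝 0)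

/-- `w ∈ L^p((0, T); W₀^{1,p}(B))` for every `T > 0`, with `∇w(t) = G(t)`. -/
structure MemLpSobolevZero (p : ℝ) (B : Set M) (w : ℝ → M → ℝ)
    (G : ℝ → ∀ x : M, TangentSpace (𝓡 N) x) : Prop where
  aestronglyMeasurable : AEStronglyMeasurable (fun z : ℝ × M => w z.1 z.2)
    ((volume.restrict (Ioi 0)).prod ((riemannianMeasure N M).restrict B))
  measurableField : MeasurableField G
  isSobolevZero : ∀ᵐ t ∂(volume.restrict (Ioi (0 : ℝ))), IsSobolevZero p B (w t) (G t)
  lintegral_lt_top : ∀ T : ℝ, 0 < T →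
    ∫⁻ t in Ioo 0 T, ∫⁻ x in B, (‖w t x‖ₑ ^ p + ‖G t x‖ₑ ^ p) ∂(riemannianMeasure N M) < ⊤

variable (N) in
/-- `u` is a (weak, non-negative) solution of
`u_t = Δ_p u^m + ε Δu + T_k(u^q)` in `B × (0, ∞)`, `u = 0` on `∂B × (0, ∞)`, `u(0) = u₀`.
`GV` and `GU` are the gradients of `u^m` and of `u`. -/
structure IsSolution (m p q ε k : ℝ) (B : Set M) (u₀ : M → ℝ) (u : ℝ → M → ℝ) : Prop where
  nonneg : ∀ᵐ z ∂((volume.restrict (Ioi (0 : ℝ))).prod ((riemannianMeasure N M).restrict B)),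
    0 ≤ u z.1 z.2
  bounded : MemLp (fun z : ℝ × M => u z.1 z.2) ∞
    ((volume.restrict (Ioi 0)).prod ((riemannianMeasure N M).restrict B))
  weak : ∃ GV GU : ℝ → ∀ x : M, TangentSpace (𝓡 N) x,
    MemLpSobolevZero p B (fun t x => u t x ^ m) GV ∧
    MemLpSobolevZero 2 B u GU ∧
    ∀ T : ℝ, 0 < T → ∀ φ : ℝ × M → ℝ, IsSpaceTimeTestFunction N B T φ →
      - (∫ t in (0)..T, ∫ x in B, u t x * deriv (fun τ => φ (τ, x)) t ∂(riemannianMeasure N M))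
        + (∫ t in (0)..T, ∫ x in B, ‖GV t x‖ ^ (p - 2) *
            inner ℝ (GV t x) (grad (fun y => φ (t, y)) x) ∂(riemannianMeasure N M))
        + ε * (∫ t in (0)..T, ∫ x in B,
            inner ℝ (GU t x) (grad (fun y => φ (t, y)) x) ∂(riemannianMeasure N M))
      = (∫ t in (0)..T, ∫ x in B, truncation k (u t x ^ q) * φ (t, x) ∂(riemannianMeasure N M))
        + ∫ x in B, u₀ x * φ (0, x) ∂(riemannianMeasure N M)

variable (N) in
/-- `u ∈ C([0, T]; L^r(B))` for every `T > 0`, where `u(t)` is the function `u t` for every `t`. -/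
def ContinuousInLp (r : ℝ) (B : Set M) (u : ℝ → M → ℝ) : Prop :=
  (∀ t : ℝ, 0 ≤ t → MemLp (u t) (ENNReal.ofReal r) ((riemannianMeasure N M).restrict B)) ∧
    ∀ t₀ : ℝ, 0 ≤ t₀ →
      Tendsto (fun t => eLpNorm (fun x => u t x - u t₀ x) (ENNReal.ofReal r)
        ((riemannianMeasure N M).restrict B)) (𝓝[Ici 0] t₀) (𝓝 0)

end Riemannian

end Leibenson

end

set_option linter.unusedSectionVars false
set_option linter.style.haveILetI false

noncomputable section

namespace Leibenson

/-! ### Smooth weights, their primitives, and truncated powers -/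

section Analysis

/-! Write M_r(t) for the integral of u(t)^r over the ball, and put δ = m(p-1) - 1 > 0. Formally,
testing the equation with u^(r-1), r > 1, gives (1/r) M_r' + c_r ∫|∇u^β|^p ≤ ∫u^(q+r-1) with β =
(m(p-1)+r-1)/p and c_r = (r-1) m^(p-1)/β^p: the viscous term has a sign and the truncation only
lowers the source. Hölder with three factors, combined with the Sobolev and Poincaré inequalities
for u^β, bounds the right side by a constant times (M_{qN/p})^θ ∫|∇u^β|^p, where θ > 0 and the
dissipation appears to the power one (`IsSlice.lintegral_rpow_le_of_sobolev`). So while M_{qN/p} is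
small, half of the dissipation absorbs the source and M_r does not increase. Taking r = qN/p shows
that the smallness never gets lost (`lt_of_continuousOn_of_le`).

For r = s₀ this makes M_{s₀} non-increasing. For r = s, Poincaré bounds the remaining half of the
dissipation below by M_{s+δ}, and interpolation of s between s₀ and s + δ gives M_s^(1+a) ≤ M_{s₀}^a
M_{s+δ} with a = δ/(s - s₀). Hence M_s' ≤ -κ M_s^(1+a) with κ proportional to M_{s₀}(0)^(-a), in
integrated form, and `rpow_decay` yields M_s(t) ≤ C M_{s₀}(0) t^(-1/a); the s-th root is the claim.
The smallness threshold depends on q, the final constant does not.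

Most of the work is to justify the test function u^(r-1), carried out in
`IsWeakEvolution.lintegral_rpow_add_le`. Powers are replaced by primitives F of smooth weights f
with compact support in (0, ∞), with Φ a primitive of F, and Fatou's lemma restores the powers at
the end. In time no chain rule is used: by convexity Φ(u(t)) - Φ(u(t-h)) ≤ F(u(t)) (u(t) - u(t-h)),
and the increment of u may be tested with the frozen function F(u(t)). Averaging over t and letting
h tend to 0 (`energy_le_of_increment_le`) needs only continuity of translations in time, applied for
almost every fixed x, where all gradients live in one Hilbert space.

In space, F(u) has to be approximated by test functions in W^{1,2} and W^{1,p} at once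
(`IsSobolevZero.exists_approx`), starting from u if p ≤ 2 and from u^m if p ≥ 2; weights vanishing
near 0 permit lowering the exponent. The gradients of u and of u^m are given independently of each
other, so the relation between them has to be proved. It follows from uniqueness of weak gradients
(`ae_eq_of_tendsto_grad`), which is Euclidean integration by parts in charts, once the Riemannian
measure is known to have a positive continuous density in every chart. -/

/-- Smooth non-negative functions whose support is a compact subset of `(0, ∞)`. -/
structure IsWeight (f : ℝ → ℝ) : Prop where
  contDiff : ContDiff ℝ ∞ f
  nonneg : ∀ s, 0 ≤ f s
  exists_support : ∃ δ L : ℝ, 0 < δ ∧ δ < L ∧ (∀ s ≤ δ, f s = 0) ∧ ∀ s, L ≤ s → f s = 0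

/-- The primitive vanishing at `0`. -/
def primitive (f : ℝ → ℝ) (s : ℝ) : ℝ := ∫ r in (0)..s, f r

theorem hasDerivAt_primitive {f : ℝ → ℝ} (hf : Continuous f) (s : ℝ) :
    HasDerivAt (primitive f) (f s) s :=
  intervalIntegral.integral_hasDerivAt_right (hf.intervalIntegrable _ _)
    (hf.stronglyMeasurableAtFilter _ _) hf.continuousAt

theorem continuous_primitive {f : ℝ → ℝ} (hf : Continuous f) : Continuous (primitive f) :=
  continuous_iff_continuousAt.2 fun s => (hasDerivAt_primitive hf s).continuousAt

theorem primitive_zero (f : ℝ → ℝ) : primitive f 0 = 0 := intervalIntegral.integral_same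

theorem primitive_mono {f : ℝ → ℝ} (hf : Continuous f) (h0 : ∀ s, 0 ≤ f s) :
    Monotone (primitive f) :=
  monotone_of_deriv_nonneg (fun s => (hasDerivAt_primitive hf s).differentiableAt)
    fun s => (hasDerivAt_primitive hf s).deriv ▸ h0 s

theorem primitive_eq_zero {f : ℝ → ℝ} {δ : ℝ} (hδ : 0 ≤ δ) (h : ∀ s ≤ δ, f s = 0) {s : ℝ}
    (hs : s ≤ δ) : primitive f s = 0 := by
  refine (intervalIntegral.integral_congr (g := fun _ => 0) fun r hr => h r ?_).trans (by simp)
  exact (mem_uIcc.1 hr).elim (fun h => h.2.trans hs) fun h => h.2.trans hδ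

theorem abs_primitive_sub_le {f : ℝ → ℝ} (hf : Continuous f) {C : ℝ} {a b : ℝ}
    (hC : ∀ s ∈ uIcc a b, |f s| ≤ C) : |primitive f b - primitive f a| ≤ C * |b - a| := by
  rw [primitive, primitive, intervalIntegral.integral_interval_sub_left
    (hf.intervalIntegrable _ _) (hf.intervalIntegrable _ _), ← Real.norm_eq_abs]
  exact intervalIntegral.norm_integral_le_of_norm_le_const fun x hx => by
    simpa using hC x (uIoc_subset_uIcc hx)

/-- The tangent line inequality for the primitive of a monotone function. -/
theorem primitive_sub_le {f : ℝ → ℝ} (hf : Continuous f) (hm : Monotone f) (a b : ℝ) :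
    primitive f b - primitive f a ≤ f b * (b - a) := by
  rw [primitive, primitive, intervalIntegral.integral_interval_sub_left
    (hf.intervalIntegrable _ _) (hf.intervalIntegrable _ _)]
  rcases le_total a b with h | h
  · have := intervalIntegral.integral_mono_on h (hf.intervalIntegrable a b)
      ((continuous_const (y := f b)).intervalIntegrable (μ := volume) a b) fun x hx => hm hx.2
    simpa [mul_comm] using this
  · rw [intervalIntegral.integral_symm]
    have := intervalIntegral.integral_mono_on h
      ((continuous_const (y := f b)).intervalIntegrable (μ := volume) b a) (hf.intervalIntegrable b a)
      fun x hx => hm hx.1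
    simp only [intervalIntegral.integral_const, smul_eq_mul] at this
    linarith

namespace IsWeight

variable {f : ℝ → ℝ}

theorem continuous (hf : IsWeight f) : Continuous f := hf.contDiff.continuous

theorem exists_bound (hf : IsWeight f) : ∃ C, 0 < C ∧ ∀ s, f s ≤ C := by
  obtain ⟨δ, L, hδ, hL, h1, h2⟩ := hf.exists_support
  obtain ⟨C, hC⟩ := (isCompact_Icc (a := δ) (b := L)).exists_bound_of_continuousOn
    hf.continuous.continuousOn
  refine ⟨max C 1, by positivity, fun s => ?_⟩
  rcases le_or_gt s δ with h | h
  · rw [h1 s h]; positivity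
  rcases le_or_gt L s with h' | h'
  · rw [h2 s h']; positivity
  · exact ((le_abs_self _).trans (hC s ⟨h.le, h'.le⟩)).trans (le_max_left _ _)

theorem contDiff_primitive (hf : IsWeight f) : ContDiff ℝ ∞ (primitive f) := by
  rw [contDiff_infty_iff_deriv]
  have : deriv (primitive f) = f := funext fun s => (hasDerivAt_primitive hf.continuous s).deriv
  exact ⟨fun s => (hasDerivAt_primitive hf.continuous s).differentiableAt, by
    rw [this]; exact hf.contDiff⟩

theorem primitive_nonneg (hf : IsWeight f) (s : ℝ) : 0 ≤ primitive f s := by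
  obtain ⟨δ, L, hδ, hL, h1, h2⟩ := hf.exists_support
  rcases le_total s 0 with h | h
  · rw [primitive_eq_zero hδ.le h1 (h.trans hδ.le)]
  · exact (primitive_zero f).symm.le.trans (primitive_mono hf.continuous hf.nonneg h)

theorem abs_primitive_sub_le (hf : IsWeight f) {C : ℝ} (hC : ∀ s, f s ≤ C) (a b : ℝ) :
    |primitive f b - primitive f a| ≤ C * |b - a| :=
  Leibenson.abs_primitive_sub_le hf.continuous fun s _ => by
    rw [abs_of_nonneg (hf.nonneg s)]; exact hC s

theorem abs_primitive_le (hf : IsWeight f) {C : ℝ} (hC : ∀ s, f s ≤ C) (s : ℝ) :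
    |primitive f s| ≤ C * |s| := by
  simpa [primitive_zero] using hf.abs_primitive_sub_le hC 0 s

/-- The second primitive, a convex function. -/
theorem primitive_primitive_nonneg (hf : IsWeight f) (s : ℝ) : 0 ≤ primitive (primitive f) s := by
  obtain ⟨δ, L, hδ, hL, h1, h2⟩ := hf.exists_support
  have h := continuous_primitive hf.continuous
  rcases le_total s 0 with hs | hs
  · rw [primitive_eq_zero le_rfl (fun r hr => primitive_eq_zero hδ.le h1 (hr.trans hδ.le)) hs]
  · exact (primitive_zero _).symm.le.trans (primitive_mono h hf.primitive_nonneg hs)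

theorem primitive_primitive_sub_le (hf : IsWeight f) (a b : ℝ) :
    primitive (primitive f) b - primitive (primitive f) a ≤ primitive f b * (b - a) :=
  primitive_sub_le (continuous_primitive hf.continuous) (primitive_mono hf.continuous hf.nonneg) a b

theorem abs_primitive_primitive_sub_le (hf : IsWeight f) {C : ℝ} (hC : ∀ s, f s ≤ C) (a b : ℝ) :
    |primitive (primitive f) b - primitive (primitive f) a| ≤ C * (|a| + |b|) * |b - a| := by
  have hC0 : 0 ≤ C := (hf.nonneg 0).trans (hC 0)
  refine Leibenson.abs_primitive_sub_le (continuous_primitive hf.continuous) fun s hs => ?_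
  refine (hf.abs_primitive_le hC s).trans ?_
  gcongr
  rcases mem_uIcc.1 hs with h | h <;> rcases abs_cases s with h' | h' <;>
    rcases abs_cases a with h2 | h2 <;> rcases abs_cases b with h3 | h3 <;> linarith

theorem primitive_primitive_le (hf : IsWeight f) {C : ℝ} (hC : ∀ s, f s ≤ C) (s : ℝ) :
    primitive (primitive f) s ≤ C * s ^ 2 := by
  have := hf.abs_primitive_primitive_sub_le hC 0 s
  simp only [primitive_zero, sub_zero, abs_zero, zero_add] at this
  calc _ ≤ _ := le_abs_self _
    _ ≤ _ := this
    _ = C * s ^ 2 := by rw [mul_assoc, ← sq, sq_abs]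

end IsWeight

/-- Smooth cutoffs with compact support in `(0, ∞)` converging to `1` there. -/
def cutoff (n : ℕ) (s : ℝ) : ℝ :=
  Real.smoothTransition (n * s - 1) * Real.smoothTransition (n - s)

theorem cutoff_nonneg (n : ℕ) (s : ℝ) : 0 ≤ cutoff n s :=
  mul_nonneg (Real.smoothTransition.nonneg _) (Real.smoothTransition.nonneg _)

theorem cutoff_le_one (n : ℕ) (s : ℝ) : cutoff n s ≤ 1 :=
  mul_le_one₀ (Real.smoothTransition.le_one _) (Real.smoothTransition.nonneg _)
    (Real.smoothTransition.le_one _)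

theorem tendsto_cutoff {s : ℝ} (hs : 0 < s) : Tendsto (fun n => cutoff n s) atTop (𝓝 1) := by
  refine tendsto_const_nhds.congr' ?_
  obtain ⟨n₀, hn₀⟩ := exists_nat_gt (max (2 / s) (s + 1))
  filter_upwards [eventually_ge_atTop n₀] with n hn
  have hn' : (n₀ : ℝ) ≤ n := by exact_mod_cast hn
  have h1 : 2 / s < n := (le_max_left _ _).trans_lt (hn₀.trans_le hn')
  have h2 : s + 1 < n := (le_max_right _ _).trans_lt (hn₀.trans_le hn')
  rw [div_lt_iff₀ hs] at h1
  rw [cutoff, Real.smoothTransition.one_of_one_le (by linarith),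
    Real.smoothTransition.one_of_one_le (by linarith), one_mul]

theorem isWeight_mul_cutoff {g : ℝ → ℝ} (hg : ∀ s, 0 < s → ContDiffAt ℝ ∞ g s)
    (h0 : ∀ s, 0 < s → 0 ≤ g s) (n : ℕ) : IsWeight fun s => g s * cutoff n s := by
  -- The support bounds 1/(n+1) and n + 2, instead of 1/n and n, also cover n = 0 and keep the lower
  -- one below the upper one.
  have hδ : (0 : ℝ) < 1 / (n + 1) := by positivity
  have hz : ∀ s : ℝ, s ≤ 1 / (n + 1) → cutoff n s = 0 := by
    intro s hs
    have : (n : ℝ) * s ≤ 1 := by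
      rcases le_total s 0 with h | h
      · nlinarith [(Nat.cast_nonneg n : (0 : ℝ) ≤ n)]
      · rw [le_div_iff₀ (by positivity)] at hs
        linarith
    rw [cutoff, Real.smoothTransition.zero_of_nonpos (by linarith), zero_mul]
  refine ⟨contDiff_iff_contDiffAt.2 fun s => ?_, fun s => ?_, 1 / (n + 1), n + 2, hδ, ?_,
    fun s hs => by simp only [hz s hs, mul_zero], fun s hs => ?_⟩
  · rcases lt_or_ge s (1 / (n + 1)) with h | h
    · refine (contDiffAt_const (c := (0 : ℝ))).congr_of_eventuallyEq ?_
      filter_upwards [Iio_mem_nhds h] with r hr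
      simp only [hz r (le_of_lt hr), mul_zero]
    · refine (hg s (hδ.trans_le h)).mul (ContDiff.contDiffAt ?_)
      unfold cutoff
      exact (Real.smoothTransition.contDiff.comp (by fun_prop)).mul
        (Real.smoothTransition.contDiff.comp (by fun_prop))
  · rcases le_or_gt s 0 with h | h
    · rw [hz s (h.trans hδ.le), mul_zero]
    · exact mul_nonneg (h0 s h) (cutoff_nonneg n s)
  · have : (1 : ℝ) / (n + 1) ≤ 1 := by
      rw [div_le_one (by positivity)]; linarith [(Nat.cast_nonneg n : (0 : ℝ) ≤ n)]
    linarith [(Nat.cast_nonneg n : (0 : ℝ) ≤ n)]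
  · rw [cutoff, Real.smoothTransition.zero_of_nonpos (x := n - s) (by linarith), mul_zero, mul_zero]

/-- The truncation `c s^e χ_n(s)` of a power. -/
def powWeight (c e : ℝ) (n : ℕ) (s : ℝ) : ℝ := c * s ^ e * cutoff n s

theorem isWeight_powWeight {c : ℝ} (hc : 0 ≤ c) (e : ℝ) (n : ℕ) : IsWeight (powWeight c e n) :=
  isWeight_mul_cutoff (g := fun s => c * s ^ e)
    (fun _ hs => contDiffAt_const.mul (Real.contDiffAt_rpow_const_of_ne hs.ne'))
    (fun _ hs => mul_nonneg hc (Real.rpow_nonneg hs.le _)) n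

theorem tendsto_powWeight (c e : ℝ) {s : ℝ} (hs : 0 < s) :
    Tendsto (fun n => powWeight c e n s) atTop (𝓝 (c * s ^ e)) := by
  simpa [powWeight] using (tendsto_cutoff hs).const_mul (c * s ^ e)

theorem powWeight_le {c : ℝ} (hc : 0 ≤ c) (e : ℝ) (n : ℕ) {s : ℝ} (hs : 0 ≤ s) :
    powWeight c e n s ≤ c * s ^ e :=
  mul_le_of_le_one_right (mul_nonneg hc (Real.rpow_nonneg hs _)) (cutoff_le_one n s)

/-- Monotone limits of primitives: the primitive of `g n ≤ c s^e` converges to that of `c s^e`. -/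
theorem tendsto_primitive_of_le_rpow {c e : ℝ} (he : -1 < e) {g : ℕ → ℝ → ℝ}
    (hg : ∀ n, Continuous (g n)) (h0 : ∀ n s, 0 ≤ g n s)
    (hle : ∀ n s, 0 ≤ s → g n s ≤ c * s ^ e)
    (hlim : ∀ s, 0 < s → Tendsto (fun n => g n s) atTop (𝓝 (c * s ^ e))) {s : ℝ} (hs : 0 ≤ s) :
    (∀ n, primitive (g n) s ≤ c / (e + 1) * s ^ (e + 1)) ∧
    Tendsto (fun n => primitive (g n) s) atTop (𝓝 (c / (e + 1) * s ^ (e + 1))) := by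
  have hint : IntervalIntegrable (fun r : ℝ => c * r ^ e) volume 0 s :=
    (intervalIntegral.intervalIntegrable_rpow' he).const_mul c
  have hval : ∫ r in (0)..s, c * r ^ e = c / (e + 1) * s ^ (e + 1) := by
    rw [intervalIntegral.integral_const_mul, integral_rpow (Or.inl he),
      Real.zero_rpow (by linarith)]
    ring
  refine ⟨fun n => ?_, ?_⟩
  · rw [← hval]
    exact intervalIntegral.integral_mono_on hs ((hg n).intervalIntegrable _ _) hint
      fun r hr => hle n r hr.1
  · rw [← hval]
    refine intervalIntegral.tendsto_integral_filter_of_dominated_convergence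
      (fun r => c * r ^ e) (Eventually.of_forall fun n => (hg n).aestronglyMeasurable)
      (Eventually.of_forall fun n => Eventually.of_forall fun r hr => ?_) hint
      (Eventually.of_forall fun r hr => ?_)
    · rw [uIoc_of_le hs] at hr
      rw [Real.norm_eq_abs, abs_of_nonneg (h0 n r)]
      exact hle n r hr.1.le
    · rw [uIoc_of_le hs] at hr
      exact hlim r hr.1

/-! ### Calculus in time: decay, weak derivatives, translations -/

/-- Algebraic decay from a superlinear dissipation inequality. -/
theorem rpow_decay {y : ℝ → ℝ} {a κ : ℝ} (ha : 0 < a) (hκ : 0 < κ) (h0 : ∀ t, 0 ≤ t → 0 ≤ y t)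
    (h : ∀ t₁ t₂, 0 ≤ t₁ → t₁ ≤ t₂ → y t₂ + κ * (t₂ - t₁) * y t₂ ^ (1 + a) ≤ y t₁) {t : ℝ}
    (ht : 0 < t) : y t ≤ (2 ^ (1 + 1 / a) / κ) ^ (1 / a) * t ^ (-(1 / a)) := by
  have hmono : ∀ s, 0 ≤ s → y s ≤ y 0 := fun s hs => by
    have h1 := h 0 s le_rfl hs
    have h2 : 0 ≤ κ * (s - 0) * y s ^ (1 + a) := by
      have := Real.rpow_nonneg (h0 s hs) (1 + a)
      rw [sub_zero]; positivity
    linarith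
  -- The rescaled function s^(1/a) y(s) is bounded on [0, t]; let Q be its supremum. The hypothesis
  -- on [s/2, s] compares its (1+a)-th power with Q itself, so Q^(1+a) is at most a multiple of Q,
  -- which bounds Q. No derivative of y is needed.
  set S : Set ℝ := (fun s => s ^ (1 / a) * y s) '' Icc 0 t
  have hbdd : BddAbove S := by
    refine ⟨t ^ (1 / a) * y 0, ?_⟩
    rintro _ ⟨s, hs, rfl⟩
    exact mul_le_mul (Real.rpow_le_rpow hs.1 hs.2 (by positivity)) (hmono s hs.1) (h0 s hs.1)
      (by positivity)
  set Q := sSup S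
  have hQ : ∀ s ∈ Icc 0 t, s ^ (1 / a) * y s ≤ Q := fun s hs => le_csSup hbdd ⟨s, hs, rfl⟩
  have hQ0 : 0 ≤ Q := (mul_nonneg (by positivity) (h0 t ht.le)).trans (hQ t ⟨ht.le, le_rfl⟩)
  have key : ∀ s ∈ Icc 0 t, κ / 2 * (s ^ (1 / a) * y s) ^ (1 + a) ≤ 2 ^ (1 / a) * Q := by
    rintro s ⟨hs0, hst⟩
    have h1 := h (s / 2) s (by linarith) (by linarith)
    have h2 := hQ (s / 2) ⟨by linarith, by linarith⟩
    have hys := h0 s hs0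
    have h3 : (s ^ (1 / a) * y s) ^ (1 + a) = s ^ (1 / a) * (s * y s ^ (1 + a)) := by
      rcases hs0.eq_or_lt with rfl | hpos
      · rw [Real.zero_rpow (by positivity), zero_mul, zero_mul, Real.zero_rpow (by positivity)]
      · rw [Real.mul_rpow (by positivity) hys, ← Real.rpow_mul hs0,
          show 1 / a * (1 + a) = 1 / a + 1 by field_simp, Real.rpow_add hpos, Real.rpow_one]
        ring
    have h4 : (s / 2) ^ (1 / a) * 2 ^ (1 / a) = s ^ (1 / a) := by
      rw [← Real.mul_rpow (by linarith) (by norm_num)]; congr 1; ring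
    have h5 : 0 ≤ s ^ (1 / a) := Real.rpow_nonneg hs0 _
    calc κ / 2 * (s ^ (1 / a) * y s) ^ (1 + a)
        = s ^ (1 / a) * (κ * (s - s / 2) * y s ^ (1 + a)) := by rw [h3]; ring
      _ ≤ s ^ (1 / a) * y (s / 2) := by gcongr; linarith
      _ = 2 ^ (1 / a) * ((s / 2) ^ (1 / a) * y (s / 2)) := by rw [← h4]; ring
      _ ≤ 2 ^ (1 / a) * Q := by gcongr
  have hQpow : κ / 2 * Q ^ (1 + a) ≤ 2 ^ (1 / a) * Q := by
    have hc : Q ≤ (2 ^ (1 / a) * Q / (κ / 2)) ^ (1 / (1 + a)) := by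
      refine csSup_le ⟨_, ⟨t, ⟨ht.le, le_rfl⟩, rfl⟩⟩ ?_
      rintro _ ⟨s, hs, rfl⟩
      have h1 : (s ^ (1 / a) * y s) ^ (1 + a) ≤ 2 ^ (1 / a) * Q / (κ / 2) := by
        rw [le_div_iff₀ (by positivity), mul_comm]; exact key s hs
      have h2 : 0 ≤ s ^ (1 / a) * y s := mul_nonneg (Real.rpow_nonneg hs.1 _) (h0 s hs.1)
      have h3 := Real.rpow_le_rpow (Real.rpow_nonneg h2 _) h1 (show 0 ≤ 1 / (1 + a) by positivity)
      rwa [← Real.rpow_mul h2, mul_one_div_cancel (by positivity), Real.rpow_one] at h3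
    have h1 := Real.rpow_le_rpow hQ0 hc (show 0 ≤ 1 + a by positivity)
    rw [← Real.rpow_mul (by positivity), one_div_mul_cancel (by positivity), Real.rpow_one,
      le_div_iff₀ (by positivity)] at h1
    linarith
  have hQle : Q ≤ (2 ^ (1 + 1 / a) / κ) ^ (1 / a) := by
    rcases hQ0.eq_or_lt with h1 | h1
    · rw [← h1]; positivity
    · have h2 : Q ^ a ≤ 2 ^ (1 + 1 / a) / κ := by
        rw [Real.rpow_add h1, Real.rpow_one] at hQpow
        have h3 : κ / 2 * Q ^ a ≤ 2 ^ (1 / a) := by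
          by_contra hcon
          push Not at hcon
          nlinarith [mul_lt_mul_of_pos_right hcon h1]
        rw [le_div_iff₀ hκ, Real.rpow_add (by norm_num), Real.rpow_one]
        linarith
      have h3 := Real.rpow_le_rpow (by positivity) h2 (show 0 ≤ 1 / a by positivity)
      rwa [← Real.rpow_mul h1.le, mul_one_div_cancel ha.ne', Real.rpow_one] at h3
  have h1 := (hQ t ⟨ht.le, le_rfl⟩).trans hQle
  rw [Real.rpow_neg ht.le, ← div_eq_mul_inv, le_div_iff₀ (by positivity), mul_comm]
  exact h1

/-- Testing with smoothed indicators of (-∞, t], whose negative derivatives are approximate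
identities concentrating at t from the left, recovers the value at t because a is continuous there.
-/
theorem eq_add_integral_of_weak_deriv_pos {a b : ℝ → ℝ} (ha : ContinuousOn a (Ici 0))
    (hb : ∀ T, 0 < T → IntervalIntegrable b volume 0 T) {a₀ : ℝ}
    (h : ∀ T, 0 < T → ∀ η : ℝ → ℝ, ContDiff ℝ ∞ η → HasCompactSupport η → η T = 0 →
      -(∫ t in (0)..T, a t * deriv η t) = (∫ t in (0)..T, b t * η t) + a₀ * η 0)
    {t : ℝ} (ht : 0 < t) : a t = a₀ + ∫ τ in (0)..t, b τ := by
  set st := Real.smoothTransition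
  have hst : ContDiff ℝ ∞ st := Real.smoothTransition.contDiff
  set ζ : ℕ → ℝ → ℝ := fun n τ => st (n * (t - τ)) with hζ
  -- The second factor equals 1 on [-1, ∞) and vanishes for τ ≤ -2; it only makes the support
  -- compact.
  set η : ℕ → ℝ → ℝ := fun n τ => ζ n τ * st (τ + 2) with hη
  have hζc : ∀ n, ContDiff ℝ ∞ (ζ n) := fun n => hst.comp (by fun_prop)
  have hηc : ∀ n, ContDiff ℝ ∞ (η n) := fun n => (hζc n).mul (hst.comp (by fun_prop))
  have hηζ : ∀ n τ, -1 ≤ τ → η n τ = ζ n τ := fun n τ hτ => by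
    simp only [hη, st, Real.smoothTransition.one_of_one_le (x := τ + 2) (by linarith), mul_one]
  have hder : ∀ n τ, 0 ≤ τ → deriv (η n) τ = deriv (ζ n) τ := fun n τ hτ => by
    refine EventuallyEq.deriv_eq ?_
    filter_upwards [Ioi_mem_nhds (show (-1 : ℝ) < τ by linarith)] with r hr
    exact hηζ n r (le_of_lt hr)
  have hdnonpos : ∀ n τ, deriv (ζ n) τ ≤ 0 := fun n τ => by
    have hanti : Antitone (ζ n) := fun x y hxy => Real.smoothTransition.monotone
      (mul_le_mul_of_nonneg_left (by linarith) (Nat.cast_nonneg n))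
    exact hanti.deriv_nonpos
  have hsupp : ∀ n, 0 < n → HasCompactSupport (η n) := fun n hn => by
    refine HasCompactSupport.of_support_subset_isCompact (isCompact_Icc (a := -2) (b := t)) ?_
    intro τ hτ
    have h1 := left_ne_zero_of_mul (Function.mem_support.1 hτ)
    have h2 := right_ne_zero_of_mul (Function.mem_support.1 hτ)
    have h1' : 0 < (n : ℝ) * (t - τ) := by
      by_contra hc; exact h1 (Real.smoothTransition.zero_of_nonpos (not_lt.1 hc))
    have h2' : 0 < τ + 2 := by
      by_contra hc; exact h2 (Real.smoothTransition.zero_of_nonpos (not_lt.1 hc))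
    have h3 : 0 < t - τ := pos_of_mul_pos_right h1' (Nat.cast_nonneg n)
    exact ⟨by linarith, by linarith⟩
  have hζt : ∀ n, ζ n t = 0 := fun n => by simp [hζ, st]
  have hint : ∀ n, IntervalIntegrable (deriv (ζ n)) volume 0 t := fun n =>
    ((hζc n).continuous_deriv (by simp)).intervalIntegrable _ _
  have hacont : ContinuousOn a (uIcc 0 t) := ha.mono (by rw [uIcc_of_le ht.le]; exact Icc_subset_Ici_self)
  have heq : ∀ᶠ n : ℕ in atTop, -(∫ τ in (0)..t, (a τ - a t) * deriv (ζ n) τ) + a t =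
      (∫ τ in (0)..t, b τ * ζ n τ) + a₀ := by
    obtain ⟨n₀, hn₀⟩ := exists_nat_gt (1 / t)
    filter_upwards [eventually_ge_atTop n₀, eventually_gt_atTop 0] with n hn hn0
    have hnt : 1 ≤ n * t := by
      rw [div_lt_iff₀ ht] at hn₀
      have : (n₀ : ℝ) * t ≤ n * t := by gcongr
      linarith
    have hζ0 : ζ n 0 = 1 := by
      simp only [hζ, st, sub_zero]; exact Real.smoothTransition.one_of_one_le hnt
    have h1 := h t ht (η n) (hηc n) (hsupp n hn0) (by rw [hηζ n t (by linarith), hζt])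
    rw [hηζ n 0 (by norm_num), hζ0, mul_one,
      intervalIntegral.integral_congr (f := fun τ => a τ * deriv (η n) τ)
        (g := fun τ => a τ * deriv (ζ n) τ)
        fun τ hτ => by
          rw [uIcc_of_le ht.le] at hτ
          simp only [hder n τ hτ.1],
      intervalIntegral.integral_congr (f := fun τ => b τ * η n τ)
        (g := fun τ => b τ * ζ n τ)
        fun τ hτ => by
          rw [uIcc_of_le ht.le] at hτ
          simp only [hηζ n τ (by linarith [hτ.1])]] at h1
    rw [← h1]
    have h2 : ∫ τ in (0)..t, deriv (ζ n) τ = -1 := by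
      rw [intervalIntegral.integral_deriv_eq_sub
        (fun x _ => (hζc n).differentiable (by simp) x) (hint n), hζt, hζ0]; ring
    simp only [sub_mul]
    rw [intervalIntegral.integral_sub ((hint n).continuousOn_mul hacont) ((hint n).const_mul _),
      intervalIntegral.integral_const_mul, h2]
    ring
  have hlim1 : Tendsto (fun n => -(∫ τ in (0)..t, (a τ - a t) * deriv (ζ n) τ) + a t) atTop
      (𝓝 (-0 + a t)) := by
    refine (Tendsto.neg ?_).add_const _
    rw [Metric.tendsto_atTop]
    intro ε hε
    obtain ⟨δ, hδ, hδa⟩ := Metric.continuousWithinAt_iff.1 (ha t ht.le) (ε / 2) (by positivity)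
    obtain ⟨n₀, hn₀⟩ := exists_nat_gt (max (1 / t) (1 / δ))
    refine ⟨n₀, fun n hn => ?_⟩
    have hn' : max (1 / t) (1 / δ) < n := hn₀.trans_le (by exact_mod_cast hn)
    have hnt : 1 ≤ n * t := by
      have := (le_max_left _ _).trans_lt hn'
      rw [div_lt_iff₀ ht] at this; exact this.le
    have hnδ : 1 < n * δ := by
      have := (le_max_right _ _).trans_lt hn'
      rwa [div_lt_iff₀ hδ] at this
    have hζ0 : ζ n 0 = 1 := by
      simp only [hζ, st, sub_zero]; exact Real.smoothTransition.one_of_one_le hnt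
    have h2 : ∫ τ in (0)..t, deriv (ζ n) τ = -1 := by
      rw [intervalIntegral.integral_deriv_eq_sub
        (fun x _ => (hζc n).differentiable (by simp) x) (hint n), hζt, hζ0]; ring
    have hbd : ‖∫ τ in (0)..t, (a τ - a t) * deriv (ζ n) τ‖ ≤
        ∫ τ in (0)..t, (ε / 2) * -deriv (ζ n) τ := by
      refine intervalIntegral.norm_integral_le_of_norm_le ht.le (Eventually.of_forall fun τ hτ => ?_)
        ((hint n).neg.const_mul _)
      rw [norm_mul, Real.norm_eq_abs (deriv _ _), abs_of_nonpos (hdnonpos n τ)]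
      rcases le_or_gt (t - δ) τ with hc | hc
      · rcases hc.eq_or_lt with hc | hc
        · have : deriv (ζ n) τ = 0 := by
            refine (EventuallyEq.deriv_eq (f := fun _ => (1 : ℝ)) ?_).trans (deriv_const _ _)
            have h3 : 1 < n * (t - τ) := by rw [← hc]; simpa using hnδ
            have h4 : ContinuousAt (fun r : ℝ => (n : ℝ) * (t - r)) τ := by fun_prop
            filter_upwards [h4.eventually_const_lt h3] with r hr
            exact Real.smoothTransition.one_of_one_le hr.le
          simp [this]
        · refine mul_le_mul_of_nonneg_right ?_ (neg_nonneg.2 (hdnonpos n τ))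
          have := hδa (x := τ) hτ.1.le (by
            rw [Real.dist_eq, abs_lt]; constructor <;> linarith [hτ.2])
          rw [Real.dist_eq] at this
          exact this.le
      · have : deriv (ζ n) τ = 0 := by
          refine (EventuallyEq.deriv_eq (f := fun _ => (1 : ℝ)) ?_).trans (deriv_const _ _)
          have h3 : 1 < n * (t - τ) := by
            refine hnδ.trans_le ?_
            gcongr; linarith
          have h4 : ContinuousAt (fun r : ℝ => (n : ℝ) * (t - r)) τ := by fun_prop
          filter_upwards [h4.eventually_const_lt h3] with r hr
          exact Real.smoothTransition.one_of_one_le hr.le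
        simp [this]
    rw [intervalIntegral.integral_const_mul, intervalIntegral.integral_neg, h2] at hbd
    rw [dist_zero_right]
    linarith
  have hlim2 : Tendsto (fun n => (∫ τ in (0)..t, b τ * ζ n τ) + a₀) atTop
      (𝓝 ((∫ τ in (0)..t, b τ) + a₀)) := by
    refine Tendsto.add_const _ ?_
    refine intervalIntegral.tendsto_integral_filter_of_dominated_convergence (fun τ => ‖b τ‖)
      (Eventually.of_forall fun n => ?_) (Eventually.of_forall fun n => Eventually.of_forall
        fun τ _ => ?_) (hb t ht).norm ?_
    · exact (hb t ht).aestronglyMeasurable_restrict_uIoc.mul (hζc n).continuous.aestronglyMeasurable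
    · rw [norm_mul, Real.norm_eq_abs (ζ n τ), abs_of_nonneg (Real.smoothTransition.nonneg _)]
      exact mul_le_of_le_one_right (norm_nonneg _) (Real.smoothTransition.le_one _)
    · filter_upwards [Measure.ae_ne volume t] with τ hτt hτ
      rw [uIoc_of_le ht.le] at hτ
      have hlt : 0 < t - τ := sub_pos.2 (lt_of_le_of_ne hτ.2 hτt)
      refine tendsto_const_nhds.congr' ?_
      obtain ⟨n₀, hn₀⟩ := exists_nat_gt (1 / (t - τ))
      filter_upwards [eventually_ge_atTop n₀] with n hn
      have : 1 ≤ n * (t - τ) := by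
        rw [div_lt_iff₀ hlt] at hn₀
        have : (n₀ : ℝ) * (t - τ) ≤ n * (t - τ) := by gcongr
        linarith
      simp only [hζ, st, Real.smoothTransition.one_of_one_le this, mul_one]
  have := tendsto_nhds_unique_of_eventuallyEq hlim1 hlim2 heq
  linarith

/-- A continuous function with an integrable weak derivative is its primitive. -/
theorem eq_add_integral_of_weak_deriv {a b : ℝ → ℝ} (ha : ContinuousOn a (Ici 0))
    (hb : ∀ T, 0 < T → IntervalIntegrable b volume 0 T) {a₀ : ℝ}
    (h : ∀ T, 0 < T → ∀ η : ℝ → ℝ, ContDiff ℝ ∞ η → HasCompactSupport η → η T = 0 →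
      -(∫ t in (0)..T, a t * deriv η t) = (∫ t in (0)..T, b t * η t) + a₀ * η 0)
    {t : ℝ} (ht : 0 ≤ t) : a t = a₀ + ∫ τ in (0)..t, b τ := by
  rcases ht.eq_or_lt with rfl | ht
  -- At time 0 both sides are limits from the right of the identity at positive times.
  · have h1 : Tendsto a (𝓝[>] 0) (𝓝 (a 0)) :=
      (ha 0 self_mem_Ici).mono_left (nhdsWithin_mono _ Ioi_subset_Ici_self)
    have hb1 : IntegrableOn b (uIcc 0 1) volume := by
      rw [uIcc_of_le zero_le_one]
      exact (intervalIntegrable_iff_integrableOn_Icc_of_le zero_le_one).1 (hb 1 one_pos)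
    have hc := intervalIntegral.continuousOn_primitive_interval hb1
    have h2 : Tendsto (fun s => a₀ + ∫ τ in (0)..s, b τ) (𝓝[>] 0)
        (𝓝 (a₀ + ∫ τ in (0)..0, b τ)) := by
      refine Tendsto.const_add _ ((hc 0 left_mem_uIcc).mono_left ?_)
      rw [uIcc_of_le zero_le_one]
      exact nhdsWithin_le_of_mem (mem_of_superset (Ioc_mem_nhdsGT one_pos) Ioc_subset_Icc_self)
    refine tendsto_nhds_unique_of_eventuallyEq h1 h2 ?_
    filter_upwards [self_mem_nhdsWithin] with s hs
    exact eq_add_integral_of_weak_deriv_pos ha hb h hs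
  · exact eq_add_integral_of_weak_deriv_pos ha hb h ht

/-- Translations preserve Lebesgue measure and depend continuously on the shift in the compact-open
topology, so they act continuously on L^r for finite r. -/
theorem tendsto_eLpNorm_comp_sub {E : Type*} [NormedAddCommGroup E] {r : ℝ≥0∞} (hr : 1 ≤ r)
    (hr' : r ≠ ⊤) {a : ℝ → E} (ha : MemLp a r volume) :
    Tendsto (fun σ : ℝ => eLpNorm (fun t => a (t - σ) - a t) r volume) (𝓝 0) (𝓝 0) := by
  haveI : Fact (1 ≤ r) := ⟨hr⟩
  let g : ℝ → C(ℝ, ℝ) := fun σ => ⟨fun t => t - σ, by fun_prop⟩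
  have hg : Tendsto g (𝓝 0) (𝓝 (g 0)) := by
    have : Continuous g := (ContinuousMap.curry
      (⟨fun z : ℝ × ℝ => z.2 - z.1, by fun_prop⟩ : C(ℝ × ℝ, ℝ))).continuous
    exact this.tendsto 0
  have hgm : ∀ σ, MeasurePreserving (g σ) volume volume := fun σ => measurePreserving_sub_right _ σ
  have h1 := (tendsto_const_nhds (x := ha.toLp a)).compMeasurePreservingLp hg hgm (hgm 0) hr'
  rw [tendsto_iff_edist_tendsto_0] at h1
  refine h1.congr fun σ => ?_
  rw [Lp.edist_def]
  refine eLpNorm_congr_ae ?_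
  have h2 := (Lp.coeFn_compMeasurePreserving (ha.toLp a) (hgm σ)).trans
    ((hgm σ).quasiMeasurePreserving.ae_eq_comp ha.coeFn_toLp)
  have h3 := (Lp.coeFn_compMeasurePreserving (ha.toLp a) (hgm 0)).trans
    ((hgm 0).quasiMeasurePreserving.ae_eq_comp ha.coeFn_toLp)
  filter_upwards [h2, h3] with t h2 h3
  rw [Pi.sub_apply, h2, h3]
  simp [g]

/-- Hölder's inequality and continuity of translations in L^r'. Only the factor a is shifted; it is
extended by zero outside (0, T), and σ < t₁ keeps the shifted times inside that interval. -/
theorem tendsto_integral_inner_shift {E : Type*} [NormedAddCommGroup E] [InnerProductSpace ℝ E]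
    {r r' : ℝ} (hr : r.HolderConjugate r') {a z : ℝ → E} {T t₁ t₂ : ℝ} (ht₁ : 0 < t₁)
    (ht₂ : t₂ < T) (ha : MemLp a (ENNReal.ofReal r') (volume.restrict (Ioo 0 T)))
    (hz : MemLp z (ENNReal.ofReal r) (volume.restrict (Ioo 0 T))) :
    (∀ σ, 0 ≤ σ → σ < t₁ →
      IntegrableOn (fun t => (inner ℝ (a (t - σ)) (z t) : ℝ)) (Ioc t₁ t₂)) ∧
    Tendsto (fun σ => ∫ t in Ioc t₁ t₂, (inner ℝ (a (t - σ)) (z t) : ℝ)) (𝓝[>] 0)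
      (𝓝 (∫ t in Ioc t₁ t₂, (inner ℝ (a t) (z t) : ℝ))) := by
  set b : ℝ → E := (Ioo 0 T).indicator a
  have hb : MemLp b (ENNReal.ofReal r') volume := (memLp_indicator_iff_restrict measurableSet_Ioo).2 ha
  have hsub : Ioc t₁ t₂ ⊆ Ioo 0 T := fun t h => ⟨ht₁.trans h.1, h.2.trans_lt ht₂⟩
  have hz' : MemLp z (ENNReal.ofReal r) (volume.restrict (Ioc t₁ t₂)) :=
    hz.mono_measure (Measure.restrict_mono_set _ hsub)
  have hr1 : 1 ≤ ENNReal.ofReal r' := by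
    rw [← ENNReal.ofReal_one]; exact ENNReal.ofReal_le_ofReal hr.symm.lt.le
  have hlim := tendsto_eLpNorm_comp_sub hr1 ENNReal.ofReal_ne_top hb
  have hHC : ENNReal.HolderConjugate (ENNReal.ofReal r') (ENNReal.ofReal r) := hr.symm.ennrealOfReal
  have hint : ∀ {d : ℝ → E}, MemLp d (ENNReal.ofReal r') volume →
      Integrable (fun t => (inner ℝ (d t) (z t) : ℝ)) (volume.restrict (Ioc t₁ t₂)) ∧
      ‖∫ t in Ioc t₁ t₂, (inner ℝ (d t) (z t) : ℝ)‖ₑ ≤ eLpNorm d (ENNReal.ofReal r') volume *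
        eLpNorm z (ENNReal.ofReal r) (volume.restrict (Ioc t₁ t₂)) := by
    intro d hd
    have hd' : MemLp d (ENNReal.ofReal r') (volume.restrict (Ioc t₁ t₂)) :=
      hd.mono_measure Measure.restrict_le_self
    have h1 := eLpNorm_le_eLpNorm_mul_eLpNorm_of_nnnorm (p := ENNReal.ofReal r')
      (q := ENNReal.ofReal r) (r := 1) hd'.1 hz'.1
      (fun x y => (inner ℝ x y : ℝ)) 1 (Eventually.of_forall fun t => by
        rw [one_mul]; exact nnnorm_inner_le_nnnorm _ _)
    rw [ENNReal.coe_one, one_mul] at h1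
    have h2 : Integrable (fun t => (inner ℝ (d t) (z t) : ℝ)) (volume.restrict (Ioc t₁ t₂)) :=
      memLp_one_iff_integrable.1 ⟨hd'.1.inner hz'.1,
        h1.trans_lt (ENNReal.mul_lt_top hd'.2 hz'.2)⟩
    refine ⟨h2, (enorm_integral_le_lintegral_enorm _).trans ?_⟩
    rw [← eLpNorm_one_eq_lintegral_enorm]
    refine h1.trans ?_
    gcongr
    exact Measure.restrict_le_self
  have hbs : ∀ σ, MemLp (fun t => b (t - σ)) (ENNReal.ofReal r') volume := fun σ =>
    hb.comp_measurePreserving (measurePreserving_sub_right _ σ)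
  have habs : ∀ σ, 0 ≤ σ → σ < t₁ → ∀ t ∈ Ioc t₁ t₂, (inner ℝ (b (t - σ)) (z t) : ℝ) =
      inner ℝ (a (t - σ)) (z t) := by
    intro σ h0 h1 t ht
    have : t - σ ∈ Ioo 0 T := ⟨by linarith [ht.1], by linarith [ht.2]⟩
    simp only [b, indicator_of_mem this]
  refine ⟨fun σ h0 h1 => (integrableOn_congr_fun (habs σ h0 h1) measurableSet_Ioc).1
    (hint (hbs σ)).1, ?_⟩
  have hab : ∀ σ, 0 < σ → σ < t₁ → ∫ t in Ioc t₁ t₂, (inner ℝ (a (t - σ)) (z t) : ℝ) =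
      ∫ t in Ioc t₁ t₂, (inner ℝ (b (t - σ)) (z t) : ℝ) := by
    intro σ h0 h1
    exact setIntegral_congr_fun measurableSet_Ioc fun t ht => (habs σ h0.le h1 t ht).symm
  have hab0 : ∫ t in Ioc t₁ t₂, (inner ℝ (a t) (z t) : ℝ) =
      ∫ t in Ioc t₁ t₂, (inner ℝ (b t) (z t) : ℝ) := by
    refine setIntegral_congr_fun measurableSet_Ioc fun t ht => ?_
    simp only [b, indicator_of_mem (hsub ht)]
  rw [hab0]
  have h2 : Tendsto (fun σ => ∫ t in Ioc t₁ t₂, (inner ℝ (b (t - σ)) (z t) : ℝ)) (𝓝[>] 0)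
      (𝓝 (∫ t in Ioc t₁ t₂, (inner ℝ (b t) (z t) : ℝ))) := by
    rw [tendsto_iff_edist_tendsto_0]
    have h3 := ENNReal.Tendsto.mul_const (hlim.mono_left (nhdsWithin_le_nhds (s := Ioi 0)))
      (Or.inr hz'.2.ne)
    rw [zero_mul] at h3
    refine tendsto_of_tendsto_of_tendsto_of_le_of_le tendsto_const_nhds h3 (fun σ => zero_le)
      fun σ => ?_
    have h4 := (hint ((hbs σ).sub hb)).2
    have h5 : ∫ t in Ioc t₁ t₂, (inner ℝ (((fun t => b (t - σ)) - b) t) (z t) : ℝ) =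
        (∫ t in Ioc t₁ t₂, (inner ℝ (b (t - σ)) (z t) : ℝ)) -
          ∫ t in Ioc t₁ t₂, (inner ℝ (b t) (z t) : ℝ) := by
      rw [← integral_sub (hint (hbs σ)).1 (hint hb).1]
      simp only [Pi.sub_apply, inner_sub_left]
    rw [h5] at h4
    rw [edist_eq_enorm_sub]
    exact h4
  refine h2.congr' ?_
  filter_upwards [Ioo_mem_nhdsGT ht₁] with σ hσ
  exact (hab σ hσ.1 hσ.2).symm

/-! ### Stability of W^{1,P} convergence under composition with primitives of weights -/

section Approximation

variable {X : Type*} [MeasurableSpace X] {ν : Measure X}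

theorem tendsto_lintegral_add_rpow {P : ℝ} (hP : 1 ≤ P) {a b : ℕ → X → ℝ≥0∞}
    (ha : ∀ n, AEMeasurable (a n) ν)
    (h1 : Tendsto (fun n => ∫⁻ x, a n x ^ P ∂ν) atTop (𝓝 0))
    (h2 : Tendsto (fun n => ∫⁻ x, b n x ^ P ∂ν) atTop (𝓝 0)) :
    Tendsto (fun n => ∫⁻ x, (a n x + b n x) ^ P ∂ν) atTop (𝓝 0) := by
  have h3 := ENNReal.Tendsto.const_mul (a := 2 ^ (P - 1)) (h1.add h2)
    (Or.inr (ENNReal.rpow_ne_top_of_nonneg (by linarith) (by norm_num)))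
  rw [add_zero, mul_zero] at h3
  refine tendsto_of_tendsto_of_tendsto_of_le_of_le tendsto_const_nhds h3 (fun n => zero_le)
    fun n => ?_
  simp only
  rw [← lintegral_add_left' ((ha n).pow_const P), ← lintegral_const_mul' _ _
    (ENNReal.rpow_ne_top_of_nonneg (by linarith) (by norm_num))]
  exact lintegral_mono fun x => ENNReal.rpow_add_le_mul_rpow_add_rpow _ _ hP

theorem tendsto_lintegral_const_mul_rpow {P : ℝ} (hP : 0 ≤ P) {a : ℕ → X → ℝ≥0∞} {C : ℝ≥0∞}
    (hC : C ≠ ⊤) (h1 : Tendsto (fun n => ∫⁻ x, a n x ^ P ∂ν) atTop (𝓝 0)) :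
    Tendsto (fun n => ∫⁻ x, (C * a n x) ^ P ∂ν) atTop (𝓝 0) := by
  have hCP : C ^ P ≠ ⊤ := ENNReal.rpow_ne_top_of_nonneg hP hC
  have h3 := ENNReal.Tendsto.const_mul (a := C ^ P) h1 (Or.inr hCP)
  rw [mul_zero] at h3
  refine h3.congr fun n => ?_
  rw [← lintegral_const_mul' _ _ hCP]
  simp only [ENNReal.mul_rpow_of_nonneg _ _ hP]

theorem exists_subseq_tendsto_ae_of_lintegral {P : ℝ} (hP : 0 < P) {φ : ℕ → X → ℝ} {w : X → ℝ}
    (hφ : ∀ n, AEMeasurable (φ n) ν) (hw : AEMeasurable w ν)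
    (h1 : Tendsto (fun n => ∫⁻ x, ‖φ n x - w x‖ₑ ^ P ∂ν) atTop (𝓝 0)) :
    ∃ k : ℕ → ℕ, StrictMono k ∧ ∀ᵐ x ∂ν, Tendsto (fun n => φ (k n) x) atTop (𝓝 (w x)) := by
  refine TendstoInMeasure.exists_seq_tendsto_ae (tendstoInMeasure_of_tendsto_eLpNorm
    (p := ENNReal.ofReal P) (by simpa using hP) (fun n => (hφ n).aestronglyMeasurable)
    hw.aestronglyMeasurable ?_)
  have h := (ENNReal.continuous_rpow_const (y := 1 / P)).tendsto 0 |>.comp h1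
  rw [ENNReal.zero_rpow_of_pos (by positivity)] at h
  refine h.congr fun n => ?_
  rw [eLpNorm_eq_lintegral_rpow_enorm_toReal (by simpa using hP) ENNReal.ofReal_ne_top,
    ENNReal.toReal_ofReal hP.le]
  rfl

variable {E : X → Type*} [∀ x, NormedAddCommGroup (E x)] [∀ x, NormedSpace ℝ (E x)]

/-- Composition with the primitive of a weight is continuous in `W^{1,P}`, with values in every
`W^{1,a}` with `1 ≤ a ≤ P`. -/
theorem exists_subseq_tendsto_primitive {P : ℝ} (hP : 1 ≤ P) {f : ℝ → ℝ} (hf : IsWeight f)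
    {φ : ℕ → X → ℝ} {w : X → ℝ} {g : ℕ → ∀ x, E x} {G : ∀ x, E x}
    (hφ : ∀ n, AEMeasurable (φ n) ν) (hw : AEMeasurable w ν)
    (hg : ∀ n, AEMeasurable (fun x => ‖g n x - G x‖ₑ) ν) (hG : AEMeasurable (fun x => ‖G x‖ₑ) ν)
    (h1 : Tendsto (fun n => ∫⁻ x, ‖φ n x - w x‖ₑ ^ P ∂ν) atTop (𝓝 0))
    (h2 : Tendsto (fun n => ∫⁻ x, ‖g n x - G x‖ₑ ^ P ∂ν) atTop (𝓝 0))
    (hwP : ∫⁻ x, ‖w x‖ₑ ^ P ∂ν ≠ ⊤) (hGP : ∫⁻ x, ‖G x‖ₑ ^ P ∂ν ≠ ⊤) :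
    ∃ k : ℕ → ℕ, ∀ a, 1 ≤ a → a ≤ P →
      Tendsto (fun n => ∫⁻ x, ‖primitive f (φ (k n) x) - primitive f (w x)‖ₑ ^ a ∂ν)
        atTop (𝓝 0) ∧
      Tendsto (fun n => ∫⁻ x, ‖f (φ (k n) x) • g (k n) x - f (w x) • G x‖ₑ ^ a ∂ν)
        atTop (𝓝 0) := by
  have hP0 : 0 < P := by linarith
  obtain ⟨k, hk, hae⟩ := exists_subseq_tendsto_ae_of_lintegral hP0 hφ hw h1
  obtain ⟨C, hC0, hC⟩ := hf.exists_bound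
  obtain ⟨δ, L, hδ, hL, hf1, hf2⟩ := hf.exists_support
  have hk1 := h1.comp hk.tendsto_atTop
  have hk2 := h2.comp hk.tendsto_atTop
  have hfm : Measurable f := hf.continuous.measurable
  -- In the product rule for f(φ)g - f(w)G this is the one term not controlled by the given
  -- convergences. It tends to zero by dominated convergence, which is why an almost everywhere
  -- convergent subsequence is taken.
  set T : ℕ → X → ℝ≥0∞ := fun n x => ‖f (φ (k n) x) - f (w x)‖ₑ * ‖G x‖ₑ with hT
  have hTlim : Tendsto (fun n => ∫⁻ x, T n x ^ P ∂ν) atTop (𝓝 0) := by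
    have hb : ∫⁻ x, (ENNReal.ofReal C * ‖G x‖ₑ) ^ P ∂ν ≠ ⊤ := by
      simp only [ENNReal.mul_rpow_of_nonneg _ _ hP0.le]
      rw [lintegral_const_mul' _ _ (ENNReal.rpow_ne_top_of_nonneg hP0.le ENNReal.ofReal_ne_top)]
      exact ENNReal.mul_ne_top (ENNReal.rpow_ne_top_of_nonneg hP0.le ENNReal.ofReal_ne_top) hGP
    have hGfin : ∀ᵐ x ∂ν, ‖G x‖ₑ ≠ ⊤ := Eventually.of_forall fun x => enorm_ne_top
    have := tendsto_lintegral_of_dominated_convergence' (μ := ν) (F := fun n x => T n x ^ P)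
      (f := fun _ => 0) (fun x => (ENNReal.ofReal C * ‖G x‖ₑ) ^ P)
      (fun n => (((hfm.comp_aemeasurable (hφ (k n))).sub
        (hfm.comp_aemeasurable hw)).enorm.mul hG).pow_const P)
      (fun n => Eventually.of_forall fun x => ?_) hb ?_
    · simpa using this
    · refine ENNReal.rpow_le_rpow ?_ hP0.le
      simp only [hT]
      gcongr
      rw [← ofReal_norm]
      refine ENNReal.ofReal_le_ofReal ?_
      rw [Real.norm_eq_abs, abs_le]
      constructor <;> linarith [hC (φ (k n) x), hf.nonneg (φ (k n) x), hC (w x), hf.nonneg (w x)]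
    · filter_upwards [hae] with x hx
      have h3 : Tendsto (fun n => f (φ (k n) x) - f (w x)) atTop (𝓝 0) := by
        have := ((hf.continuous.tendsto (w x)).comp hx).sub_const (f (w x))
        rwa [sub_self] at this
      have h4 : Tendsto (fun n => T n x) atTop (𝓝 0) := by
        have h5 : Tendsto (fun n => ‖f (φ (k n) x) - f (w x)‖ₑ) atTop (𝓝 0) := by
          have h5 := (continuous_enorm.tendsto (0 : ℝ)).comp h3
          rwa [enorm_zero] at h5
        simpa using ENNReal.Tendsto.mul_const h5 (Or.inr (enorm_ne_top (x := G x)))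
      have h6 := (ENNReal.continuous_rpow_const (y := P)).tendsto 0 |>.comp h4
      rwa [ENNReal.zero_rpow_of_pos hP0] at h6
  set D : ℕ → X → ℝ≥0∞ := fun n x => ENNReal.ofReal C * ‖φ (k n) x - w x‖ₑ +
    (ENNReal.ofReal C * ‖g (k n) x - G x‖ₑ + T n x) with hD
  have hDm1 : ∀ n, AEMeasurable (fun x => ENNReal.ofReal C * ‖φ (k n) x - w x‖ₑ) ν := fun n =>
    ((hφ (k n)).sub hw).enorm.const_mul _
  have hDm2 : ∀ n, AEMeasurable (fun x => ENNReal.ofReal C * ‖g (k n) x - G x‖ₑ) ν := fun n =>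
    (hg (k n)).const_mul _
  have hDm : ∀ n, AEMeasurable (D n) ν := fun n => (hDm1 n).add ((hDm2 n).add
    (((hfm.comp_aemeasurable (hφ (k n))).sub (hfm.comp_aemeasurable hw)).enorm.mul hG))
  have hDlim : Tendsto (fun n => ∫⁻ x, D n x ^ P ∂ν) atTop (𝓝 0) :=
    tendsto_lintegral_add_rpow hP hDm1
      (tendsto_lintegral_const_mul_rpow hP0.le ENNReal.ofReal_ne_top hk1)
      (tendsto_lintegral_add_rpow hP hDm2
        (tendsto_lintegral_const_mul_rpow hP0.le ENNReal.ofReal_ne_top hk2) hTlim)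
  -- Everything to be estimated vanishes where both φ and w are at most δ, and ρ ≥ 1 elsewhere, with
  -- bounded L^P norm. Hölder against a power of ρ therefore lowers the exponent from P to a without
  -- assuming that ν is finite.
  set ρ : ℕ → X → ℝ≥0∞ := fun n x => (ENNReal.ofReal δ)⁻¹ * (‖φ (k n) x - w x‖ₑ + ‖w x‖ₑ) with hρ
  have hδ0 : ENNReal.ofReal δ ≠ 0 := by simpa using hδ
  have hρm : ∀ n, AEMeasurable (ρ n) ν := fun n =>
    ((((hφ (k n)).sub hw).enorm).add hw.enorm).const_mul _
  set A : ℝ≥0∞ := (ENNReal.ofReal δ)⁻¹ ^ P * 2 ^ (P - 1) with hA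
  have hAtop : A ≠ ⊤ := ENNReal.mul_ne_top (ENNReal.rpow_ne_top_of_nonneg hP0.le (by simpa using hδ))
    (ENNReal.rpow_ne_top_of_nonneg (by linarith) (by norm_num))
  have hρle : ∀ n, ∫⁻ x, ρ n x ^ P ∂ν ≤
      A * (∫⁻ x, ‖φ (k n) x - w x‖ₑ ^ P ∂ν + ∫⁻ x, ‖w x‖ₑ ^ P ∂ν) := by
    intro n
    have hm : AEMeasurable (fun x => ‖φ (k n) x - w x‖ₑ ^ P) ν :=
      ((hφ (k n)).sub hw).enorm.pow_const P
    rw [← lintegral_add_left' hm,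
      ← lintegral_const_mul' _ _ hAtop]
    refine lintegral_mono fun x => ?_
    simp only [hρ, hA]
    rw [ENNReal.mul_rpow_of_nonneg _ _ hP0.le, mul_assoc]
    gcongr
    exact ENNReal.rpow_add_le_mul_rpow_add_rpow _ _ hP
  have hone : ∀ n x, (δ < φ (k n) x ∨ δ < w x) → 1 ≤ ρ n x := by
    intro n x h
    simp only [hρ]
    rw [mul_comm, ← div_eq_mul_inv, ENNReal.le_div_iff_mul_le (Or.inl hδ0)
      (Or.inl ENNReal.ofReal_ne_top), one_mul]
    have : δ ≤ ‖φ (k n) x - w x‖ + ‖w x‖ := by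
      have h3 := norm_add_le (φ (k n) x - w x) (w x)
      rw [sub_add_cancel] at h3
      rcases h with h | h
      · exact (h.le.trans (le_abs_self _)).trans h3
      · have := (h.le.trans (le_abs_self _))
        rw [← Real.norm_eq_abs] at this
        linarith [norm_nonneg (φ (k n) x - w x)]
    rw [← ofReal_norm, ← ofReal_norm, ← ENNReal.ofReal_add (norm_nonneg _) (norm_nonneg _)]
    exact ENNReal.ofReal_le_ofReal this
  have hb1 : ∀ n x, ‖primitive f (φ (k n) x) - primitive f (w x)‖ₑ ≤ D n x := by
    intro n x
    refine le_trans ?_ le_self_add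
    rw [← ofReal_norm, ← ofReal_norm, ← ENNReal.ofReal_mul hC0.le]
    exact ENNReal.ofReal_le_ofReal (hf.abs_primitive_sub_le hC _ _)
  have hb2 : ∀ n x, ‖f (φ (k n) x) • g (k n) x - f (w x) • G x‖ₑ ≤ D n x := by
    intro n x
    refine le_trans ?_ le_add_self
    have : f (φ (k n) x) • g (k n) x - f (w x) • G x =
        f (φ (k n) x) • (g (k n) x - G x) + (f (φ (k n) x) - f (w x)) • G x := by
      rw [smul_sub, sub_smul]; abel
    rw [this]
    refine (enorm_add_le _ _).trans ?_
    rw [enorm_smul, enorm_smul]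
    gcongr
    rw [← ofReal_norm, Real.norm_of_nonneg (hf.nonneg _)]
    exact ENNReal.ofReal_le_ofReal (hC _)
  refine ⟨k, fun a ha haP => ?_⟩
  have ha0 : 0 < a := by linarith
  have haP1 : a / P ≤ 1 := (div_le_one hP0).2 haP
  have haP0 : 0 ≤ 1 - a / P := by linarith
  have hlim : Tendsto (fun n => (∫⁻ x, D n x ^ P ∂ν) ^ (a / P) *
      (A * (∫⁻ x, ‖φ (k n) x - w x‖ₑ ^ P ∂ν + ∫⁻ x, ‖w x‖ₑ ^ P ∂ν)) ^ (1 - a / P))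
      atTop (𝓝 0) := by
    have h3 := (ENNReal.continuous_rpow_const (y := a / P)).tendsto 0 |>.comp hDlim
    rw [ENNReal.zero_rpow_of_pos (by positivity)] at h3
    have h4 := ENNReal.Tendsto.const_mul (a := A) (hk1.add_const (∫⁻ x, ‖w x‖ₑ ^ P ∂ν))
      (Or.inr hAtop)
    have h5 := (ENNReal.continuous_rpow_const (y := 1 - a / P)).tendsto _ |>.comp h4
    have h6 := ENNReal.Tendsto.mul h3 (Or.inr (ENNReal.rpow_ne_top_of_nonneg haP0
      (ENNReal.mul_ne_top hAtop (by simpa using hwP)))) h5 (Or.inr ENNReal.zero_ne_top)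
    rw [zero_mul] at h6
    exact h6
  have hgen : ∀ (d : ℕ → X → ℝ≥0∞), (∀ n x, d n x ≤ D n x) →
      (∀ n x, ¬ (δ < φ (k n) x ∨ δ < w x) → d n x = 0) →
      Tendsto (fun n => ∫⁻ x, d n x ^ a ∂ν) atTop (𝓝 0) := by
    intro d hd1 hd2
    refine tendsto_of_tendsto_of_tendsto_of_le_of_le tendsto_const_nhds hlim (fun n => zero_le)
      fun n => ?_
    calc ∫⁻ x, d n x ^ a ∂ν
        ≤ ∫⁻ x, (D n x ^ P) ^ (a / P) * (ρ n x ^ P) ^ (1 - a / P) ∂ν := by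
          refine lintegral_mono fun x => ?_
          by_cases hx : δ < φ (k n) x ∨ δ < w x
          · rw [← ENNReal.rpow_mul, mul_div_cancel₀ _ hP0.ne', ← ENNReal.rpow_mul]
            refine (ENNReal.rpow_le_rpow (hd1 n x) ha0.le).trans (le_mul_of_one_le_right' ?_)
            simpa using ENNReal.rpow_le_rpow (hone n x hx) (mul_nonneg hP0.le haP0)
          · rw [hd2 n x hx, ENNReal.zero_rpow_of_pos ha0]; exact zero_le
      _ ≤ (∫⁻ x, D n x ^ P ∂ν) ^ (a / P) * (∫⁻ x, ρ n x ^ P ∂ν) ^ (1 - a / P) :=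
          ENNReal.lintegral_mul_norm_pow_le ((hDm n).pow_const P) ((hρm n).pow_const P)
            (by positivity) haP0 (by ring)
      _ ≤ _ := by
          gcongr
          exact hρle n
  refine ⟨hgen _ hb1 fun n x hx => ?_, hgen _ hb2 fun n x hx => ?_⟩
  · push Not at hx
    rw [primitive_eq_zero hδ.le hf1 hx.1, primitive_eq_zero hδ.le hf1 hx.2]; simp
  · push Not at hx
    rw [hf1 _ hx.1, hf1 _ hx.2]; simp

end Approximation

/-! ### From finite time increments to an energy inequality -/

section Energy

variable {X : Type*} [MeasurableSpace X] {ν : Measure X} [SFinite ν]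

theorem lintegral_shift_le {P : ℝ → ℝ → X → ℝ} {Q₁ Q₂ : ℝ → X → ℝ≥0∞}
    (hQ₁ : Measurable fun z : ℝ × X => Q₁ z.1 z.2)
    (hle : ∀ τ s x, ‖P τ s x‖ₑ ≤ Q₁ τ x + Q₂ s x) {T t₁ t₂ : ℝ} (ht₂ : t₂ < T) {σ : ℝ}
    (h0 : 0 < σ) (h1 : σ < t₁) (x : X) :
    ∫⁻ t in Ioc t₁ t₂, ‖P (t - σ) t x‖ₑ ≤
      (∫⁻ t in Ioo 0 T, Q₁ t x) + ∫⁻ t in Ioo 0 T, Q₂ t x := by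
  have hm1 : Measurable fun t => Q₁ t x := hQ₁.comp (f := fun t => (t, x)) (by fun_prop)
  have hsub : Ioc t₁ t₂ ⊆ Ioo 0 T := fun t h => ⟨by linarith [h.1], by linarith [h.2]⟩
  calc ∫⁻ t in Ioc t₁ t₂, ‖P (t - σ) t x‖ₑ ≤ ∫⁻ t in Ioc t₁ t₂, (Q₁ (t - σ) x + Q₂ t x) :=
        lintegral_mono fun t => hle _ _ _
    _ = (∫⁻ t in Ioc t₁ t₂, Q₁ (t - σ) x) + ∫⁻ t in Ioc t₁ t₂, Q₂ t x :=
        lintegral_add_left (hm1.comp (by fun_prop)) _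
    _ ≤ _ := by
        refine add_le_add ?_ (lintegral_mono_set hsub)
        rw [← lintegral_indicator measurableSet_Ioc, ← lintegral_indicator measurableSet_Ioo,
          ← lintegral_sub_right_eq_self (fun t => (Ioo 0 T).indicator (fun t => Q₁ t x) t) σ]
        refine lintegral_mono fun t => ?_
        by_cases ht : t ∈ Ioc t₁ t₂
        · have : t - σ ∈ Ioo 0 T := ⟨by linarith [ht.1], by linarith [ht.2]⟩
          simp only [indicator_of_mem ht, indicator_of_mem this, le_refl]
        · rw [indicator_of_notMem ht]; exact zero_le

/-- Passage to the limit in the difference quotients of the energy. -/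
theorem energy_le_of_increment_le {P : ℝ → ℝ → X → ℝ}
    (hPm : Measurable fun z : ℝ × ℝ × X => P z.1 z.2.1 z.2.2)
    {Q₁ Q₂ : ℝ → X → ℝ≥0∞} (hQ₁ : Measurable fun z : ℝ × X => Q₁ z.1 z.2)
    (hQ₂ : Measurable fun z : ℝ × X => Q₂ z.1 z.2)
    (hle : ∀ τ s x, ‖P τ s x‖ₑ ≤ Q₁ τ x + Q₂ s x) {T : ℝ}
    (hQ₁T : ∫⁻ x, (∫⁻ t in Ioo 0 T, Q₁ t x) ∂ν ≠ ⊤)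
    (hQ₂T : ∫⁻ x, (∫⁻ t in Ioo 0 T, Q₂ t x) ∂ν ≠ ⊤)
    {t₁ t₂ : ℝ} (ht₁ : 0 < t₁) (ht : t₁ ≤ t₂) (ht₂ : t₂ < T)
    (hshift : ∀ᵐ x ∂ν, Tendsto (fun σ => ∫ t in Ioc t₁ t₂, P (t - σ) t x) (𝓝[>] 0)
      (𝓝 (∫ t in Ioc t₁ t₂, P t t x)))
    {e : ℝ → ℝ} (he : Continuous e)
    (hinc : ∀ᵐ t, t ∈ Ioc t₁ t₂ → ∀ h, 0 < h → h < t →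
      e t - e (t - h) ≤ -∫ τ in Ioc (t - h) t, ∫ x, P τ t x ∂ν) :
    e t₂ - e t₁ ≤ -∫ x, (∫ t in Ioc t₁ t₂, P t t x) ∂ν := by
  set lam : Measure ℝ := volume.restrict (Ioc t₁ t₂)
  set q : X → ℝ≥0∞ := fun x => (∫⁻ t in Ioo 0 T, Q₁ t x) + ∫⁻ t in Ioo 0 T, Q₂ t x with hq
  have hq1m : Measurable fun x => ∫⁻ t in Ioo 0 T, Q₁ t x := hQ₁.lintegral_prod_left'
  have hqm : Measurable q := hq1m.add hQ₂.lintegral_prod_left'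
  have hqint : ∫⁻ x, q x ∂ν ≠ ⊤ := by
    rw [lintegral_add_left hq1m]; exact ENNReal.add_ne_top.2 ⟨hQ₁T, hQ₂T⟩
  have hqbound : ∀ σ, 0 < σ → σ < t₁ → ∀ x, ∫⁻ t in Ioc t₁ t₂, ‖P (t - σ) t x‖ₑ ≤ q x :=
    fun σ h0 h1 x => lintegral_shift_le hQ₁ hle ht₂ h0 h1 x
  have hPσ : ∀ σ, Measurable fun z : ℝ × X => P (z.1 - σ) z.1 z.2 := fun σ =>
    hPm.comp (f := fun z : ℝ × X => (z.1 - σ, z.1, z.2)) (by fun_prop)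
  have hA : ∀ σ, 0 < σ → σ < t₁ →
      Integrable (fun z : ℝ × X => P (z.1 - σ) z.1 z.2) (lam.prod ν) := by
    intro σ h0 h1
    refine ⟨(hPσ σ).aestronglyMeasurable, ?_⟩
    rw [hasFiniteIntegral_iff_enorm, lintegral_prod_symm' _ (hPσ σ).enorm]
    exact (lintegral_mono fun x => hqbound σ h0 h1 x).trans_lt hqint.lt_top
  -- R(σ) is the dissipation with coefficients taken at the earlier time t - σ and test function at
  -- time t. Its limit for σ → 0 is the term wanted, by dominated convergence in x with the
  -- shift-independent majorant q.
  set R : ℝ → ℝ := fun σ => ∫ x, (∫ t in Ioc t₁ t₂, P (t - σ) t x) ∂ν with hR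
  set R₀ : ℝ := ∫ x, (∫ t in Ioc t₁ t₂, P t t x) ∂ν
  have hRlim : Tendsto R (𝓝[>] 0) (𝓝 R₀) := by
    refine tendsto_integral_filter_of_dominated_convergence (fun x => (q x).toReal)
      (Eventually.of_forall fun σ => ?_) ?_ (integrable_toReal_of_lintegral_ne_top hqm.aemeasurable
        hqint) hshift
    · exact (((hPσ σ).comp measurable_swap).stronglyMeasurable.integral_prod_right'
        (ν := lam)).aestronglyMeasurable
    · filter_upwards [Ioo_mem_nhdsGT ht₁] with σ hσ
      filter_upwards [ae_lt_top hqm hqint] with x hx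
      rw [← toReal_enorm]
      exact ENNReal.toReal_mono hx.ne ((enorm_integral_le_lintegral_enorm _).trans
        (hqbound σ hσ.1 hσ.2 x))
  -- Integrating the increment bound over t, substituting τ = t - σ with 0 < σ ≤ h and exchanging
  -- integrals turns the right side into an integral of R over the shifts in (0, h].
  have hF : ∀ h, 0 < h → h < t₁ → IntegrableOn R (Ioc 0 h) ∧
      (∫ t in Ioc t₁ t₂, e t - e (t - h)) ≤ -∫ σ in Ioc 0 h, R σ := by
    intro h hh0 hh1
    set κ : Measure ℝ := volume.restrict (Ioc 0 h)
    have hPB : Measurable fun z : (ℝ × ℝ) × X => P (z.1.1 - z.1.2) z.1.1 z.2 :=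
      hPm.comp (f := fun z : (ℝ × ℝ) × X => (z.1.1 - z.1.2, z.1.1, z.2)) (by fun_prop)
    have hB : Integrable (fun z : (ℝ × ℝ) × X => P (z.1.1 - z.1.2) z.1.1 z.2)
        ((lam.prod κ).prod ν) := by
      refine ⟨hPB.aestronglyMeasurable, ?_⟩
      rw [hasFiniteIntegral_iff_enorm, lintegral_prod_symm' _ hPB.enorm]
      have : ∀ x, ∫⁻ z, ‖P (z.1 - z.2) z.1 x‖ₑ ∂(lam.prod κ) ≤ q x * ENNReal.ofReal h := by
        intro x
        have hm : Measurable fun z : ℝ × ℝ => ‖P (z.1 - z.2) z.1 x‖ₑ :=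
          (hPm.comp (f := fun z : ℝ × ℝ => (z.1 - z.2, z.1, x)) (by fun_prop)).enorm
        rw [lintegral_prod_symm' _ hm]
        calc _ ≤ ∫⁻ σ in Ioc 0 h, q x :=
              setLIntegral_mono' measurableSet_Ioc fun σ hσ =>
                hqbound σ hσ.1 (hσ.2.trans_lt hh1) x
          _ = _ := by rw [setLIntegral_const, Real.volume_Ioc, sub_zero]
      refine (lintegral_mono this).trans_lt ?_
      rw [lintegral_mul_const _ hqm]
      exact ENNReal.mul_lt_top hqint.lt_top ENNReal.ofReal_lt_top
    have hF2 : Integrable (fun z : ℝ × ℝ => ∫ x, P (z.1 - z.2) z.1 x ∂ν) (lam.prod κ) :=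
      hB.integral_prod_left
    have hRe : ∀ σ ∈ Ioc 0 h, R σ = ∫ t in Ioc t₁ t₂, ∫ x, P (t - σ) t x ∂ν := fun σ hσ =>
      (integral_integral_swap (hA σ hσ.1 (hσ.2.trans_lt hh1))).symm
    refine ⟨?_, ?_⟩
    · exact (integrableOn_congr_fun hRe measurableSet_Ioc).2 hF2.integral_prod_right
    · rw [setIntegral_congr_fun measurableSet_Ioc hRe, ← integral_integral_swap hF2, ← integral_neg]
      refine setIntegral_mono_on_ae ?_ hF2.integral_prod_left.neg measurableSet_Ioc ?_
      · exact (he.sub (he.comp (by fun_prop))).integrableOn_Ioc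
      · filter_upwards [hinc] with t ht ht'
        refine (ht ht' h hh0 (hh1.trans ht'.1)).trans (le_of_eq ?_)
        rw [← intervalIntegral.integral_of_le (by linarith),
          ← intervalIntegral.integral_of_le hh0.le,
          intervalIntegral.integral_comp_sub_left (fun τ => ∫ x, P τ t x ∂ν), sub_zero]
  refine le_of_forall_pos_le_add fun η hη => ?_
  have ev1 := hRlim.eventually_const_lt (show R₀ - η / 3 < R₀ by linarith)
  obtain ⟨h1, hh1, hh1R⟩ := mem_nhdsGT_iff_exists_Ioo_subset.1 ev1
  obtain ⟨d1, hd1, hd1e⟩ := Metric.continuous_iff.1 he t₁ (η / 3) (by positivity)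
  obtain ⟨d2, hd2, hd2e⟩ := Metric.continuous_iff.1 he t₂ (η / 3) (by positivity)
  set h := min (min (h1 / 2) (t₁ / 2)) (min (d1 / 2) (d2 / 2))
  have hh1' : (0 : ℝ) < h1 := hh1
  have hpos : 0 < h := by positivity
  have l1 : h < h1 := by
    have : h ≤ h1 / 2 := (min_le_left _ _).trans (min_le_left _ _)
    linarith
  have l2 : h < t₁ := by
    have : h ≤ t₁ / 2 := (min_le_left _ _).trans (min_le_right _ _)
    linarith
  have l3 : h < d1 := by
    have : h ≤ d1 / 2 := (min_le_right _ _).trans (min_le_left _ _)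
    linarith
  have l4 : h < d2 := by
    have : h ≤ d2 / 2 := (min_le_right _ _).trans (min_le_right _ _)
    linarith
  obtain ⟨hRi, hmain⟩ := hF h hpos l2
  have hlow : (R₀ - η / 3) * h ≤ ∫ σ in Ioc 0 h, R σ := by
    have := setIntegral_mono_on (μ := volume) (s := Ioc 0 h) (f := fun _ => R₀ - η / 3)
      (integrableOn_const (by simp) (by simp)) hRi measurableSet_Ioc
      fun σ hσ => (hh1R ⟨hσ.1, hσ.2.trans_lt l1⟩).le
    rw [setIntegral_const] at this
    simpa [hpos.le, mul_comm] using this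
  have hii : ∀ a b, IntervalIntegrable e volume a b := fun a b => he.intervalIntegrable a b
  have hish : IntervalIntegrable (fun t => e (t - h)) volume t₁ t₂ :=
    (he.comp (by fun_prop : Continuous fun t : ℝ => t - h)).intervalIntegrable _ _
  -- The integrated increments telescope to integrals of e over two windows of length h ending at t₂
  -- and t₁. After division by h these are averages, close to e(t₂) and e(t₁) by continuity.
  have hlhs : ∫ t in Ioc t₁ t₂, e t - e (t - h) =
      (∫ t in (t₂ - h)..t₂, e t) - ∫ t in (t₁ - h)..t₁, e t := by
    rw [← intervalIntegral.integral_of_le ht, intervalIntegral.integral_sub (hii _ _) hish,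
      intervalIntegral.integral_comp_sub_right,
      intervalIntegral.integral_interval_sub_interval_comm (hii _ _) (hii _ _) (hii _ _),
      intervalIntegral.integral_symm (t₁ - h) t₁, intervalIntegral.integral_symm (t₂ - h) t₂]
    ring
  have hup1 : ∫ t in (t₁ - h)..t₁, e t ≤ (e t₁ + η / 3) * h := by
    have := intervalIntegral.integral_mono_on (by linarith) (hii (t₁ - h) t₁)
      ((continuous_const (y := e t₁ + η / 3)).intervalIntegrable (μ := volume) (t₁ - h) t₁)
      fun t ht' => by
        have := hd1e t (by rw [Real.dist_eq, abs_lt]; constructor <;> linarith [ht'.1, ht'.2])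
        rw [Real.dist_eq, abs_lt] at this
        linarith [this.2]
    rw [intervalIntegral.integral_const, smul_eq_mul] at this
    linarith
  have hup2 : (e t₂ - η / 3) * h ≤ ∫ t in (t₂ - h)..t₂, e t := by
    have := intervalIntegral.integral_mono_on (by linarith)
      ((continuous_const (y := e t₂ - η / 3)).intervalIntegrable (μ := volume) (t₂ - h) t₂)
      (hii (t₂ - h) t₂)
      fun t ht' => by
        have := hd2e t (by rw [Real.dist_eq, abs_lt]; constructor <;> linarith [ht'.1, ht'.2])
        rw [Real.dist_eq, abs_lt] at this
        linarith [this.1]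
    rw [intervalIntegral.integral_const, smul_eq_mul] at this
    linarith
  rw [hlhs] at hmain
  have hfin : (e t₂ - e t₁) * h ≤ (-R₀ + η) * h := by nlinarith
  exact le_of_mul_le_mul_right hfin hpos

end Energy

end Analysis

/-! ### Charts, Gram densities and the Riemannian measure -/

section Geometry

theorem isManifold_one {N : ℕ} {M : Type*} [TopologicalSpace M]
    [ChartedSpace (EuclideanSpace ℝ (Fin N)) M] [IsManifold (𝓡 N) ∞ M] : IsManifold (𝓡 N) 1 M :=
  IsManifold.of_le (n := ∞) (by simp)

variable {N : ℕ} {M : Type*} [MetricSpace M] [ChartedSpace (EuclideanSpace ℝ (Fin N)) M]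
  [RiemannianBundle (fun x : M => TangentSpace (𝓡 N) x)] [IsManifold (𝓡 N) ∞ M]
  [IsContMDiffRiemannianBundle (𝓡 N) ∞ (EuclideanSpace ℝ (Fin N))
    (fun x : M => TangentSpace (𝓡 N) x)]
local notation "𝔼" => EuclideanSpace ℝ (Fin N)

attribute [local instance] isManifold_one

theorem isContinuousRiemannianBundle_tangent :
    IsContinuousRiemannianBundle 𝔼 (fun x : M => TangentSpace (𝓡 N) x) := by
  obtain ⟨g, hg, h⟩ := IsContMDiffRiemannianBundle.exists_contMDiff (IB := 𝓡 N) (n := ∞) (F := 𝔼)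
    (E := fun x : M => TangentSpace (𝓡 N) x)
  exact ⟨g, hg.continuous, h⟩

theorem continuousOn_coordField (c : M) (i : Fin N) :
    ContinuousOn (fun y => (⟨(chartAt 𝔼 c).symm y, coordField c i y⟩ : TangentBundle (𝓡 N) M))
      (chartAt 𝔼 c).target := by
  have h1 := (contMDiffOn_chart_symm (I := 𝓡 N) (n := ∞) (x := c)).continuousOn_tangentMapWithin
    (by simp) (chartAt 𝔼 c).open_target.uniqueMDiffOn
  have h2 : Continuous (fun y : 𝔼 =>
      (⟨y, EuclideanSpace.basisFun (Fin N) ℝ i⟩ : TangentBundle (𝓡 N) 𝔼)) := by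
    have : Continuous (fun y : 𝔼 => ((y, EuclideanSpace.basisFun (Fin N) ℝ i) : 𝔼 × 𝔼)) := by
      fun_prop
    exact (tangentBundleModelSpaceHomeomorph (𝓡 N)).symm.continuous.comp this
  have h3 := h1.comp h2.continuousOn (s := (chartAt 𝔼 c).target) (fun y hy => hy)
  refine h3.congr fun y hy => ?_
  simp only [Function.comp, tangentMapWithin, coordField]
  rw [mfderivWithin_of_isOpen (chartAt 𝔼 c).open_target hy]

theorem continuousOn_gram_coordField (c : M) :
    ContinuousOn (fun y => Matrix.gram ℝ fun i : Fin N => coordField c i y)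
      (chartAt 𝔼 c).target := by
  have := isContinuousRiemannianBundle_tangent (N := N) (M := M)
  refine continuousOn_pi.2 fun i => continuousOn_pi.2 fun j => ?_
  exact (continuousOn_coordField c i).inner_bundle (continuousOn_coordField c j)

/-- The derivative at `y` of the inverse of the chart at `c`, as a map on the model space. -/
def chartSymmDeriv (c : M) (y : 𝔼) : 𝔼 →L[ℝ] 𝔼 :=
  mfderiv (𝓡 N) (𝓡 N) (chartAt 𝔼 c).symm y

/-- Near y the inverse of one chart is the inverse of the other composed with the transition map;
this is the chain rule for that identity of germs. -/
theorem chartSymmDeriv_comp (c c' : M) {y : 𝔼} (hy : y ∈ (chartAt 𝔼 c).target)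
    (hy' : (chartAt 𝔼 c).symm y ∈ (chartAt 𝔼 c').source) :
    DifferentiableAt ℝ (fun z => chartAt 𝔼 c' ((chartAt 𝔼 c).symm z)) y ∧
    chartSymmDeriv c y = (chartSymmDeriv c' (chartAt 𝔼 c' ((chartAt 𝔼 c).symm y))).comp
      (fderiv ℝ (fun z => chartAt 𝔼 c' ((chartAt 𝔼 c).symm z)) y) := by
  have h1 : MDifferentiableAt (𝓡 N) (𝓡 N) (chartAt 𝔼 c).symm y :=
    mdifferentiableAt_atlas_symm (chart_mem_atlas 𝔼 c) hy
  have h2 : MDifferentiableAt (𝓡 N) (𝓡 N) (chartAt 𝔼 c') ((chartAt 𝔼 c).symm y) :=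
    mdifferentiableAt_atlas (chart_mem_atlas 𝔼 c') hy'
  have h12 : MDifferentiableAt (𝓡 N) (𝓡 N) (chartAt 𝔼 c' ∘ (chartAt 𝔼 c).symm) y := h2.comp y h1
  have h3 : MDifferentiableAt (𝓡 N) (𝓡 N) (chartAt 𝔼 c').symm
      ((chartAt 𝔼 c' ∘ (chartAt 𝔼 c).symm) y) :=
    mdifferentiableAt_atlas_symm (chart_mem_atlas 𝔼 c') ((chartAt 𝔼 c').map_source hy')
  have hd := mdifferentiableAt_iff_differentiableAt.1 h12
  refine ⟨hd, ?_⟩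
  have hcomp := mfderiv_comp y h3 h12
  have heq : ((chartAt 𝔼 c').symm ∘ (chartAt 𝔼 c' ∘ (chartAt 𝔼 c).symm)) =ᶠ[𝓝 y]
      (chartAt 𝔼 c).symm := by
    have := h1.continuousAt.preimage_mem_nhds ((chartAt 𝔼 c').open_source.mem_nhds hy')
    filter_upwards [this] with z hz
    exact (chartAt 𝔼 c').left_inv hz
  rw [mfderiv_eq_fderiv] at hcomp
  rw [chartSymmDeriv, ← heq.mfderiv_eq]
  exact hcomp

theorem chartSymmDeriv_injective (c : M) {y : 𝔼} (hy : y ∈ (chartAt 𝔼 c).target) :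
    Function.Injective (chartSymmDeriv c y) := by
  have h1 : MDifferentiableAt (𝓡 N) (𝓡 N) (chartAt 𝔼 c).symm y :=
    mdifferentiableAt_atlas_symm (chart_mem_atlas 𝔼 c) hy
  have h2 : MDifferentiableAt (𝓡 N) (𝓡 N) (chartAt 𝔼 c) ((chartAt 𝔼 c).symm y) :=
    mdifferentiableAt_atlas (chart_mem_atlas 𝔼 c) ((chartAt 𝔼 c).map_target hy)
  have hcomp := mfderiv_comp y h2 h1
  have heq : ((chartAt 𝔼 c) ∘ (chartAt 𝔼 c).symm) =ᶠ[𝓝 y] id := by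
    filter_upwards [(chartAt 𝔼 c).open_target.mem_nhds hy] with z hz
    exact (chartAt 𝔼 c).right_inv hz
  rw [heq.mfderiv_eq, mfderiv_id] at hcomp
  intro a b hab
  have h3 := DFunLike.congr_fun hcomp a
  have h4 := DFunLike.congr_fun hcomp b
  have h5 : (mfderiv (𝓡 N) (𝓡 N) (chartAt 𝔼 c) ((chartAt 𝔼 c).symm y)) (chartSymmDeriv c y a) =
    (mfderiv (𝓡 N) (𝓡 N) (chartAt 𝔼 c) ((chartAt 𝔼 c).symm y)) (chartSymmDeriv c y b) := by
    rw [hab]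
  exact h3.trans (h5.trans h4.symm)

theorem linearIndependent_coordField (c : M) {y : 𝔼} (hy : y ∈ (chartAt 𝔼 c).target) :
    LinearIndependent ℝ fun i : Fin N => coordField c i y := by
  have h := (EuclideanSpace.basisFun (Fin N) ℝ).toBasis.linearIndependent.map'
    (chartSymmDeriv c y).toLinearMap (LinearMap.ker_eq_bot.2 (chartSymmDeriv_injective c hy))
  rw [OrthonormalBasis.coe_toBasis] at h
  exact h

theorem continuousOn_sqrtDetMetric (c : M) :
    ContinuousOn (sqrtDetMetric c) (chartAt 𝔼 c).target :=
  Real.continuous_sqrt.comp_continuousOn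
    ((Continuous.matrix_det continuous_id).comp_continuousOn (continuousOn_gram_coordField c))

theorem det_gram_pos {V : Type*} [NormedAddCommGroup V] [InnerProductSpace ℝ V] {v : Fin N → V}
    (hv : LinearIndependent ℝ v) : 0 < (Matrix.gram ℝ v).det :=
  (Matrix.posDef_gram_of_linearIndependent hv).det_pos

theorem sqrtDetMetric_pos (c : M) {y : 𝔼} (hy : y ∈ (chartAt 𝔼 c).target) :
    0 < sqrtDetMetric c y := by
  rw [sqrtDetMetric]
  exact Real.sqrt_pos.2 (det_gram_pos (linearIndependent_coordField c hy))

/-- The Gram density of a linear map from the model space to the tangent space at `x`. -/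
def gramDensity (x : M) (L : 𝔼 →L[ℝ] 𝔼) : ℝ :=
  Real.sqrt (Matrix.gram ℝ (E := TangentSpace (𝓡 N) x) fun i : Fin N =>
    L (EuclideanSpace.basisFun (Fin N) ℝ i)).det

/-- Separating the base point from the linear map lets the frames of two charts at the same point of
M be compared inside a single inner product space. -/
theorem sqrtDetMetric_eq_gramDensity (c : M) (y : 𝔼) :
    sqrtDetMetric c y = gramDensity ((chartAt 𝔼 c).symm y) (chartSymmDeriv c y) := rfl

/-- If A is the matrix of T, the Gram matrix of the transformed frame is AᵀGA, so the determinant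
picks up the square of det A. -/
theorem det_gram_comp {V : Type*} [NormedAddCommGroup V] [InnerProductSpace ℝ V]
    (L : 𝔼 →ₗ[ℝ] V) (T : 𝔼 →ₗ[ℝ] 𝔼) :
    (Matrix.gram ℝ fun i : Fin N => L (T (EuclideanSpace.basisFun (Fin N) ℝ i))).det =
      LinearMap.det T ^ 2 *
        (Matrix.gram ℝ fun i : Fin N => L (EuclideanSpace.basisFun (Fin N) ℝ i)).det := by
  set b := (EuclideanSpace.basisFun (Fin N) ℝ).toBasis
  set A := LinearMap.toMatrix b b T
  have hA : ∀ i, T (EuclideanSpace.basisFun (Fin N) ℝ i) =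
      ∑ j, A j i • (EuclideanSpace.basisFun (Fin N) ℝ j) := by
    intro i
    have := b.sum_repr (T (b i))
    simp only [b, OrthonormalBasis.coe_toBasis] at this
    rw [← this]
    refine Finset.sum_congr rfl fun j _ => ?_
    simp [A, b, LinearMap.toMatrix_apply]
  have : (Matrix.gram ℝ fun i : Fin N => L (T (EuclideanSpace.basisFun (Fin N) ℝ i))) =
      A.transpose * (Matrix.gram ℝ fun i : Fin N => L (EuclideanSpace.basisFun (Fin N) ℝ i)) *
        A := by
    ext i k
    simp only [Matrix.gram_apply, Matrix.mul_apply, Matrix.transpose_apply, hA, map_sum, map_smul,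
      sum_inner, inner_sum, inner_smul_left, inner_smul_right, Finset.sum_mul, RCLike.conj_to_real]
    simp only [Finset.mul_sum]
    refine Finset.sum_congr rfl fun j _ => Finset.sum_congr rfl fun l _ => ?_
    rw [real_inner_comm]
    ring
  rw [this, Matrix.det_mul, Matrix.det_mul, Matrix.det_transpose, ← LinearMap.det_toMatrix b T]
  ring

theorem gramDensity_comp (x : M) (L T : 𝔼 →L[ℝ] 𝔼) :
    gramDensity x (L.comp T) = |T.det| * gramDensity x L := by
  have h := det_gram_comp (V := TangentSpace (𝓡 N) x) (L : 𝔼 →ₗ[ℝ] 𝔼) (T : 𝔼 →ₗ[ℝ] 𝔼)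
  rw [gramDensity, gramDensity]
  refine (congrArg Real.sqrt h).trans ?_
  rw [Real.sqrt_mul (sq_nonneg _), Real.sqrt_sq_eq_abs]
  rfl

theorem sqrtDetMetric_transition (c c' : M) {y : 𝔼} (hy : y ∈ (chartAt 𝔼 c).target)
    (hy' : (chartAt 𝔼 c).symm y ∈ (chartAt 𝔼 c').source) :
    sqrtDetMetric c y =
      |(fderiv ℝ (fun z => chartAt 𝔼 c' ((chartAt 𝔼 c).symm z)) y).det| *
        sqrtDetMetric c' (chartAt 𝔼 c' ((chartAt 𝔼 c).symm y)) := by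
  rw [sqrtDetMetric_eq_gramDensity, sqrtDetMetric_eq_gramDensity,
    (chartSymmDeriv_comp c c' hy hy').2, gramDensity_comp, (chartAt 𝔼 c').left_inv hy']

theorem inner_grad (v : M → ℝ) (x : M) (ξ : TangentSpace (𝓡 N) x) :
    inner ℝ (grad v x) ξ = mfderiv (𝓡 N) 𝓘(ℝ, ℝ) v x ξ := by
  haveI : FiniteDimensional ℝ (TangentSpace (𝓡 N) x) :=
    inferInstanceAs (FiniteDimensional ℝ (EuclideanSpace ℝ (Fin N)))
  haveI : CompleteSpace (TangentSpace (𝓡 N) x) := FiniteDimensional.complete ℝ _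
  exact InnerProductSpace.toDual_symm_apply

variable [SecondCountableTopology M] [Nonempty M] [MeasurableSpace M] [BorelSpace M]

theorem measurableSet_chart_symm_preimage {A : Set M} (hA : MeasurableSet A) (c : M) :
    MeasurableSet ((chartAt 𝔼 c).symm ⁻¹' A ∩ (chartAt 𝔼 c).target) := by
  have h1 : Measurable ((chartAt 𝔼 c).target.domRestrict (chartAt 𝔼 c).symm) :=
    (continuousOn_iff_continuous_domRestrict.1 (chartAt 𝔼 c).continuousOn_symm).measurable
  have h2 := (chartAt 𝔼 c).open_target.measurableSet.subtype_image (h1 hA)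
  convert h2 using 1
  ext y
  simp only [mem_inter_iff, mem_preimage, mem_image, Subtype.exists, exists_and_right,
    exists_eq_right, domRestrict_apply]
  tauto

theorem aemeasurable_chart_symm (c : M) :
    AEMeasurable (chartAt 𝔼 c).symm (volume.restrict (chartAt 𝔼 c).target) :=
  (chartAt 𝔼 c).continuousOn_symm.aemeasurable (chartAt 𝔼 c).open_target.measurableSet

theorem aemeasurable_sqrtDetMetric (c : M) :
    AEMeasurable (fun y => ENNReal.ofReal (sqrtDetMetric c y))
      (volume.restrict (chartAt 𝔼 c).target) :=
  ((continuousOn_sqrtDetMetric c).aemeasurable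
    (chartAt 𝔼 c).open_target.measurableSet).ennreal_ofReal

theorem lintegral_chartVolume (c : M) {h : M → ℝ≥0∞} (hh : Measurable h) :
    ∫⁻ x, h x ∂(chartVolume (N := N) c) =
      ∫⁻ y in (chartAt 𝔼 c).target,
        ENNReal.ofReal (sqrtDetMetric c y) * h ((chartAt 𝔼 c).symm y) := by
  have hac := withDensity_absolutelyContinuous (volume.restrict (chartAt 𝔼 c).target)
    (fun y => ENNReal.ofReal (sqrtDetMetric c y))
  rw [chartVolume, lintegral_map' hh.aemeasurable ((aemeasurable_chart_symm c).mono_ac hac),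
    lintegral_withDensity_eq_lintegral_mul₀ (aemeasurable_sqrtDetMetric c)
      (g := fun y => h ((chartAt 𝔼 c).symm y)) (hh.comp_aemeasurable (aemeasurable_chart_symm c))]
  rfl

theorem chartVolume_apply (c : M) {A : Set M} (hA : MeasurableSet A) :
    chartVolume (N := N) c A =
      ∫⁻ y in (chartAt 𝔼 c).symm ⁻¹' A ∩ (chartAt 𝔼 c).target,
        ENNReal.ofReal (sqrtDetMetric c y) := by
  have hac := withDensity_absolutelyContinuous (volume.restrict (chartAt 𝔼 c).target)
    (fun y => ENNReal.ofReal (sqrtDetMetric c y))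
  rw [chartVolume, Measure.map_apply_of_aemeasurable ((aemeasurable_chart_symm c).mono_ac hac) hA,
    withDensity_apply', Measure.restrict_restrict' (chartAt 𝔼 c).open_target.measurableSet]

/-- The Jacobian of the transition map that appears in the change of variables is exactly the factor
relating the two densities. -/
theorem chartVolume_eq_of_subset (c c' : M) {A : Set M} (hA : MeasurableSet A)
    (h : A ⊆ (chartAt 𝔼 c).source) (h' : A ⊆ (chartAt 𝔼 c').source) :
    chartVolume (N := N) c A = chartVolume (N := N) c' A := by
  rw [chartVolume_apply c hA, chartVolume_apply c' hA]
  set e := chartAt 𝔼 c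
  set e' := chartAt 𝔼 c'
  have himg : e'.symm ⁻¹' A ∩ e'.target = (fun z => e' (e.symm z)) '' (e.symm ⁻¹' A ∩ e.target) := by
    ext y
    constructor
    · rintro ⟨hy, hyt⟩
      refine ⟨e (e'.symm y), ⟨?_, e.map_source (h hy)⟩, ?_⟩
      · simpa only [mem_preimage, e.left_inv (h hy)] using hy
      · simp only [e.left_inv (h hy), e'.right_inv hyt]
    · rintro ⟨z, ⟨hz, hzt⟩, rfl⟩
      refine ⟨?_, e'.map_source (h' hz)⟩
      simpa only [mem_preimage, e'.left_inv (h' hz)] using hz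
  rw [himg, lintegral_image_eq_lintegral_abs_det_fderiv_mul volume
    (measurableSet_chart_symm_preimage hA c) (f' := fderiv ℝ (fun z => e' (e.symm z)))
    (fun y hy => (chartSymmDeriv_comp c c' hy.2 (h' hy.1)).1.hasFDerivAt.hasFDerivWithinAt)]
  · refine setLIntegral_congr_fun (measurableSet_chart_symm_preimage hA c) fun y hy => ?_
    rw [sqrtDetMetric_transition c c' hy.2 (h' hy.1), ENNReal.ofReal_mul (abs_nonneg _)]
  · intro y hy z hz hyz
    have := e'.injOn (h' hy.1) (h' hz.1) hyz
    exact e.symm.injOn hy.2 hz.2 this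

theorem chartVolume_compl_source (c : M) :
    chartVolume (N := N) c (chartAt 𝔼 c).sourceᶜ = 0 := by
  rw [chartVolume_apply c (chartAt 𝔼 c).open_source.measurableSet.compl]
  have : (chartAt 𝔼 c).symm ⁻¹' (chartAt 𝔼 c).sourceᶜ ∩ (chartAt 𝔼 c).target = ∅ := by
    ext y
    simp only [mem_inter_iff, mem_preimage, mem_compl_iff, mem_empty_iff_false, iff_false, not_and]
    intro h1 h2
    exact h1 ((chartAt 𝔼 c).map_target h2)
  rw [this]; simp

/-- The Riemannian measure is the volume of any chart on the domain of that chart. -/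
theorem riemannianMeasure_restrict_source (c : M) :
    (riemannianMeasure N M).restrict (chartAt 𝔼 c).source = chartVolume (N := N) c := by
  ext A hA
  have hS := (chartAt 𝔼 c).open_source.measurableSet
  rw [Measure.restrict_apply hA, riemannianMeasure, Measure.sum_apply _ (hA.inter hS)]
  set d : ℕ → M := (exists_chart_cover N M).choose
  have hd : (⋃ n, (chartAt 𝔼 (d n)).source) = univ := (exists_chart_cover N M).choose_spec
  set P : ℕ → Set M := fun n => (chartAt 𝔼 (d n)).source \ ⋃ k < n, (chartAt 𝔼 (d k)).source
  have hP : ∀ n, MeasurableSet (P n) := fun n => (chartAt 𝔼 (d n)).open_source.measurableSet.diff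
    (isOpen_biUnion fun k _ => (chartAt 𝔼 (d k)).open_source).measurableSet
  have hPd : P = disjointed fun n => (chartAt 𝔼 (d n)).source := by
    funext n
    rw [disjointed_eq_inter_compl]
    simp only [P, sdiff_eq, compl_iUnion]
  -- On a piece lying in both chart domains the two volumes agree, so the cover chosen in the
  -- definition is immaterial; the pieces are disjoint and exhaust M.
  have h1 : ∀ n, ((chartVolume (N := N) (d n)).restrict (P n)) (A ∩ (chartAt 𝔼 c).source) =
      chartVolume (N := N) c (A ∩ (chartAt 𝔼 c).source ∩ P n) := by
    intro n
    rw [Measure.restrict_apply (hA.inter hS)]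
    exact chartVolume_eq_of_subset _ _ ((hA.inter hS).inter (hP n))
      (fun x hx => hx.2.1) (fun x hx => hx.1.2)
  calc _ = ∑' n, chartVolume (N := N) c (A ∩ (chartAt 𝔼 c).source ∩ P n) := tsum_congr h1
    _ = chartVolume (N := N) c (⋃ n, A ∩ (chartAt 𝔼 c).source ∩ P n) := by
        rw [measure_iUnion _ fun n => (hA.inter hS).inter (hP n)]
        intro i j hij
        have := disjoint_disjointed (fun n => (chartAt 𝔼 (d n)).source) hij
        rw [← hPd] at this
        exact this.mono inter_subset_right inter_subset_right
    _ = chartVolume (N := N) c (A ∩ (chartAt 𝔼 c).source) := by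
        rw [← inter_iUnion, hPd, iUnion_disjointed, hd, inter_univ]
    _ = chartVolume (N := N) c A := by
        refine measure_congr (inter_ae_eq_left_of_ae_eq_univ ?_)
        exact ae_eq_univ.2 (chartVolume_compl_source c)

theorem lintegral_riemannianMeasure_source (c : M) {h : M → ℝ≥0∞} (hh : Measurable h) :
    ∫⁻ x in (chartAt 𝔼 c).source, h x ∂(riemannianMeasure N M) =
      ∫⁻ y in (chartAt 𝔼 c).target,
        ENNReal.ofReal (sqrtDetMetric c y) * h ((chartAt 𝔼 c).symm y) := by
  rw [riemannianMeasure_restrict_source, lintegral_chartVolume c hh]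

theorem riemannianMeasure_apply_of_subset_source (c : M) {A : Set M} (hA : MeasurableSet A)
    (h : A ⊆ (chartAt 𝔼 c).source) :
    riemannianMeasure N M A = ∫⁻ y in (chartAt 𝔼 c).symm ⁻¹' A ∩ (chartAt 𝔼 c).target,
        ENNReal.ofReal (sqrtDetMetric c y) := by
  rw [← chartVolume_apply c hA, ← riemannianMeasure_restrict_source, Measure.restrict_apply hA,
    inter_eq_left.2 h]

/-- In a chart the density is continuous, hence bounded on the image of a compact neighbourhood. -/
instance : IsLocallyFiniteMeasure (riemannianMeasure N M) := by
  have := ChartedSpace.locallyCompactSpace 𝔼 M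
  refine ⟨fun x => ?_⟩
  obtain ⟨K, hKx, hKs, hK⟩ := local_compact_nhds
    ((chartAt 𝔼 x).open_source.mem_nhds (mem_chart_source 𝔼 x))
  refine ⟨K, hKx, ?_⟩
  rw [riemannianMeasure_apply_of_subset_source x hK.measurableSet hKs]
  have himg : (chartAt 𝔼 x).symm ⁻¹' K ∩ (chartAt 𝔼 x).target = chartAt 𝔼 x '' K := by
    rw [(chartAt 𝔼 x).image_eq_target_inter_inv_preimage hKs, inter_comm]
  have hcK : IsCompact (chartAt 𝔼 x '' K) :=
    hK.image_of_continuousOn ((chartAt 𝔼 x).continuousOn.mono hKs)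
  have hsub : chartAt 𝔼 x '' K ⊆ (chartAt 𝔼 x).target := by
    rintro _ ⟨z, hz, rfl⟩; exact (chartAt 𝔼 x).map_source (hKs hz)
  rw [himg]
  obtain ⟨C, hC⟩ := hcK.exists_bound_of_continuousOn ((continuousOn_sqrtDetMetric x).mono hsub)
  calc _ ≤ ∫⁻ y in chartAt 𝔼 x '' K, ENNReal.ofReal C := by
        refine setLIntegral_mono' hcK.measurableSet fun y hy => ENNReal.ofReal_le_ofReal ?_
        exact (le_abs_self _).trans (hC y hy)
    _ < ⊤ := by
        rw [setLIntegral_const]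
        exact ENNReal.mul_lt_top ENNReal.ofReal_lt_top hcK.measure_lt_top

/-- Integration over a compact subset of a chart target is controlled by the Riemannian measure. -/
theorem exists_lintegral_chart_le (c : M) {K : Set 𝔼} (hK : IsCompact K)
    (hKt : K ⊆ (chartAt 𝔼 c).target) :
    ∃ C : ℝ≥0∞, C ≠ ⊤ ∧ ∀ h : M → ℝ≥0∞, Measurable h →
      ∫⁻ y in K, h ((chartAt 𝔼 c).symm y) ≤
        C * ∫⁻ x in (chartAt 𝔼 c).symm '' K, h x ∂(riemannianMeasure N M) := by
  set e := chartAt 𝔼 c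
  rcases K.eq_empty_or_nonempty with rfl | hne
  · exact ⟨0, by simp, fun h _ => by simp⟩
  -- The density is continuous and positive, so it has a positive minimum on K; its inverse is the
  -- constant.
  obtain ⟨y₀, hy₀, hmin⟩ := hK.exists_isMinOn hne ((continuousOn_sqrtDetMetric c).mono hKt)
  set b := sqrtDetMetric c y₀
  have hb : 0 < b := sqrtDetMetric_pos c (hKt hy₀)
  have hcK : IsCompact (e.symm '' K) := hK.image_of_continuousOn (e.continuousOn_symm.mono hKt)
  refine ⟨(ENNReal.ofReal b)⁻¹, by simp [hb], fun h hh => ?_⟩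
  have hb0 : ENNReal.ofReal b ≠ 0 := by simp [hb]
  rw [← ENNReal.mul_le_iff_le_inv hb0 ENNReal.ofReal_ne_top,
    ← lintegral_const_mul' _ _ ENNReal.ofReal_ne_top]
  have hsub : e.symm '' K ⊆ e.source := by
    rintro _ ⟨z, hz, rfl⟩; exact e.map_target (hKt hz)
  have h1 : ∫⁻ x in e.symm '' K, h x ∂(riemannianMeasure N M) =
      ∫⁻ x in e.source, (e.symm '' K).indicator h x ∂(riemannianMeasure N M) := by
    rw [lintegral_indicator hcK.measurableSet, Measure.restrict_restrict hcK.measurableSet,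
      inter_eq_left.2 hsub]
  rw [h1, lintegral_riemannianMeasure_source c (hh.indicator hcK.measurableSet)]
  calc _ ≤ ∫⁻ y in K, ENNReal.ofReal (sqrtDetMetric c y) * (e.symm '' K).indicator h (e.symm y) := by
        refine setLIntegral_mono' hK.measurableSet fun y hy => ?_
        rw [indicator_of_mem (mem_image_of_mem _ hy)]
        gcongr
        exact hmin hy
    _ ≤ _ := lintegral_mono_set hKt

/-! ### Continuity and measurability of gradients and tangent fields -/

theorem continuous_mfderiv_apply {v : M → ℝ} (hv : ContMDiff (𝓡 N) 𝓘(ℝ, ℝ) ∞ v) :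
    Continuous fun ξ : TangentBundle (𝓡 N) M => (mfderiv (𝓡 N) 𝓘(ℝ, ℝ) v ξ.1 ξ.2 : ℝ) := by
  have h := hv.continuous_tangentMap (by simp)
  exact (continuous_snd.comp (tangentBundleModelSpaceHomeomorph 𝓘(ℝ, ℝ)).continuous).comp h

/-- The norm is recovered from the inner products with a frame through the inverse Gram matrix.
Writing the inverse as adjugate over determinant makes continuous dependence on the data evident.
The formula serves twice: for continuity of |∇v|, and to see that a vector orthogonal to a frame is
zero. -/
theorem norm_sq_eq_gram {V : Type*} [NormedAddCommGroup V] [InnerProductSpace ℝ V]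
    [FiniteDimensional ℝ V] {X : Fin N → V}
    (hX : LinearIndependent ℝ X) (hspan : Module.finrank ℝ V = N) (ξ : V) :
    ‖ξ‖ ^ 2 = (Matrix.gram ℝ X).det⁻¹ *
      ((fun i => inner ℝ ξ (X i)) ⬝ᵥ ((Matrix.gram ℝ X).adjugate.mulVec fun i => inner ℝ ξ (X i))) := by
  have hdet : (Matrix.gram ℝ X).det ≠ 0 := (det_gram_pos hX).ne'
  rcases Nat.eq_zero_or_pos N with h0 | hpos
  · subst h0
    have : Subsingleton V := Module.finrank_zero_iff.1 hspan
    simp [Subsingleton.elim ξ 0]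
  · haveI : Nonempty (Fin N) := ⟨⟨0, hpos⟩⟩
    set b := basisOfLinearIndependentOfCardEqFinrank hX (by simp [hspan])
    have hb : ∀ i, b i = X i := fun i => by simp [b]
    have hsum := b.sum_repr ξ
    set a : Fin N → ℝ := fun i => b.repr ξ i
    have hd : (fun i => inner ℝ ξ (X i)) = (Matrix.gram ℝ X).mulVec a := by
      funext i
      rw [← hsum, sum_inner, Matrix.mulVec, dotProduct]
      refine Finset.sum_congr rfl fun j _ => ?_
      rw [inner_smul_left, Matrix.gram_apply, hb, real_inner_comm]
      simp [a, mul_comm]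
    rw [hd, Matrix.mulVec_mulVec, Matrix.adjugate_mul, Matrix.smul_mulVec, Matrix.one_mulVec,
      dotProduct_smul, smul_eq_mul, inv_mul_cancel_left₀ hdet, ← real_inner_self_eq_norm_sq]
    conv_lhs => rw [← hsum, inner_sum]
    rw [dotProduct]
    refine Finset.sum_congr rfl fun i _ => ?_
    rw [inner_smul_right, hb, hsum, mul_comm]
    congr 1
    exact congrFun hd i

instance (x : M) : FiniteDimensional ℝ (TangentSpace (𝓡 N) x) :=
  inferInstanceAs (FiniteDimensional ℝ 𝔼)

theorem finrank_tangentSpace (x : M) : Module.finrank ℝ (TangentSpace (𝓡 N) x) = N :=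
  (finrank_euclideanSpace_fin : Module.finrank ℝ 𝔼 = N)

theorem continuousOn_inner_grad_coordField {v : M → ℝ} (hv : ContMDiff (𝓡 N) 𝓘(ℝ, ℝ) ∞ v)
    (c : M) (i : Fin N) :
    ContinuousOn (fun y => (inner ℝ (grad v ((chartAt 𝔼 c).symm y)) (coordField c i y) : ℝ))
      (chartAt 𝔼 c).target := by
  simp only [inner_grad]
  exact (continuous_mfderiv_apply hv).comp_continuousOn (continuousOn_coordField c i)

theorem continuousOn_inv_det_mul_adjugate {X : Type*} [TopologicalSpace X]
    {A : X → Matrix (Fin N) (Fin N) ℝ} {d : X → Fin N → ℝ} {s : Set X} (hA : ContinuousOn A s)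
    (hd : ContinuousOn d s) (h0 : ∀ x ∈ s, (A x).det ≠ 0) :
    ContinuousOn (fun x => (A x).det⁻¹ * (d x ⬝ᵥ ((A x).adjugate.mulVec (d x)))) s := by
  have hc : Continuous fun z : Matrix (Fin N) (Fin N) ℝ × (Fin N → ℝ) =>
      z.2 ⬝ᵥ (z.1.adjugate.mulVec z.2) := by fun_prop
  have hdet : Continuous fun z : Matrix (Fin N) (Fin N) ℝ => z.det := by fun_prop
  exact ((hdet.comp_continuousOn hA).inv₀ h0).mul (hc.comp_continuousOn (hA.prodMk hd))

theorem continuousOn_norm_grad_source {v : M → ℝ} (hv : ContMDiff (𝓡 N) 𝓘(ℝ, ℝ) ∞ v) (c : M) :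
    ContinuousOn (fun x => ‖grad (N := N) v x‖) (chartAt 𝔼 c).source := by
  have h1 : ContinuousOn (fun y => ‖grad (N := N) v ((chartAt 𝔼 c).symm y)‖ ^ 2)
      (chartAt 𝔼 c).target := by
    have hA := continuousOn_gram_coordField (N := N) c
    have hd : ContinuousOn (fun y (i : Fin N) =>
        (inner ℝ (grad v ((chartAt 𝔼 c).symm y)) (coordField c i y) : ℝ)) (chartAt 𝔼 c).target :=
      continuousOn_pi.2 fun i => continuousOn_inner_grad_coordField hv c i
    have h0 : ∀ y ∈ (chartAt 𝔼 c).target,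
        (Matrix.gram ℝ fun i : Fin N => coordField c i y).det ≠ 0 := fun y hy h => by
      have := sqrtDetMetric_pos c hy
      rw [sqrtDetMetric, h, Real.sqrt_zero] at this
      exact lt_irrefl _ this
    have hF := continuousOn_inv_det_mul_adjugate hA hd h0
    have heq : ∀ y ∈ (chartAt 𝔼 c).target, ‖grad (N := N) v ((chartAt 𝔼 c).symm y)‖ ^ 2 =
        (Matrix.gram ℝ fun i : Fin N => coordField c i y).det⁻¹ *
        ((fun i => inner ℝ (grad v ((chartAt 𝔼 c).symm y)) (coordField c i y)) ⬝ᵥ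
          ((Matrix.gram ℝ fun i : Fin N => coordField c i y).adjugate.mulVec
            fun i => inner ℝ (grad v ((chartAt 𝔼 c).symm y)) (coordField c i y))) := fun y hy =>
      norm_sq_eq_gram (V := TangentSpace (𝓡 N) ((chartAt 𝔼 c).symm y))
        (X := fun i => coordField c i y) (linearIndependent_coordField c hy)
        (finrank_tangentSpace _) (grad v ((chartAt 𝔼 c).symm y))
    exact hF.congr heq
  have h2 := (Real.continuous_sqrt.comp_continuousOn h1).comp (chartAt 𝔼 c).continuousOn
    (chartAt 𝔼 c).mapsTo
  refine h2.congr fun x hx => ?_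
  simp only [Function.comp, Real.sqrt_sq (norm_nonneg _)]
  exact (congrArg (fun z => ‖grad (N := N) v z‖) ((chartAt 𝔼 c).left_inv hx)).symm

theorem continuous_norm_grad {v : M → ℝ} (hv : ContMDiff (𝓡 N) 𝓘(ℝ, ℝ) ∞ v) :
    Continuous fun x => ‖grad (N := N) v x‖ :=
  continuous_iff_continuousAt.2 fun x => (continuousOn_norm_grad_source hv x).continuousAt
    ((chartAt 𝔼 x).open_source.mem_nhds (mem_chart_source 𝔼 x))

/-- Needed so that on the product of two tangent bundles the Borel sets belong to the product
σ-algebra, which makes continuous functions of pairs of measurable fields measurable. -/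
theorem secondCountableTopology_tangentBundle :
    SecondCountableTopology (TangentBundle (𝓡 N) M) := by
  obtain ⟨c, hc⟩ := exists_chart_cover N M
  have : SecondCountableTopology (ModelProd 𝔼 𝔼) :=
    inferInstanceAs (SecondCountableTopology (𝔼 × 𝔼))
  refine ChartedSpace.secondCountable_of_countable_cover (ModelProd 𝔼 𝔼)
    (s := range fun n => (⟨c n, (0 : 𝔼)⟩ : TangentBundle (𝓡 N) M)) ?_ (countable_range _)
  refine eq_univ_of_forall fun ξ => ?_
  obtain ⟨n, hn⟩ := mem_iUnion.1 (hc ▸ mem_univ ξ.1 : ξ.1 ∈ ⋃ n, (chartAt 𝔼 (c n)).source)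
  refine mem_iUnion₂.2 ⟨_, mem_range_self n, ?_⟩
  exact (TangentBundle.mem_chart_source_iff _ _).2 hn

/-- A field of tangent vectors along a map `b` is measurable for the Borel `σ`-algebra of the
tangent bundle. -/
def MeasurableAlong {α : Type*} [MeasurableSpace α] (b : α → M)
    (G : ∀ a, TangentSpace (𝓡 N) (b a)) : Prop :=
  @Measurable α (TangentBundle (𝓡 N) M) _ (borel _) fun a => ⟨b a, G a⟩

theorem measurable_inner_along {α : Type*} [MeasurableSpace α] {b : α → M}
    {G H : ∀ a, TangentSpace (𝓡 N) (b a)} (hG : MeasurableAlong b G) (hH : MeasurableAlong b H) :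
    Measurable fun a => (inner ℝ (G a) (H a) : ℝ) := by
  letI : MeasurableSpace (TangentBundle (𝓡 N) M) := borel _
  haveI : BorelSpace (TangentBundle (𝓡 N) M) := ⟨rfl⟩
  have := secondCountableTopology_tangentBundle (N := N) (M := M)
  have := isContinuousRiemannianBundle_tangent (N := N) (M := M)
  -- The metric is a continuous function on the fibre product of the tangent bundle with itself,
  -- through which the pair of fields factors. The field `w` is the second vector moved to the fibre
  -- of the first along the equality of base points.
  let D := {z : TangentBundle (𝓡 N) M × TangentBundle (𝓡 N) M // z.1.proj = z.2.proj}
  let w : ∀ z : D, TangentSpace (𝓡 N) z.1.1.proj := fun z => z.2 ▸ z.1.2.2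
  have hw : ∀ z : D, (⟨z.1.1.proj, w z⟩ : TangentBundle (𝓡 N) M) = z.1.2 := by
    rintro ⟨⟨⟨a, x⟩, ⟨a', y⟩⟩, h⟩
    obtain rfl : a = a' := h
    rfl
  have hI : Continuous fun z : D => (inner ℝ z.1.1.2 (w z) : ℝ) := by
    refine Continuous.inner_bundle (F := 𝔼) (E := fun x : M => TangentSpace (𝓡 N) x)
      (b := fun z : D => z.1.1.proj) (v := fun z : D => z.1.1.2)
      (w := w) ?_ ?_
    · exact continuous_fst.comp continuous_subtype_val
    · simp only [hw]
      exact continuous_snd.comp continuous_subtype_val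
  have hf : Measurable fun a : α => (⟨(⟨b a, G a⟩, ⟨b a, H a⟩), rfl⟩ : D) :=
    (Measurable.prodMk hG hH).subtype_mk
  exact hI.measurable.comp hf

theorem measurable_norm_along {α : Type*} [MeasurableSpace α] {b : α → M}
    {G : ∀ a, TangentSpace (𝓡 N) (b a)} (hG : MeasurableAlong b G) :
    Measurable fun a => ‖G a‖ := by
  have h := (measurable_inner_along hG hG).sqrt
  simpa only [real_inner_self_eq_norm_sq, Real.sqrt_sq (norm_nonneg _)] using h

theorem measurable_inner_grad_along {α : Type*} [MeasurableSpace α] {b : α → M}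
    {G : ∀ a, TangentSpace (𝓡 N) (b a)} (hG : MeasurableAlong b G) {v : M → ℝ}
    (hv : ContMDiff (𝓡 N) 𝓘(ℝ, ℝ) ∞ v) :
    Measurable fun a => (inner ℝ (grad v (b a)) (G a) : ℝ) := by
  simp only [inner_grad]
  letI : MeasurableSpace (TangentBundle (𝓡 N) M) := borel _
  haveI : BorelSpace (TangentBundle (𝓡 N) M) := ⟨rfl⟩
  exact (continuous_mfderiv_apply hv).measurable.comp hG

theorem MeasurableAlong.comp {α β : Type*} [MeasurableSpace α] [MeasurableSpace β] {b : α → M}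
    {G : ∀ a, TangentSpace (𝓡 N) (b a)} (hG : MeasurableAlong b G) {f : β → α}
    (hf : Measurable f) : MeasurableAlong (fun z => b (f z)) fun z => G (f z) := by
  letI : MeasurableSpace (TangentBundle (𝓡 N) M) := borel _
  exact Measurable.comp (g := fun a => (⟨b a, G a⟩ : TangentBundle (𝓡 N) M)) hG hf

/-- After expanding the square, the smooth gradient enters only through its norm, which is
continuous, and through its inner product with G, which is a differential. Measurability of the
gradient as a map into the tangent bundle is not needed. -/
theorem measurable_norm_grad_sub_along {α : Type*} [MeasurableSpace α] {b : α → M}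
    (hb : Measurable b)
    {G : ∀ a, TangentSpace (𝓡 N) (b a)} (hG : MeasurableAlong b G) {v : M → ℝ}
    (hv : ContMDiff (𝓡 N) 𝓘(ℝ, ℝ) ∞ v) {θ : α → ℝ} (hθ : Measurable θ) :
    Measurable fun a => ‖grad v (b a) - θ a • G a‖ := by
  have h1 : Measurable fun a => ‖grad (N := N) v (b a)‖ :=
    (continuous_norm_grad hv).measurable.comp hb
  have h2 := measurable_inner_grad_along hG hv
  have h3 := measurable_norm_along hG
  have h4 : Measurable fun a => Real.sqrt (‖grad (N := N) v (b a)‖ ^ 2 -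
      2 * (θ a * inner ℝ (grad v (b a)) (G a)) + θ a ^ 2 * ‖G a‖ ^ 2) := by fun_prop
  convert h4 using 2 with a
  rw [← Real.sqrt_sq (norm_nonneg (grad v (b a) - θ a • G a)), norm_sub_sq_real, inner_smul_right,
    norm_smul, mul_pow, Real.norm_eq_abs, sq_abs]

theorem measurable_norm_smul_sub_smul_along {α : Type*} [MeasurableSpace α] {b : α → M}
    {G H : ∀ a, TangentSpace (𝓡 N) (b a)} (hG : MeasurableAlong b G) (hH : MeasurableAlong b H)
    {θ η : α → ℝ} (hθ : Measurable θ) (hη : Measurable η) :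
    Measurable fun a => ‖θ a • G a - η a • H a‖ := by
  have h1 := measurable_norm_along hG
  have h2 := measurable_inner_along hG hH
  have h3 := measurable_norm_along hH
  have h4 : Measurable fun a => Real.sqrt (θ a ^ 2 * ‖G a‖ ^ 2 -
      2 * (θ a * (η a * inner ℝ (G a) (H a))) + η a ^ 2 * ‖H a‖ ^ 2) := by fun_prop
  convert h4 using 2 with a
  rw [← Real.sqrt_sq (norm_nonneg (θ a • G a - η a • H a)), norm_sub_sq_real, inner_smul_right,
    inner_smul_left, norm_smul, norm_smul, mul_pow, mul_pow, Real.norm_eq_abs, sq_abs,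
    Real.norm_eq_abs, sq_abs]
  simp only [RCLike.conj_to_real]
  ring_nf

/-! ### Integration by parts in charts and uniqueness of weak gradients -/

theorem lintegral_rpow_le_mul_measure {X : Type*} [MeasurableSpace X] {ν : Measure X}
    {h : X → ℝ≥0∞} (hh : AEMeasurable h ν) {a b : ℝ} (ha : 0 < a) (hab : a ≤ b) :
    ∫⁻ x, h x ^ a ∂ν ≤ (∫⁻ x, h x ^ b ∂ν) ^ (a / b) * ν univ ^ (1 - a / b) := by
  have hb : 0 < b := ha.trans_le hab
  have h1 : a / b ≤ 1 := (div_le_one hb).2 hab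
  have := ENNReal.lintegral_mul_norm_pow_le (μ := ν) (f := fun x => h x ^ b) (g := fun _ => 1)
    (hh.pow_const b) aemeasurable_const (p := a / b) (q := 1 - a / b) (by positivity)
    (by linarith) (by ring)
  simpa [← ENNReal.rpow_mul, mul_div_cancel₀ _ hb.ne', lintegral_const] using this

theorem tendsto_integral_of_lintegral_enorm {X : Type*} [MeasurableSpace X] {ν : Measure X}
    {F : ℕ → X → ℝ} {f : X → ℝ} (hf : AEStronglyMeasurable f ν) (hF : ∀ n, Integrable (F n) ν)
    (h : Tendsto (fun n => ∫⁻ x, ‖F n x - f x‖ₑ ∂ν) atTop (𝓝 0)) :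
    Integrable f ν ∧ Tendsto (fun n => ∫ x, F n x ∂ν) atTop (𝓝 (∫ x, f x ∂ν)) := by
  have hfi : Integrable f ν := by
    obtain ⟨n, hn⟩ := (h.eventually_lt_const (zero_lt_one' ℝ≥0∞)).exists
    have h1 : Integrable (fun x => F n x - f x) ν :=
      ⟨(hF n).aestronglyMeasurable.sub hf, hn.trans ENNReal.one_lt_top⟩
    exact ((hF n).sub h1).congr (Eventually.of_forall fun x => by simp)
  exact ⟨hfi, tendsto_integral_of_L1 f hfi.1 (Eventually.of_forall hF) h⟩

/-- In the chart, ⟨∇v, ∂ᵢ⟩ is the i-th partial derivative of v composed with the inverse chart. The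
integrals are with respect to Lebesgue measure, so this is Euclidean integration by parts and no
derivative of the density occurs. -/
theorem integral_inner_grad_coordField {v : M → ℝ} (hv : ContMDiff (𝓡 N) 𝓘(ℝ, ℝ) ∞ v) (c : M)
    (i : Fin N) {ψ : 𝔼 → ℝ} (hψ : ContDiff ℝ ∞ ψ) (hψc : HasCompactSupport ψ)
    (hψs : tsupport ψ ⊆ (chartAt 𝔼 c).target) :
    Integrable (fun y => (inner ℝ (grad v ((chartAt 𝔼 c).symm y)) (coordField c i y) : ℝ) * ψ y) ∧
    Integrable (fun y => v ((chartAt 𝔼 c).symm y) *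
      fderiv ℝ ψ y (EuclideanSpace.basisFun (Fin N) ℝ i)) ∧
    ∫ y, (inner ℝ (grad v ((chartAt 𝔼 c).symm y)) (coordField c i y) : ℝ) * ψ y =
      - ∫ y, v ((chartAt 𝔼 c).symm y) * fderiv ℝ ψ y (EuclideanSpace.basisFun (Fin N) ℝ i) := by
  set e := chartAt 𝔼 c
  set ei := EuclideanSpace.basisFun (Fin N) ℝ i
  have hvd : ∀ y ∈ e.target, MDifferentiableAt (𝓡 N) 𝓘(ℝ, ℝ) v (e.symm y) := fun y _ =>
    (hv _).mdifferentiableAt (by simp)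
  have hed : ∀ y ∈ e.target, MDifferentiableAt (𝓡 N) (𝓡 N) e.symm y := fun y hy =>
    mdifferentiableAt_atlas_symm (chart_mem_atlas 𝔼 c) hy
  have hdiff : ∀ y ∈ e.target, DifferentiableAt ℝ (fun y => v (e.symm y)) y := fun y hy =>
    mdifferentiableAt_iff_differentiableAt.1 ((hvd y hy).comp y (hed y hy))
  have hfd : ∀ y ∈ e.target, fderiv ℝ (fun y => v (e.symm y)) y ei =
      inner ℝ (grad v (e.symm y)) (coordField c i y) := by
    intro y hy
    rw [inner_grad]
    have := mfderiv_comp y (hvd y hy) (hed y hy)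
    rw [mfderiv_eq_fderiv] at this
    exact DFunLike.congr_fun this ei
  have hsupp : ∀ g : 𝔼 → ℝ, tsupport (fun y => g y * ψ y) ⊆ e.target := fun g =>
    (tsupport_mul_subset_right (f := g) (g := ψ)).trans hψs
  have hψ' : tsupport (fun y => fderiv ℝ ψ y ei) ⊆ e.target :=
    (tsupport_fderiv_apply_subset ℝ ei).trans hψs
  have hve : ContinuousOn (fun y => v (e.symm y)) e.target :=
    hv.continuous.comp_continuousOn e.continuousOn_symm
  have hI1 : Integrable (fun y => (inner ℝ (grad v (e.symm y)) (coordField c i y) : ℝ) * ψ y) := by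
    refine Continuous.integrable_of_hasCompactSupport ?_ hψc.mul_left
    exact ((continuousOn_inner_grad_coordField hv c i).mul
      hψ.continuous.continuousOn).continuous_of_tsupport_subset e.open_target (hsupp _)
  have hcd : Continuous fun y => fderiv ℝ ψ y ei :=
    (hψ.continuous_fderiv (by simp)).clm_apply continuous_const
  have hI2 : Integrable (fun y => v (e.symm y) * fderiv ℝ ψ y ei) := by
    refine Continuous.integrable_of_hasCompactSupport ?_ (hψc.fderiv_apply ℝ ei).mul_left
    exact (hve.mul hcd.continuousOn).continuous_of_tsupport_subset e.open_target
      (tsupport_mul_subset_right.trans hψ')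
  have hI3 : Integrable (fun y => v (e.symm y) * ψ y) := by
    refine Continuous.integrable_of_hasCompactSupport ?_ hψc.mul_left
    exact (hve.mul hψ.continuous.continuousOn).continuous_of_tsupport_subset e.open_target (hsupp _)
  have heq : (fun y => fderiv ℝ (fun y => v (e.symm y)) y ei * ψ y) =
      fun y => (inner ℝ (grad v (e.symm y)) (coordField c i y) : ℝ) * ψ y := by
    funext y
    by_cases hy : y ∈ e.target
    · rw [hfd y hy]
    · rw [image_eq_zero_of_notMem_tsupport fun h => hy (hψs h), mul_zero, mul_zero]
  refine ⟨hI1, hI2, ?_⟩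
  have := integral_mul_fderiv_eq_neg_fderiv_mul_of_integrable (μ := volume) (v := ei)
    (heq ▸ hI1) hI2 hI3 (fun y hy => hdiff y (hψs hy))
    (fun y _ => hψ.differentiable (by simp) y)
  rw [this, heq, neg_neg]

theorem measurable_coordField (c : M) (i : Fin N) {G : ∀ x : M, TangentSpace (𝓡 N) x}
    (hG : MeasurableAlong (fun x => x) G) :
    AEMeasurable (fun y => (inner ℝ (G ((chartAt 𝔼 c).symm y)) (coordField c i y) : ℝ))
      (volume.restrict (chartAt 𝔼 c).target) := by
  refine aemeasurable_restrict_of_measurable_subtype (chartAt 𝔼 c).open_target.measurableSet ?_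
  have h1 : Measurable fun y : (chartAt 𝔼 c).target => (chartAt 𝔼 c).symm y :=
    (continuousOn_iff_continuous_domRestrict.1 (chartAt 𝔼 c).continuousOn_symm).measurable
  refine measurable_inner_along (b := fun y : (chartAt 𝔼 c).target => (chartAt 𝔼 c).symm y)
    (hG.comp h1) ?_
  letI : MeasurableSpace (TangentBundle (𝓡 N) M) := borel _
  haveI : BorelSpace (TangentBundle (𝓡 N) M) := ⟨rfl⟩
  exact (continuousOn_iff_continuous_domRestrict.1 (continuousOn_coordField c i)).measurable

/-- On a compact set Hölder lowers the exponent to 1, and the lower bound on the density passes from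
the Riemannian to Lebesgue measure. This is the sense of convergence needed to integrate by parts in
the limit. -/
theorem tendsto_lintegral_chart {c : M} {K : Set 𝔼} (hK : IsCompact K)
    (hKt : K ⊆ (chartAt 𝔼 c).target) {a : ℝ} (ha : 1 ≤ a) {h : ℕ → M → ℝ≥0∞}
    (hh : ∀ n, Measurable (h n))
    (hlim : Tendsto (fun n => ∫⁻ x, h n x ^ a ∂(riemannianMeasure N M)) atTop (𝓝 0)) :
    Tendsto (fun n => ∫⁻ y in K, h n ((chartAt 𝔼 c).symm y)) atTop (𝓝 0) := by
  obtain ⟨C, hC, hle⟩ := exists_lintegral_chart_le (N := N) c hK hKt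
  set S := (chartAt 𝔼 c).symm '' K
  have hS : IsCompact S := hK.image_of_continuousOn ((chartAt 𝔼 c).continuousOn_symm.mono hKt)
  have hSf : riemannianMeasure N M S ^ (1 - 1 / a) ≠ ⊤ :=
    ENNReal.rpow_ne_top_of_nonneg (by rw [sub_nonneg, div_le_one (by linarith)]; exact ha)
      hS.measure_lt_top.ne
  have hbd : ∀ n, ∫⁻ y in K, h n ((chartAt 𝔼 c).symm y) ≤
      C * ((∫⁻ x, h n x ^ a ∂(riemannianMeasure N M)) ^ (1 / a) *
        riemannianMeasure N M S ^ (1 - 1 / a)) := by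
    intro n
    refine (hle (h n) (hh n)).trans ?_
    gcongr
    have := lintegral_rpow_le_mul_measure (ν := (riemannianMeasure N M).restrict S)
      (hh n).aemeasurable zero_lt_one ha
    simp only [ENNReal.rpow_one, Measure.restrict_apply_univ] at this
    refine this.trans ?_
    gcongr
    exact Measure.restrict_le_self
  refine tendsto_of_tendsto_of_tendsto_of_le_of_le tendsto_const_nhds ?_ (fun n => zero_le) hbd
  have h1 : Tendsto (fun n => (∫⁻ x, h n x ^ a ∂(riemannianMeasure N M)) ^ (1 / a)) atTop
      (𝓝 0) := by
    have := (ENNReal.continuous_rpow_const (y := 1 / a)).tendsto 0 |>.comp hlim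
    rwa [ENNReal.zero_rpow_of_pos (by positivity)] at this
  have h2 := ENNReal.Tendsto.mul_const (b := riemannianMeasure N M S ^ (1 - 1 / a)) h1 (Or.inr hSf)
  have h3 := ENNReal.Tendsto.const_mul (a := C) h2 (Or.inr hC)
  simpa using h3

/-- Integration by parts against coordinate fields passes to limits of test functions. -/
theorem integral_inner_coordField_of_tendsto {a : ℝ} (ha : 1 ≤ a) {v : ℕ → M → ℝ}
    (hv : ∀ n, ContMDiff (𝓡 N) 𝓘(ℝ, ℝ) ∞ (v n)) {w θ : M → ℝ} (hw : Measurable w)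
    (hθ : Measurable θ) {G : ∀ x : M, TangentSpace (𝓡 N) x}
    (hG : MeasurableAlong (fun x => x) G)
    (hvw : Tendsto (fun n => ∫⁻ x, ‖v n x - w x‖ₑ ^ a ∂(riemannianMeasure N M)) atTop (𝓝 0))
    (hvG : Tendsto (fun n => ∫⁻ x, ‖grad (N := N) (v n) x - θ x • G x‖ₑ ^ a
      ∂(riemannianMeasure N M)) atTop (𝓝 0)) (c : M) (i : Fin N)
    {ψ : 𝔼 → ℝ} (hψ : ContDiff ℝ ∞ ψ) (hψc : HasCompactSupport ψ)
    (hψs : tsupport ψ ⊆ (chartAt 𝔼 c).target) :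
    Integrable (fun y => θ ((chartAt 𝔼 c).symm y) *
        (inner ℝ (G ((chartAt 𝔼 c).symm y)) (coordField c i y) : ℝ) * ψ y) ∧
    ∫ y, θ ((chartAt 𝔼 c).symm y) *
        (inner ℝ (G ((chartAt 𝔼 c).symm y)) (coordField c i y) : ℝ) * ψ y =
      - ∫ y, w ((chartAt 𝔼 c).symm y) * fderiv ℝ ψ y (EuclideanSpace.basisFun (Fin N) ℝ i) := by
  set e := chartAt 𝔼 c
  set ei := EuclideanSpace.basisFun (Fin N) ℝ i
  have hKc : IsCompact (tsupport ψ) := hψc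
  have hcont : ContinuousOn (fun y => ‖coordField c i y‖) e.target := by
    have h := continuousOn_gram_coordField (N := N) c
    have h2 := Real.continuous_sqrt.comp_continuousOn (continuousOn_pi.1 (continuousOn_pi.1 h i) i)
    refine h2.congr fun y _ => ?_
    simp only [Function.comp, Matrix.gram_apply, real_inner_self_eq_norm_sq,
      Real.sqrt_sq (norm_nonneg _)]
  obtain ⟨C₁, hC₁⟩ := hKc.exists_bound_of_continuousOn
    ((hcont.mono hψs).mul hψ.continuous.continuousOn)
  have hcd : Continuous fun y => fderiv ℝ ψ y ei :=
    (hψ.continuous_fderiv (by simp)).clm_apply continuous_const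
  obtain ⟨C₂, hC₂⟩ := hKc.exists_bound_of_continuousOn hcd.continuousOn
  have hfz : ∀ y, y ∉ tsupport ψ → fderiv ℝ ψ y ei = 0 := fun y hy => by
    rw [image_eq_zero_of_notMem_tsupport fun h => hy (tsupport_fderiv_subset ℝ h)]; rfl
  have hmeas : ∀ {g : 𝔼 → ℝ}, AEMeasurable g (volume.restrict e.target) →
      (∀ y, y ∉ tsupport ψ → g y = 0) → AEStronglyMeasurable g volume := by
    intro g hg hg0
    have : e.target.indicator g = g := by
      rw [indicator_eq_self]
      intro y hy
      by_contra h
      exact hy (hg0 y fun h' => h (hψs h'))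
    rw [← this]
    exact ((aemeasurable_indicator_iff e.open_target.measurableSet).2 hg).aestronglyMeasurable
  have main1 := tendsto_integral_of_lintegral_enorm (ν := volume)
    (F := fun n y => (inner ℝ (grad (v n) (e.symm y)) (coordField c i y) : ℝ) * ψ y)
    (f := fun y => θ (e.symm y) * (inner ℝ (G (e.symm y)) (coordField c i y) : ℝ) * ψ y)
    (hmeas (((hθ.comp_aemeasurable (aemeasurable_chart_symm c)).mul
      (measurable_coordField c i hG)).mul hψ.continuous.aemeasurable)
      (fun y hy => by rw [image_eq_zero_of_notMem_tsupport hy, mul_zero]))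
    (fun n => (integral_inner_grad_coordField (hv n) c i hψ hψc hψs).1) ?_
  have main2 := tendsto_integral_of_lintegral_enorm (ν := volume)
    (F := fun n y => v n (e.symm y) * fderiv ℝ ψ y ei)
    (f := fun y => w (e.symm y) * fderiv ℝ ψ y ei)
    (hmeas ((hw.comp_aemeasurable (aemeasurable_chart_symm c)).mul hcd.aemeasurable)
      (fun y hy => by rw [hfz y hy, mul_zero]))
    (fun n => (integral_inner_grad_coordField (hv n) c i hψ hψc hψs).2.1) ?_
  · refine ⟨main1.1, tendsto_nhds_unique main1.2 ?_⟩
    exact main2.2.neg.congr fun n =>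
      (integral_inner_grad_coordField (hv n) c i hψ hψc hψs).2.2.symm
  · have hlim := tendsto_lintegral_chart hKc hψs ha (h := fun n x => ‖v n x - w x‖ₑ)
      (fun n => ((hv n).continuous.measurable.sub hw).enorm) hvw
    have hlim2 := ENNReal.Tendsto.const_mul (a := ENNReal.ofReal C₂) hlim
      (Or.inr ENNReal.ofReal_ne_top)
    rw [mul_zero] at hlim2
    refine tendsto_of_tendsto_of_tendsto_of_le_of_le tendsto_const_nhds hlim2
      (fun n => zero_le) fun n => ?_
    rw [← lintegral_const_mul' _ _ ENNReal.ofReal_ne_top,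
      ← setLIntegral_eq_of_support_subset (s := tsupport ψ)]
    · refine setLIntegral_mono' hKc.measurableSet fun y hy => ?_
      rw [← sub_mul, enorm_mul, mul_comm]
      gcongr
      rw [← ofReal_norm]
      exact ENNReal.ofReal_le_ofReal (hC₂ y hy)
    · intro y hy
      by_contra h
      exact hy (by simp [hfz y h])
  · have hlim := tendsto_lintegral_chart hKc hψs ha
      (h := fun n x => ‖grad (N := N) (v n) x - θ x • G x‖ₑ) (fun n => by
        simpa only [ofReal_norm] using
          (measurable_norm_grad_sub_along (b := fun x => x) measurable_id hG (hv n) hθ).ennreal_ofReal) hvG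
    have hlim2 := ENNReal.Tendsto.const_mul (a := ENNReal.ofReal C₁) hlim
      (Or.inr ENNReal.ofReal_ne_top)
    rw [mul_zero] at hlim2
    refine tendsto_of_tendsto_of_tendsto_of_le_of_le tendsto_const_nhds hlim2
      (fun n => zero_le) fun n => ?_
    rw [← lintegral_const_mul' _ _ ENNReal.ofReal_ne_top,
      ← setLIntegral_eq_of_support_subset (s := tsupport ψ)]
    · refine setLIntegral_mono' hKc.measurableSet fun y hy => ?_
      have h1 : (inner ℝ (grad (v n) (e.symm y)) (coordField c i y) : ℝ) * ψ y -
          θ (e.symm y) * (inner ℝ (G (e.symm y)) (coordField c i y) : ℝ) * ψ y =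
          inner ℝ (grad (v n) (e.symm y) - θ (e.symm y) • G (e.symm y)) (coordField c i y) * ψ y := by
        rw [inner_sub_left, inner_smul_left, RCLike.conj_to_real]; ring
      rw [h1, ← ofReal_norm, ← ofReal_norm, ← ENNReal.ofReal_mul ((norm_nonneg _).trans (hC₁ y hy))]
      refine ENNReal.ofReal_le_ofReal ?_
      rw [norm_mul]
      have h2 := norm_inner_le_norm (𝕜 := ℝ) (grad (v n) (e.symm y) - θ (e.symm y) • G (e.symm y))
        (coordField c i y)
      have h3 : ‖‖coordField c i y‖ * ψ y‖ ≤ C₁ := hC₁ y hy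
      rw [norm_mul, norm_norm] at h3
      calc _ ≤ ‖grad (v n) (e.symm y) - θ (e.symm y) • G (e.symm y)‖ * ‖coordField c i y‖ * ‖ψ y‖ := by
            gcongr
        _ = ‖coordField c i y‖ * ‖ψ y‖ * ‖grad (v n) (e.symm y) - θ (e.symm y) • G (e.symm y)‖ := by
            ring
        _ ≤ _ := by gcongr
    · intro y hy
      by_contra h
      exact hy (by simp [image_eq_zero_of_notMem_tsupport h])

theorem span_coordField (c : M) {y : 𝔼} (hy : y ∈ (chartAt 𝔼 c).target)
    {ξ : TangentSpace (𝓡 N) ((chartAt 𝔼 c).symm y)}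
    (h : ∀ i, (inner ℝ ξ (coordField c i y) : ℝ) = 0) : ξ = 0 := by
  have h1 := norm_sq_eq_gram (V := TangentSpace (𝓡 N) ((chartAt 𝔼 c).symm y))
        (X := fun i => coordField c i y) (linearIndependent_coordField c hy)
        (finrank_tangentSpace _) ξ
  simp only [h] at h1
  have h2 : (fun _ : Fin N => (0 : ℝ)) = 0 := rfl
  rw [h2, zero_dotProduct, mul_zero] at h1
  exact norm_eq_zero.1 (pow_eq_zero_iff two_ne_zero |>.1 h1)

/-- Uniqueness of the weak gradient. -/
theorem ae_eq_of_tendsto_grad {a : ℝ} (ha : 1 ≤ a) {v v' : ℕ → M → ℝ}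
    (hv : ∀ n, ContMDiff (𝓡 N) 𝓘(ℝ, ℝ) ∞ (v n)) (hv' : ∀ n, ContMDiff (𝓡 N) 𝓘(ℝ, ℝ) ∞ (v' n))
    {w θ θ' : M → ℝ} (hw : Measurable w) (hθ : Measurable θ) (hθ' : Measurable θ')
    {G G' : ∀ x : M, TangentSpace (𝓡 N) x} (hG : MeasurableAlong (fun x => x) G)
    (hG' : MeasurableAlong (fun x => x) G')
    (hvw : Tendsto (fun n => ∫⁻ x, ‖v n x - w x‖ₑ ^ a ∂(riemannianMeasure N M)) atTop (𝓝 0))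
    (hvG : Tendsto (fun n => ∫⁻ x, ‖grad (N := N) (v n) x - θ x • G x‖ₑ ^ a
      ∂(riemannianMeasure N M)) atTop (𝓝 0))
    (hvw' : Tendsto (fun n => ∫⁻ x, ‖v' n x - w x‖ₑ ^ a ∂(riemannianMeasure N M)) atTop (𝓝 0))
    (hvG' : Tendsto (fun n => ∫⁻ x, ‖grad (N := N) (v' n) x - θ' x • G' x‖ₑ ^ a
      ∂(riemannianMeasure N M)) atTop (𝓝 0)) :
    ∀ᵐ x ∂(riemannianMeasure N M), θ x • G x = θ' x • G' x := by
  obtain ⟨d, hd⟩ := exists_chart_cover N M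
  suffices ∀ c : M, ∀ᵐ x ∂((riemannianMeasure N M).restrict (chartAt 𝔼 c).source),
      θ x • G x = θ' x • G' x by
    have h := (ae_restrict_iUnion_iff (μ := riemannianMeasure N M)
      (fun n => (chartAt 𝔼 (d n)).source) (fun x => θ x • G x = θ' x • G' x)).2 fun n => this _
    rwa [hd, Measure.restrict_univ] at h
  intro c
  set e := chartAt 𝔼 c
  -- Both fields have the same integrals against ψ∂ᵢ, namely those determined by the common function
  -- w, so their components along each ∂ᵢ agree almost everywhere; the coordinate fields form a
  -- frame.
  have hi : ∀ i, ∀ᵐ y, y ∈ e.target →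
      θ (e.symm y) * (inner ℝ (G (e.symm y)) (coordField c i y) : ℝ) -
      θ' (e.symm y) * (inner ℝ (G' (e.symm y)) (coordField c i y) : ℝ) = 0 := by
    intro i
    have key := fun (ψ : 𝔼 → ℝ) (h1 : ContDiff ℝ ∞ ψ) (h2 : HasCompactSupport ψ)
      (h3 : tsupport ψ ⊆ e.target) =>
      integral_inner_coordField_of_tendsto ha hv hw hθ hG hvw hvG c i h1 h2 h3
    have key' := fun (ψ : 𝔼 → ℝ) (h1 : ContDiff ℝ ∞ ψ) (h2 : HasCompactSupport ψ)
      (h3 : tsupport ψ ⊆ e.target) =>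
      integral_inner_coordField_of_tendsto ha hv' hw hθ' hG' hvw' hvG' c i h1 h2 h3
    refine e.open_target.ae_eq_zero_of_integral_contDiff_smul_eq_zero ?_ ?_
    · intro y hy
      obtain ⟨r, hr, hrs⟩ := Metric.isOpen_iff.1 e.open_target y hy
      -- A bump equal to 1 near y serves only to extract local integrability from the integrability
      -- against test functions.
      let ψ : ContDiffBump y := ⟨r / 4, r / 2, by positivity, by linarith⟩
      have hψs : tsupport ψ ⊆ e.target := by
        rw [ψ.tsupport_eq]
        exact (Metric.closedBall_subset_ball (by simp only [ψ]; linarith)).trans hrs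
      have hint := (key ψ ψ.contDiff ψ.hasCompactSupport hψs).1.sub
        (key' ψ ψ.contDiff ψ.hasCompactSupport hψs).1
      refine ⟨Metric.closedBall y (r / 4), mem_nhdsWithin_of_mem_nhds
        (Metric.closedBall_mem_nhds y (by positivity)), ?_⟩
      refine (hint.integrableOn (s := Metric.closedBall y (r / 4))).congr_fun ?_
        Metric.isClosed_closedBall.measurableSet
      intro z hz
      have : ψ z = 1 := ψ.one_of_mem_closedBall hz
      simp only [Pi.sub_apply, this, mul_one]
      rfl
    · intro ψ h1 h2 h3
      have hk := key ψ h1 h2 h3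
      have hk' := key' ψ h1 h2 h3
      have : ∀ y, ψ y • (θ (e.symm y) * (inner ℝ (G (e.symm y)) (coordField c i y) : ℝ) -
          θ' (e.symm y) * (inner ℝ (G' (e.symm y)) (coordField c i y) : ℝ)) =
          θ (e.symm y) * (inner ℝ (G (e.symm y)) (coordField c i y) : ℝ) * ψ y -
          θ' (e.symm y) * (inner ℝ (G' (e.symm y)) (coordField c i y) : ℝ) * ψ y := fun y => by
        rw [smul_eq_mul]; ring
      simp only [this]
      rw [integral_sub hk.1 hk'.1, hk.2, hk'.2, sub_self]
  have hm : Measurable fun x => ‖θ x • G x - θ' x • G' x‖ₑ := by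
    simpa only [ofReal_norm] using
      (measurable_norm_smul_sub_smul_along hG hG' hθ hθ').ennreal_ofReal
  have h0 : ∫⁻ x in e.source, ‖θ x • G x - θ' x • G' x‖ₑ ∂(riemannianMeasure N M) = 0 := by
    rw [lintegral_riemannianMeasure_source c hm, setLIntegral_congr_fun_ae
      (g := fun _ => 0) e.open_target.measurableSet, lintegral_zero]
    filter_upwards [ae_all_iff.2 hi] with y hy hyt
    have : θ (e.symm y) • G (e.symm y) - θ' (e.symm y) • G' (e.symm y) = 0 := by
      refine span_coordField c hyt fun i => ?_
      rw [inner_sub_left, inner_smul_left, inner_smul_left]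
      exact hy i hyt
    change _ * ‖θ (e.symm y) • G (e.symm y) - θ' (e.symm y) • G' (e.symm y)‖ₑ = 0
    rw [this]; simp
  filter_upwards [(lintegral_eq_zero_iff hm).1 h0] with x hx
  exact sub_eq_zero.1 (enorm_eq_zero.1 hx)

/-! ### Weights under the substitution σ = s^m -/

section PowerChange

/-- The weight whose primitive, composed with `s ↦ s ^ m`, is the primitive of `f` on `[0, ∞)`. -/
def weightPow (m : ℝ) (f : ℝ → ℝ) (σ : ℝ) : ℝ := f (σ ^ (1 / m)) * σ ^ (1 / m - 1) / m

/-- The argument is clipped at 0 because real powers of negative numbers carry no meaning here.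
Smoothness survives because f vanishes near 0, where the root is singular. -/
theorem isWeight_weightPow {m : ℝ} (hm : 0 < m) {f : ℝ → ℝ} (hf : IsWeight f) :
    IsWeight (fun σ => weightPow m f (max σ 0)) := by
  obtain ⟨δ, L, hδ, hL, hf1, hf2⟩ := hf.exists_support
  have hroot : ∀ c : ℝ, 0 ≤ c → (c ^ m) ^ (1 / m) = c := fun c hc => by
    rw [← Real.rpow_mul hc, mul_one_div_cancel hm.ne', Real.rpow_one]
  have hlow : ∀ σ, σ ≤ δ ^ m → weightPow m f (max σ 0) = 0 := by
    intro σ hσ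
    have : (max σ 0) ^ (1 / m) ≤ δ := by
      calc (max σ 0) ^ (1 / m) ≤ (δ ^ m) ^ (1 / m) :=
            Real.rpow_le_rpow (le_max_right _ _) (max_le hσ (by positivity)) (by positivity)
        _ = δ := hroot δ hδ.le
    rw [weightPow, hf1 _ this]; simp
  refine ⟨contDiff_iff_contDiffAt.2 fun σ => ?_, fun σ => ?_, δ ^ m, L ^ m, by positivity,
    Real.rpow_lt_rpow hδ.le hL hm, hlow, fun σ hσ => ?_⟩
  · rcases lt_or_ge σ (δ ^ m) with h | h
    · refine (contDiffAt_const (c := (0 : ℝ))).congr_of_eventuallyEq ?_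
      filter_upwards [Iio_mem_nhds h] with τ hτ using hlow τ (le_of_lt hτ)
    · have hσ : 0 < σ := lt_of_lt_of_le (by positivity) h
      have h1 : ContDiffAt ℝ ∞ (fun τ : ℝ => τ ^ (1 / m)) σ :=
        Real.contDiffAt_rpow_const_of_ne hσ.ne'
      have h2 : ContDiffAt ℝ ∞ (fun τ : ℝ => τ ^ (1 / m - 1)) σ :=
        Real.contDiffAt_rpow_const_of_ne hσ.ne'
      refine (((hf.contDiff.contDiffAt.comp σ h1).mul h2).div_const m).congr_of_eventuallyEq ?_
      filter_upwards [Ioi_mem_nhds hσ] with τ hτ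
      simp only [weightPow, max_eq_left (mem_Ioi.1 hτ).le, Function.comp_apply]
  · exact div_nonneg (mul_nonneg (hf.nonneg _) (Real.rpow_nonneg (le_max_right _ _) _)) hm.le
  · have : L ≤ (max σ 0) ^ (1 / m) := by
      calc L = (L ^ m) ^ (1 / m) := (hroot L (hδ.trans hL).le).symm
        _ ≤ _ := Real.rpow_le_rpow (Real.rpow_nonneg (hδ.trans hL).le _)
            (hσ.trans (le_max_left _ _)) (by positivity)
    rw [weightPow, hf2 _ this]; simp

theorem weightPow_rpow {m : ℝ} (hm : 0 < m) (f : ℝ → ℝ) {s : ℝ} (hs : 0 < s) :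
    weightPow m f (max (s ^ m) 0) * (m * s ^ (m - 1)) = f s := by
  have h1 : 0 < s ^ m := by positivity
  rw [max_eq_left h1.le, weightPow, ← Real.rpow_mul hs.le, ← Real.rpow_mul hs.le,
    mul_one_div_cancel hm.ne', Real.rpow_one]
  have : s ^ (m * (1 / m - 1)) * s ^ (m - 1) = 1 := by
    rw [← Real.rpow_add hs]
    have : m * (1 / m - 1) + (m - 1) = 0 := by field_simp; ring
    rw [this, Real.rpow_zero]
  have e : ∀ a x y : ℝ, a * x / m * (m * y) = a * (x * y) := fun a x y => by field_simp
  rw [e, this, mul_one]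

/-- Both sides have derivative f and vanish at 0. At the endpoint 0, where f = 0, the assumption m >
1 makes s^m differentiable with derivative zero. -/
theorem primitive_weightPow {m : ℝ} (hm : 1 < m) {f : ℝ → ℝ} (hf : IsWeight f) {s : ℝ}
    (hs : 0 ≤ s) :
    primitive (fun σ => weightPow m f (max σ 0)) (s ^ m) = primitive f s := by
  have hm0 : 0 < m := by linarith
  obtain ⟨δ, L, hδ, hL, hf1, hf2⟩ := hf.exists_support
  have hw := isWeight_weightPow hm0 hf
  have hder : ∀ r ∈ uIcc 0 s, HasDerivAt
      (fun r => primitive (fun σ => weightPow m f (max σ 0)) (r ^ m)) (f r) r := by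
    intro r hr
    rw [uIcc_of_le hs] at hr
    have h1 := (hasDerivAt_primitive hw.continuous (r ^ m)).comp r
      (Real.hasDerivAt_rpow_const (x := r) (p := m) (Or.inr hm.le))
    refine h1.congr_deriv ?_
    rcases hr.1.eq_or_lt with h | h
    · rw [← h, Real.zero_rpow (sub_pos.2 hm).ne', hf1 0 hδ.le]; simp
    · exact weightPow_rpow hm0 f h
  have := intervalIntegral.integral_eq_sub_of_hasDerivAt hder
    (hf.continuous.intervalIntegrable _ _)
  rw [Real.zero_rpow hm0.ne', primitive_zero, sub_zero] at this
  exact this.symm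

end PowerChange

/-! ### Chain rule for w and w^m, and simultaneous approximation -/

section Composition

theorem IsTestFunction.primitive_comp {B : Set M} {f : ℝ → ℝ} (hf : IsWeight f) {φ : M → ℝ}
    (hφ : IsTestFunction N B φ) : IsTestFunction N B fun x => primitive f (φ x) := by
  refine ⟨hf.contDiff_primitive.contMDiff.comp hφ.1, hφ.2.1.comp_left (primitive_zero f), ?_⟩
  refine (closure_mono ?_).trans hφ.2.2
  exact Function.support_comp_subset (primitive_zero f) φ

theorem grad_primitive_comp {f : ℝ → ℝ} (hf : IsWeight f) {φ : M → ℝ}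
    (hφ : ContMDiff (𝓡 N) 𝓘(ℝ, ℝ) ∞ φ) (x : M) :
    grad (N := N) (fun x => primitive f (φ x)) x = f (φ x) • grad (N := N) φ x := by
  refine ext_inner_right ℝ fun ξ => ?_
  rw [inner_grad, inner_smul_left, inner_grad]
  have h1 : HasMFDerivAt (𝓡 N) 𝓘(ℝ, ℝ) φ x (mfderiv (𝓡 N) 𝓘(ℝ, ℝ) φ x) :=
    ((hφ.mdifferentiable (by simp)) x).hasMFDerivAt
  have h2 := (hasDerivAt_primitive hf.continuous (φ x)).hasFDerivAt.hasMFDerivAt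
  have h3 := (h2.comp x h1).mfderiv
  simp only [Function.comp_def] at h3
  rw [h3]
  have hc : ∀ d : ℝ, d * f (φ x) = f (φ x) * d := fun d => mul_comm _ _
  exact hc _

theorem grad_eq_zero_of_notMem_tsupport {v : M → ℝ} {x : M} (hx : x ∉ tsupport v) :
    grad (N := N) v x = 0 := by
  refine ext_inner_right ℝ fun ξ => ?_
  have h : v =ᶠ[𝓝 x] fun _ => (0 : ℝ) := notMem_tsupport_iff_eventuallyEq.1 hx
  rw [inner_grad, inner_zero_left, h.mfderiv_eq, mfderiv_const]
  rfl

theorem IsTestFunction.eq_zero {B : Set M} {v : M → ℝ} (hv : IsTestFunction N B v) {x : M}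
    (hx : x ∉ B) : v x = 0 :=
  image_eq_zero_of_notMem_tsupport fun h => hx (hv.2.2 h)

theorem IsTestFunction.grad_eq_zero {B : Set M} {v : M → ℝ} (hv : IsTestFunction N B v) {x : M}
    (hx : x ∉ B) : grad (N := N) v x = 0 :=
  grad_eq_zero_of_notMem_tsupport fun h => hx (hv.2.2 h)

theorem IsTestFunction.measurable {B : Set M} {v : M → ℝ} (hv : IsTestFunction N B v) :
    Measurable v := hv.1.continuous.measurable

/-- Uniqueness of weak gradients is available on all of M while the approximations are measured on
B. Extending the limit by zero costs nothing, since test functions vanish off B. -/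
theorem lintegral_indicator_sub {B : Set M} (hB : MeasurableSet B) {a : ℝ} (ha : 0 < a)
    {v w : M → ℝ} (hv : IsTestFunction N B v) :
    ∫⁻ x, ‖v x - B.indicator w x‖ₑ ^ a ∂(riemannianMeasure N M) =
      ∫⁻ x in B, ‖v x - w x‖ₑ ^ a ∂(riemannianMeasure N M) := by
  rw [← lintegral_indicator hB]
  congr 1 with x
  by_cases hx : x ∈ B
  · simp [hx]
  · simp [hx, hv.eq_zero hx, ha]

theorem lintegral_indicator_grad_sub {B : Set M} (hB : MeasurableSet B) {a : ℝ} (ha : 0 < a)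
    {v θ : M → ℝ} (hv : IsTestFunction N B v) {G : ∀ x : M, TangentSpace (𝓡 N) x} :
    ∫⁻ x, ‖grad (N := N) v x - B.indicator θ x • G x‖ₑ ^ a ∂(riemannianMeasure N M) =
      ∫⁻ x in B, ‖grad (N := N) v x - θ x • G x‖ₑ ^ a ∂(riemannianMeasure N M) := by
  rw [← lintegral_indicator hB]
  congr 1 with x
  by_cases hx : x ∈ B
  · simp [hx]
  · simp [hx, hv.grad_eq_zero hx, ha]

/-- Approximation of `F(w)`, `F = ∫ f`, by test functions, if `w ∈ W₀^{1,P}(B)`. -/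
theorem IsSobolevZero.exists_primitive {P : ℝ} (hP : 1 ≤ P) {B : Set M} {w : M → ℝ}
    (hw : Measurable w) {G : ∀ x : M, TangentSpace (𝓡 N) x}
    (hG : MeasurableAlong (fun x : M => x) G) (h : IsSobolevZero P B w G)
    (hwP : ∫⁻ x in B, ‖w x‖ₑ ^ P ∂(riemannianMeasure N M) ≠ ⊤)
    (hGP : ∫⁻ x in B, ‖G x‖ₑ ^ P ∂(riemannianMeasure N M) ≠ ⊤)
    {f : ℝ → ℝ} (hf : IsWeight f) :
    ∃ v : ℕ → M → ℝ, (∀ n, IsTestFunction N B (v n)) ∧ ∀ a, 1 ≤ a → a ≤ P →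
      Tendsto (fun n => ∫⁻ x in B, ‖v n x - primitive f (w x)‖ₑ ^ a ∂(riemannianMeasure N M))
        atTop (𝓝 0) ∧
      Tendsto (fun n => ∫⁻ x in B, ‖grad (N := N) (v n) x - f (w x) • G x‖ₑ ^ a
        ∂(riemannianMeasure N M)) atTop (𝓝 0) := by
  obtain ⟨φ, hφ, h1, h2⟩ := h
  have hm : ∀ n, Measurable fun x => ‖grad (N := N) (φ n) x - G x‖ₑ := fun n => by
    have := measurable_norm_grad_sub_along measurable_id hG (hφ n).1
      (measurable_const (a := (1 : ℝ)))
    simp only [one_smul] at this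
    simp only [← ofReal_norm]
    exact this.ennreal_ofReal
  have hGm : Measurable fun x => ‖G x‖ₑ := by
    simp only [← ofReal_norm]
    exact (measurable_norm_along hG).ennreal_ofReal
  obtain ⟨k, hk⟩ := exists_subseq_tendsto_primitive hP hf
    (fun n => (hφ n).measurable.aemeasurable) hw.aemeasurable
    (fun n => (hm n).aemeasurable) hGm.aemeasurable h1 h2 hwP hGP
  refine ⟨fun n x => primitive f (φ (k n) x), fun n => (hφ _).primitive_comp hf,
    fun a ha haP => ⟨(hk a ha haP).1, ?_⟩⟩
  simpa only [grad_primitive_comp hf (hφ _).1] using (hk a ha haP).2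

/-- The chain rule for `w` and `w ^ m`. -/
theorem IsSobolevZero.ae_chain_rule {p m : ℝ} (hp : 1 ≤ p) (hm : 1 < m) {B : Set M}
    (hB : MeasurableSet B) {w : M → ℝ} (hw : Measurable w) (hw0 : ∀ x, 0 ≤ w x)
    {GU GV : ∀ x : M, TangentSpace (𝓡 N) x} (hGU : MeasurableAlong (fun x : M => x) GU)
    (hGV : MeasurableAlong (fun x : M => x) GV) (hU : IsSobolevZero 2 B w GU)
    (hV : IsSobolevZero p B (fun x => w x ^ m) GV)
    (hwU : ∫⁻ x in B, ‖w x‖ₑ ^ (2 : ℝ) ∂(riemannianMeasure N M) ≠ ⊤)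
    (hU2 : ∫⁻ x in B, ‖GU x‖ₑ ^ (2 : ℝ) ∂(riemannianMeasure N M) ≠ ⊤)
    (hwV : ∫⁻ x in B, ‖w x ^ m‖ₑ ^ p ∂(riemannianMeasure N M) ≠ ⊤)
    (hVp : ∫⁻ x in B, ‖GV x‖ₑ ^ p ∂(riemannianMeasure N M) ≠ ⊤)
    {f : ℝ → ℝ} (hf : IsWeight f) :
    ∀ᵐ x ∂((riemannianMeasure N M).restrict B),
      f (w x) • GU x = weightPow m f (max (w x ^ m) 0) • GV x := by
  have hm0 : 0 < m := by linarith
  have hwt := isWeight_weightPow hm0 hf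
  obtain ⟨v, hv, hva⟩ := hU.exists_primitive (by norm_num) hw hGU hwU hU2 hf
  obtain ⟨v', hv', hva'⟩ := hV.exists_primitive hp (hw.pow_const m) hGV hwV hVp hwt
  -- F(w) is approximated once through w in W^{1,2} and once through w^m in W^{1,p}. The smaller
  -- exponent is admissible for both, and there the two candidate gradients must coincide.
  have ha1 : 1 ≤ min p 2 := le_min hp (by norm_num)
  have ha0 : 0 < min p 2 := by linarith
  obtain ⟨h1, h2⟩ := hva _ ha1 (min_le_right _ _)
  obtain ⟨h3, h4⟩ := hva' _ ha1 (min_le_left _ _)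
  simp only [primitive_weightPow hm hf (hw0 _)] at h3
  have hF : Measurable fun x => primitive f (w x) := hf.contDiff_primitive.continuous.measurable.comp hw
  have hθ : Measurable fun x => f (w x) := hf.continuous.measurable.comp hw
  have hθ' : Measurable fun x => weightPow m f (max (w x ^ m) 0) :=
    hwt.continuous.measurable.comp (hw.pow_const m)
  have key := ae_eq_of_tendsto_grad ha1 (fun n => (hv n).1) (fun n => (hv' n).1)
    (hF.indicator hB) (hθ.indicator hB) (hθ'.indicator hB) hGU hGV
    (by simpa only [lintegral_indicator_sub hB ha0 (hv _)] using h1)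
    (by simpa only [lintegral_indicator_grad_sub hB ha0 (hv _)] using h2)
    (by simpa only [lintegral_indicator_sub hB ha0 (hv' _)] using h3)
    (by simpa only [lintegral_indicator_grad_sub hB ha0 (hv' _)] using h4)
  rw [ae_restrict_iff' hB]
  filter_upwards [key] with x hx hxB
  simpa [hxB] using hx

/-- The chain rule holds for each of the countably many cutoffs off a common null set. At a point
where w > 0 some cutoff is non-zero, and its factor cancels. Where w = 0 nothing is claimed; the
weights vanish there. -/
theorem IsSobolevZero.ae_smul_eq {p m : ℝ} (hp : 1 ≤ p) (hm : 1 < m) {B : Set M}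
    (hB : MeasurableSet B) {w : M → ℝ} (hw : Measurable w) (hw0 : ∀ x, 0 ≤ w x)
    {GU GV : ∀ x : M, TangentSpace (𝓡 N) x} (hGU : MeasurableAlong (fun x : M => x) GU)
    (hGV : MeasurableAlong (fun x : M => x) GV) (hU : IsSobolevZero 2 B w GU)
    (hV : IsSobolevZero p B (fun x => w x ^ m) GV)
    (hwU : ∫⁻ x in B, ‖w x‖ₑ ^ (2 : ℝ) ∂(riemannianMeasure N M) ≠ ⊤)
    (hU2 : ∫⁻ x in B, ‖GU x‖ₑ ^ (2 : ℝ) ∂(riemannianMeasure N M) ≠ ⊤)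
    (hwV : ∫⁻ x in B, ‖w x ^ m‖ₑ ^ p ∂(riemannianMeasure N M) ≠ ⊤)
    (hVp : ∫⁻ x in B, ‖GV x‖ₑ ^ p ∂(riemannianMeasure N M) ≠ ⊤) :
    ∀ᵐ x ∂((riemannianMeasure N M).restrict B), 0 < w x →
      GV x = (m * w x ^ (m - 1)) • GU x := by
  have hm0 : 0 < m := by linarith
  have h : ∀ n : ℕ, ∀ᵐ x ∂((riemannianMeasure N M).restrict B),
      powWeight 1 0 n (w x) • GU x = weightPow m (powWeight 1 0 n) (max (w x ^ m) 0) • GV x :=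
    fun n => hU.ae_chain_rule hp hm hB hw hw0 hGU hGV hV hwU hU2 hwV hVp
      (isWeight_powWeight zero_le_one 0 n)
  filter_upwards [ae_all_iff.2 h] with x hx hx0
  have h1 := (tendsto_powWeight 1 0 hx0).eventually_const_lt (u := 0) (by simp)
  obtain ⟨n, hn⟩ := h1.exists
  have h2 := hx n
  set f := powWeight 1 0 n
  have h3 := weightPow_rpow hm0 f hx0
  have h4 : m * w x ^ (m - 1) ≠ 0 := by positivity
  have h5 : weightPow m f (max (w x ^ m) 0) ≠ 0 := by
    intro h0; rw [h0, zero_mul] at h3; exact hn.ne h3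
  rw [← h3, mul_smul] at h2
  exact (smul_right_injective _ h5 h2).symm

/-- Approximation of `F(w)`, `F = ∫ f`, in `W^{1,2}` and `W^{1,p}` simultaneously. -/
theorem IsSobolevZero.exists_approx {p m : ℝ} (hp : 1 ≤ p) (hm : 1 < m) {B : Set M}
    (hB : MeasurableSet B) {w : M → ℝ} (hw : Measurable w) (hw0 : ∀ x, 0 ≤ w x)
    {GU GV : ∀ x : M, TangentSpace (𝓡 N) x} (hGU : MeasurableAlong (fun x : M => x) GU)
    (hGV : MeasurableAlong (fun x : M => x) GV) (hU : IsSobolevZero 2 B w GU)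
    (hV : IsSobolevZero p B (fun x => w x ^ m) GV)
    (hwU : ∫⁻ x in B, ‖w x‖ₑ ^ (2 : ℝ) ∂(riemannianMeasure N M) ≠ ⊤)
    (hU2 : ∫⁻ x in B, ‖GU x‖ₑ ^ (2 : ℝ) ∂(riemannianMeasure N M) ≠ ⊤)
    (hwV : ∫⁻ x in B, ‖w x ^ m‖ₑ ^ p ∂(riemannianMeasure N M) ≠ ⊤)
    (hVp : ∫⁻ x in B, ‖GV x‖ₑ ^ p ∂(riemannianMeasure N M) ≠ ⊤)
    {f : ℝ → ℝ} (hf : IsWeight f) :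
    ∃ v : ℕ → M → ℝ, (∀ n, IsTestFunction N B (v n)) ∧ ∀ a, a = 2 ∨ a = p →
      Tendsto (fun n => ∫⁻ x in B, ‖v n x - primitive f (w x)‖ₑ ^ a ∂(riemannianMeasure N M))
        atTop (𝓝 0) ∧
      Tendsto (fun n => ∫⁻ x in B, ‖grad (N := N) (v n) x - f (w x) • GU x‖ₑ ^ a
        ∂(riemannianMeasure N M)) atTop (𝓝 0) := by
  -- The approximation starts from the larger of the two exponents and descends to the smaller. For
  -- p ≥ 2 it is built from w^m, and the chain rule rewrites its limiting gradient in terms of that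
  -- of w.
  rcases le_total p 2 with h2 | h2
  · obtain ⟨v, hv, hva⟩ := hU.exists_primitive (by norm_num) hw hGU hwU hU2 hf
    refine ⟨v, hv, ?_⟩
    rintro a (rfl | rfl)
    · exact hva _ (by norm_num) le_rfl
    · exact hva _ hp h2
  · obtain ⟨v, hv, hva⟩ := hV.exists_primitive hp (hw.pow_const m) hGV hwV hVp
      (isWeight_weightPow (by linarith) hf)
    have hc := hU.ae_chain_rule hp hm hB hw hw0 hGU hGV hV hwU hU2 hwV hVp hf
    refine ⟨v, hv, fun a ha => ?_⟩
    have ha1 : 1 ≤ a := by rcases ha with rfl | rfl <;> linarith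
    have ha2 : a ≤ p := by rcases ha with rfl | rfl <;> linarith
    obtain ⟨h3, h4⟩ := hva a ha1 ha2
    simp only [primitive_weightPow hm hf (hw0 _)] at h3
    refine ⟨h3, h4.congr fun n => lintegral_congr_ae ?_⟩
    filter_upwards [hc] with x hx
    rw [hx]

end Composition

theorem lintegral_le_of_tendsto_ae {X : Type*} [MeasurableSpace X] {ν : Measure X}
    {h : ℕ → X → ℝ≥0∞} {g : X → ℝ≥0∞} (hh : ∀ n, AEMeasurable (h n) ν)
    (hlim : ∀ᵐ x ∂ν, Tendsto (fun n => h n x) atTop (𝓝 (g x))) {b : ℕ → ℝ≥0∞} {b₀ : ℝ≥0∞}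
    (hb : ∀ n, ∫⁻ x, h n x ∂ν ≤ b n) (hb₀ : Tendsto b atTop (𝓝 b₀)) : ∫⁻ x, g x ∂ν ≤ b₀ := by
  calc ∫⁻ x, g x ∂ν = ∫⁻ x, liminf (fun n => h n x) atTop ∂ν :=
        lintegral_congr_ae (by filter_upwards [hlim] with x hx using hx.liminf_eq.symm)
    _ ≤ liminf (fun n => ∫⁻ x, h n x ∂ν) atTop := lintegral_liminf_le' hh
    _ ≤ liminf b atTop := liminf_le_liminf (Eventually.of_forall hb)
    _ = b₀ := hb₀.liminf_eq

theorem tendsto_enorm_rpow {a : ℝ} {y : ℕ → ℝ} {l : ℝ} (h : Tendsto y atTop (𝓝 l)) :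
    Tendsto (fun n => ‖y n‖ₑ ^ a) atTop (𝓝 (‖l‖ₑ ^ a)) :=
  ((ENNReal.continuous_rpow_const (y := a)).tendsto _).comp ((continuous_enorm.tendsto l).comp h)

/-! ### Functional inequalities for powers of a time slice -/

section Slice

/-- `w ≥ 0` lies in `W₀^{1,2}(B)` and `w ^ m` in `W₀^{1,p}(B)`, with gradients `GU` and `GV`. -/
structure IsSlice (p m : ℝ) (B : Set M) (w : M → ℝ) (GU GV : ∀ x : M, TangentSpace (𝓡 N) x) :
    Prop where
  measurable : Measurable w
  nonneg : ∀ x, 0 ≤ w x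
  measurableGU : MeasurableAlong (fun x : M => x) GU
  measurableGV : MeasurableAlong (fun x : M => x) GV
  sobolevU : IsSobolevZero 2 B w GU
  sobolevV : IsSobolevZero p B (fun x => w x ^ m) GV
  lintegralU : ∫⁻ x in B, ‖w x‖ₑ ^ (2 : ℝ) ∂(riemannianMeasure N M) ≠ ⊤
  lintegralGU : ∫⁻ x in B, ‖GU x‖ₑ ^ (2 : ℝ) ∂(riemannianMeasure N M) ≠ ⊤
  lintegralV : ∫⁻ x in B, ‖w x ^ m‖ₑ ^ p ∂(riemannianMeasure N M) ≠ ⊤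
  lintegralGV : ∫⁻ x in B, ‖GV x‖ₑ ^ p ∂(riemannianMeasure N M) ≠ ⊤

variable {p m : ℝ} {B : Set M} {w : M → ℝ} {GU GV : ∀ x : M, TangentSpace (𝓡 N) x}

theorem IsSlice.ae_smul_eq (hp : 1 ≤ p) (hm : 1 < m) (hB : MeasurableSet B)
    (h : IsSlice p m B w GU GV) : ∀ᵐ x ∂((riemannianMeasure N M).restrict B), 0 < w x →
      GV x = (m * w x ^ (m - 1)) • GU x :=
  h.sobolevU.ae_smul_eq hp hm hB h.measurable h.nonneg h.measurableGU h.measurableGV h.sobolevV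
    h.lintegralU h.lintegralGU h.lintegralV h.lintegralGV

theorem IsSlice.exists_approx (hp : 1 ≤ p) (hm : 1 < m) (hB : MeasurableSet B)
    (h : IsSlice p m B w GU GV) {f : ℝ → ℝ} (hf : IsWeight f) :
    ∃ v : ℕ → M → ℝ, (∀ n, IsTestFunction N B (v n)) ∧ ∀ a, a = 2 ∨ a = p →
      Tendsto (fun n => ∫⁻ x in B, ‖v n x - primitive f (w x)‖ₑ ^ a ∂(riemannianMeasure N M))
        atTop (𝓝 0) ∧
      Tendsto (fun n => ∫⁻ x in B, ‖grad (N := N) (v n) x - f (w x) • GU x‖ₑ ^ a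
        ∂(riemannianMeasure N M)) atTop (𝓝 0) :=
  h.sobolevU.exists_approx hp hm hB h.measurable h.nonneg h.measurableGU h.measurableGV h.sobolevV
    h.lintegralU h.lintegralGU h.lintegralV h.lintegralGV hf

theorem IsTestFunction.lintegral_le {a : ℝ} (ha : 0 < a) (hp : 0 < p) (hB : MeasurableSet B)
    {c : ℝ} (hS : ∀ v : M → ℝ, IsTestFunction N univ v →
      eLpNorm v (ENNReal.ofReal a) (riemannianMeasure N M) ≤ ENNReal.ofReal c *
        eLpNorm (fun x => ‖grad (N := N) v x‖) (ENNReal.ofReal p) (riemannianMeasure N M))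
    {v : M → ℝ} (hv : IsTestFunction N B v) :
    ∫⁻ x in B, ‖v x‖ₑ ^ a ∂(riemannianMeasure N M) ≤ (ENNReal.ofReal c *
      (∫⁻ x in B, ‖grad (N := N) v x‖ₑ ^ p ∂(riemannianMeasure N M)) ^ (1 / p)) ^ a := by
  have h := hS v ⟨hv.1, hv.2.1, subset_univ _⟩
  rw [eLpNorm_eq_lintegral_rpow_enorm_toReal (by simpa using ha) ENNReal.ofReal_ne_top,
    eLpNorm_eq_lintegral_rpow_enorm_toReal (by simpa using hp) ENNReal.ofReal_ne_top,
    ENNReal.toReal_ofReal ha.le, ENNReal.toReal_ofReal hp.le] at h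
  have h1 : ∫⁻ x, ‖‖grad (N := N) v x‖‖ₑ ^ p ∂(riemannianMeasure N M) =
      ∫⁻ x in B, ‖grad (N := N) v x‖ₑ ^ p ∂(riemannianMeasure N M) := by
    rw [← lintegral_indicator hB]
    congr 1 with x
    by_cases hx : x ∈ B
    · simp [hx]
    · simp [hx, hv.grad_eq_zero hx, hp]
  rw [h1] at h
  have h2 := ENNReal.rpow_le_rpow h ha.le
  rw [← ENNReal.rpow_mul, one_div_mul_cancel ha.ne', ENNReal.rpow_one] at h2
  exact (lintegral_mono' Measure.restrict_le_self le_rfl).trans h2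

theorem IsSlice.measurable_enorm_GU (h : IsSlice p m B w GU GV) : Measurable fun x => ‖GU x‖ₑ := by
  simp only [← ofReal_norm]
  exact (measurable_norm_along h.measurableGU).ennreal_ofReal

/-- A functional inequality for test functions holds for the powers of `w`. -/
theorem IsSlice.lintegral_rpow_le {a : ℝ} (ha : 0 < a) (hp : 1 ≤ p) (hm : 1 < m)
    (hB : MeasurableSet B) {c : ℝ} (hS : ∀ v : M → ℝ, IsTestFunction N univ v →
      eLpNorm v (ENNReal.ofReal a) (riemannianMeasure N M) ≤ ENNReal.ofReal c *
        eLpNorm (fun x => ‖grad (N := N) v x‖) (ENNReal.ofReal p) (riemannianMeasure N M))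
    (h : IsSlice p m B w GU GV) {β : ℝ} (hβ : 0 < β) :
    ∫⁻ x in B, ‖w x ^ β‖ₑ ^ a ∂(riemannianMeasure N M) ≤ (ENNReal.ofReal c *
      (∫⁻ x in B, {x | 0 < w x}.indicator (fun x => (‖β * w x ^ (β - 1)‖ₑ * ‖GU x‖ₑ) ^ p) x
        ∂(riemannianMeasure N M)) ^ (1 / p)) ^ a := by
  have hp0 : 0 < p := by linarith
  set ν := (riemannianMeasure N M).restrict B
  set Q := ∫⁻ x, {x | 0 < w x}.indicator (fun x => (‖β * w x ^ (β - 1)‖ₑ * ‖GU x‖ₑ) ^ p) x ∂ν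
  have hGm := h.measurable_enorm_GU
  -- H n truncates s^β, with derivative at most β s^(β-1). Fatou's lemma is used twice: along test
  -- functions approximating H n (w), and then as n tends to infinity.
  set H : ℕ → ℝ → ℝ := fun n => primitive (powWeight β (β - 1) n)
  have hW : ∀ n, IsWeight (powWeight β (β - 1) n) := fun n => isWeight_powWeight hβ.le _ n
  have hlimH : ∀ x, Tendsto (fun n => H n (w x)) atTop (𝓝 (w x ^ β)) := fun x => by
    have := (tendsto_primitive_of_le_rpow (c := β) (e := β - 1) (by linarith)
      (fun n => (hW n).continuous) (fun n => (hW n).nonneg)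
      (fun n s hs => powWeight_le hβ.le (β - 1) n hs)
      (fun s hs => tendsto_powWeight β (β - 1) hs) (h.nonneg x)).2
    simpa [hβ.ne'] using this
  refine lintegral_le_of_tendsto_ae (h := fun n x => ‖H n (w x)‖ₑ ^ a) (b := fun _ => _)
    (fun n => ?_) (Eventually.of_forall fun x => tendsto_enorm_rpow (hlimH x)) (fun n => ?_)
    tendsto_const_nhds
  · exact (((hW n).contDiff_primitive.continuous.measurable.comp
      h.measurable).enorm.pow_const a).aemeasurable
  obtain ⟨v, hv, hva⟩ := h.exists_approx hp hm hB (hW n)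
  obtain ⟨h1, h2⟩ := hva p (Or.inr rfl)
  obtain ⟨k, hk, hkae⟩ := exists_subseq_tendsto_ae_of_lintegral hp0
    (fun n => (hv n).measurable.aemeasurable)
    (((hW n).contDiff_primitive.continuous.measurable.comp h.measurable).aemeasurable) h1
  set f := powWeight β (β - 1) n
  have hfm : Measurable fun x => f (w x) := (hW n).continuous.measurable.comp h.measurable
  set e : ℕ → ℝ≥0∞ := fun j => (∫⁻ x, ‖grad (N := N) (v (k j)) x - f (w x) • GU x‖ₑ ^ p ∂ν) ^ (1 / p)
  have he : Tendsto e atTop (𝓝 0) := by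
    have := ((ENNReal.continuous_rpow_const (y := 1 / p)).tendsto 0).comp (h2.comp hk.tendsto_atTop)
    rwa [ENNReal.zero_rpow_of_pos (by positivity)] at this
  -- This bound does not depend on n, so the right side survives the second limit.
  have hfQ : ∫⁻ x, ‖f (w x) • GU x‖ₑ ^ p ∂ν ≤ Q := by
    refine lintegral_mono fun x => ?_
    rcases (h.nonneg x).eq_or_lt with h0 | h0
    · obtain ⟨δ, L, hδ, hL, hf1, hf2⟩ := (hW n).exists_support
      have hz : f (w x) = 0 := hf1 _ (by rw [← h0]; exact hδ.le)
      simp [hz, hp0]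
    · rw [indicator_of_mem (by exact h0), enorm_smul]
      gcongr
      rw [← ofReal_norm, ← ofReal_norm, Real.norm_of_nonneg ((hW n).nonneg _)]
      exact ENNReal.ofReal_le_ofReal ((powWeight_le hβ.le (β - 1) n h0.le).trans (le_abs_self _))
  have hgrad : ∀ j, (∫⁻ x, ‖grad (N := N) (v (k j)) x‖ₑ ^ p ∂ν) ^ (1 / p) ≤ e j + Q ^ (1 / p) := by
    intro j
    have hdm : Measurable fun x => ‖grad (N := N) (v (k j)) x - f (w x) • GU x‖ₑ := by
      simp only [← ofReal_norm]
      exact (measurable_norm_grad_sub_along measurable_id h.measurableGU (hv _).1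
        hfm).ennreal_ofReal
    have hsm : Measurable fun x => ‖f (w x) • GU x‖ₑ := by
      simp only [enorm_smul]; exact hfm.enorm.mul hGm
    refine le_trans ?_ ((ENNReal.lintegral_Lp_add_le hdm.aemeasurable hsm.aemeasurable hp).trans
      (add_le_add le_rfl (ENNReal.rpow_le_rpow hfQ (by positivity))))
    refine ENNReal.rpow_le_rpow (lintegral_mono fun x => ENNReal.rpow_le_rpow ?_ hp0.le)
      (by positivity)
    have := enorm_add_le (grad (N := N) (v (k j)) x - f (w x) • GU x) (f (w x) • GU x)
    rwa [sub_add_cancel] at this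
  refine lintegral_le_of_tendsto_ae (h := fun j x => ‖v (k j) x‖ₑ ^ a)
    (b := fun j => (ENNReal.ofReal c * (e j + Q ^ (1 / p))) ^ a)
    (fun j => ((hv _).measurable.enorm.pow_const a).aemeasurable) ?_ (fun j => ?_) ?_
  · filter_upwards [hkae] with x hx using tendsto_enorm_rpow hx
  · refine ((hv _).lintegral_le ha hp0 hB hS).trans (ENNReal.rpow_le_rpow ?_ ha.le)
    gcongr
    exact hgrad j
  · have := ((ENNReal.continuous_rpow_const (y := a)).tendsto _).comp
      (ENNReal.Tendsto.const_mul (a := ENNReal.ofReal c) (he.add_const (Q ^ (1 / p)))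
        (Or.inr ENNReal.ofReal_ne_top))
    rwa [zero_add] at this

end Slice

/-! ### The density of the weak form and its growth -/

section Pairing

/-- A form of Young's inequality, by cases on whether b/l is at most a. The free parameter puts a
small factor on the norms of the solution, at the cost of a large constant on those of the test
function. -/
theorem rpow_sub_one_mul_le {p a b l : ℝ} (hp : 1 < p) (ha : 0 ≤ a) (hb : 0 ≤ b) (hl : 0 < l) :
    a ^ (p - 1) * b ≤ l * (a ^ p + (b / l) ^ p) := by
  have hsplit : ∀ c : ℝ, 0 ≤ c → c ^ (p - 1) * c = c ^ p := fun c hc => by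
    rcases hc.eq_or_lt with h | h
    · rw [← h, mul_zero, Real.zero_rpow (by linarith)]
    · rw [← Real.rpow_add_one h.ne']; ring_nf
  have hbl : 0 ≤ b / l := by positivity
  have hb' : b = l * (b / l) := by field_simp
  rcases le_total (b / l) a with h | h
  · have h1 : a ^ (p - 1) * (b / l) ≤ a ^ p := by
      rw [← hsplit a ha]
      exact mul_le_mul_of_nonneg_left h (by positivity)
    have h2 : 0 ≤ (b / l) ^ p := by positivity
    calc a ^ (p - 1) * b = l * (a ^ (p - 1) * (b / l)) := by field_simp
      _ ≤ _ := by gcongr; linarith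
  · have h1 : a ^ (p - 1) * (b / l) ≤ (b / l) ^ p := by
      rw [← hsplit _ hbl]
      exact mul_le_mul_of_nonneg_right (Real.rpow_le_rpow ha h (by linarith)) hbl
    have h2 : 0 ≤ a ^ p := by positivity
    calc a ^ (p - 1) * b = l * (a ^ (p - 1) * (b / l)) := by field_simp
      _ ≤ _ := by gcongr; linarith

theorem mul_le_sq_add {a b l : ℝ} (ha : 0 ≤ a) (hb : 0 ≤ b) (hl : 0 < l) :
    a * b ≤ l * (a ^ (2 : ℝ) + (b / l) ^ (2 : ℝ)) := by
  have := rpow_sub_one_mul_le (p := 2) one_lt_two ha hb hl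
  norm_num at this ⊢
  exact this

theorem abs_truncation_le {k σ : ℝ} (hk : 0 < k) (hσ : 0 ≤ σ) : |truncation k σ| ≤ σ := by
  rw [truncation, max_eq_right (by linarith [le_min hσ hk.le]), abs_of_nonneg (le_min hσ hk.le)]
  exact min_le_left _ _

/-- The bound is linear in s, so the source inherits square integrability from the bounded solution
without use of the measure of the domain. -/
theorem abs_truncation_rpow_le {k K q s : ℝ} (hk : 0 < k) (hq : 1 < q) (hs : 0 ≤ s) (hsK : s ≤ K) :
    |truncation k (s ^ q)| ≤ K ^ (q - 1) * s := by
  refine (abs_truncation_le hk (by positivity)).trans ?_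
  rcases hs.eq_or_lt with h | h
  · rw [← h, Real.zero_rpow (by linarith), mul_zero]
  · calc s ^ q = s ^ (q - 1) * s := by rw [← Real.rpow_add_one h.ne']; ring_nf
      _ ≤ _ := by
        gcongr

variable {E : Type*} [NormedAddCommGroup E] [InnerProductSpace ℝ E]

/-- The density of the weak form of the equation, with the values `V`, `W`, `s` of `∇u^m`, `∇u`
and `u` and the values `z`, `Z` of the test function and of its gradient. -/
def pairing (p q ε k : ℝ) (V W : E) (s z : ℝ) (Z : E) : ℝ :=
  ‖V‖ ^ (p - 2) * inner ℝ V Z + ε * inner ℝ W Z - truncation k (s ^ q) * z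

theorem pairing_sub (p q ε k : ℝ) (V W : E) (s z z' : ℝ) (Z Z' : E) :
    pairing p q ε k V W s (z - z') (Z - Z') =
      pairing p q ε k V W s z Z - pairing p q ε k V W s z' Z' := by
  simp only [pairing, inner_sub_right]; ring

theorem norm_rpow_mul_norm {p : ℝ} (hp : 1 < p) (V : E) : ‖V‖ ^ (p - 2) * ‖V‖ = ‖V‖ ^ (p - 1) := by
  rcases (norm_nonneg V).eq_or_lt with h | h
  · rw [← h, mul_zero, Real.zero_rpow (by linarith)]
  · rw [← Real.rpow_add_one h.ne']; ring_nf

theorem abs_pairing_le {p q ε k K l : ℝ} (hp : 1 < p) (hq : 1 < q) (hε : 0 < ε) (hk : 0 < k)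
    (hl : 0 < l) (V W : E) {s : ℝ} (hs : 0 ≤ s) (hsK : s ≤ K) (z : ℝ) (Z : E) :
    |pairing p q ε k V W s z Z| ≤ l * (1 + ε + K ^ (q - 1)) *
      (‖V‖ ^ p + ‖W‖ ^ (2 : ℝ) + s ^ (2 : ℝ) +
        ((‖Z‖ / l) ^ p + ((‖Z‖ / l) ^ (2 : ℝ) + (|z| / l) ^ (2 : ℝ)))) := by
  have hK : 0 ≤ K := hs.trans hsK
  have h1 : |‖V‖ ^ (p - 2) * inner ℝ V Z| ≤ l * (‖V‖ ^ p + (‖Z‖ / l) ^ p) := by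
    rw [abs_mul, abs_of_nonneg (by positivity)]
    calc ‖V‖ ^ (p - 2) * |inner ℝ V Z| ≤ ‖V‖ ^ (p - 2) * (‖V‖ * ‖Z‖) := by
          gcongr; exact abs_real_inner_le_norm _ _
      _ = ‖V‖ ^ (p - 1) * ‖Z‖ := by rw [← mul_assoc, norm_rpow_mul_norm hp]
      _ ≤ _ := rpow_sub_one_mul_le hp (norm_nonneg _) (norm_nonneg _) hl
  have h2 : |ε * inner ℝ W Z| ≤ ε * (l * (‖W‖ ^ (2 : ℝ) + (‖Z‖ / l) ^ (2 : ℝ))) := by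
    rw [abs_mul, abs_of_pos hε]
    gcongr
    exact (abs_real_inner_le_norm _ _).trans (mul_le_sq_add (norm_nonneg _) (norm_nonneg _) hl)
  have h3 : |truncation k (s ^ q) * z| ≤
      K ^ (q - 1) * (l * (s ^ (2 : ℝ) + (|z| / l) ^ (2 : ℝ))) := by
    rw [abs_mul]
    calc _ ≤ K ^ (q - 1) * s * |z| := by
          gcongr; exact abs_truncation_rpow_le hk hq hs hsK
      _ ≤ _ := by
          rw [mul_assoc]
          exact mul_le_mul_of_nonneg_left (mul_le_sq_add hs (abs_nonneg _) hl) (by positivity)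
  have h4 : |pairing p q ε k V W s z Z| ≤ _ :=
    (abs_sub _ _).trans (add_le_add ((abs_add_le _ _).trans (add_le_add h1 h2)) h3)
  refine h4.trans ?_
  set a := ‖V‖ ^ p + (‖Z‖ / l) ^ p
  set b := ‖W‖ ^ (2 : ℝ) + (‖Z‖ / l) ^ (2 : ℝ)
  set c := s ^ (2 : ℝ) + (|z| / l) ^ (2 : ℝ)
  have ha : 0 ≤ a := by positivity
  have hb : 0 ≤ b := by positivity
  have hc : 0 ≤ c := by positivity
  have hKq : 0 ≤ K ^ (q - 1) := by positivity
  calc l * a + ε * (l * b) + K ^ (q - 1) * (l * c)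
      ≤ l * (1 + ε + K ^ (q - 1)) * a + l * (1 + ε + K ^ (q - 1)) * b +
        l * (1 + ε + K ^ (q - 1)) * c := by
        have e1 : 0 ≤ l * a := by positivity
        have e2 : 0 ≤ l * b := by positivity
        have e3 : 0 ≤ l * c := by positivity
        nlinarith [mul_nonneg hε.le e1, mul_nonneg hε.le e3, mul_nonneg hKq e1, mul_nonneg hKq e2]
    _ = _ := by simp only [a, b, c]; ring

theorem ofReal_rpow_norm {F : Type*} [SeminormedAddCommGroup F] {a : ℝ} (ha : 0 ≤ a) (v : F) :
    ENNReal.ofReal (‖v‖ ^ a) = ‖v‖ₑ ^ a := by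
  rw [← ENNReal.ofReal_rpow_of_nonneg (norm_nonneg _) ha, ofReal_norm]

theorem enorm_pairing_le {p q ε k K l : ℝ} (hp : 1 < p) (hq : 1 < q) (hε : 0 < ε) (hk : 0 < k)
    (hl : 0 < l) (V W : E) {s : ℝ} (hs : 0 ≤ s) (hsK : s ≤ K) (z : ℝ) (Z : E) :
    ‖pairing p q ε k V W s z Z‖ₑ ≤ ENNReal.ofReal (l * (1 + ε + K ^ (q - 1))) *
      (‖V‖ₑ ^ p + ‖W‖ₑ ^ (2 : ℝ) + ‖s‖ₑ ^ (2 : ℝ) +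
        (ENNReal.ofReal (l⁻¹ ^ p) * ‖Z‖ₑ ^ p + ENNReal.ofReal (l⁻¹ ^ (2 : ℝ)) *
          (‖Z‖ₑ ^ (2 : ℝ) + ‖z‖ₑ ^ (2 : ℝ)))) := by
  have hK : 0 ≤ K := hs.trans hsK
  have h := ENNReal.ofReal_le_ofReal (abs_pairing_le hp hq hε hk hl V W hs hsK z Z)
  rw [← Real.norm_eq_abs, ofReal_norm] at h
  refine h.trans (le_of_eq ?_)
  have hdiv : ∀ a b : ℝ, 0 ≤ a → (a / l) ^ b = l⁻¹ ^ b * a ^ b := fun a b ha => by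
    rw [div_eq_inv_mul, Real.mul_rpow (by positivity) ha]
  rw [hdiv _ _ (norm_nonneg _), hdiv _ _ (norm_nonneg _), hdiv _ _ (abs_nonneg _), ← mul_add,
    ← Real.norm_eq_abs z, ENNReal.ofReal_mul (by positivity), ENNReal.ofReal_add (by positivity)
    (by positivity), ENNReal.ofReal_add (by positivity) (by positivity), ENNReal.ofReal_add
    (by positivity) (by positivity), ENNReal.ofReal_add (by positivity) (by positivity),
    ENNReal.ofReal_mul (by positivity), ENNReal.ofReal_mul (by positivity), ENNReal.ofReal_add
    (by positivity) (by positivity), ofReal_rpow_norm (by linarith), ofReal_rpow_norm (by norm_num),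
    ofReal_rpow_norm (by linarith), ENNReal.ofReal_mul (p := l⁻¹ ^ (2 : ℝ)) (by positivity),
    ENNReal.ofReal_add (p := ‖Z‖ ^ (2 : ℝ)) (by positivity) (by positivity),
    ofReal_rpow_norm (by norm_num), ofReal_rpow_norm (by norm_num)]
  congr 3
  rw [← ofReal_rpow_norm (by norm_num), Real.norm_of_nonneg hs]

end Pairing

/-! ### Integrability and stability of the weak form over time intervals -/

section Evolution

variable (N) in
/-- A function `z` on `M` and a field `Z` which have the measurability needed to be used as a test
function and its gradient. -/
structure IsTestPair (z : M → ℝ) (Z : ∀ x : M, TangentSpace (𝓡 N) x) : Prop where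
  measurable : Measurable z
  measurable_enorm : Measurable fun x => ‖Z x‖ₑ
  measurable_inner : ∀ G : ∀ a : ℝ × M, TangentSpace (𝓡 N) a.2,
    MeasurableAlong (fun a : ℝ × M => a.2) G → Measurable fun a => inner ℝ (G a) (Z a.2)

theorem measurable_enorm_along {α : Type*} [MeasurableSpace α] {b : α → M}
    {G : ∀ a, TangentSpace (𝓡 N) (b a)} (hG : MeasurableAlong b G) :
    Measurable fun a => ‖G a‖ₑ := by
  simp only [← ofReal_norm]
  exact (measurable_norm_along hG).ennreal_ofReal

theorem IsTestFunction.isTestPair {B : Set M} {v : M → ℝ} (hv : IsTestFunction N B v) :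
    IsTestPair N v (grad (N := N) v) where
  measurable := hv.measurable
  measurable_enorm := by
    simp only [← ofReal_norm]
    exact (continuous_norm_grad hv.1).measurable.ennreal_ofReal
  measurable_inner G hG := by
    have h := measurable_inner_grad_along hG hv.1
    simp_rw [real_inner_comm] at h
    exact h

theorem isTestPair_smul {z θ : M → ℝ} (hz : Measurable z) (hθ : Measurable θ)
    {G : ∀ x : M, TangentSpace (𝓡 N) x} (hG : MeasurableAlong (fun x : M => x) G) :
    IsTestPair N z (fun x => θ x • G x) where
  measurable := hz
  measurable_enorm := by
    simp only [enorm_smul]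
    exact hθ.enorm.mul (measurable_enorm_along hG)
  measurable_inner H hH := by
    simp only [inner_smul_right]
    exact (hθ.comp measurable_snd).mul (measurable_inner_along hH (hG.comp measurable_snd))

theorem IsTestFunction.isTestPair_sub {B : Set M} {v : M → ℝ} (hv : IsTestFunction N B v)
    {z θ : M → ℝ} (hz : Measurable z) (hθ : Measurable θ)
    {G : ∀ x : M, TangentSpace (𝓡 N) x} (hG : MeasurableAlong (fun x : M => x) G) :
    IsTestPair N (fun x => v x - z x) (fun x => grad (N := N) v x - θ x • G x) where
  measurable := hv.measurable.sub hz
  measurable_enorm := by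
    simp only [← ofReal_norm]
    exact (measurable_norm_grad_sub_along measurable_id hG hv.1 hθ).ennreal_ofReal
  measurable_inner H hH := by
    simp only [inner_sub_right]
    exact (hv.isTestPair.measurable_inner H hH).sub
      ((isTestPair_smul hz hθ hG).measurable_inner H hH)

/-- The density of the norms which control a solution with its gradients. -/
def normDensity (p : ℝ) (U : ℝ → M → ℝ) (GU GV : ℝ → ∀ x : M, TangentSpace (𝓡 N) x) (t : ℝ)
    (x : M) : ℝ≥0∞ :=
  ‖GV t x‖ₑ ^ p + ‖GU t x‖ₑ ^ (2 : ℝ) + ‖U t x‖ₑ ^ (2 : ℝ)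

/-- A measurable, bounded representative `U` of a solution, with the gradients `GU` of `U` and `GV`
of `U ^ m`. -/
structure IsEvolution (p m K : ℝ) (B : Set M) (U : ℝ → M → ℝ)
    (GU GV : ℝ → ∀ x : M, TangentSpace (𝓡 N) x) : Prop where
  measurable : Measurable fun z : ℝ × M => U z.1 z.2
  nonneg : ∀ t x, 0 ≤ U t x
  le : ∀ t x, U t x ≤ K
  measurableGU : MeasurableAlong (fun z : ℝ × M => z.2) fun z => GU z.1 z.2
  measurableGV : MeasurableAlong (fun z : ℝ × M => z.2) fun z => GV z.1 z.2
  isSlice : ∀ᵐ t, 0 < t → IsSlice p m B (U t) (GU t) (GV t)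
  lintegral_ne_top : ∀ T : ℝ, ∫⁻ t in Ioo 0 T, (∫⁻ x in B,
    normDensity p U GU GV t x ∂(riemannianMeasure N M)) ≠ ⊤

variable {p m q ε k K : ℝ} {B : Set M} {U : ℝ → M → ℝ} {GU GV : ℝ → ∀ x : M, TangentSpace (𝓡 N) x}

theorem IsEvolution.measurable_norms (h : IsEvolution p m K B U GU GV) :
    Measurable fun z : ℝ × M => normDensity p U GU GV z.1 z.2 :=
  (((measurable_enorm_along h.measurableGV).pow_const p).add
    ((measurable_enorm_along h.measurableGU).pow_const 2)).add (h.measurable.enorm.pow_const 2)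

theorem measurable_truncation (k : ℝ) : Measurable (truncation k) :=
  measurable_const.max (measurable_id.min measurable_const)

theorem IsEvolution.measurable_pairing (h : IsEvolution p m K B U GU GV) (q ε k : ℝ) {z : M → ℝ}
    {Z : ∀ x : M, TangentSpace (𝓡 N) x} (hz : IsTestPair N z Z) :
    Measurable fun a : ℝ × M =>
      pairing p q ε k (GV a.1 a.2) (GU a.1 a.2) (U a.1 a.2) (z a.2) (Z a.2) := by
  unfold pairing
  exact ((((measurable_norm_along h.measurableGV).pow_const _).mul
    (hz.measurable_inner _ h.measurableGV)).add
    ((hz.measurable_inner _ h.measurableGU).const_mul ε)).sub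
    (((measurable_truncation k).comp (h.measurable.pow_const q)).mul
      (hz.measurable.comp measurable_snd))

theorem IsEvolution.lintegral_pairing_le (h : IsEvolution p m K B U GU GV) (hp : 1 < p) (hq : 1 < q)
    (hε : 0 < ε) (hk : 0 < k) {l : ℝ} (hl : 0 < l) {z : M → ℝ}
    {Z : ∀ x : M, TangentSpace (𝓡 N) x} (hz : IsTestPair N z Z) (T : ℝ) :
    ∫⁻ t in Ioo 0 T, (∫⁻ x in B,
      ‖pairing p q ε k (GV t x) (GU t x) (U t x) (z x) (Z x)‖ₑ ∂(riemannianMeasure N M)) ≤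
    ENNReal.ofReal (l * (1 + ε + K ^ (q - 1))) * ((∫⁻ t in Ioo 0 T, (∫⁻ x in B,
      normDensity p U GU GV t x ∂(riemannianMeasure N M))) +
      (ENNReal.ofReal (l⁻¹ ^ p) * ∫⁻ x in B, ‖Z x‖ₑ ^ p ∂(riemannianMeasure N M) +
        ENNReal.ofReal (l⁻¹ ^ (2 : ℝ)) * (∫⁻ x in B, ‖Z x‖ₑ ^ (2 : ℝ) ∂(riemannianMeasure N M) +
          ∫⁻ x in B, ‖z x‖ₑ ^ (2 : ℝ) ∂(riemannianMeasure N M))) * ENNReal.ofReal T) := by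
  set ν := (riemannianMeasure N M).restrict B
  have hQm := h.measurable_norms
  have hZp := hz.measurable_enorm.pow_const p
  have hZ2 := hz.measurable_enorm.pow_const (2 : ℝ)
  have hz2 := hz.measurable.enorm.pow_const (2 : ℝ)
  set c := ∫⁻ x, (ENNReal.ofReal (l⁻¹ ^ p) * ‖Z x‖ₑ ^ p + ENNReal.ofReal (l⁻¹ ^ (2 : ℝ)) *
          (‖Z x‖ₑ ^ (2 : ℝ) + ‖z x‖ₑ ^ (2 : ℝ))) ∂ν with hc
  have hce : c = ENNReal.ofReal (l⁻¹ ^ p) * ∫⁻ x, ‖Z x‖ₑ ^ p ∂ν +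
        ENNReal.ofReal (l⁻¹ ^ (2 : ℝ)) * (∫⁻ x, ‖Z x‖ₑ ^ (2 : ℝ) ∂ν +
          ∫⁻ x, ‖z x‖ₑ ^ (2 : ℝ) ∂ν) := by
    rw [hc, lintegral_add_left (hZp.const_mul _), lintegral_const_mul _ hZp,
      lintegral_const_mul' _ _ ENNReal.ofReal_ne_top, lintegral_add_left hZ2]
  rw [← hce]
  calc _ ≤ ∫⁻ t in Ioo 0 T, ENNReal.ofReal (l * (1 + ε + K ^ (q - 1))) * ((∫⁻ x,
        normDensity p U GU GV t x ∂ν) + c) := by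
        refine lintegral_mono fun t => ?_
        refine (lintegral_mono fun x => enorm_pairing_le hp hq hε hk hl _ _ (h.nonneg t x)
          (h.le t x) _ _).trans (le_of_eq ?_)
        have hQt : Measurable fun x => normDensity p U GU GV t x :=
          hQm.comp (g := fun z : ℝ × M => normDensity p U GU GV z.1 z.2) (f := fun x => (t, x))
            measurable_prodMk_left
        rw [lintegral_const_mul' _ _ ENNReal.ofReal_ne_top, ← lintegral_add_left hQt]
        rfl
    _ = _ := by
        have hQi : Measurable fun t => ∫⁻ x,
            normDensity p U GU GV t x ∂ν :=
          Measurable.lintegral_prod_right' (f := fun z : ℝ × M => normDensity p U GU GV z.1 z.2) hQm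
        rw [lintegral_const_mul' _ _ ENNReal.ofReal_ne_top, lintegral_add_left hQi,
          setLIntegral_const, Real.volume_Ioo, sub_zero]

theorem IsEvolution.integrable_pairing (h : IsEvolution p m K B U GU GV) (hp : 1 < p) (hq : 1 < q)
    (hε : 0 < ε) (hk : 0 < k) {z : M → ℝ} {Z : ∀ x : M, TangentSpace (𝓡 N) x}
    (hz : IsTestPair N z Z) (hZp : ∫⁻ x in B, ‖Z x‖ₑ ^ p ∂(riemannianMeasure N M) ≠ ⊤)
    (hZ2 : ∫⁻ x in B, ‖Z x‖ₑ ^ (2 : ℝ) ∂(riemannianMeasure N M) ≠ ⊤)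
    (hz2 : ∫⁻ x in B, ‖z x‖ₑ ^ (2 : ℝ) ∂(riemannianMeasure N M) ≠ ⊤) (T : ℝ) :
    Integrable (fun a : ℝ × M =>
      pairing p q ε k (GV a.1 a.2) (GU a.1 a.2) (U a.1 a.2) (z a.2) (Z a.2))
      ((volume.restrict (Ioo 0 T)).prod ((riemannianMeasure N M).restrict B)) := by
  have hm := h.measurable_pairing q ε k hz
  refine ⟨hm.aestronglyMeasurable, ?_⟩
  rw [hasFiniteIntegral_iff_enorm, lintegral_prod _ hm.enorm.aemeasurable]
  refine (h.lintegral_pairing_le hp hq hε hk one_pos hz T).trans_lt ?_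
  have := h.lintegral_ne_top T
  finiteness

/-- For fixed l in Young's inequality the norms of the error tend to zero despite their large
constants, so the limit superior is at most a fixed multiple of l; then l → 0. -/
theorem IsEvolution.tendsto_integral_pairing (h : IsEvolution p m K B U GU GV) (hp : 1 < p)
    (hq : 1 < q) (hε : 0 < ε) (hk : 0 < k) {z : ℕ → M → ℝ}
    {Z : ℕ → ∀ x : M, TangentSpace (𝓡 N) x} {z₀ : M → ℝ} {Z₀ : ∀ x : M, TangentSpace (𝓡 N) x}
    (hz : ∀ j, IsTestPair N (fun x => z j x - z₀ x) (fun x => Z j x - Z₀ x))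
    (hZp : Tendsto (fun j => ∫⁻ x in B, ‖Z j x - Z₀ x‖ₑ ^ p ∂(riemannianMeasure N M)) atTop (𝓝 0))
    (hZ2 : Tendsto (fun j => ∫⁻ x in B, ‖Z j x - Z₀ x‖ₑ ^ (2 : ℝ) ∂(riemannianMeasure N M)) atTop
      (𝓝 0))
    (hz2 : Tendsto (fun j => ∫⁻ x in B, ‖z j x - z₀ x‖ₑ ^ (2 : ℝ) ∂(riemannianMeasure N M)) atTop
      (𝓝 0)) (T : ℝ) :
    Tendsto (fun j => ∫⁻ t in Ioo 0 T, (∫⁻ x in B,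
      ‖pairing p q ε k (GV t x) (GU t x) (U t x) (z j x) (Z j x) -
        pairing p q ε k (GV t x) (GU t x) (U t x) (z₀ x) (Z₀ x)‖ₑ ∂(riemannianMeasure N M)))
      atTop (𝓝 0) := by
  simp only [← pairing_sub]
  set A := ∫⁻ t in Ioo 0 T, (∫⁻ x in B,
      normDensity p U GU GV t x ∂(riemannianMeasure N M))
  have hA : A ≠ ⊤ := h.lintegral_ne_top T
  set c := 1 + ε + K ^ (q - 1)
  have hbound : ∀ l : ℝ, 0 < l → limsup (fun j => ∫⁻ t in Ioo 0 T, (∫⁻ x in B,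
      ‖pairing p q ε k (GV t x) (GU t x) (U t x) (z j x - z₀ x) (Z j x - Z₀ x)‖ₑ
        ∂(riemannianMeasure N M))) atTop ≤ ENNReal.ofReal (l * c) * A := by
    intro l hl
    have hlim := ENNReal.Tendsto.const_mul (a := ENNReal.ofReal (l * c))
      (tendsto_const_nhds (x := A) |>.add (ENNReal.Tendsto.mul_const (b := ENNReal.ofReal T)
        ((ENNReal.Tendsto.const_mul (a := ENNReal.ofReal (l⁻¹ ^ p)) hZp
          (Or.inr ENNReal.ofReal_ne_top)).add
        (ENNReal.Tendsto.const_mul (a := ENNReal.ofReal (l⁻¹ ^ (2 : ℝ))) (hZ2.add hz2)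
          (Or.inr ENNReal.ofReal_ne_top))) (Or.inr ENNReal.ofReal_ne_top)))
      (Or.inr ENNReal.ofReal_ne_top)
    simp only [mul_zero, add_zero, zero_mul] at hlim
    rw [← hlim.limsup_eq]
    exact limsup_le_limsup (Eventually.of_forall fun j =>
      h.lintegral_pairing_le hp hq hε hk hl (hz j) T)
  refine tendsto_of_le_liminf_of_limsup_le zero_le ?_
  have h0 : Tendsto (fun l : ℝ => ENNReal.ofReal (l * c) * A) (𝓝[>] 0) (𝓝 0) := by
    have h1 : Tendsto (fun l : ℝ => ENNReal.ofReal (l * c)) (𝓝[>] 0) (𝓝 0) := by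
      have : Continuous fun l : ℝ => ENNReal.ofReal (l * c) :=
        ENNReal.continuous_ofReal.comp (by fun_prop)
      have := (this.tendsto 0).mono_left (nhdsWithin_le_nhds (s := Ioi 0))
      simpa using this
    simpa using ENNReal.Tendsto.mul_const h1 (Or.inr hA)
  exact ge_of_tendsto h0 (by filter_upwards [self_mem_nhdsWithin] with l hl using hbound l hl)

end Evolution

/-! ### Uniform bounds for weighted gradients -/

section Weights

variable {p m q ε k K : ℝ} {B : Set M}

theorem IsSlice.measurable_enorm_smul {w : M → ℝ} {GU GV : ∀ x : M, TangentSpace (𝓡 N) x}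
    (h : IsSlice p m B w GU GV) {f : ℝ → ℝ} (hf : IsWeight f) :
    Measurable fun x => ‖f (w x) • GU x‖ₑ := by
  simp only [enorm_smul]
  exact (hf.continuous.measurable.comp h.measurable).enorm.mul h.measurable_enorm_GU

/-- `f(w) ∇w` is bounded in `L^p` and in `L^2`, and `F(w)`, `F = ∫ f`, in `L^2`. -/
theorem exists_lintegral_weight_le (hp : 1 < p) (hm : 1 < m) (hB : MeasurableSet B) {f : ℝ → ℝ}
    (hf : IsWeight f) : ∃ C : ℝ≥0∞, C ≠ ⊤ ∧ ∀ (w : M → ℝ) (GU GV : ∀ x : M, TangentSpace (𝓡 N) x),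
      IsSlice p m B w GU GV → ∫⁻ x in B, (‖f (w x) • GU x‖ₑ ^ p + ‖f (w x) • GU x‖ₑ ^ (2 : ℝ) +
        ‖primitive f (w x)‖ₑ ^ (2 : ℝ)) ∂(riemannianMeasure N M) ≤
      C * ∫⁻ x in B, (‖GV x‖ₑ ^ p + ‖GU x‖ₑ ^ (2 : ℝ) + ‖w x‖ₑ ^ (2 : ℝ))
        ∂(riemannianMeasure N M) := by
  have hp0 : 0 < p := by linarith
  obtain ⟨C₁, hC₁, hf₁⟩ := hf.exists_bound
  obtain ⟨C₂, hC₂, hf₂⟩ := (isWeight_weightPow (by linarith : 0 < m) hf).exists_bound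
  obtain ⟨δ, L, hδ, hL, hfδ, -⟩ := hf.exists_support
  set c₁ := ENNReal.ofReal C₁
  set c₂ := ENNReal.ofReal C₂
  have hδ0 : ENNReal.ofReal δ ≠ 0 := by simpa using hδ
  set d := (ENNReal.ofReal δ)⁻¹
  have hd : d ≠ ⊤ := by simpa [d] using hδ
  have henorm : ∀ s, ‖f s‖ₑ ≤ c₁ := fun s => by
    rw [← ofReal_norm, Real.norm_of_nonneg (hf.nonneg _)]; exact ENNReal.ofReal_le_ofReal (hf₁ s)
  refine ⟨c₁ ^ p * (1 + d ^ (2 : ℝ)) + c₂ ^ p + c₁ ^ (2 : ℝ) + c₁ ^ (2 : ℝ), by finiteness,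
    fun w GU GV h => ?_⟩
  have hchain := h.sobolevU.ae_chain_rule hp.le hm hB h.measurable h.nonneg h.measurableGU
    h.measurableGV h.sobolevV h.lintegralU h.lintegralGU h.lintegralV h.lintegralGV hf
  rw [← lintegral_const_mul' _ _ (by finiteness)]
  refine lintegral_mono_ae ?_
  filter_upwards [hchain] with x hx
  set a := ‖GV x‖ₑ ^ p
  set b := ‖GU x‖ₑ ^ (2 : ℝ)
  set e := ‖w x‖ₑ ^ (2 : ℝ)
  have h1 : ‖f (w x) • GU x‖ₑ ^ p ≤ (c₁ ^ p * (1 + d ^ (2 : ℝ)) + c₂ ^ p) * (a + b + e) := by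
    -- For p ≤ 2 the p-th power of the gradient is at most its square plus 1, and 1 ≤ (w/δ)² where
    -- the weight is non-zero. For p ≥ 2 the chain rule turns the weighted gradient of w into a
    -- bounded multiple of that of w^m.
    rcases le_total p 2 with hp2 | hp2
    · by_cases hw : w x ≤ δ
      · rw [hfδ _ hw]; simp [hp0]
      · push Not at hw
        have h3 : 1 ≤ d ^ (2 : ℝ) * e := by
          simp only [e]
          rw [← ENNReal.mul_rpow_of_nonneg _ _ (by norm_num)]
          have : 1 ≤ d * ‖w x‖ₑ := by
            simp only [d]
            rw [mul_comm, ← div_eq_mul_inv, ENNReal.le_div_iff_mul_le (Or.inl hδ0)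
              (Or.inl ENNReal.ofReal_ne_top), one_mul, ← ofReal_norm]
            exact ENNReal.ofReal_le_ofReal (hw.le.trans (le_abs_self _))
          simpa using ENNReal.rpow_le_rpow this (by norm_num : (0 : ℝ) ≤ 2)
        have h4 : ‖GU x‖ₑ ^ p ≤ b + 1 := by
          rcases le_total ‖GU x‖ₑ 1 with h5 | h5
          · exact (ENNReal.rpow_le_one h5 hp0.le).trans le_add_self
          · exact (ENNReal.rpow_le_rpow_of_exponent_le h5 hp2).trans le_self_add
        calc ‖f (w x) • GU x‖ₑ ^ p = ‖f (w x)‖ₑ ^ p * ‖GU x‖ₑ ^ p := by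
              rw [enorm_smul, ENNReal.mul_rpow_of_nonneg _ _ hp0.le]
          _ ≤ c₁ ^ p * (b + d ^ (2 : ℝ) * e) := by
              gcongr
              · exact henorm _
              · exact h4.trans (by gcongr)
          _ ≤ c₁ ^ p * ((1 + d ^ (2 : ℝ)) * (a + b + e)) := by
              gcongr
              rw [add_mul, one_mul]
              gcongr
              · exact le_self_add.trans' (le_add_self)
              · exact le_add_self
          _ ≤ _ := by
              rw [← mul_assoc]; gcongr; exact le_self_add
    · rw [hx]
      calc ‖weightPow m f (max (w x ^ m) 0) • GV x‖ₑ ^ p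
          = ‖weightPow m f (max (w x ^ m) 0)‖ₑ ^ p * a := by
            rw [enorm_smul, ENNReal.mul_rpow_of_nonneg _ _ hp0.le]
        _ ≤ c₂ ^ p * (a + b + e) := by
            gcongr
            · rw [← ofReal_norm, Real.norm_of_nonneg
                ((isWeight_weightPow (by linarith : 0 < m) hf).nonneg _)]
              exact ENNReal.ofReal_le_ofReal (hf₂ _)
            · rw [add_assoc]; exact le_self_add
        _ ≤ _ := by gcongr; exact le_add_self
  have h2 : ‖f (w x) • GU x‖ₑ ^ (2 : ℝ) ≤ c₁ ^ (2 : ℝ) * (a + b + e) := by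
    rw [enorm_smul, ENNReal.mul_rpow_of_nonneg _ _ (by norm_num)]
    gcongr
    · exact henorm _
    · exact le_self_add.trans' le_add_self
  have h3 : ‖primitive f (w x)‖ₑ ^ (2 : ℝ) ≤ c₁ ^ (2 : ℝ) * (a + b + e) := by
    have : ‖primitive f (w x)‖ₑ ≤ c₁ * ‖w x‖ₑ := by
      rw [← ofReal_norm, ← ofReal_norm, ← ENNReal.ofReal_mul hC₁.le]
      exact ENNReal.ofReal_le_ofReal (hf.abs_primitive_le hf₁ _)
    refine (ENNReal.rpow_le_rpow this (by norm_num)).trans ?_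
    rw [ENNReal.mul_rpow_of_nonneg _ _ (by norm_num)]
    gcongr
    exact le_add_self
  rw [add_mul, add_mul]
  gcongr

end Weights

/-! ### Time translations at a fixed point of the manifold -/

section Fibre

variable {p q ε k : ℝ}

/-- The tangent space at x carries the topology induced from the tangent bundle, so a field
measurable in the bundle is measurable as a curve in this one Hilbert space. L^p theory in time then
applies without parallel transport. -/
theorem stronglyMeasurable_fibre {G : ℝ → ∀ x : M, TangentSpace (𝓡 N) x}
    (hG : MeasurableAlong (fun z : ℝ × M => z.2) fun z => G z.1 z.2) (x : M) :
    StronglyMeasurable fun t => (G t x : TangentSpace (𝓡 N) x) := by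
  letI : MeasurableSpace (TangentSpace (𝓡 N) x) := borel _
  haveI : BorelSpace (TangentSpace (𝓡 N) x) := ⟨rfl⟩
  have hm : Measurable fun t => (G t x : TangentSpace (𝓡 N) x) := by
    refine measurable_of_isOpen fun V hV => ?_
    obtain ⟨W, hW, rfl⟩ := (FiberBundle.totalSpaceMk_isInducing 𝔼
      (TangentSpace (𝓡 N) : M → Type _) x).isOpen_iff.1 hV
    have h1 := hG.comp (f := fun t : ℝ => (t, x)) measurable_prodMk_right
    letI : MeasurableSpace (TangentBundle (𝓡 N) M) := borel _
    haveI : BorelSpace (TangentBundle (𝓡 N) M) := ⟨rfl⟩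
    exact h1 hW.measurableSet
  haveI : ProperSpace (TangentSpace (𝓡 N) x) := FiniteDimensional.proper ℝ _
  exact hm.stronglyMeasurable

theorem memLp_of_lintegral {X E : Type*} [MeasurableSpace X] [NormedAddCommGroup E] {ν : Measure X}
    {a : X → E} (ha : AEStronglyMeasurable a ν) {r : ℝ} (hr : 0 < r)
    (h : ∫⁻ x, ‖a x‖ₑ ^ r ∂ν ≠ ⊤) : MemLp a (ENNReal.ofReal r) ν := by
  refine ⟨ha, ?_⟩
  rw [eLpNorm_eq_lintegral_rpow_enorm_toReal (by simpa using hr) ENNReal.ofReal_ne_top,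
    ENNReal.toReal_ofReal hr.le]
  exact ENNReal.rpow_lt_top_of_nonneg (by positivity) h

/-- Continuity of the pairing under shifts in time of the coefficients. -/
theorem tendsto_integral_pairing_shift {E : Type*} [NormedAddCommGroup E] [InnerProductSpace ℝ E]
    (hp : 1 < p) {V W Z : ℝ → E} {s z : ℝ → ℝ} {T t₁ t₂ : ℝ} (ht₁ : 0 < t₁) (ht₂ : t₂ < T)
    (hV : StronglyMeasurable V) (hW : StronglyMeasurable W) (hZ : StronglyMeasurable Z)
    (hs : Measurable s) (hz : Measurable z) (hVp : ∫⁻ t in Ioo 0 T, ‖V t‖ₑ ^ p ≠ ⊤)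
    (hW2 : ∫⁻ t in Ioo 0 T, ‖W t‖ₑ ^ (2 : ℝ) ≠ ⊤)
    (hs2 : ∫⁻ t in Ioo 0 T, ‖truncation k (s t ^ q)‖ₑ ^ (2 : ℝ) ≠ ⊤)
    (hZp : ∫⁻ t in Ioo 0 T, ‖Z t‖ₑ ^ p ≠ ⊤) (hZ2 : ∫⁻ t in Ioo 0 T, ‖Z t‖ₑ ^ (2 : ℝ) ≠ ⊤)
    (hz2 : ∫⁻ t in Ioo 0 T, ‖z t‖ₑ ^ (2 : ℝ) ≠ ⊤) :
    Tendsto (fun σ => ∫ t in Ioc t₁ t₂,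
      pairing p q ε k (V (t - σ)) (W (t - σ)) (s (t - σ)) (z t) (Z t)) (𝓝[>] 0)
      (𝓝 (∫ t in Ioc t₁ t₂, pairing p q ε k (V t) (W t) (s t) (z t) (Z t))) := by
  have hp0 : 0 < p := by linarith
  have hpq : p.HolderConjugate (p / (p - 1)) := Real.HolderConjugate.conjExponent hp
  have h22 : (2 : ℝ).HolderConjugate 2 := Real.HolderConjugate.two_two
  have hVm : AEStronglyMeasurable (fun t => ‖V t‖ ^ (p - 2) • V t)
      (volume.restrict (Ioo 0 T)) :=
    ((hV.norm.measurable.pow_const (p - 2)).stronglyMeasurable.smul hV).aestronglyMeasurable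
  -- The flux |V|^(p-2) V lies in the conjugate space L^(p/(p-1)), which is what Hölder against Z in
  -- L^p requires.
  have e1 : ∀ v : E, ‖‖v‖ ^ (p - 2) • v‖ₑ ^ (p / (p - 1)) = ‖v‖ₑ ^ p := by
    intro v
    have : ‖‖v‖ ^ (p - 2) • v‖ = ‖v‖ ^ (p - 1) := by
      rw [norm_smul, Real.norm_of_nonneg (by positivity), norm_rpow_mul_norm hp]
    rw [← ofReal_norm, this, ofReal_rpow_norm (by linarith), ← ENNReal.rpow_mul,
      mul_div_cancel₀ _ (by linarith)]
  obtain ⟨i1, l1⟩ := tendsto_integral_inner_shift hpq ht₁ ht₂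
    (memLp_of_lintegral hVm hpq.symm.pos (by simpa only [e1] using hVp))
    (memLp_of_lintegral hZ.aestronglyMeasurable hp0 hZp)
  obtain ⟨i2, l2⟩ := tendsto_integral_inner_shift h22 ht₁ ht₂
    (memLp_of_lintegral hW.aestronglyMeasurable two_pos hW2)
    (memLp_of_lintegral hZ.aestronglyMeasurable two_pos hZ2)
  obtain ⟨i3, l3⟩ := tendsto_integral_inner_shift h22 ht₁ ht₂
    (memLp_of_lintegral ((measurable_truncation k).comp (hs.pow_const q)).aestronglyMeasurable
      two_pos hs2)
    (memLp_of_lintegral hz.aestronglyMeasurable two_pos hz2)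
  have key : ∀ σ, 0 ≤ σ → σ < t₁ → ∫ t in Ioc t₁ t₂,
      pairing p q ε k (V (t - σ)) (W (t - σ)) (s (t - σ)) (z t) (Z t) =
      (∫ t in Ioc t₁ t₂, (inner ℝ (‖V (t - σ)‖ ^ (p - 2) • V (t - σ)) (Z t) : ℝ)) +
      ε * (∫ t in Ioc t₁ t₂, (inner ℝ (W (t - σ)) (Z t) : ℝ)) -
      ∫ t in Ioc t₁ t₂, (inner ℝ ((truncation k ∘ fun t => s t ^ q) (t - σ)) (z t) : ℝ) := by
    intro σ h0 h1
    have h12 : IntegrableOn (fun t => (inner ℝ (‖V (t - σ)‖ ^ (p - 2) • V (t - σ)) (Z t) : ℝ) +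
        ε * inner ℝ (W (t - σ)) (Z t)) (Ioc t₁ t₂) := (i1 σ h0 h1).add ((i2 σ h0 h1).const_mul ε)
    rw [← integral_const_mul, ← integral_add (i1 σ h0 h1) ((i2 σ h0 h1).const_mul ε),
      ← integral_sub h12 (i3 σ h0 h1)]
    refine integral_congr_ae (Eventually.of_forall fun t => ?_)
    simp only [pairing, inner_smul_left, Function.comp_apply]
    simp [mul_comm]
  have key0 := key 0 le_rfl ht₁
  simp only [sub_zero] at key0
  rw [key0]
  refine ((l1.add (l2.const_mul ε)).sub l3).congr' ?_
  filter_upwards [Ioo_mem_nhdsGT ht₁] with σ hσ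
  exact (key σ hσ.1.le hσ.2).symm

end Fibre

/-! ### L² continuity of products and of the convex energy -/

section SquareIntegrable

variable {X : Type*} [MeasurableSpace X] {ν : Measure X}

theorem lintegral_add_three {a b : X → ℝ≥0∞} (c : X → ℝ≥0∞) (ha : Measurable a)
    (hb : Measurable b) :
    ∫⁻ x, (a x + b x + c x) ∂ν = ∫⁻ x, a x ∂ν + ∫⁻ x, b x ∂ν + ∫⁻ x, c x ∂ν := by
  have hab : Measurable fun x => a x + b x := ha.add hb
  rw [lintegral_add_left hab, lintegral_add_left ha]

theorem lintegral_enorm_mul_le {f g : X → ℝ} (hf : AEStronglyMeasurable f ν)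
    (hg : AEStronglyMeasurable g ν) :
    ∫⁻ x, ‖f x * g x‖ₑ ∂ν ≤ eLpNorm f 2 ν * eLpNorm g 2 ν := by
  have h1 := eLpNorm_le_eLpNorm_mul_eLpNorm_of_nnnorm (p := 2) (q := 2) (r := 1) hf hg
    (fun x y => x * y) 1 (Eventually.of_forall fun t => by rw [one_mul, nnnorm_mul])
  rwa [ENNReal.coe_one, one_mul, eLpNorm_one_eq_lintegral_enorm] at h1

theorem integrable_mul_of_memLp_two {f g : X → ℝ} (hf : MemLp f 2 ν) (hg : MemLp g 2 ν) :
    Integrable (fun x => f x * g x) ν :=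
  ⟨hf.1.mul hg.1, (lintegral_enorm_mul_le hf.1 hg.1).trans_lt (ENNReal.mul_lt_top hf.2 hg.2)⟩

theorem eLpNorm_two_eq (f : X → ℝ) : eLpNorm f 2 ν = (∫⁻ x, ‖f x‖ₑ ^ (2 : ℝ) ∂ν) ^ (1 / (2 : ℝ)) := by
  rw [eLpNorm_eq_lintegral_rpow_enorm_toReal (by norm_num) (by norm_num)]
  norm_num

theorem memLp_two_of_lintegral {f : X → ℝ} (hf : AEStronglyMeasurable f ν)
    (h : ∫⁻ x, ‖f x‖ₑ ^ (2 : ℝ) ∂ν ≠ ⊤) : MemLp f 2 ν := by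
  have := memLp_of_lintegral hf two_pos h
  simpa using this

theorem tendsto_integral_mul_of_lintegral {D z : X → ℝ} {v : ℕ → X → ℝ} (hD : MemLp D 2 ν)
    (hz : MemLp z 2 ν) (hv : ∀ j, Measurable (v j))
    (hlim : Tendsto (fun j => ∫⁻ x, ‖v j x - z x‖ₑ ^ (2 : ℝ) ∂ν) atTop (𝓝 0)) :
    Tendsto (fun j => ∫ x, D x * v j x ∂ν) atTop (𝓝 (∫ x, D x * z x ∂ν)) := by
  have h2 : Tendsto (fun j => eLpNorm (fun x => v j x - z x) 2 ν) atTop (𝓝 0) := by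
    have := ((ENNReal.continuous_rpow_const (y := 1 / (2 : ℝ))).tendsto 0).comp hlim
    rw [ENNReal.zero_rpow_of_pos (by norm_num)] at this
    exact this.congr fun j => (eLpNorm_two_eq _).symm
  have hd : ∀ j, AEStronglyMeasurable (fun x => v j x - z x) ν := fun j =>
    (hv j).aestronglyMeasurable.sub hz.1
  refine tendsto_integral_of_L1 _ (integrable_mul_of_memLp_two hD hz).1 ?_ ?_
  · have h3 := h2.eventually_lt_const (u := 1) one_pos
    filter_upwards [h3] with j hj
    have h4 : MemLp (v j) 2 ν := by
      have : MemLp (fun x => v j x - z x) 2 ν := ⟨hd j, hj.trans_le le_top⟩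
      convert this.add hz using 1
      ext x; simp
    exact integrable_mul_of_memLp_two hD h4
  · have h3 := ENNReal.Tendsto.const_mul (a := eLpNorm D 2 ν) h2 (Or.inr hD.2.ne)
    rw [mul_zero] at h3
    refine tendsto_of_tendsto_of_tendsto_of_le_of_le tendsto_const_nhds h3 (fun j => zero_le)
      fun j => ?_
    simp only [← mul_sub]
    exact lintegral_enorm_mul_le hD.1 (hd j)

variable {f : ℝ → ℝ}

theorem IsWeight.integrable_primitive_primitive (hf : IsWeight f) {w : X → ℝ} (hw : MemLp w 2 ν) :
    Integrable (fun x => primitive (primitive f) (w x)) ν := by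
  obtain ⟨C, hC0, hC⟩ := hf.exists_bound
  refine ((integrable_mul_of_memLp_two hw hw).const_mul C).mono'
    ((continuous_primitive hf.contDiff_primitive.continuous).comp_aestronglyMeasurable hw.1)
    (Eventually.of_forall fun x => ?_)
  rw [Real.norm_of_nonneg (hf.primitive_primitive_nonneg _), ← sq]
  exact hf.primitive_primitive_le hC _

/-- The second primitive satisfies |Φ(b) - Φ(a)| ≤ C(|a| + |b|)|b - a|, so it acts continuously from
L² to L¹ by Cauchy–Schwarz. -/
theorem IsWeight.tendsto_integral_primitive_primitive (hf : IsWeight f) {ι : Type*} {l : Filter ι}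
    {w : ι → X → ℝ} {w₀ : X → ℝ} (hw : ∀ᶠ i in l, MemLp (w i) 2 ν) (hw₀ : MemLp w₀ 2 ν)
    (hlim : Tendsto (fun i => eLpNorm (fun x => w i x - w₀ x) 2 ν) l (𝓝 0)) :
    Tendsto (fun i => ∫ x, primitive (primitive f) (w i x) ∂ν) l
      (𝓝 (∫ x, primitive (primitive f) (w₀ x) ∂ν)) := by
  obtain ⟨C, hC0, hC⟩ := hf.exists_bound
  refine tendsto_integral_of_L1 _ (hf.integrable_primitive_primitive hw₀).1
    (hw.mono fun i hi => hf.integrable_primitive_primitive hi) ?_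
  have h3 := ENNReal.Tendsto.const_mul (a := ENNReal.ofReal C) (ENNReal.Tendsto.mul
    (hlim.add_const (eLpNorm w₀ 2 ν + eLpNorm w₀ 2 ν)) (Or.inr (by simp)) hlim
    (Or.inr (by simpa using hw₀.2.ne))) (Or.inr ENNReal.ofReal_ne_top)
  rw [mul_zero, mul_zero] at h3
  refine tendsto_of_tendsto_of_tendsto_of_le_of_le' tendsto_const_nhds h3
    (Eventually.of_forall fun i => zero_le) ?_
  filter_upwards [hw] with i hi
  have hd : MemLp (fun x => w i x - w₀ x) 2 ν := hi.sub hw₀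
  calc ∫⁻ x, ‖primitive (primitive f) (w i x) - primitive (primitive f) (w₀ x)‖ₑ ∂ν
      ≤ ∫⁻ x, ENNReal.ofReal C * ‖(|w₀ x| + |w i x|) * (w i x - w₀ x)‖ₑ ∂ν := by
        refine lintegral_mono fun x => ?_
        rw [← ofReal_norm, ← ofReal_norm, ← ENNReal.ofReal_mul hC0.le]
        refine ENNReal.ofReal_le_ofReal ?_
        have := hf.abs_primitive_primitive_sub_le hC (w₀ x) (w i x)
        rw [Real.norm_eq_abs, norm_mul, Real.norm_eq_abs (w i x - w₀ x),
          Real.norm_of_nonneg (by positivity), ← mul_assoc]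
        exact this
    _ ≤ ENNReal.ofReal C * (eLpNorm (fun x => |w₀ x| + |w i x|) 2 ν *
          eLpNorm (fun x => w i x - w₀ x) 2 ν) := by
        rw [lintegral_const_mul' _ _ ENNReal.ofReal_ne_top]
        gcongr
        exact lintegral_enorm_mul_le (hw₀.1.norm.add hi.1.norm) hd.1
    _ ≤ _ := by
        gcongr
        calc eLpNorm (fun x => |w₀ x| + |w i x|) 2 ν
            ≤ eLpNorm (fun x => |w i x - w₀ x| + (|w₀ x| + |w₀ x|)) 2 ν := by
              refine eLpNorm_mono fun x => ?_
              rw [Real.norm_of_nonneg (by positivity), Real.norm_of_nonneg (by positivity)]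
              have := abs_add_le (w i x - w₀ x) (w₀ x)
              rw [sub_add_cancel] at this
              linarith
          _ ≤ eLpNorm (fun x => |w i x - w₀ x|) 2 ν + eLpNorm (fun x => |w₀ x| + |w₀ x|) 2 ν :=
              eLpNorm_add_le hd.1.norm (hw₀.1.norm.add hw₀.1.norm) (by norm_num)
          _ ≤ eLpNorm (fun x => |w i x - w₀ x|) 2 ν +
                (eLpNorm (fun x => |w₀ x|) 2 ν + eLpNorm (fun x => |w₀ x|) 2 ν) := by
              gcongr
              exact eLpNorm_add_le hw₀.1.norm hw₀.1.norm (by norm_num)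
          _ = _ := by
              simp only [← Real.norm_eq_abs]
              rw [eLpNorm_norm, eLpNorm_norm]

end SquareIntegrable

/-! ### Testing increments of the solution with frozen functions -/

section WeakEvolution

/-- A solution `u`, continuous in `L^2`, with a bounded representative `U`, in the form of the
evolution of the integrals against test functions. -/
structure IsWeakEvolution (p m q ε k K : ℝ) (B : Set M) (U : ℝ → M → ℝ)
    (GU GV : ℝ → ∀ x : M, TangentSpace (𝓡 N) x) (u : ℝ → M → ℝ) : Prop
    extends IsEvolution p m K B U GU GV where
  memLp : ∀ t, 0 ≤ t → MemLp (u t) 2 ((riemannianMeasure N M).restrict B)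
  tendsto : ∀ t₀, 0 ≤ t₀ → Tendsto (fun t => eLpNorm (fun x => u t x - u t₀ x) 2
    ((riemannianMeasure N M).restrict B)) (𝓝[Ici 0] t₀) (𝓝 0)
  ae_eq : ∀ᵐ t, 0 < t → U t =ᵐ[(riemannianMeasure N M).restrict B] u t
  increment : ∀ v, IsTestFunction N B v → ∀ t₁ t₂, 0 ≤ t₁ → t₁ ≤ t₂ →
    ∫ x in B, (u t₂ x - u t₁ x) * v x ∂(riemannianMeasure N M) =
      -∫ t in Ioc t₁ t₂, (∫ x in B, pairing p q ε k (GV t x) (GU t x) (U t x) (v x)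
        (grad (N := N) v x) ∂(riemannianMeasure N M))

variable {p m q ε k K : ℝ} {B : Set M} {U : ℝ → M → ℝ} {GU GV : ℝ → ∀ x : M, TangentSpace (𝓡 N) x}
  {u : ℝ → M → ℝ} {f : ℝ → ℝ}

theorem IsSlice.lintegral_weight_ne_top (hp : 1 < p) (hm : 1 < m) (hB : MeasurableSet B)
    (hf : IsWeight f) {w : M → ℝ} {GU GV : ∀ x : M, TangentSpace (𝓡 N) x}
    (h : IsSlice p m B w GU GV) :
    ∫⁻ x in B, ‖f (w x) • GU x‖ₑ ^ p ∂(riemannianMeasure N M) ≠ ⊤ ∧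
    ∫⁻ x in B, ‖f (w x) • GU x‖ₑ ^ (2 : ℝ) ∂(riemannianMeasure N M) ≠ ⊤ ∧
    ∫⁻ x in B, ‖primitive f (w x)‖ₑ ^ (2 : ℝ) ∂(riemannianMeasure N M) ≠ ⊤ := by
  obtain ⟨C, hC, hle⟩ := exists_lintegral_weight_le (N := N) (M := M) hp hm hB hf
  have h1 := hle w GU GV h
  have hGV : Measurable fun x => ‖GV x‖ₑ ^ p := (measurable_enorm_along h.measurableGV).pow_const p
  have hGU : Measurable fun x => ‖GU x‖ₑ ^ (2 : ℝ) := h.measurable_enorm_GU.pow_const 2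
  have hfin : ∫⁻ x in B, (‖GV x‖ₑ ^ p + ‖GU x‖ₑ ^ (2 : ℝ) + ‖w x‖ₑ ^ (2 : ℝ))
      ∂(riemannianMeasure N M) ≠ ⊤ := by
    rw [lintegral_add_three _ hGV hGU]
    exact ENNReal.add_ne_top.2 ⟨ENNReal.add_ne_top.2 ⟨h.lintegralGV, h.lintegralGU⟩, h.lintegralU⟩
  have h2 := ne_top_of_le_ne_top (ENNReal.mul_ne_top hC hfin) h1
  have m1 := (h.measurable_enorm_smul hf).pow_const p
  have m2 := (h.measurable_enorm_smul hf).pow_const (2 : ℝ)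
  rw [lintegral_add_three _ m1 m2] at h2
  simp only [ENNReal.add_ne_top] at h2
  exact ⟨h2.1.1, h2.1.2, h2.2⟩

theorem IsSlice.isTestPair {w : M → ℝ} {GU GV : ∀ x : M, TangentSpace (𝓡 N) x}
    (h : IsSlice p m B w GU GV) (hf : IsWeight f) :
    IsTestPair N (fun x => primitive f (w x)) (fun x => f (w x) • GU x) :=
  isTestPair_smul (hf.contDiff_primitive.continuous.measurable.comp h.measurable)
    (hf.continuous.measurable.comp h.measurable) h.measurableGU

/-- Both functions are continuous with compact support, and the Riemannian measure is locally
finite. -/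
theorem IsTestFunction.lintegral_rpow_ne_top {v : M → ℝ} (hv : IsTestFunction N B v) {a : ℝ}
    (ha : 0 < a) : ∫⁻ x in B, ‖v x‖ₑ ^ a ∂(riemannianMeasure N M) ≠ ⊤ ∧
      ∫⁻ x in B, ‖grad (N := N) v x‖ₑ ^ a ∂(riemannianMeasure N M) ≠ ⊤ := by
  have key : ∀ g : M → ℝ, Continuous g → (∀ x ∉ tsupport v, g x = 0) →
      ∫⁻ x in B, ‖g x‖ₑ ^ a ∂(riemannianMeasure N M) ≠ ⊤ := by
    intro g hg hg0
    have hc : HasCompactSupport fun x => |g x| ^ a :=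
      HasCompactSupport.intro hv.2.1 fun x hx => by rw [hg0 x hx, abs_zero, Real.zero_rpow ha.ne']
    have hi : Integrable (fun x => |g x| ^ a) (riemannianMeasure N M) :=
      (hg.abs.rpow_const fun x => Or.inr ha.le).integrable_of_hasCompactSupport hc
    refine ne_top_of_le_ne_top hi.2.ne ((lintegral_mono' Measure.restrict_le_self le_rfl).trans
      (lintegral_mono fun x => ?_))
    rw [Real.enorm_rpow_of_nonneg (abs_nonneg _) ha.le, Real.enorm_abs]
  refine ⟨key v hv.1.continuous fun x hx => image_eq_zero_of_notMem_tsupport hx, ?_⟩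
  have h1 := key _ (continuous_norm_grad hv.1)
    fun x hx => by rw [grad_eq_zero_of_notMem_tsupport hx, norm_zero]
  simpa only [enorm_norm] using h1

/-- The slice w does not depend on time, so approximation by spatial test functions suffices, and no
regularity of the solution in time is required of the test function. -/
theorem IsWeakEvolution.integral_mul_primitive
    (h : IsWeakEvolution p m q ε k K B U GU GV u) (hp : 1 < p) (hm : 1 < m) (hq : 1 < q)
    (hε : 0 < ε) (hk : 0 < k) (hB : MeasurableSet B) (hf : IsWeight f) {w : M → ℝ}
    {Gw Gv : ∀ x : M, TangentSpace (𝓡 N) x} (hw : IsSlice p m B w Gw Gv) {t₁ t₂ : ℝ}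
    (ht₁ : 0 ≤ t₁) (ht : t₁ ≤ t₂) :
    ∫ x in B, (u t₂ x - u t₁ x) * primitive f (w x) ∂(riemannianMeasure N M) =
      -∫ t in Ioc t₁ t₂, (∫ x in B, pairing p q ε k (GV t x) (GU t x) (U t x) (primitive f (w x))
        (f (w x) • Gw x) ∂(riemannianMeasure N M)) := by
  set ν := (riemannianMeasure N M).restrict B
  obtain ⟨v, hv, hva⟩ := hw.exists_approx hp.le hm hB hf
  obtain ⟨v2, g2⟩ := hva 2 (Or.inl rfl)
  obtain ⟨vp, gp⟩ := hva p (Or.inr rfl)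
  obtain ⟨np, n2, nF⟩ := hw.lintegral_weight_ne_top hp hm hB hf
  have hD : MemLp (fun x => u t₂ x - u t₁ x) 2 ν := (h.memLp t₂ (ht₁.trans ht)).sub (h.memLp t₁ ht₁)
  have hFm : Measurable fun x => primitive f (w x) :=
    hf.contDiff_primitive.continuous.measurable.comp hw.measurable
  have hfm : Measurable fun x => f (w x) := hf.continuous.measurable.comp hw.measurable
  have hF : MemLp (fun x => primitive f (w x)) 2 ν :=
    memLp_two_of_lintegral hFm.aestronglyMeasurable nF
  have hL := tendsto_integral_mul_of_lintegral hD hF (fun j => (hv j).measurable) v2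
  have hL := hL.congr fun j => h.increment _ (hv j) t₁ t₂ ht₁ ht
  refine tendsto_nhds_unique hL (Tendsto.neg ?_)
  set lam : Measure ℝ := volume.restrict (Ioc t₁ t₂)
  -- Integrability is available on open intervals (0, T); the margin 1 keeps the endpoint t₂ inside.
  have hlam : lam.prod ν ≤ (volume.restrict (Ioo 0 (t₂ + 1))).prod ν :=
    Measure.prod_mono (Measure.restrict_mono_set _
      fun t ht' => ⟨ht₁.trans_lt ht'.1, by linarith [ht'.2]⟩) le_rfl
  have hI0 := (h.integrable_pairing hp hq hε hk (hw.isTestPair hf) np n2 nF (t₂ + 1)).mono_measure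
    hlam
  have hIj := fun j => (h.integrable_pairing hp hq hε hk (hv j).isTestPair
    ((hv j).lintegral_rpow_ne_top (by linarith)).2 ((hv j).lintegral_rpow_ne_top two_pos).2
    ((hv j).lintegral_rpow_ne_top two_pos).1 (t₂ + 1)).mono_measure hlam
  have hlim := h.tendsto_integral_pairing (q := q) (ε := ε) (k := k) hp hq hε hk
    (fun j => (hv j).isTestPair_sub hFm hfm hw.measurableGU) gp g2 v2 (t₂ + 1)
  have := tendsto_integral_of_L1 _ hI0.1 (Eventually.of_forall hIj)
    (tendsto_of_tendsto_of_tendsto_of_le_of_le tendsto_const_nhds hlim (fun j => zero_le)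
      fun j => by
        refine (lintegral_mono' hlam le_rfl).trans (le_of_eq ?_)
        exact lintegral_prod _ (((h.measurable_pairing q ε k (hv j).isTestPair).sub
          (h.measurable_pairing q ε k (hw.isTestPair hf))).enorm).aemeasurable)
  rw [integral_prod _ hI0] at this
  refine this.congr fun j => ?_
  rw [integral_prod _ (hIj j)]

end WeakEvolution

section Slices

variable {α X : Type*} [MeasurableSpace α] [MeasurableSpace X] {lam : Measure α} {ν : Measure X}

theorem lintegral_swap_of_measurable [SFinite lam] [SFinite ν] {g : α → X → ℝ≥0∞}
    (hg : Measurable fun z : α × X => g z.1 z.2) :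
    ∫⁻ x, (∫⁻ t, g t x ∂lam) ∂ν = ∫⁻ t, (∫⁻ x, g t x ∂ν) ∂lam :=
  lintegral_lintegral_swap (hg.comp measurable_swap).aemeasurable

theorem measurable_lintegral_fst [SFinite lam] {g : α → X → ℝ≥0∞}
    (hg : Measurable fun z : α × X => g z.1 z.2) : Measurable fun x => ∫⁻ t, g t x ∂lam :=
  Measurable.lintegral_prod_left' (f := fun z : α × X => g z.1 z.2) hg

theorem measurable_fst_slice {β : Type*} [MeasurableSpace β] {g : α → X → β}
    (hg : Measurable fun z : α × X => g z.1 z.2) (x : X) : Measurable fun t => g t x :=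
  hg.comp (f := fun t => (t, x)) measurable_prodMk_right

end Slices

/-! ### The energy inequality with a weight -/

section EnergyInequality

variable {p m q ε k K : ℝ} {B : Set M} {U : ℝ → M → ℝ} {GU GV : ℝ → ∀ x : M, TangentSpace (𝓡 N) x}
  {u : ℝ → M → ℝ} {f : ℝ → ℝ}

variable (N) in
/-- The integral over `B` of `Φ(u(t))`, `Φ'' = f`, extended by its value at `0` to negative times. -/
def weightEnergy (f : ℝ → ℝ) (B : Set M) (u : ℝ → M → ℝ) (t : ℝ) : ℝ :=
  ∫ x in B, primitive (primitive f) (u (max t 0) x) ∂(riemannianMeasure N M)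

theorem IsWeakEvolution.continuous_weightEnergy (h : IsWeakEvolution p m q ε k K B U GU GV u)
    (hf : IsWeight f) : Continuous (weightEnergy N f B u) := by
  refine continuous_iff_continuousAt.2 fun t₀ => ?_
  have hmax : Tendsto (fun t : ℝ => max t 0) (𝓝 t₀) (𝓝[Ici 0] (max t₀ 0)) :=
    tendsto_nhdsWithin_of_tendsto_nhds_of_eventually_within _
      ((continuous_id.max continuous_const).tendsto t₀)
      (Eventually.of_forall fun t => mem_Ici.2 (le_max_right _ _))
  exact hf.tendsto_integral_primitive_primitive
    (Eventually.of_forall fun t => h.memLp _ (le_max_right _ _)) (h.memLp _ (le_max_right _ _))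
    ((h.tendsto _ (le_max_right _ _)).comp hmax)

/-- Convexity replaces the chain rule in time: the increment of Φ(u) is at most F at the later value
times the increment of u. The latter is then tested with F of the slice frozen at the later time. -/
theorem IsWeakEvolution.weightEnergy_sub_le (h : IsWeakEvolution p m q ε k K B U GU GV u)
    (hp : 1 < p) (hm : 1 < m) (hq : 1 < q) (hε : 0 < ε) (hk : 0 < k) (hB : MeasurableSet B)
    (hf : IsWeight f) {t : ℝ} (hs : IsSlice p m B (U t) (GU t) (GV t))
    (hU : U t =ᵐ[(riemannianMeasure N M).restrict B] u t) {d : ℝ} (hd : 0 < d) (hdt : d < t) :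
    weightEnergy N f B u t - weightEnergy N f B u (t - d) ≤
      -∫ τ in Ioc (t - d) t, (∫ x in B, pairing p q ε k (GV τ x) (GU τ x) (U τ x)
        (primitive f (U t x)) (f (U t x) • GU t x) ∂(riemannianMeasure N M)) := by
  rw [← h.integral_mul_primitive hp hm hq hε hk hB hf hs (by linarith) (by linarith), weightEnergy,
    weightEnergy, max_eq_left (by linarith), max_eq_left (by linarith)]
  have i1 := hf.integrable_primitive_primitive (h.memLp t (by linarith))
  have i2 := hf.integrable_primitive_primitive (h.memLp (t - d) (by linarith))
  obtain ⟨-, -, nF⟩ := hs.lintegral_weight_ne_top hp hm hB hf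
  have hFm : Measurable fun x => primitive f (U t x) :=
    hf.contDiff_primitive.continuous.measurable.comp hs.measurable
  rw [← integral_sub i1 i2]
  refine integral_mono_ae (i1.sub i2) (integrable_mul_of_memLp_two
    ((h.memLp t (by linarith)).sub (h.memLp (t - d) (by linarith)))
    (memLp_two_of_lintegral hFm.aestronglyMeasurable nF)) ?_
  filter_upwards [hU] with x hx
  rw [hx, mul_comm]
  exact hf.primitive_primitive_sub_le _ _

theorem IsEvolution.measurable_pairing_weight (h : IsEvolution p m K B U GU GV) (q ε k : ℝ)
    (hf : IsWeight f) : Measurable fun z : ℝ × ℝ × M =>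
      pairing p q ε k (GV z.1 z.2.2) (GU z.1 z.2.2) (U z.1 z.2.2) (primitive f (U z.2.1 z.2.2))
        (f (U z.2.1 z.2.2) • GU z.2.1 z.2.2) := by
  have m1 : Measurable fun z : ℝ × ℝ × M => (z.1, z.2.2) := by fun_prop
  have m2 : Measurable fun z : ℝ × ℝ × M => z.2 := by fun_prop
  have gV1 := h.measurableGV.comp m1
  have gU1 := h.measurableGU.comp m1
  have gU2 := h.measurableGU.comp m2
  have u1 : Measurable fun z : ℝ × ℝ × M => U z.1 z.2.2 := h.measurable.comp m1
  have u2 : Measurable fun z : ℝ × ℝ × M => U z.2.1 z.2.2 := h.measurable.comp m2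
  have hfu : Measurable fun z : ℝ × ℝ × M => f (U z.2.1 z.2.2) := hf.continuous.measurable.comp u2
  have hFu : Measurable fun z : ℝ × ℝ × M => primitive f (U z.2.1 z.2.2) :=
    hf.contDiff_primitive.continuous.measurable.comp u2
  have n1 := measurable_norm_along gV1
  have j1 := measurable_inner_along gV1 gU2
  have j2 := measurable_inner_along gU1 gU2
  simp only [pairing, inner_smul_right]
  exact (((n1.pow_const _).mul (hfu.mul j1)).add ((hfu.mul j2).const_mul ε)).sub
    (((measurable_truncation k).comp (u1.pow_const q)).mul hFu)

/-- The norms of the composition of a solution with a weight and its primitive. -/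
def weightDensity (p : ℝ) (f : ℝ → ℝ) (U : ℝ → M → ℝ) (GU : ℝ → ∀ x : M, TangentSpace (𝓡 N) x)
    (t : ℝ) (x : M) : ℝ≥0∞ :=
  ‖f (U t x) • GU t x‖ₑ ^ p + (‖f (U t x) • GU t x‖ₑ ^ (2 : ℝ) +
    ‖primitive f (U t x)‖ₑ ^ (2 : ℝ))

theorem IsEvolution.measurable_weightDensity (h : IsEvolution p m K B U GU GV) (hf : IsWeight f) :
    Measurable fun z : ℝ × M => weightDensity p f U GU z.1 z.2 := by
  have hfu : Measurable fun z : ℝ × M => f (U z.1 z.2) := hf.continuous.measurable.comp h.measurable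
  have hFu : Measurable fun z : ℝ × M => primitive f (U z.1 z.2) :=
    hf.contDiff_primitive.continuous.measurable.comp h.measurable
  have hG := measurable_enorm_along h.measurableGU
  simp only [weightDensity, enorm_smul]
  exact ((hfu.enorm.mul hG).pow_const p).add
    (((hfu.enorm.mul hG).pow_const 2).add (hFu.enorm.pow_const 2))

theorem IsEvolution.lintegral_weightDensity_ne_top (h : IsEvolution p m K B U GU GV) (hp : 1 < p)
    (hm : 1 < m) (hB : MeasurableSet B) (hf : IsWeight f) (T : ℝ) :
    ∫⁻ t in Ioo 0 T, (∫⁻ x in B, weightDensity p f U GU t x ∂(riemannianMeasure N M)) ≠ ⊤ := by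
  obtain ⟨C, hC, hle⟩ := exists_lintegral_weight_le (N := N) (M := M) hp hm hB hf
  have h1 : ∫⁻ t in Ioo 0 T, (∫⁻ x in B, weightDensity p f U GU t x ∂(riemannianMeasure N M)) ≤
      ∫⁻ t in Ioo 0 T, C * (∫⁻ x in B, normDensity p U GU GV t x ∂(riemannianMeasure N M)) := by
    refine lintegral_mono_ae ((ae_restrict_iff' measurableSet_Ioo).2 ?_)
    filter_upwards [h.isSlice] with t ht ht0
    simp only [weightDensity, ← add_assoc]
    exact hle _ _ _ (ht ht0.1)
  rw [lintegral_const_mul' _ _ hC] at h1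
  exact ne_top_of_le_ne_top (ENNReal.mul_ne_top hC (h.lintegral_ne_top T)) h1

/-- The two times appear in separate summands, so the majorant of a time shift can be integrated by
translating one summand alone. -/
theorem IsEvolution.enorm_pairing_weight_le (h : IsEvolution p m K B U GU GV) (hp : 1 < p)
    (hq : 1 < q) (hε : 0 < ε) (hk : 0 < k) (f : ℝ → ℝ) (τ s : ℝ) (x : M) :
    ‖pairing p q ε k (GV τ x) (GU τ x) (U τ x) (primitive f (U s x)) (f (U s x) • GU s x)‖ₑ ≤
      ENNReal.ofReal (1 + ε + K ^ (q - 1)) * normDensity p U GU GV τ x +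
        ENNReal.ofReal (1 + ε + K ^ (q - 1)) * weightDensity p f U GU s x := by
  have := enorm_pairing_le hp hq hε hk one_pos (GV τ x) (GU τ x) (h.nonneg τ x) (h.le τ x)
    (primitive f (U s x)) (f (U s x) • GU s x)
  rw [inv_one, Real.one_rpow, Real.one_rpow, ENNReal.ofReal_one, one_mul, one_mul, one_mul,
    mul_add] at this
  exact this

theorem IsEvolution.tendsto_integral_pairing_weight_of_lintegral (h : IsEvolution p m K B U GU GV)
    (hp : 1 < p) (hq : 1 < q) (ε : ℝ) (hk : 0 < k) (hf : IsWeight f) {T t₁ t₂ : ℝ} (ht₁ : 0 < t₁)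
    (ht₂ : t₂ < T) (x : M) (h1 : ∫⁻ t in Ioo 0 T, normDensity p U GU GV t x < ⊤)
    (h2 : ∫⁻ t in Ioo 0 T, weightDensity p f U GU t x < ⊤) :
    Tendsto (fun σ => ∫ t in Ioc t₁ t₂,
      pairing p q ε k (GV (t - σ) x) (GU (t - σ) x) (U (t - σ) x) (primitive f (U t x))
        (f (U t x) • GU t x)) (𝓝[>] 0)
      (𝓝 (∫ t in Ioc t₁ t₂, pairing p q ε k (GV t x) (GU t x) (U t x) (primitive f (U t x))
        (f (U t x) • GU t x))) := by
  have hUx : Measurable fun t => U t x := measurable_fst_slice h.measurable x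
  have hVs := stronglyMeasurable_fibre h.measurableGV x
  have hWs := stronglyMeasurable_fibre h.measurableGU x
  have hfU : Measurable fun t => f (U t x) := hf.continuous.measurable.comp hUx
  have hFU : Measurable fun t => primitive f (U t x) :=
    hf.contDiff_primitive.continuous.measurable.comp hUx
  have mono : ∀ {a b : ℝ → ℝ≥0∞}, ∫⁻ t in Ioo 0 T, b t < ⊤ → (∀ t, a t ≤ b t) →
      ∫⁻ t in Ioo 0 T, a t ≠ ⊤ := fun hb hab => ((lintegral_mono hab).trans_lt hb).ne
  have hK2 : ENNReal.ofReal (K ^ (q - 1)) ^ (2 : ℝ) ≠ ⊤ := by finiteness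
  have h3 : ∫⁻ t in Ioo 0 T, ENNReal.ofReal (K ^ (q - 1)) ^ (2 : ℝ) * normDensity p U GU GV t x < ⊤ := by
    rw [lintegral_const_mul' _ _ hK2]
    exact ENNReal.mul_lt_top hK2.lt_top h1
  have f1 : ∫⁻ t in Ioo 0 T, ‖GV t x‖ₑ ^ p ≠ ⊤ := mono h1 fun t => by
    rw [normDensity, add_assoc]; exact le_self_add
  have f2 : ∫⁻ t in Ioo 0 T, ‖GU t x‖ₑ ^ (2 : ℝ) ≠ ⊤ := mono h1 fun t => by
    rw [normDensity]; exact le_self_add.trans' le_add_self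
  have f3 : ∫⁻ t in Ioo 0 T, ‖truncation k (U t x ^ q)‖ₑ ^ (2 : ℝ) ≠ ⊤ := mono h3 fun t => by
    have hUn : ‖U t x‖ₑ ^ (2 : ℝ) ≤ normDensity p U GU GV t x := le_add_self
    refine le_trans ?_ (mul_le_mul_right hUn _)
    rw [← ENNReal.mul_rpow_of_nonneg _ _ (by norm_num)]
    refine ENNReal.rpow_le_rpow ?_ (by norm_num)
    have hK : 0 ≤ K := (h.nonneg t x).trans (h.le t x)
    rw [← ofReal_norm, ← ofReal_norm, ← ENNReal.ofReal_mul (by positivity)]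
    refine ENNReal.ofReal_le_ofReal ?_
    rw [Real.norm_of_nonneg (h.nonneg t x)]
    exact abs_truncation_rpow_le hk hq (h.nonneg t x) (h.le t x)
  have f4 : ∫⁻ t in Ioo 0 T, ‖f (U t x) • GU t x‖ₑ ^ p ≠ ⊤ := mono h2 fun t => by
    rw [weightDensity]; exact le_self_add
  have f5 : ∫⁻ t in Ioo 0 T, ‖f (U t x) • GU t x‖ₑ ^ (2 : ℝ) ≠ ⊤ := mono h2 fun t => by
    rw [weightDensity]; exact le_add_self.trans' le_self_add
  have f6 : ∫⁻ t in Ioo 0 T, ‖primitive f (U t x)‖ₑ ^ (2 : ℝ) ≠ ⊤ := mono h2 fun t => by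
    rw [weightDensity]; exact le_add_self.trans' le_add_self
  exact tendsto_integral_pairing_shift (E := TangentSpace (𝓡 N) x) (V := fun t => GV t x)
    (W := fun t => GU t x) (Z := fun t => f (U t x) • GU t x) (s := fun t => U t x)
    (z := fun t => primitive f (U t x)) hp ht₁ ht₂ hVs hWs (hfU.stronglyMeasurable.smul hWs) hUx hFU
    f1 f2 f3 f4 f5 f6

/-- By Tonelli, the norms integrable over space-time are integrable in time for almost every x; for
such x the statement in the fibre applies. -/
theorem IsEvolution.tendsto_integral_pairing_weight (h : IsEvolution p m K B U GU GV) (hp : 1 < p)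
    (hm : 1 < m) (hq : 1 < q) (ε : ℝ) (hk : 0 < k) (hB : MeasurableSet B) (hf : IsWeight f)
    {T t₁ t₂ : ℝ} (ht₁ : 0 < t₁) (ht₂ : t₂ < T) :
    ∀ᵐ x ∂((riemannianMeasure N M).restrict B), Tendsto (fun σ => ∫ t in Ioc t₁ t₂,
      pairing p q ε k (GV (t - σ) x) (GU (t - σ) x) (U (t - σ) x) (primitive f (U t x))
        (f (U t x) • GU t x)) (𝓝[>] 0)
      (𝓝 (∫ t in Ioc t₁ t₂, pairing p q ε k (GV t x) (GU t x) (U t x) (primitive f (U t x))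
        (f (U t x) • GU t x))) := by
  have hn := h.measurable_norms
  have hw := h.measurable_weightDensity hf
  have hnT : ∫⁻ x in B, (∫⁻ t in Ioo 0 T, normDensity p U GU GV t x) ∂(riemannianMeasure N M) ≠ ⊤ := by
    rw [lintegral_swap_of_measurable hn]
    exact h.lintegral_ne_top T
  have hwT : ∫⁻ x in B, (∫⁻ t in Ioo 0 T, weightDensity p f U GU t x) ∂(riemannianMeasure N M) ≠ ⊤ := by
    rw [lintegral_swap_of_measurable hw]
    exact h.lintegral_weightDensity_ne_top hp hm hB hf T
  filter_upwards [ae_lt_top (measurable_lintegral_fst hn) hnT,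
    ae_lt_top (measurable_lintegral_fst hw) hwT] with x h1 h2
  exact h.tendsto_integral_pairing_weight_of_lintegral hp hq ε hk hf ht₁ ht₂ x h1 h2

/-- With V = m s^(m-1) W the p-Laplacian term is exactly the left side. The viscous term is
non-negative and is dropped, and the truncated source is at most s^q. At s = 0 the weight vanishes,
so no relation between V and W is needed there. -/
theorem le_pairing_weight {E : Type*} [NormedAddCommGroup E] [InnerProductSpace ℝ E] (hp : 1 < p)
    (hm : 1 < m) (hε : 0 < ε) (hk : 0 < k) (hf : IsWeight f) {V W : E} {s : ℝ} (hs : 0 ≤ s)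
    (hV : 0 < s → V = (m * s ^ (m - 1)) • W) :
    f s * (m ^ (p - 1) * s ^ ((m - 1) * (p - 1))) * ‖W‖ ^ p ≤
      pairing p q ε k V W s (primitive f s) (f s • W) + s ^ q * primitive f s := by
  obtain ⟨δ, L, hδ, -, hfδ, -⟩ := hf.exists_support
  have hT : truncation k (s ^ q) * primitive f s ≤ s ^ q * primitive f s :=
    mul_le_mul_of_nonneg_right ((le_abs_self _).trans (abs_truncation_le hk (by positivity)))
      (hf.primitive_nonneg s)
  have hε2 : 0 ≤ ε * (f s * ‖W‖ ^ 2) := mul_nonneg hε.le (mul_nonneg (hf.nonneg _) (sq_nonneg _))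
  have hmain : f s * (m ^ (p - 1) * s ^ ((m - 1) * (p - 1))) * ‖W‖ ^ p =
      ‖V‖ ^ (p - 2) * inner ℝ V (f s • W) := by
    rcases hs.eq_or_lt with h | h
    · rw [← h, hfδ 0 hδ.le]; simp
    · set c := m * s ^ (m - 1)
      have hm0 : 0 < m := by linarith
      have hc : 0 < c := by positivity
      have hcp : m ^ (p - 1) * s ^ ((m - 1) * (p - 1)) = c ^ (p - 1) := by
        rw [Real.mul_rpow (by linarith) (by positivity), ← Real.rpow_mul hs]
      have e1 : ‖V‖ ^ (p - 2) * inner ℝ V (f s • W) =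
          f s * (c ^ (p - 2) * c) * (‖W‖ ^ (p - 2) * ‖W‖ * ‖W‖) := by
        rw [hV h, norm_smul, Real.norm_of_nonneg hc.le, Real.mul_rpow hc.le (norm_nonneg _),
          inner_smul_left, inner_smul_right, real_inner_self_eq_norm_sq]
        simp only [conj_trivial]
        ring
      have e2 : ‖W‖ ^ (p - 1) * ‖W‖ = ‖W‖ ^ p := by
        rcases (norm_nonneg W).eq_or_lt with h | h
        · rw [← h, mul_zero, Real.zero_rpow (by linarith)]
        · rw [← Real.rpow_add_one h.ne']; ring_nf
      have e3 : c ^ (p - 2) * c = c ^ (p - 1) := by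
        rw [← Real.rpow_add_one hc.ne']; ring_nf
      rw [hcp, e1, norm_rpow_mul_norm hp, e2, e3]
  have hin : inner ℝ W (f s • W) = f s * ‖W‖ ^ 2 := by
    rw [inner_smul_right, real_inner_self_eq_norm_sq]
  rw [hmain, pairing, hin]
  linarith

/-- The energy inequality with a weight. -/
theorem IsWeakEvolution.weightEnergy_add_le (h : IsWeakEvolution p m q ε k K B U GU GV u)
    (hp : 1 < p) (hm : 1 < m) (hq : 1 < q) (hε : 0 < ε) (hk : 0 < k) (hB : MeasurableSet B)
    (hf : IsWeight f) {t₁ t₂ : ℝ} (ht₁ : 0 < t₁) (ht : t₁ ≤ t₂) :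
    ENNReal.ofReal (weightEnergy N f B u t₂) + ∫⁻ t in Ioc t₁ t₂, (∫⁻ x in B,
      ENNReal.ofReal (f (U t x) * (m ^ (p - 1) * U t x ^ ((m - 1) * (p - 1))) * ‖GU t x‖ ^ p)
        ∂(riemannianMeasure N M)) ≤
    ENNReal.ofReal (weightEnergy N f B u t₁) + ∫⁻ t in Ioc t₁ t₂, (∫⁻ x in B,
      ENNReal.ofReal (U t x ^ q * primitive f (U t x)) ∂(riemannianMeasure N M)) := by
  set ν := (riemannianMeasure N M).restrict B
  set P : ℝ → ℝ → M → ℝ := fun τ s x => pairing p q ε k (GV τ x) (GU τ x) (U τ x)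
    (primitive f (U s x)) (f (U s x) • GU s x) with hP
  set c := ENNReal.ofReal (1 + ε + K ^ (q - 1))
  have hPm : Measurable fun z : ℝ × ℝ × M => P z.1 z.2.1 z.2.2 :=
    h.measurable_pairing_weight q ε k hf
  set Q₁ : ℝ → M → ℝ≥0∞ := fun t x => c * normDensity p U GU GV t x
  set Q₂ : ℝ → M → ℝ≥0∞ := fun t x => c * weightDensity p f U GU t x
  have hQ₁ : Measurable fun z : ℝ × M => Q₁ z.1 z.2 := h.measurable_norms.const_mul c
  have hQ₂ : Measurable fun z : ℝ × M => Q₂ z.1 z.2 := (h.measurable_weightDensity hf).const_mul c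
  have hle : ∀ τ s x, ‖P τ s x‖ₑ ≤ Q₁ τ x + Q₂ s x := h.enorm_pairing_weight_le hp hq hε hk f
  have hQ₁T : ∫⁻ t in Ioo 0 (t₂ + 1), (∫⁻ x, Q₁ t x ∂ν) ≠ ⊤ := by
    have hc : c ≠ ⊤ := ENNReal.ofReal_ne_top
    simp only [Q₁]
    simp_rw [lintegral_const_mul' _ _ hc]
    exact ENNReal.mul_ne_top ENNReal.ofReal_ne_top (h.lintegral_ne_top _)
  have hQ₂T : ∫⁻ t in Ioo 0 (t₂ + 1), (∫⁻ x, Q₂ t x ∂ν) ≠ ⊤ := by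
    have hc : c ≠ ⊤ := ENNReal.ofReal_ne_top
    simp only [Q₂]
    simp_rw [lintegral_const_mul' _ _ hc]
    exact ENNReal.mul_ne_top ENNReal.ofReal_ne_top (h.lintegral_weightDensity_ne_top hp hm hB hf _)
  have hmain := energy_le_of_increment_le (ν := ν) hPm hQ₁ hQ₂ hle (T := t₂ + 1)
    (by rw [lintegral_swap_of_measurable hQ₁]; exact hQ₁T)
    (by rw [lintegral_swap_of_measurable hQ₂]; exact hQ₂T)
    ht₁ ht (by linarith)
    (h.tendsto_integral_pairing_weight hp hm hq ε hk hB hf ht₁ (lt_add_one t₂))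
    (h.continuous_weightEnergy hf) (by
      filter_upwards [h.isSlice, h.ae_eq] with t hs hu ht' d hd hdt
      have ht0 : 0 < t := ht₁.trans ht'.1
      exact h.weightEnergy_sub_le hp hm hq hε hk hB hf (hs ht0) (hu ht0) hd hdt)
  set lam : Measure ℝ := volume.restrict (Ioc t₁ t₂)
  have hsub : Ioc t₁ t₂ ⊆ Ioo 0 (t₂ + 1) := fun t h => ⟨ht₁.trans h.1, by linarith [h.2]⟩
  have hlam : lam ≤ volume.restrict (Ioo 0 (t₂ + 1)) := Measure.restrict_mono_set _ hsub
  have hPd : Measurable fun z : ℝ × M => P z.1 z.1 z.2 :=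
    hPm.comp (f := fun z : ℝ × M => (z.1, z.1, z.2)) (by fun_prop)
  have hUm := h.measurable
  have hFm : Measurable fun z : ℝ × M => primitive f (U z.1 z.2) :=
    hf.contDiff_primitive.continuous.measurable.comp hUm
  have hPi : Integrable (fun z : ℝ × M => P z.1 z.1 z.2) (lam.prod ν) := by
    refine ⟨hPd.aestronglyMeasurable, ?_⟩
    rw [hasFiniteIntegral_iff_enorm]
    calc ∫⁻ z, ‖P z.1 z.1 z.2‖ₑ ∂(lam.prod ν)
        ≤ ∫⁻ z, (Q₁ z.1 z.2 + Q₂ z.1 z.2) ∂(lam.prod ν) := lintegral_mono fun z => hle _ _ _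
      _ = (∫⁻ t, (∫⁻ x, Q₁ t x ∂ν) ∂lam) + ∫⁻ t, (∫⁻ x, Q₂ t x ∂ν) ∂lam := by
          rw [lintegral_add_left hQ₁, lintegral_prod _ hQ₁.aemeasurable,
            lintegral_prod _ hQ₂.aemeasurable]
      _ ≤ _ := add_le_add (lintegral_mono' hlam le_rfl) (lintegral_mono' hlam le_rfl)
      _ < ⊤ := (ENNReal.add_ne_top.2 ⟨hQ₁T, hQ₂T⟩).lt_top
  set D : ℝ × M → ℝ := fun z => f (U z.1 z.2) *
    (m ^ (p - 1) * U z.1 z.2 ^ ((m - 1) * (p - 1))) * ‖GU z.1 z.2‖ ^ p with hD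
  set S : ℝ × M → ℝ := fun z => U z.1 z.2 ^ q * primitive f (U z.1 z.2) with hS
  have hDm : Measurable D := ((hf.continuous.measurable.comp hUm).mul
    ((hUm.pow_const _).const_mul _)).mul ((measurable_norm_along h.measurableGU).pow_const _)
  have hSm : Measurable S := (hUm.pow_const q).mul hFm
  have hS0 : ∀ z, 0 ≤ S z := fun z =>
    mul_nonneg (Real.rpow_nonneg (h.nonneg _ _) _) (hf.primitive_nonneg _)
  have hD0 : ∀ z, 0 ≤ D z := fun z => by
    have := h.nonneg z.1 z.2
    have := hf.nonneg (U z.1 z.2)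
    have hm0 : 0 < m := by linarith
    simp only [hD]; positivity
  obtain ⟨C, hC0, hC⟩ := hf.exists_bound
  have hSi : Integrable S (lam.prod ν) := by
    refine ⟨hSm.aestronglyMeasurable, ?_⟩
    rw [hasFiniteIntegral_iff_enorm]
    set c' := ENNReal.ofReal (K ^ (q - 1) * C)
    calc ∫⁻ z, ‖S z‖ₑ ∂(lam.prod ν) ≤ ∫⁻ z, c' * normDensity p U GU GV z.1 z.2 ∂(lam.prod ν) := by
          refine lintegral_mono fun z => ?_
          have hU0 := h.nonneg z.1 z.2
          have hUK := h.le z.1 z.2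
          have hK := hU0.trans hUK
          refine le_trans ?_ (mul_le_mul_right (show ‖U z.1 z.2‖ₑ ^ (2 : ℝ) ≤ _ from le_add_self) _)
          rw [← ofReal_rpow_norm (by norm_num), ← ofReal_norm, ← ENNReal.ofReal_mul (by positivity)]
          refine ENNReal.ofReal_le_ofReal ?_
          rw [Real.norm_of_nonneg (hS0 z), Real.norm_of_nonneg hU0]
          have e1 : U z.1 z.2 ^ q ≤ K ^ (q - 1) * U z.1 z.2 := by
            rcases hU0.eq_or_lt with h0 | h0
            · rw [← h0, Real.zero_rpow (by linarith), mul_zero]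
            · calc U z.1 z.2 ^ q = U z.1 z.2 ^ (q - 1) * U z.1 z.2 := by
                    rw [← Real.rpow_add_one h0.ne']; ring_nf
                _ ≤ _ := by gcongr
          have e2 : primitive f (U z.1 z.2) ≤ C * U z.1 z.2 := by
            have := hf.abs_primitive_le hC (U z.1 z.2)
            rw [abs_of_nonneg hU0] at this
            exact (le_abs_self _).trans this
          calc S z ≤ (K ^ (q - 1) * U z.1 z.2) * (C * U z.1 z.2) :=
                mul_le_mul e1 e2 (hf.primitive_nonneg _) (by positivity)
            _ = _ := by norm_num; ring
      _ = c' * ∫⁻ t, (∫⁻ x, normDensity p U GU GV t x ∂ν) ∂lam := by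
          rw [lintegral_const_mul' _ _ ENNReal.ofReal_ne_top,
            lintegral_prod _ h.measurable_norms.aemeasurable]
      _ ≤ c' * ∫⁻ t in Ioo 0 (t₂ + 1), (∫⁻ x, normDensity p U GU GV t x ∂ν) := by
          gcongr
      _ < ⊤ := (ENNReal.mul_ne_top ENNReal.ofReal_ne_top (h.lintegral_ne_top _)).lt_top
  -- The pairing P has no sign, but P + S dominates the non-negative D. Since P and S are both
  -- integrable, the signed energy inequality can be turned into one between non-negative integrals.
  have hae : ∀ᵐ z ∂(lam.prod ν), D z ≤ P z.1 z.1 z.2 + S z := by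
    have hPSm : Measurable fun z : ℝ × M => P z.1 z.1 z.2 + S z := hPd.add hSm
    rw [Measure.ae_prod_iff_ae_ae (measurableSet_le hDm hPSm), ae_restrict_iff'
      measurableSet_Ioc]
    filter_upwards [h.isSlice] with t hs ht'
    filter_upwards [(hs (ht₁.trans ht'.1)).ae_smul_eq hp.le hm hB] with x hx
    exact le_pairing_weight hp hm hε hk hf (h.nonneg t x) hx
  have hswap : ∫ x, (∫ t, P t t x ∂lam) ∂ν = ∫ z, P z.1 z.1 z.2 ∂(lam.prod ν) :=
    (integral_prod_symm _ hPi).symm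
  rw [hswap] at hmain
  have hPS0 : 0 ≤ᵐ[lam.prod ν] fun z => P z.1 z.1 z.2 + S z :=
    hae.mono fun z hz => (hD0 z).trans hz
  have hDle : ∫⁻ z, ENNReal.ofReal (D z) ∂(lam.prod ν) ≤
      ENNReal.ofReal (∫ z, P z.1 z.1 z.2 ∂(lam.prod ν) + ∫ z, S z ∂(lam.prod ν)) := by
    have hPSi : Integrable (fun z : ℝ × M => P z.1 z.1 z.2 + S z) (lam.prod ν) := hPi.add hSi
    rw [← integral_add hPi hSi, ofReal_integral_eq_lintegral_ofReal hPSi hPS0]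
    exact lintegral_mono_ae (hae.mono fun z hz => ENNReal.ofReal_le_ofReal hz)
  have hSe : ∫⁻ z, ENNReal.ofReal (S z) ∂(lam.prod ν) = ENNReal.ofReal (∫ z, S z ∂(lam.prod ν)) :=
    (ofReal_integral_eq_lintegral_ofReal hSi (Eventually.of_forall hS0)).symm
  rw [lintegral_prod _ hDm.ennreal_ofReal.aemeasurable] at hDle
  rw [lintegral_prod _ hSm.ennreal_ofReal.aemeasurable] at hSe
  have hPS : 0 ≤ ∫ z, P z.1 z.1 z.2 ∂(lam.prod ν) + ∫ z, S z ∂(lam.prod ν) := by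
    rw [← integral_add hPi hSi]; exact integral_nonneg_of_ae hPS0
  have he0 : ∀ t, 0 ≤ weightEnergy N f B u t := fun t =>
    integral_nonneg fun x => hf.primitive_primitive_nonneg _
  change _ + ∫⁻ t, (∫⁻ x, ENNReal.ofReal (D (t, x)) ∂ν) ∂lam ≤
    _ + ∫⁻ t, (∫⁻ x, ENNReal.ofReal (S (t, x)) ∂ν) ∂lam
  rw [hSe, ← ENNReal.ofReal_add (he0 _) (integral_nonneg hS0)]
  refine (add_le_add_right hDle _).trans ?_
  rw [← ENNReal.ofReal_add (he0 _) hPS]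
  refine ENNReal.ofReal_le_ofReal ?_
  linarith

end EnergyInequality

/-! ### The energy inequality for L^r norms -/

section PowerEnergy

theorem liminf_add_liminf_le_of_le {a b : ℕ → ℝ≥0∞} {c : ℝ≥0∞} (h : ∀ n, a n + b n ≤ c) :
    liminf a atTop + liminf b atTop ≤ c := by
  rw [liminf_eq_iSup_iInf_of_nat, liminf_eq_iSup_iInf_of_nat, ENNReal.iSup_add_iSup_of_monotone]
  · exact iSup_le fun n => (add_le_add (iInf₂_le n le_rfl) (iInf₂_le n le_rfl)).trans (h n)
  · exact fun i j hij => le_iInf₂ fun n hn => iInf₂_le n (hij.trans hn)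
  · exact fun i j hij => le_iInf₂ fun n hn => iInf₂_le n (hij.trans hn)

/-- Fatou's lemma for two integrals at once: the energy at the final time lives on the ball, the
dissipation on space-time, and only their sum is bounded. -/
theorem lintegral_add_lintegral_le_of_tendsto {X Y : Type*} [MeasurableSpace X] [MeasurableSpace Y]
    {ν : Measure X} {ρ : Measure Y} {h : ℕ → X → ℝ≥0∞} {g : X → ℝ≥0∞} {h' : ℕ → Y → ℝ≥0∞}
    {g' : Y → ℝ≥0∞} (hh : ∀ n, AEMeasurable (h n) ν) (hh' : ∀ n, AEMeasurable (h' n) ρ)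
    (hlim : ∀ᵐ x ∂ν, Tendsto (fun n => h n x) atTop (𝓝 (g x)))
    (hlim' : ∀ᵐ y ∂ρ, Tendsto (fun n => h' n y) atTop (𝓝 (g' y))) {c : ℝ≥0∞}
    (hc : ∀ n, ∫⁻ x, h n x ∂ν + ∫⁻ y, h' n y ∂ρ ≤ c) : ∫⁻ x, g x ∂ν + ∫⁻ y, g' y ∂ρ ≤ c := by
  refine le_trans (add_le_add ?_ ?_) (liminf_add_liminf_le_of_le hc)
  · rw [lintegral_congr_ae (hlim.mono fun x hx => hx.liminf_eq.symm)]
    exact lintegral_liminf_le' hh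
  · rw [lintegral_congr_ae (hlim'.mono fun x hx => hx.liminf_eq.symm)]
    exact lintegral_liminf_le' hh'

variable {p m q ε k K : ℝ} {B : Set M} {U : ℝ → M → ℝ} {GU GV : ℝ → ∀ x : M, TangentSpace (𝓡 N) x}
  {u : ℝ → M → ℝ}

/-- The density of `|∇U ^ β| ^ p`. -/
def dissipationDensity (p β : ℝ) (U : ℝ → M → ℝ) (GU : ℝ → ∀ x : M, TangentSpace (𝓡 N) x) (t : ℝ)
    (x : M) : ℝ≥0∞ :=
  {x | 0 < U t x}.indicator (fun x => (‖β * U t x ^ (β - 1)‖ₑ * ‖GU t x‖ₑ) ^ p) x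

theorem IsEvolution.measurable_dissipationDensity (h : IsEvolution p m K B U GU GV) (β : ℝ) :
    Measurable fun z : ℝ × M => dissipationDensity p β U GU z.1 z.2 := by
  have h1 : Measurable fun z : ℝ × M => (‖β * U z.1 z.2 ^ (β - 1)‖ₑ * ‖GU z.1 z.2‖ₑ) ^ p :=
    (((h.measurable.pow_const _).const_mul β).enorm.mul
      (measurable_enorm_along h.measurableGU)).pow_const p
  exact h1.indicator (measurableSet_lt measurable_const h.measurable)

theorem ofReal_weightEnergy_powWeight {r : ℝ} (hr : 1 < r) (n : ℕ) {t : ℝ} (ht : 0 ≤ t)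
    (hu : MemLp (u t) 2 ((riemannianMeasure N M).restrict B)) :
    ENNReal.ofReal (weightEnergy N (powWeight (r - 1) (r - 2) n) B u t) =
      ∫⁻ x in B, ENNReal.ofReal (primitive (primitive (powWeight (r - 1) (r - 2) n)) (u t x))
        ∂(riemannianMeasure N M) := by
  have hW : IsWeight (powWeight (r - 1) (r - 2) n) := isWeight_powWeight (by linarith) _ n
  rw [weightEnergy, max_eq_left ht, ofReal_integral_eq_lintegral_ofReal
    (hW.integrable_primitive_primitive hu)
    (Eventually.of_forall fun x => hW.primitive_primitive_nonneg _)]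

/-- The weights truncate (r-1) s^(r-2), whose first primitive is s^(r-1) and whose second is s^r/r.
The condition r > 1 makes the singularity at 0 integrable, and domination by the limit bounds the
right side of the energy inequality uniformly in n. -/
theorem powWeight_primitive_bounds {r : ℝ} (hr : 1 < r) {s : ℝ} (hs : 0 ≤ s) :
    (∀ n, primitive (powWeight (r - 1) (r - 2) n) s ≤ s ^ (r - 1)) ∧
    (∀ n, primitive (primitive (powWeight (r - 1) (r - 2) n)) s ≤ 1 / r * s ^ r) ∧
    Tendsto (fun n => primitive (primitive (powWeight (r - 1) (r - 2) n)) s) atTop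
      (𝓝 (1 / r * s ^ r)) := by
  have hr1 : 0 ≤ r - 1 := by linarith
  have hW : ∀ n, IsWeight (powWeight (r - 1) (r - 2) n) := fun n => isWeight_powWeight hr1 _ n
  have h1 : ∀ s : ℝ, 0 ≤ s → (∀ n, primitive (powWeight (r - 1) (r - 2) n) s ≤ 1 * s ^ (r - 1)) ∧
      Tendsto (fun n => primitive (powWeight (r - 1) (r - 2) n) s) atTop (𝓝 (1 * s ^ (r - 1))) := by
    intro s hs
    have := tendsto_primitive_of_le_rpow (c := r - 1) (e := r - 2) (by linarith)
      (fun n => (hW n).continuous) (fun n => (hW n).nonneg)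
      (fun n s hs => powWeight_le hr1 (r - 2) n hs)
      (fun s hs => tendsto_powWeight (r - 1) (r - 2) hs) hs
    have e1 : r - 2 + 1 = r - 1 := by ring
    rwa [e1, div_self (by linarith)] at this
  have h2 := tendsto_primitive_of_le_rpow (c := 1) (e := r - 1) (by linarith)
    (fun n => (hW n).contDiff_primitive.continuous) (fun n => (hW n).primitive_nonneg)
    (fun n s hs => (h1 s hs).1 n) (fun s hs => (h1 s hs.le).2) hs
  rw [sub_add_cancel] at h2
  refine ⟨fun n => ?_, h2⟩
  simpa using (h1 s hs).1 n

/-- The energy inequality for the `L^r` norm. -/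
theorem IsWeakEvolution.lintegral_rpow_add_le (h : IsWeakEvolution p m q ε k K B U GU GV u)
    (hp : 1 < p) (hm : 1 < m) (hq : 1 < q) (hε : 0 < ε) (hk : 0 < k) (hB : MeasurableSet B)
    (h0 : ∀ t, 0 ≤ t → ∀ᵐ x ∂((riemannianMeasure N M).restrict B), 0 ≤ u t x) {r β : ℝ}
    (hr : 1 < r) (hβ : β * p = m * (p - 1) + r - 1) {t₁ t₂ : ℝ} (ht₁ : 0 < t₁) (ht : t₁ ≤ t₂) :
    ENNReal.ofReal (1 / r) * ∫⁻ x in B, ‖u t₂ x‖ₑ ^ r ∂(riemannianMeasure N M) +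
      ENNReal.ofReal ((r - 1) * m ^ (p - 1) / β ^ p) * ∫⁻ t in Ioc t₁ t₂, (∫⁻ x in B,
        dissipationDensity p β U GU t x ∂(riemannianMeasure N M)) ≤
    ENNReal.ofReal (1 / r) * ∫⁻ x in B, ‖u t₁ x‖ₑ ^ r ∂(riemannianMeasure N M) +
      ∫⁻ t in Ioc t₁ t₂, (∫⁻ x in B, ‖U t x‖ₑ ^ (q + r - 1) ∂(riemannianMeasure N M)) := by
  have hp0 : 0 < p := by linarith
  have hr0 : 0 < r := by linarith
  have hm0 : 0 < m := by linarith
  have hβ0 : 0 < β := by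
    by_contra hcon
    push Not at hcon
    have h1 : 0 < m * (p - 1) := mul_pos hm0 (by linarith)
    nlinarith
  set ν := (riemannianMeasure N M).restrict B
  set lam : Measure ℝ := volume.restrict (Ioc t₁ t₂)
  set c := ENNReal.ofReal ((r - 1) * m ^ (p - 1) / β ^ p)
  set f : ℕ → ℝ → ℝ := fun n => powWeight (r - 1) (r - 2) n
  have hW : ∀ n, IsWeight (f n) := fun n => isWeight_powWeight (by linarith) _ n
  have hconv : ∀ t, 0 ≤ t → ∫⁻ x, ENNReal.ofReal (1 / r) * ‖u t x‖ₑ ^ r ∂ν =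
      ∫⁻ x, ENNReal.ofReal (1 / r * u t x ^ r) ∂ν := fun t ht =>
    lintegral_congr_ae (by
      filter_upwards [h0 t ht] with x hx
      rw [ENNReal.ofReal_mul (by positivity), ← ofReal_rpow_norm hr0.le, Real.norm_of_nonneg hx])
  have hdm := h.measurable_dissipationDensity β
  have hdi : ∫⁻ z, c * dissipationDensity p β U GU z.1 z.2 ∂(lam.prod ν) =
      c * ∫⁻ t, (∫⁻ x, dissipationDensity p β U GU t x ∂ν) ∂lam := by
    rw [lintegral_const_mul' _ _ ENNReal.ofReal_ne_top, lintegral_prod _ hdm.aemeasurable]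
  have ht₂ : 0 ≤ t₂ := by linarith
  rw [← hdi, ← lintegral_const_mul' _ _ ENNReal.ofReal_ne_top,
    ← lintegral_const_mul' _ _ ENNReal.ofReal_ne_top, hconv t₁ ht₁.le, hconv t₂ ht₂]
  set D : ℕ → ℝ × M → ℝ := fun n z => f n (U z.1 z.2) *
    (m ^ (p - 1) * U z.1 z.2 ^ ((m - 1) * (p - 1))) * ‖GU z.1 z.2‖ ^ p
  have hDm : ∀ n, Measurable (D n) := fun n => (((hW n).continuous.measurable.comp h.measurable).mul
    ((h.measurable.pow_const _).const_mul _)).mul ((measurable_norm_along h.measurableGU).pow_const _)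
  refine lintegral_add_lintegral_le_of_tendsto
    (h := fun n x => ENNReal.ofReal (primitive (primitive (f n)) (u t₂ x)))
    (h' := fun n z => ENNReal.ofReal (D n z))
    (fun n => (((continuous_primitive
      (hW n).contDiff_primitive.continuous).measurable.comp_aemeasurable
        (h.memLp t₂ ht₂).1.aemeasurable).ennreal_ofReal))
    (fun n => (hDm n).ennreal_ofReal.aemeasurable) ?_ (Eventually.of_forall fun z => ?_) fun n => ?_
  · filter_upwards [h0 t₂ ht₂] with x hx
    exact (ENNReal.continuous_ofReal.tendsto _).comp (powWeight_primitive_bounds hr hx).2.2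
  · rcases (h.nonneg z.1 z.2).eq_or_lt with hU | hU
    · have e1 : ∀ n, D n z = 0 := fun n => by
        obtain ⟨δ, L, hδ, -, hfδ, -⟩ := (hW n).exists_support
        simp only [D]
        rw [hfδ _ (by rw [← hU]; exact hδ.le)]; simp
      have e2 : dissipationDensity p β U GU z.1 z.2 = 0 := by
        rw [dissipationDensity, indicator_of_notMem]
        simp [← hU]
      simp only [e1, e2, mul_zero, ENNReal.ofReal_zero]
      exact tendsto_const_nhds
    · have e1 : c * dissipationDensity p β U GU z.1 z.2 = ENNReal.ofReal
          ((r - 1) * U z.1 z.2 ^ (r - 2) * (m ^ (p - 1) * U z.1 z.2 ^ ((m - 1) * (p - 1))) *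
            ‖GU z.1 z.2‖ ^ p) := by
        rw [dissipationDensity, indicator_of_mem (by exact hU)]
        have e3 : ‖β * U z.1 z.2 ^ (β - 1)‖ₑ * ‖GU z.1 z.2‖ₑ =
            ENNReal.ofReal (β * U z.1 z.2 ^ (β - 1) * ‖GU z.1 z.2‖) := by
          rw [ENNReal.ofReal_mul (by positivity), ofReal_norm, ← ofReal_norm (_ * _),
            Real.norm_of_nonneg (by positivity)]
        rw [e3, ENNReal.ofReal_rpow_of_nonneg (by positivity) hp0.le,
          ← ENNReal.ofReal_mul (div_nonneg (mul_nonneg (by linarith) (by positivity))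
            (by positivity)), Real.mul_rpow (by positivity) (norm_nonneg _),
          Real.mul_rpow hβ0.le (by positivity), ← Real.rpow_mul hU.le]
        congr 1
        -- This matching of exponents determines β: the density U^(r-2) U^((m-1)(p-1)) |∇U|^p is
        -- |∇U^β|^p up to the factor β^p.
        have e4 : (β - 1) * p = (r - 2) + (m - 1) * (p - 1) := by linarith
        rw [e4, Real.rpow_add hU]
        have : β ^ p ≠ 0 := by positivity
        field_simp
      rw [e1]
      refine (ENNReal.continuous_ofReal.tendsto _).comp ?_
      exact ((tendsto_powWeight (r - 1) (r - 2) hU).mul_const _).mul_const _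
  · have hE := h.weightEnergy_add_le hp hm hq hε hk hB (hW n) ht₁ ht
    rw [ofReal_weightEnergy_powWeight hr n ht₂ (h.memLp t₂ ht₂),
      ofReal_weightEnergy_powWeight hr n ht₁.le (h.memLp t₁ ht₁.le)] at hE
    rw [lintegral_prod _ (hDm n).ennreal_ofReal.aemeasurable]
    refine hE.trans (add_le_add (lintegral_mono_ae ?_) (lintegral_mono fun t => lintegral_mono
      fun x => ?_))
    · filter_upwards [h0 t₁ ht₁.le] with x hx
      exact ENNReal.ofReal_le_ofReal ((powWeight_primitive_bounds hr hx).2.1 n)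
    · rw [← ofReal_rpow_norm (by linarith), Real.norm_of_nonneg (h.nonneg t x)]
      refine ENNReal.ofReal_le_ofReal ?_
      have hU := h.nonneg t x
      calc U t x ^ q * primitive (f n) (U t x) ≤ U t x ^ q * U t x ^ (r - 1) := by
            gcongr
            exact (powWeight_primitive_bounds hr hU).1 n
        _ = U t x ^ (q + r - 1) := by
            rw [add_sub_assoc, Real.rpow_add_of_nonneg hU (by linarith) (by linarith)]

end PowerEnergy

/-! ### A bounded, jointly measurable representative -/

section Representative

theorem ae_lt_top_of_lintegral_Ioo {g : ℝ → ℝ≥0∞} (hg : Measurable g)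
    (h : ∀ T, 0 < T → ∫⁻ t in Ioo 0 T, g t < ⊤) : ∀ᵐ t, 0 < t → g t < ⊤ := by
  have h1 : ∀ n : ℕ, ∀ᵐ t, t ∈ Ioo (0 : ℝ) (n + 1 : ℝ) → g t < ⊤ := fun n =>
    (ae_restrict_iff' measurableSet_Ioo).1 (ae_lt_top hg (h _ (by positivity)).ne)
  filter_upwards [ae_all_iff.2 h1] with t ht h0
  obtain ⟨n, hn⟩ := exists_nat_gt t
  exact ht n ⟨h0, hn.trans (by linarith)⟩

/-- A measurable version is clipped to [0, K], with K the essential supremum. Sign, bound and joint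
measurability then hold everywhere, and null sets enter only in comparing with u(t). -/
theorem exists_bounded_representative {X : Type*} [MeasurableSpace X] {ν : Measure X} [SFinite ν]
    {u : ℝ → X → ℝ}
    (h0 : ∀ᵐ z ∂((volume.restrict (Ioi (0 : ℝ))).prod ν), 0 ≤ u z.1 z.2)
    (hu : MemLp (fun z : ℝ × X => u z.1 z.2) ∞ ((volume.restrict (Ioi 0)).prod ν)) :
    ∃ (K : ℝ) (U : ℝ → X → ℝ), Measurable (fun z : ℝ × X => U z.1 z.2) ∧ (∀ t x, 0 ≤ U t x) ∧
      (∀ t x, U t x ≤ K) ∧ ∀ᵐ t, 0 < t → U t =ᵐ[ν] u t := by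
  set P := (volume.restrict (Ioi (0 : ℝ))).prod ν
  set g := hu.1.mk with hg
  set K := (eLpNorm (fun z : ℝ × X => u z.1 z.2) ∞ P).toReal with hK
  have hgm : Measurable g := hu.1.stronglyMeasurable_mk.measurable
  have hK0 : 0 ≤ K := ENNReal.toReal_nonneg
  refine ⟨K, fun t x => max 0 (min (g (t, x)) K), measurable_const.max (hgm.min measurable_const),
    fun t x => le_max_left _ _, fun t x => max_le hK0 (min_le_right _ _), ?_⟩
  have hb : ∀ᵐ z ∂P, ‖u z.1 z.2‖ₑ ≤ eLpNorm (fun z : ℝ × X => u z.1 z.2) ∞ P := by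
    rw [eLpNorm_exponent_top]
    exact ae_le_eLpNormEssSup
  have hP : ∀ᵐ z ∂P, max 0 (min (g (z.1, z.2)) K) = u z.1 z.2 := by
    filter_upwards [h0, hb, hu.1.ae_eq_mk] with z hz hz' hz''
    rw [show g (z.1, z.2) = u z.1 z.2 from hz''.symm]
    have : u z.1 z.2 ≤ K := by
      rw [hK, ← Real.norm_of_nonneg hz, ← toReal_enorm]
      exact ENNReal.toReal_mono hu.2.ne hz'
    rw [min_eq_left this, max_eq_right hz]
  have := (ae_restrict_iff' measurableSet_Ioi).1 (Measure.ae_ae_of_ae_prod hP)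
  exact this

end Representative

/-! ### Time slices of the Sobolev data -/

section Solution

variable {p m q ε k K : ℝ} {B : Set M} {U u : ℝ → M → ℝ} {u₀ : M → ℝ}
  {GU GV : ℝ → ∀ x : M, TangentSpace (𝓡 N) x}

theorem IsSobolevZero.congr {a : ℝ} {w w' : M → ℝ} {G : ∀ x : M, TangentSpace (𝓡 N) x}
    (h : IsSobolevZero a B w G) (hw : w =ᵐ[(riemannianMeasure N M).restrict B] w') :
    IsSobolevZero a B w' G := by
  obtain ⟨φ, h1, h2, h3⟩ := h
  refine ⟨φ, h1, h2.congr fun n => lintegral_congr_ae ?_, h3⟩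
  filter_upwards [hw] with x hx
  rw [hx]

theorem MemLpSobolevZero.slice {a : ℝ} {w w' : ℝ → M → ℝ}
    {G : ℝ → ∀ x : M, TangentSpace (𝓡 N) x} (h : MemLpSobolevZero a B w G)
    (hw' : Measurable fun z : ℝ × M => w' z.1 z.2)
    (hw : ∀ᵐ t, 0 < t → w' t =ᵐ[(riemannianMeasure N M).restrict B] w t) :
    (∀ᵐ t, 0 < t → IsSobolevZero a B (w' t) (G t) ∧
      ∫⁻ x in B, ‖w' t x‖ₑ ^ a ∂(riemannianMeasure N M) ≠ ⊤ ∧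
      ∫⁻ x in B, ‖G t x‖ₑ ^ a ∂(riemannianMeasure N M) ≠ ⊤) ∧
    ∀ T, 0 < T → ∫⁻ t in Ioo 0 T, ∫⁻ x in B, (‖w' t x‖ₑ ^ a + ‖G t x‖ₑ ^ a)
      ∂(riemannianMeasure N M) < ⊤ := by
  have hG : MeasurableAlong (fun z : ℝ × M => z.2) fun z => G z.1 z.2 := h.measurableField
  have hT : ∀ T, 0 < T → ∫⁻ t in Ioo 0 T, ∫⁻ x in B, (‖w' t x‖ₑ ^ a + ‖G t x‖ₑ ^ a)
      ∂(riemannianMeasure N M) < ⊤ := fun T hT => by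
    refine lt_of_eq_of_lt ?_ (h.lintegral_lt_top T hT)
    refine lintegral_congr_ae ?_
    filter_upwards [ae_restrict_of_ae hw, ae_restrict_mem measurableSet_Ioo] with t ht htm
    refine lintegral_congr_ae ?_
    filter_upwards [ht htm.1] with x hx
    rw [hx]
  have hsum : Measurable fun z : ℝ × M => ‖w' z.1 z.2‖ₑ ^ a + ‖G z.1 z.2‖ₑ ^ a :=
    (hw'.enorm.pow_const a).add ((measurable_enorm_along hG).pow_const a)
  refine ⟨?_, hT⟩
  have hi : Measurable fun t => ∫⁻ x in B, (‖w' t x‖ₑ ^ a + ‖G t x‖ₑ ^ a)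
      ∂(riemannianMeasure N M) :=
    Measurable.lintegral_prod_right' (f := fun z : ℝ × M => ‖w' z.1 z.2‖ₑ ^ a + ‖G z.1 z.2‖ₑ ^ a)
      hsum
  filter_upwards [hw, ae_lt_top_of_lintegral_Ioo hi hT,
    (ae_restrict_iff' measurableSet_Ioi).1 h.isSobolevZero] with t h1 h2 h3 ht
  exact ⟨(h3 ht).congr (h1 ht).symm,
    ((lintegral_mono fun x => le_self_add).trans_lt (h2 ht)).ne,
    ((lintegral_mono fun x => le_add_self).trans_lt (h2 ht)).ne⟩

theorem isEvolution_of_memLpSobolevZero (hU : Measurable fun z : ℝ × M => U z.1 z.2)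
    (h0 : ∀ t x, 0 ≤ U t x) (hK : ∀ t x, U t x ≤ K)
    (hUu : ∀ᵐ t, 0 < t → U t =ᵐ[(riemannianMeasure N M).restrict B] u t)
    (hV : MemLpSobolevZero p B (fun t x => u t x ^ m) GV) (hW : MemLpSobolevZero 2 B u GU) :
    IsEvolution p m K B U GU GV := by
  have hGU : MeasurableAlong (fun z : ℝ × M => z.2) fun z => GU z.1 z.2 := hW.measurableField
  have hGV : MeasurableAlong (fun z : ℝ × M => z.2) fun z => GV z.1 z.2 := hV.measurableField
  have hUm : Measurable fun z : ℝ × M => U z.1 z.2 ^ m := hU.pow_const m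
  obtain ⟨hW1, hW2⟩ := hW.slice hU hUu
  obtain ⟨hV1, hV2⟩ := hV.slice (w' := fun t x => U t x ^ m) hUm (by
    filter_upwards [hUu] with t ht h
    filter_upwards [ht h] with x hx
    rw [hx])
  refine ⟨hU, h0, hK, hGU, hGV, ?_, fun T => ?_⟩
  · filter_upwards [hW1, hV1] with t h1 h2 ht
    exact ⟨hU.comp (f := fun x => (t, x)) measurable_prodMk_left, h0 t,
      hGU.comp (f := fun x : M => (t, x)) measurable_prodMk_left,
      hGV.comp (f := fun x : M => (t, x)) measurable_prodMk_left, (h1 ht).1, (h2 ht).1,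
      (h1 ht).2.1, (h1 ht).2.2, (h2 ht).2.1, (h2 ht).2.2⟩
  · rcases le_or_gt T 0 with hT | hT
    · simp [Ioo_eq_empty_of_le hT]
    · refine (lt_of_le_of_lt ?_ (ENNReal.add_lt_top.2 ⟨hV2 T hT, hW2 T hT⟩)).ne
      have hs : Measurable fun z : ℝ × M => ‖U z.1 z.2 ^ m‖ₑ ^ p + ‖GV z.1 z.2‖ₑ ^ p :=
        (hUm.enorm.pow_const p).add ((measurable_enorm_along hGV).pow_const p)
      have hi : Measurable fun t => ∫⁻ x in B, (‖U t x ^ m‖ₑ ^ p + ‖GV t x‖ₑ ^ p)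
          ∂(riemannianMeasure N M) :=
        Measurable.lintegral_prod_right'
          (f := fun z : ℝ × M => ‖U z.1 z.2 ^ m‖ₑ ^ p + ‖GV z.1 z.2‖ₑ ^ p) hs
      rw [← lintegral_add_left hi]
      refine lintegral_mono fun t => ?_
      have hst : Measurable fun x => ‖U t x ^ m‖ₑ ^ p + ‖GV t x‖ₑ ^ p :=
        hs.comp (g := fun z : ℝ × M => ‖U z.1 z.2 ^ m‖ₑ ^ p + ‖GV z.1 z.2‖ₑ ^ p)
          (f := fun x => (t, x)) measurable_prodMk_left
      rw [← lintegral_add_left hst]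
      refine lintegral_mono fun x => ?_
      rw [normDensity, add_assoc]
      refine add_le_add le_add_self ?_
      rw [add_comm]

end Solution

/-! ### From the space-time weak form to an identity at every time -/

section WeakFormulation

variable {p m q ε k K : ℝ} {B : Set M} {U u : ℝ → M → ℝ} {u₀ : M → ℝ}
  {GU GV : ℝ → ∀ x : M, TangentSpace (𝓡 N) x}

theorem grad_const_mul {v : M → ℝ} {x : M} (hv : MDifferentiableAt (𝓡 N) 𝓘(ℝ, ℝ) v x) (c : ℝ) :
    grad (N := N) (fun y => c * v y) x = c • grad (N := N) v x := by
  have h : mfderiv (𝓡 N) 𝓘(ℝ, ℝ) (fun y => c * v y) x = c • mfderiv (𝓡 N) 𝓘(ℝ, ℝ) v x :=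
    const_smul_mfderiv hv c
  refine ext_inner_right ℝ fun ξ => ?_
  rw [inner_grad, inner_smul_left, inner_grad, h]
  rfl

/-- Products η(t)v(x) are the only space-time test functions that the argument uses. -/
theorem IsTestFunction.isSpaceTimeTestFunction {v : M → ℝ} (hv : IsTestFunction N B v) {η : ℝ → ℝ}
    (hη : ContDiff ℝ ∞ η) (hηc : HasCompactSupport η) {T : ℝ} (hT : η T = 0) :
    IsSpaceTimeTestFunction N B T fun z : ℝ × M => η z.1 * v z.2 := by
  refine ⟨(hη.contMDiff.comp contMDiff_fst).smul (hv.1.comp contMDiff_snd), ?_, ?_, ?_⟩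
  · refine HasCompactSupport.intro (hηc.isCompact.prod hv.2.1.isCompact) fun z hz => ?_
    rw [mem_prod, not_and_or] at hz
    rcases hz with h | h
    · rw [image_eq_zero_of_notMem_tsupport h, zero_mul]
    · rw [image_eq_zero_of_notMem_tsupport h, mul_zero]
  · have h1 : tsupport (fun z : ℝ × M => η z.1 * v z.2) ⊆ univ ×ˢ tsupport v := by
      refine closure_minimal (fun z hz => ⟨mem_univ _, ?_⟩)
        (isClosed_univ.prod (isClosed_tsupport v))
      exact subset_tsupport _ (right_ne_zero_of_mul hz)
    exact h1.trans (prod_mono_right hv.2.2)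
  · intro x _
    simp [hT]

/-- The integrals against a fixed test function evolve as the equation says. -/
def IsIntegratedSolution (p q ε k : ℝ) (B : Set M) (u₀ : M → ℝ) (U : ℝ → M → ℝ)
    (GU GV : ℝ → ∀ x : M, TangentSpace (𝓡 N) x) (u : ℝ → M → ℝ) : Prop :=
  ∀ v, IsTestFunction N B v → ∀ t, 0 ≤ t →
    ∫ x in B, u t x * v x ∂(riemannianMeasure N M) =
      ∫ x in B, u₀ x * v x ∂(riemannianMeasure N M) -
      ∫ τ in (0)..t, (∫ x in B, pairing p q ε k (GV τ x) (GU τ x) (U τ x) (v x)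
        (grad (N := N) v x) ∂(riemannianMeasure N M))

/-- The terms are separated by varying the data of the integrable pairing: a zero test value removes
the source, the difference between ε = 2 and ε = 1 isolates the gradient of u, and a zero test
gradient isolates the source. -/
theorem IsEvolution.integrable_flux (h : IsEvolution p m K B U GU GV) (hp : 1 < p) (hq : 1 < q)
    (hk : 0 < k) {v : M → ℝ} (hv : IsTestFunction N B v) (T : ℝ) :
    Integrable (fun a : ℝ × M => ‖GV a.1 a.2‖ ^ (p - 2) * inner ℝ (GV a.1 a.2) (grad v a.2))
      ((volume.restrict (Ioo 0 T)).prod ((riemannianMeasure N M).restrict B)) ∧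
    Integrable (fun a : ℝ × M => (inner ℝ (GU a.1 a.2) (grad v a.2) : ℝ))
      ((volume.restrict (Ioo 0 T)).prod ((riemannianMeasure N M).restrict B)) ∧
    Integrable (fun a : ℝ × M => truncation k (U a.1 a.2 ^ q) * v a.2)
      ((volume.restrict (Ioo 0 T)).prod ((riemannianMeasure N M).restrict B)) := by
  have hP := hv.isTestPair
  have hg2 := hv.lintegral_rpow_ne_top two_pos
  have hgp := hv.lintegral_rpow_ne_top (zero_lt_one.trans hp)
  have z2 : ∫⁻ x in B, ‖(0 : ℝ)‖ₑ ^ (2 : ℝ) ∂(riemannianMeasure N M) ≠ ⊤ := by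
    simp
  have zZ : ∀ a : ℝ, 0 < a → ∫⁻ x in B, ‖(0 : TangentSpace (𝓡 N) x)‖ₑ ^ a
      ∂(riemannianMeasure N M) ≠ ⊤ := fun a ha => by
    simp [ENNReal.zero_rpow_of_pos ha]
  have hP1 : IsTestPair N (fun _ : M => (0 : ℝ)) (grad (N := N) v) :=
    ⟨measurable_const, hP.2, hP.3⟩
  have hP2 : IsTestPair N v (fun x => (0 : TangentSpace (𝓡 N) x)) :=
    ⟨hP.1, by simp, fun G _ => by simp⟩
  have h1 := h.integrable_pairing hp hq one_pos hk hP1 hgp.2 hg2.2 z2 T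
  have h2 := h.integrable_pairing hp hq two_pos hk hP1 hgp.2 hg2.2 z2 T
  have h3 := h.integrable_pairing hp hq one_pos hk hP2 (zZ p (zero_lt_one.trans hp)) (zZ 2 two_pos)
    hg2.1 T
  simp only [pairing, mul_zero, sub_zero, inner_zero_right, zero_sub, add_zero] at h1 h2 h3
  have h4 := h2.sub h1
  have h5 : Integrable (fun a : ℝ × M => (inner ℝ (GU a.1 a.2) (grad v a.2) : ℝ))
      ((volume.restrict (Ioo 0 T)).prod ((riemannianMeasure N M).restrict B)) := by
    refine h4.congr (Eventually.of_forall fun a => ?_)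
    simp only [Pi.sub_apply]; ring
  refine ⟨?_, h5, ?_⟩
  · refine (h1.sub h5).congr (Eventually.of_forall fun a => ?_)
    simp only [Pi.sub_apply]; ring
  · simpa using h3.neg

theorem continuousOn_integral_mul {v : M → ℝ}
    (hu : ∀ t, 0 ≤ t → MemLp (u t) 2 ((riemannianMeasure N M).restrict B))
    (huc : ∀ t₀, 0 ≤ t₀ → Tendsto (fun t => eLpNorm (fun x => u t x - u t₀ x) 2
      ((riemannianMeasure N M).restrict B)) (𝓝[Ici 0] t₀) (𝓝 0))
    (hv : MemLp v 2 ((riemannianMeasure N M).restrict B)) :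
    ContinuousOn (fun t => ∫ x in B, u t x * v x ∂(riemannianMeasure N M)) (Ici 0) := by
  intro t₀ ht₀
  refine tendsto_integral_of_L1 _ (integrable_mul_of_memLp_two (hu t₀ ht₀) hv).1 ?_ ?_
  · filter_upwards [self_mem_nhdsWithin] with t ht
    exact integrable_mul_of_memLp_two (hu t ht) hv
  · have h3 := ENNReal.Tendsto.mul_const (b := eLpNorm v 2 ((riemannianMeasure N M).restrict B))
      (huc t₀ ht₀) (Or.inr hv.2.ne)
    rw [zero_mul] at h3
    refine tendsto_of_tendsto_of_tendsto_of_le_of_le' tendsto_const_nhds h3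
      (Eventually.of_forall fun i => zero_le) ?_
    filter_upwards [self_mem_nhdsWithin] with t ht
    simp only [← sub_mul]
    exact lintegral_enorm_mul_le ((hu t ht).1.sub (hu t₀ ht₀).1) hv.1

/-- Testing with η(t)v(x) says that ∫u(t)v has an integrable weak derivative in time and initial
value ∫u₀v. Continuity in L² makes this an identity at every t ≥ 0, including t = 0. -/
theorem isIntegratedSolution_of_weak (h : IsEvolution p m K B U GU GV) (hp : 1 < p) (hq : 1 < q)
    (hk : 0 < k)
    (hUu : ∀ᵐ t, 0 < t → U t =ᵐ[(riemannianMeasure N M).restrict B] u t)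
    (hu : ∀ t, 0 ≤ t → MemLp (u t) 2 ((riemannianMeasure N M).restrict B))
    (huc : ∀ t₀, 0 ≤ t₀ → Tendsto (fun t => eLpNorm (fun x => u t x - u t₀ x) 2
      ((riemannianMeasure N M).restrict B)) (𝓝[Ici 0] t₀) (𝓝 0))
    (hweak : ∀ T : ℝ, 0 < T → ∀ φ : ℝ × M → ℝ, IsSpaceTimeTestFunction N B T φ →
      - (∫ t in (0)..T, ∫ x in B, u t x * deriv (fun τ => φ (τ, x)) t ∂(riemannianMeasure N M))
        + (∫ t in (0)..T, ∫ x in B, ‖GV t x‖ ^ (p - 2) *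
            inner ℝ (GV t x) (grad (fun y => φ (t, y)) x) ∂(riemannianMeasure N M))
        + ε * (∫ t in (0)..T, ∫ x in B,
            inner ℝ (GU t x) (grad (fun y => φ (t, y)) x) ∂(riemannianMeasure N M))
      = (∫ t in (0)..T, ∫ x in B, truncation k (u t x ^ q) * φ (t, x) ∂(riemannianMeasure N M))
        + ∫ x in B, u₀ x * φ (0, x) ∂(riemannianMeasure N M)) :
    IsIntegratedSolution p q ε k B u₀ U GU GV u := by
  intro v hv t ht
  set μ := riemannianMeasure N M
  set fA : ℝ → M → ℝ := fun t x => ‖GV t x‖ ^ (p - 2) * inner ℝ (GV t x) (grad v x) with hfA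
  set fB : ℝ → M → ℝ := fun t x => inner ℝ (GU t x) (grad v x) with hfB
  set fc : ℝ → M → ℝ := fun t x => truncation k (U t x ^ q) * v x with hfc
  set A : ℝ → ℝ := fun t => ∫ x in B, fA t x ∂μ with hA
  set D : ℝ → ℝ := fun t => ∫ x in B, fB t x ∂μ with hD
  set c : ℝ → ℝ := fun t => ∫ x in B, fc t x ∂μ with hc
  have hi : ∀ T, 0 < T → IntervalIntegrable A volume 0 T ∧ IntervalIntegrable D volume 0 T ∧
      IntervalIntegrable c volume 0 T := fun T hT => by
    obtain ⟨h1, h2, h3⟩ := h.integrable_flux hp hq hk hv T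
    exact ⟨(intervalIntegrable_iff_integrableOn_Ioo_of_le (f := A) hT.le).2 h1.integral_prod_left,
      (intervalIntegrable_iff_integrableOn_Ioo_of_le (f := D) hT.le).2 h2.integral_prod_left,
      (intervalIntegrable_iff_integrableOn_Ioo_of_le (f := c) hT.le).2 h3.integral_prod_left⟩
  have hv2 : MemLp v 2 (μ.restrict B) :=
    memLp_two_of_lintegral hv.measurable.aestronglyMeasurable (hv.lintegral_rpow_ne_top two_pos).1
  have hmd : ∀ x, MDifferentiableAt (𝓡 N) 𝓘(ℝ, ℝ) v x := fun x =>
    (hv.1 x).mdifferentiableAt (by simp)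
  have key := eq_add_integral_of_weak_deriv (a := fun t => ∫ x in B, u t x * v x ∂μ)
    (b := fun t => c t - A t - ε * D t) (a₀ := ∫ x in B, u₀ x * v x ∂μ)
    (continuousOn_integral_mul hu huc hv2)
    (fun T hT => ((hi T hT).2.2.sub (hi T hT).1).sub ((hi T hT).2.1.const_mul ε)) ?_ ht
  · refine key.trans ?_
    rw [sub_eq_add_neg, ← intervalIntegral.integral_neg]
    congr 1
    rw [intervalIntegral.integral_of_le ht, intervalIntegral.integral_of_le ht]
    refine setIntegral_congr_ae measurableSet_Ioc ?_
    obtain ⟨h1, h2, h3⟩ := h.integrable_flux hp hq hk hv (t + 1)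
    have a1 := (ae_restrict_iff' measurableSet_Ioo).1 h1.prod_right_ae
    have a2 := (ae_restrict_iff' measurableSet_Ioo).1 h2.prod_right_ae
    have a3 := (ae_restrict_iff' measurableSet_Ioo).1 h3.prod_right_ae
    filter_upwards [a1, a2, a3] with τ b1 b2 b3 hτ
    have hτ' : τ ∈ Ioo 0 (t + 1) := ⟨hτ.1, hτ.2.trans_lt (by linarith)⟩
    have b1 : Integrable (fA τ) (μ.restrict B) := b1 hτ'
    have b2 : Integrable (fB τ) (μ.restrict B) := b2 hτ'
    have b3 : Integrable (fc τ) (μ.restrict B) := b3 hτ'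
    have e : ∀ x, pairing p q ε k (GV τ x) (GU τ x) (U τ x) (v x) (grad (N := N) v x) =
      fA τ x + ε * fB τ x - fc τ x := fun x => rfl
    simp only [e]
    have b4 : Integrable (fun x => fA τ x + ε * fB τ x) (μ.restrict B) := b1.add (b2.const_mul ε)
    rw [integral_sub b4 b3, integral_add b1 (b2.const_mul ε),
      integral_const_mul]
    ring
  · intro T hT η hη hηc hηT
    have hw := hweak T hT _ (hv.isSpaceTimeTestFunction hη hηc hηT)
    have e1 : ∀ τ, ∫ x in B, u τ x * deriv (fun τ => η τ * v x) τ ∂μ =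
        (∫ x in B, u τ x * v x ∂μ) * deriv η τ := fun τ => by
      rw [← integral_mul_const]
      congr 1; ext x
      rw [deriv_mul_const_field]; ring
    have e2 : ∀ τ, ∫ x in B, ‖GV τ x‖ ^ (p - 2) *
        inner ℝ (GV τ x) (grad (N := N) (fun y => η τ * v y) x) ∂μ = A τ * η τ := fun τ => by
      rw [hA, ← integral_mul_const]
      congr 1; ext x
      rw [grad_const_mul (hmd x), inner_smul_right]; ring
    have e3 : ∀ τ, ∫ x in B, inner ℝ (GU τ x) (grad (N := N) (fun y => η τ * v y) x) ∂μ =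
        D τ * η τ := fun τ => by
      rw [hD, ← integral_mul_const]
      congr 1; ext x
      rw [grad_const_mul (hmd x), inner_smul_right]; ring
    have e4 : ∫ τ in (0)..T, ∫ x in B, truncation k (u τ x ^ q) * (η τ * v x) ∂μ =
        ∫ τ in (0)..T, c τ * η τ := by
      rw [intervalIntegral.integral_of_le hT.le, intervalIntegral.integral_of_le hT.le]
      refine setIntegral_congr_ae measurableSet_Ioc ?_
      filter_upwards [hUu] with τ h1 h2
      rw [hc, ← integral_mul_const]
      refine integral_congr_ae ?_
      filter_upwards [h1 h2.1] with x hx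
      rw [hfc]
      simp only
      rw [hx]; ring
    have e5 : ∫ x in B, u₀ x * (η 0 * v x) ∂μ = (∫ x in B, u₀ x * v x ∂μ) * η 0 := by
      rw [← integral_mul_const]
      congr 1; ext x; ring
    simp only [e1, e2, e3, e4, e5] at hw
    obtain ⟨i1, i2, i3⟩ := hi T hT
    have hηco : ContinuousOn η (uIcc 0 T) := hη.continuous.continuousOn
    have j1 := i1.mul_continuousOn hηco
    have j2 := i2.mul_continuousOn hηco
    have j3 := i3.mul_continuousOn hηco
    have e6 : ∫ τ in (0)..T, (c τ - A τ - ε * D τ) * η τ = (∫ τ in (0)..T, c τ * η τ) -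
        (∫ τ in (0)..T, A τ * η τ) - ε * ∫ τ in (0)..T, D τ * η τ := by
      rw [← intervalIntegral.integral_const_mul, ← intervalIntegral.integral_sub j3 j1,
        ← intervalIntegral.integral_sub (j3.sub j1) (j2.const_mul ε)]
      congr 1; ext τ
      ring
    rw [e6]
    linarith [hw]

end WeakFormulation

/-! ### Sign, initial value, and passage from solutions to weak evolutions -/

section Construction

variable {p m q ε k K : ℝ} {B : Set M} {U u : ℝ → M → ℝ} {u₀ : M → ℝ}
  {GU GV : ℝ → ∀ x : M, TangentSpace (𝓡 N) x}

theorem IsIntegratedSolution.isWeakEvolution (hs : IsIntegratedSolution p q ε k B u₀ U GU GV u)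
    (h : IsEvolution p m K B U GU GV) (hp : 1 < p) (hq : 1 < q) (hε : 0 < ε) (hk : 0 < k)
    (hUu : ∀ᵐ t, 0 < t → U t =ᵐ[(riemannianMeasure N M).restrict B] u t)
    (hu : ∀ t, 0 ≤ t → MemLp (u t) 2 ((riemannianMeasure N M).restrict B))
    (huc : ∀ t₀, 0 ≤ t₀ → Tendsto (fun t => eLpNorm (fun x => u t x - u t₀ x) 2
      ((riemannianMeasure N M).restrict B)) (𝓝[Ici 0] t₀) (𝓝 0)) :
    IsWeakEvolution p m q ε k K B U GU GV u where
  toIsEvolution := h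
  memLp := hu
  tendsto := huc
  ae_eq := hUu
  increment v hv t₁ t₂ ht₁ h12 := by
    have hv2 : MemLp v 2 ((riemannianMeasure N M).restrict B) :=
      memLp_two_of_lintegral hv.measurable.aestronglyMeasurable
        (hv.lintegral_rpow_ne_top two_pos).1
    have ht₂ := ht₁.trans h12
    simp only [sub_mul]
    rw [integral_sub (integrable_mul_of_memLp_two (hu t₂ ht₂) hv2)
      (integrable_mul_of_memLp_two (hu t₁ ht₁) hv2), hs v hv t₂ ht₂, hs v hv t₁ ht₁,
      ← intervalIntegral.integral_of_le h12]
    have hi : ∀ T, 0 ≤ T → IntervalIntegrable (fun τ => ∫ x in B, pairing p q ε k (GV τ x) (GU τ x)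
        (U τ x) (v x) (grad (N := N) v x) ∂(riemannianMeasure N M)) volume 0 T := fun T hT =>
      (intervalIntegrable_iff_integrableOn_Ioo_of_le hT).2
        (h.integrable_pairing hp hq hε hk hv.isTestPair
          (hv.lintegral_rpow_ne_top (zero_lt_one.trans hp)).2 (hv.lintegral_rpow_ne_top two_pos).2
          (hv.lintegral_rpow_ne_top two_pos).1 T).integral_prod_left
    rw [← intervalIntegral.integral_interval_sub_left (hi t₂ ht₂) (hi t₁ ht₁)]
    ring

/-- The sign is known at first only for almost every time. Where u(t) ≥ 0, the negative part of
u(t₀) is at most |u(t) - u(t₀)|; such times are dense, and L² continuity makes the negative part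
vanish. -/
theorem IsWeakEvolution.ae_nonneg (h : IsWeakEvolution p m q ε k K B U GU GV u) {t₀ : ℝ}
    (ht₀ : 0 ≤ t₀) : ∀ᵐ x ∂((riemannianMeasure N M).restrict B), 0 ≤ u t₀ x := by
  set ν := (riemannianMeasure N M).restrict B
  have hfr : ∃ᶠ t in 𝓝[Ici 0] t₀, eLpNorm (fun x => min (u t₀ x) 0) 2 ν ≤
      eLpNorm (fun x => u t x - u t₀ x) 2 ν := by
    have hle : 𝓝[>] t₀ ≤ 𝓝[Ici 0] t₀ := nhdsWithin_mono _ fun t ht => ht₀.trans (le_of_lt ht)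
    refine Frequently.filter_mono ?_ hle
    intro hne
    obtain ⟨b, hb, hbs⟩ := (mem_nhdsGT_iff_exists_Ioo_subset).1 hne
    obtain ⟨t, ht, htb⟩ := (Measure.dense_of_ae h.ae_eq).exists_between (mem_Ioi.1 hb)
    refine hbs htb (eLpNorm_mono_ae ?_)
    filter_upwards [ht (ht₀.trans_lt htb.1)] with x hx
    have h0 : 0 ≤ u t x := hx ▸ h.nonneg t x
    rw [Real.norm_eq_abs, Real.norm_eq_abs]
    rcases le_total (u t₀ x) 0 with h1 | h1
    · rw [min_eq_left h1, abs_of_nonpos h1, abs_of_nonneg (by linarith)]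
      linarith
    · rw [min_eq_right h1, abs_zero]
      exact abs_nonneg _
  have h0 : eLpNorm (fun x => min (u t₀ x) 0) 2 ν = 0 :=
    le_antisymm (ge_of_tendsto_of_frequently (h.tendsto t₀ ht₀) hfr) zero_le
  have hms : AEStronglyMeasurable (fun x => min (u t₀ x) 0) ν :=
    (h.memLp t₀ ht₀).1.inf aestronglyMeasurable_const
  rw [eLpNorm_eq_zero_iff hms (by norm_num)] at h0
  filter_upwards [h0] with x hx
  exact min_eq_right_iff.1 hx

theorem ae_eq_of_integral_mul_test (hB : IsOpen B) {f g : M → ℝ}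
    (hf : LocallyIntegrable f ((riemannianMeasure N M).restrict B))
    (hg : LocallyIntegrable g ((riemannianMeasure N M).restrict B))
    (h : ∀ v, IsTestFunction N B v → ∫ x in B, f x * v x ∂(riemannianMeasure N M) =
      ∫ x in B, g x * v x ∂(riemannianMeasure N M)) :
    f =ᵐ[(riemannianMeasure N M).restrict B] g := by
  have := ChartedSpace.locallyCompactSpace 𝔼 M
  have : SigmaCompactSpace M := inferInstance
  have hl : LocallyIntegrableOn (fun x => f x - g x) B (riemannianMeasure N M) :=
    locallyIntegrableOn_of_locallyIntegrable_restrict (hf.sub hg)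
  have key := hB.ae_eq_zero_of_integral_contMDiff_smul_eq_zero (𝓡 N) hl fun v h1 h2 h3 => by
    have hv : IsTestFunction N B v := ⟨h1, h2, h3⟩
    have i1 := hf.integrable_smul_left_of_hasCompactSupport h1.continuous h2
    have i2 := hg.integrable_smul_left_of_hasCompactSupport h1.continuous h2
    rw [← setIntegral_eq_integral_of_forall_compl_eq_zero (s := B)]
    · simp only [smul_eq_mul, mul_sub] at i1 i2 ⊢
      rw [integral_sub i1 i2, sub_eq_zero]
      simpa only [mul_comm] using h v hv
    · intro x hx
      have : v x = 0 := by
        by_contra h0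
        exact hx (h3 (subset_tsupport _ h0))
      rw [this, zero_smul]
  refine (ae_restrict_iff' hB.measurableSet).2 ?_
  filter_upwards [key] with x hx hxB
  exact sub_eq_zero.1 (hx hxB)

/-- The initial value is identified by the integrated equation at t = 0, where the time integral
drops out, together with the fundamental lemma of the calculus of variations. -/
theorem IsSolution.exists_isWeakEvolution (hsol : IsSolution N m p q ε k B u₀ u) (hB : IsOpen B)
    (hp : 1 < p) (hq : 1 < q) (hε : 0 < ε) (hk : 0 < k) (hc : ContinuousInLp N 2 B u)
    (hu₀ : MemLp u₀ ∞ ((riemannianMeasure N M).restrict B)) :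
    (∃ (K : ℝ) (U : ℝ → M → ℝ) (GU GV : ℝ → ∀ x : M, TangentSpace (𝓡 N) x),
      IsWeakEvolution p m q ε k K B U GU GV u) ∧
      u 0 =ᵐ[(riemannianMeasure N M).restrict B] u₀ := by
  obtain ⟨GV, GU, hV, hW, hweak⟩ := hsol.weak
  obtain ⟨K, U, hU, h0, hK, hUu⟩ := exists_bounded_representative hsol.nonneg hsol.bounded
  obtain ⟨hc1, hc2⟩ := hc
  rw [show ENNReal.ofReal 2 = 2 by simp] at hc1 hc2
  have h := isEvolution_of_memLpSobolevZero hU h0 hK hUu hV hW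
  have hs := isIntegratedSolution_of_weak h hp hq hk hUu hc1 hc2 hweak
  refine ⟨⟨K, U, GU, GV, hs.isWeakEvolution h hp hq hε hk hUu hc1 hc2⟩, ?_⟩
  refine ae_eq_of_integral_mul_test hB ((hc1 0 le_rfl).locallyIntegrable (by norm_num))
    (hu₀.locallyIntegrable le_top) fun v hv => ?_
  rw [hs v hv 0 le_rfl, intervalIntegral.integral_same, sub_zero]

end Construction

/-! ### Hölder interpolation of moments -/

section Interpolation

variable {X : Type*} [MeasurableSpace X] {ν : Measure X}

theorem lintegral_rpow_interpolation {f : X → ℝ≥0∞} (hf : AEMeasurable f ν) {a b θ η : ℝ}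
    (ha : 0 ≤ a) (hb : 0 ≤ b) (hθ : 0 ≤ θ) (hη : 0 ≤ η) (h : θ + η = 1) :
    ∫⁻ x, f x ^ (a * θ + b * η) ∂ν ≤ (∫⁻ x, f x ^ a ∂ν) ^ θ * (∫⁻ x, f x ^ b ∂ν) ^ η := by
  refine le_trans (le_of_eq ?_) (ENNReal.lintegral_mul_norm_pow_le (hf.pow_const a)
    (hf.pow_const b) hθ hη h)
  refine lintegral_congr fun x => ?_
  rw [ENNReal.rpow_add_of_nonneg _ _ (by positivity) (by positivity), ENNReal.rpow_mul,
    ENNReal.rpow_mul]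

theorem lintegral_rpow_interpolation_three {f : X → ℝ≥0∞} (hf : AEMeasurable f ν)
    {a b c θ η ζ : ℝ} (ha : 0 ≤ a) (hb : 0 ≤ b) (hc : 0 ≤ c) (hθ : 0 ≤ θ) (hη : 0 ≤ η)
    (hζ : 0 ≤ ζ) (h : θ + η + ζ = 1) :
    ∫⁻ x, f x ^ (a * θ + b * η + c * ζ) ∂ν ≤
      (∫⁻ x, f x ^ a ∂ν) ^ θ * (∫⁻ x, f x ^ b ∂ν) ^ η * (∫⁻ x, f x ^ c ∂ν) ^ ζ := by
  have key := ENNReal.lintegral_prod_norm_pow_le (μ := ν) (Finset.univ : Finset (Fin 3))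
    (f := ![fun x => f x ^ a, fun x => f x ^ b, fun x => f x ^ c]) (p := ![θ, η, ζ])
    (by
      intro i _
      fin_cases i
      · exact hf.pow_const a
      · exact hf.pow_const b
      · exact hf.pow_const c)
    (by simpa [Fin.sum_univ_three] using h)
    (by
      intro i _
      fin_cases i <;> assumption)
  simp only [Fin.prod_univ_three] at key
  refine le_trans (le_of_eq ?_) key
  refine lintegral_congr fun x => ?_
  rw [ENNReal.rpow_add_of_nonneg _ _ (by positivity) (by positivity),
    ENNReal.rpow_add_of_nonneg _ _ (by positivity) (by positivity), ENNReal.rpow_mul,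
    ENNReal.rpow_mul, ENNReal.rpow_mul]
  rfl

theorem tendsto_lintegral_rpow_of_eLpNorm_sub {ι : Type*} {l : Filter ι} {r : ℝ} (hr : 1 ≤ r)
    {w : ι → X → ℝ} {w₀ : X → ℝ} (hw : ∀ᶠ i in l, AEStronglyMeasurable (w i) ν)
    (hw₀ : MemLp w₀ (ENNReal.ofReal r) ν)
    (h : Tendsto (fun i => eLpNorm (fun x => w i x - w₀ x) (ENNReal.ofReal r) ν) l (𝓝 0)) :
    Tendsto (fun i => ∫⁻ x, ‖w i x‖ₑ ^ r ∂ν) l (𝓝 (∫⁻ x, ‖w₀ x‖ₑ ^ r ∂ν)) := by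
  have hr0 : 0 < r := by linarith
  have hr1 : 1 ≤ ENNReal.ofReal r := by rwa [ENNReal.one_le_ofReal]
  have e : ∀ f : X → ℝ, ∫⁻ x, ‖f x‖ₑ ^ r ∂ν = eLpNorm f (ENNReal.ofReal r) ν ^ r := fun f => by
    rw [eLpNorm_eq_lintegral_rpow_enorm_toReal (by simpa using hr0) ENNReal.ofReal_ne_top,
      ENNReal.toReal_ofReal hr0.le, ← ENNReal.rpow_mul, one_div, inv_mul_cancel₀ hr0.ne',
      ENNReal.rpow_one]
  simp only [e]
  refine (ENNReal.continuous_rpow_const.tendsto _).comp ?_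
  have h1 := ENNReal.Tendsto.sub (tendsto_const_nhds (x := eLpNorm w₀ (ENNReal.ofReal r) ν)) h
    (Or.inl hw₀.2.ne)
  have h2 := (tendsto_const_nhds (x := eLpNorm w₀ (ENNReal.ofReal r) ν)).add h
  rw [tsub_zero] at h1
  rw [add_zero] at h2
  refine tendsto_of_tendsto_of_tendsto_of_le_of_le' h1 h2 ?_ ?_
  · filter_upwards [hw] with i hi
    refine tsub_le_iff_right.2 ?_
    have := eLpNorm_add_le hi (hw₀.1.sub hi) hr1
    rw [add_sub_cancel] at this
    refine this.trans (add_le_add le_rfl ?_)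
    rw [eLpNorm_sub_comm]
    rfl
  · filter_upwards [hw] with i hi
    have := eLpNorm_add_le hw₀.1 (hi.sub hw₀.1) hr1
    rw [add_sub_cancel] at this
    exact this

end Interpolation

/-! ### Persistence of smallness -/

section Barrier

/-- At the first time σ with y(σ) ≥ η, continuity gives y ≤ η on [0, σ]. Then the conditional
monotonicity, extended to the starting time 0 by continuity, gives y(σ) ≤ y(0) < η, a contradiction.
-/
theorem lt_of_continuousOn_of_le {y : ℝ → ℝ} {η : ℝ} (hc : ContinuousOn y (Ici 0)) (h0 : y 0 < η)
    (h : ∀ t₁ t₂, 0 < t₁ → t₁ ≤ t₂ → (∀ t ∈ Icc t₁ t₂, y t ≤ η) → y t₂ ≤ y t₁) {t : ℝ}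
    (ht : 0 ≤ t) : y t < η := by
  by_contra! hcon
  set S := Ici (0 : ℝ) ∩ y ⁻¹' Ici η with hS
  have hSc : IsClosed S := hc.preimage_isClosed_of_isClosed isClosed_Ici isClosed_Ici
  have hSb : BddBelow S := ⟨0, fun z hz => hz.1⟩
  have hmem : sInf S ∈ S := hSc.csInf_mem ⟨t, ht, hcon⟩ hSb
  set σ := sInf S
  have hlt : ∀ z, 0 ≤ z → z < σ → y z < η := fun z hz hzσ => by
    by_contra! hz'
    exact absurd (csInf_le hSb ⟨hz, hz'⟩) (not_le.2 hzσ)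
  have hσ0 : 0 < σ := by
    refine lt_of_le_of_ne hmem.1 fun h' => ?_
    have := hmem.2
    rw [← h'] at this
    exact absurd h0 (not_lt.2 this)
  have hσ : y σ ≤ η := by
    have h1 : Tendsto y (𝓝[Ico 0 σ] σ) (𝓝 (y σ)) :=
      (hc σ hmem.1).mono_left (nhdsWithin_mono _ fun z hz => hz.1)
    have : (𝓝[Ico 0 σ] σ).NeBot := by
      rw [← mem_closure_iff_nhdsWithin_neBot, closure_Ico hσ0.ne]
      exact ⟨hσ0.le, le_rfl⟩
    refine le_of_tendsto h1 ?_
    filter_upwards [self_mem_nhdsWithin] with z hz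
    exact (hlt z hz.1 hz.2).le
  have h1 : Tendsto y (𝓝[>] 0) (𝓝 (y 0)) :=
    (hc 0 self_mem_Ici).mono_left (nhdsWithin_mono _ Ioi_subset_Ici_self)
  have h2 : y σ ≤ y 0 := by
    refine ge_of_tendsto h1 ?_
    filter_upwards [Ioo_mem_nhdsGT hσ0] with z hz
    refine h z σ hz.1 hz.2.le fun τ hτ => ?_
    rcases hτ.2.eq_or_lt with h' | h'
    · rw [h']; exact hσ
    · exact (hlt τ (hz.1.le.trans hτ.1) h').le
  have h3 : η ≤ y σ := hmem.2
  linarith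

end Barrier

/-! ### Absorption of the source by the dissipation -/

section Dissipation

variable {p m q ε k K : ℝ} {B : Set M} {U u : ℝ → M → ℝ}
  {GU GV : ℝ → ∀ x : M, TangentSpace (𝓡 N) x}

/-- The constant of the absorption inequality. -/
def absorptionConst (m p q Sp Cp : ℝ) : ℝ :=
  (1 / Cp) ^ (p * (m * (p - 1) / q)) * (1 / Sp) ^ (p * ((q - m * (p - 1)) / q))

theorem IsSlice.lintegral_rpow_le_of_poincare {Cp : ℝ} {w : M → ℝ}
    {gU gV : ∀ x : M, TangentSpace (𝓡 N) x} (h : IsSlice p m B w gU gV) (hp : 1 < p) (hm : 1 < m)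
    (hB : MeasurableSet B) (hP : PoincareInequality N M p Cp) {β : ℝ} (hβ : 0 < β) :
    ∫⁻ x in B, ‖w x‖ₑ ^ (β * p) ∂(riemannianMeasure N M) ≤ ENNReal.ofReal (1 / Cp) ^ p *
      ∫⁻ x in B, {x | 0 < w x}.indicator (fun x => (‖β * w x ^ (β - 1)‖ₑ * ‖gU x‖ₑ) ^ p) x
        ∂(riemannianMeasure N M) := by
  have hp0 : 0 < p := by linarith
  have h1 := h.lintegral_rpow_le hp0 hp.le hm hB hP hβ
  rw [ENNReal.mul_rpow_of_nonneg _ _ hp0.le, ← ENNReal.rpow_mul, one_div_mul_cancel hp0.ne',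
    ENNReal.rpow_one] at h1
  refine le_trans (le_of_eq (lintegral_congr fun x => ?_)) h1
  rw [Real.enorm_rpow_of_nonneg (h.nonneg x) hβ.le, ENNReal.rpow_mul]

/-- The power q + r - 1 is split by Hölder between the exponents qN/p, βp and βp*, where p* =
pN/(N-p). Poincaré controls the second factor and Sobolev the third; they contribute the dissipation
to the powers m(p-1)/q and (q-m(p-1))/q, which add up to one. That linearity is what permits
absorption and singles out qN/p as the norm to be small. -/
theorem IsSlice.lintegral_rpow_le_of_sobolev {Sp Cp : ℝ} {w : M → ℝ}
    {gU gV : ∀ x : M, TangentSpace (𝓡 N) x} (h : IsSlice p m B w gU gV) (hp : 1 < p) (hm : 1 < m)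
    (hpN : p < N) (hmp : 1 < m * (p - 1)) (hq : m * (p - 1) < q) (hSp : 0 < Sp) (hCp : 0 < Cp)
    (hB : MeasurableSet B) (hS : SobolevInequality N M p Sp) (hP : PoincareInequality N M p Cp)
    {r β : ℝ} (hr : 1 < r) (hβ : β * p = m * (p - 1) + r - 1) :
    ∫⁻ x in B, ‖w x‖ₑ ^ (q + r - 1) ∂(riemannianMeasure N M) ≤
      (∫⁻ x in B, ‖w x‖ₑ ^ (q * N / p) ∂(riemannianMeasure N M)) ^
        (p * (q - m * (p - 1)) / (q * N)) *
      ENNReal.ofReal (absorptionConst m p q Sp Cp) *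
      ∫⁻ x in B, {x | 0 < w x}.indicator (fun x => (‖β * w x ^ (β - 1)‖ₑ * ‖gU x‖ₑ) ^ p) x
        ∂(riemannianMeasure N M) := by
  have hp0 : 0 < p := by linarith
  have hN : (0 : ℝ) < N := by linarith
  have hNp : 0 < N - p := by linarith
  have hq0 : 0 < q := by linarith
  have hκ : 0 < q - m * (p - 1) := by linarith
  have hβ0 : 0 < β := by
    have : 0 < β * p := by rw [hβ]; linarith
    exact pos_of_mul_pos_left this hp0.le
  set Q := ∫⁻ x in B, {x | 0 < w x}.indicator (fun x => (‖β * w x ^ (β - 1)‖ₑ * ‖gU x‖ₑ) ^ p) x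
        ∂(riemannianMeasure N M) with hQ
  set θ := p * (q - m * (p - 1)) / (q * N) with hθ
  set a := p * N / (N - p) with ha
  set ζ := (q - m * (p - 1)) * (N - p) / (q * N) with hζ
  have ha0 : 0 < a := by positivity
  have hmp0 : 0 < m * (p - 1) := by linarith
  have hζ0 : 0 < ζ := by positivity
  have hη0 : 0 < m * (p - 1) / q := by positivity
  have h2 := h.lintegral_rpow_le_of_poincare hp hm hB hP hβ0
  have h3 := h.lintegral_rpow_le ha0 hp.le hm hB hS hβ0
  rw [← hQ] at h2 h3
  have e3 : ∫⁻ x in B, ‖w x ^ β‖ₑ ^ a ∂(riemannianMeasure N M) =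
      ∫⁻ x in B, ‖w x‖ₑ ^ (β * a) ∂(riemannianMeasure N M) := lintegral_congr fun x => by
    rw [Real.enorm_rpow_of_nonneg (h.nonneg x) hβ0.le, ENNReal.rpow_mul]
  rw [e3] at h3
  have key := lintegral_rpow_interpolation_three (ν := (riemannianMeasure N M).restrict B)
    (f := fun x => ‖w x‖ₑ) h.measurable.enorm.aemeasurable (a := q * N / p) (b := β * p)
    (c := β * a) (θ := θ) (η := m * (p - 1) / q) (ζ := ζ) (by positivity) (by positivity)
    (by positivity) (by positivity) hη0.le hζ0.le (by rw [hθ, hζ]; field_simp; ring)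
  -- The first factor contributes q - m(p-1); the other two together contribute βp = m(p-1) + r - 1.
  have hexp : q * N / p * θ + β * p * (m * (p - 1) / q) + β * a * ζ = q + r - 1 := by
    have : β * a * ζ = β * p * ((q - m * (p - 1)) / q) := by
      rw [ha, hζ]; field_simp
    rw [this, hβ, hθ]; field_simp; ring
  rw [hexp] at key
  refine key.trans ?_
  rw [mul_assoc, mul_assoc]
  refine mul_le_mul' le_rfl ?_
  calc _ ≤ (ENNReal.ofReal (1 / Cp) ^ p * Q) ^ (m * (p - 1) / q) *
        ((ENNReal.ofReal (1 / Sp) * Q ^ (1 / p)) ^ a) ^ ζ := by gcongr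
    _ = (ENNReal.ofReal (1 / Cp) ^ (p * (m * (p - 1) / q)) * Q ^ (m * (p - 1) / q)) *
        (ENNReal.ofReal (1 / Sp) ^ (p * ((q - m * (p - 1)) / q)) *
          Q ^ ((q - m * (p - 1)) / q)) := by
        have e1 : a * ζ = p * ((q - m * (p - 1)) / q) := by rw [ha, hζ]; field_simp
        have e2 : 1 / p * (p * ((q - m * (p - 1)) / q)) = (q - m * (p - 1)) / q := by
          field_simp
        rw [ENNReal.mul_rpow_of_nonneg _ _ hη0.le, ← ENNReal.rpow_mul, ← ENNReal.rpow_mul, e1,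
          ENNReal.mul_rpow_of_nonneg _ _ (by positivity), ← ENNReal.rpow_mul, e2]
    _ = _ := by
        have e4 : Q ^ (m * (p - 1) / q) * Q ^ ((q - m * (p - 1)) / q) = Q := by
          rw [← ENNReal.rpow_add_of_nonneg _ _ hη0.le (by positivity), ← add_div,
            add_sub_cancel, div_self hq0.ne', ENNReal.rpow_one]
        rw [absorptionConst, ENNReal.ofReal_mul (by positivity),
          ENNReal.ofReal_rpow_of_pos (by positivity), ENNReal.ofReal_rpow_of_pos (by positivity)]
        rw [mul_mul_mul_comm, e4]

end Dissipation

/-! ### The differential inequality for moments, in integrated form -/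

section Moments

variable {p m q ε k K : ℝ} {B : Set M} {U u : ℝ → M → ℝ}
  {GU GV : ℝ → ∀ x : M, TangentSpace (𝓡 N) x}

variable (N) in
/-- The integral of `|u(t)|^r` over `B`. -/
def moment (B : Set M) (u : ℝ → M → ℝ) (r t : ℝ) : ℝ≥0∞ :=
  ∫⁻ x in B, ‖u t x‖ₑ ^ r ∂(riemannianMeasure N M)

theorem moment_eq_eLpNorm_rpow {r : ℝ} (hr : 0 < r) (t : ℝ) : moment N B u r t =
    eLpNorm (u t) (ENNReal.ofReal r) ((riemannianMeasure N M).restrict B) ^ r := by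
  rw [eLpNorm_eq_lintegral_rpow_enorm_toReal (by simpa using hr) ENNReal.ofReal_ne_top,
    ENNReal.toReal_ofReal hr.le, ← ENNReal.rpow_mul, one_div_mul_cancel hr.ne', ENNReal.rpow_one,
    moment]

theorem ContinuousInLp.moment_ne_top {r : ℝ} (hr : 1 < r) (h : ContinuousInLp N r B u) {t : ℝ}
    (ht : 0 ≤ t) : moment N B u r t ≠ ⊤ := by
  rw [moment_eq_eLpNorm_rpow (by linarith)]
  exact ENNReal.rpow_ne_top_of_nonneg (by linarith) (h.1 t ht).2.ne

theorem ContinuousInLp.continuousOn_moment {r : ℝ} (hr : 1 < r) (h : ContinuousInLp N r B u) :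
    ContinuousOn (moment N B u r) (Ici 0) := fun t ht =>
  tendsto_lintegral_rpow_of_eLpNorm_sub hr.le
    (by filter_upwards [self_mem_nhdsWithin] with τ hτ using (h.1 τ hτ).1) (h.1 t ht) (h.2 t ht)

theorem ContinuousInLp.lintegral_moment_ne_top {r : ℝ} (hr : 1 < r) (h : ContinuousInLp N r B u)
    {t₁ t₂ : ℝ} (ht₁ : 0 ≤ t₁) : ∫⁻ t in Ioc t₁ t₂, moment N B u r t ≠ ⊤ := by
  rcases lt_or_ge t₂ t₁ with h12 | h12
  · simp [Ioc_eq_empty_of_le h12.le]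
  obtain ⟨t₀, ht₀, hmax⟩ := isCompact_Icc.exists_isMaxOn (nonempty_Icc.2 h12)
    ((h.continuousOn_moment hr).mono fun t ht => ht₁.trans ht.1)
  refine (lt_of_le_of_lt (setLIntegral_mono measurable_const
    fun t ht => isMaxOn_iff.1 hmax t ⟨ht.1.le, ht.2⟩) ?_).ne
  rw [setLIntegral_const]
  exact ENNReal.mul_lt_top (h.moment_ne_top hr (ht₁.trans ht₀.1)).lt_top (by simp)

theorem IsWeakEvolution.ae_moment_eq (h : IsWeakEvolution p m q ε k K B U GU GV u) (r : ℝ) :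
    ∀ᵐ t, 0 < t → ∫⁻ x in B, ‖U t x‖ₑ ^ r ∂(riemannianMeasure N M) = moment N B u r t := by
  filter_upwards [h.ae_eq] with t ht h0
  refine lintegral_congr_ae ?_
  filter_upwards [ht h0] with x hx
  rw [hx]

/-- The dissipation constant of the energy inequality for the `r`-th moment. -/
def dissipationConst (m p r : ℝ) : ℝ :=
  (r - 1) * m ^ (p - 1) / ((m * (p - 1) + r - 1) / p) ^ p

theorem dissipationConst_pos (hm : 0 < m) (hp : 1 < p) {r : ℝ} (hr : 1 < r) :
    0 < dissipationConst m p r := by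
  have h1 : 0 < r - 1 := by linarith
  have h2 : 0 < p - 1 := by linarith
  have h3 : 0 < m * (p - 1) + r - 1 := by nlinarith [mul_pos hm h2]
  unfold dissipationConst
  positivity

/-- Half of the dissipation absorbs the source, by smallness of the qN/p-th moment. By Poincaré the
other half dominates the moment of order βp = m(p-1) + r - 1. -/
theorem IsWeakEvolution.moment_add_le {Sp Cp : ℝ}
    (h : IsWeakEvolution p m q ε k K B U GU GV u) (hp : 1 < p) (hm : 1 < m) (hpN : p < N)
    (hmp : 1 < m * (p - 1)) (hq : m * (p - 1) < q) (hε : 0 < ε) (hk : 0 < k) (hSp : 0 < Sp)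
    (hCp : 0 < Cp) (hB : MeasurableSet B) (hS : SobolevInequality N M p Sp)
    (hP : PoincareInequality N M p Cp) (hu : ∀ r, 1 < r → ContinuousInLp N r B u) {r : ℝ}
    (hr : 1 < r) {η : ℝ≥0∞}
    (hη : η ^ (p * (q - m * (p - 1)) / (q * N)) * ENNReal.ofReal (absorptionConst m p q Sp Cp) ≤
      ENNReal.ofReal (dissipationConst m p r / 2)) {t₁ t₂ : ℝ} (ht₁ : 0 < t₁) (ht : t₁ ≤ t₂)
    (hsmall : ∀ t ∈ Icc t₁ t₂, moment N B u (q * N / p) t ≤ η) :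
    ENNReal.ofReal (1 / r) * moment N B u r t₂ +
      ENNReal.ofReal (dissipationConst m p r / 2 * Cp ^ p) *
        ∫⁻ t in Ioc t₁ t₂, moment N B u (m * (p - 1) + r - 1) t ≤
    ENNReal.ofReal (1 / r) * moment N B u r t₁ := by
  have hp0 : 0 < p := by linarith
  have hq0 : 1 < q := by linarith
  have hN : (0 : ℝ) < N := by linarith
  set β := (m * (p - 1) + r - 1) / p with hβd
  have hβ : β * p = m * (p - 1) + r - 1 := by rw [hβd]; field_simp
  have hβ0 : 0 < β := div_pos (by linarith) hp0
  have hc := dissipationConst_pos (zero_lt_one.trans hm) hp hr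
  set c := dissipationConst m p r with hcd
  set D : ℝ → ℝ≥0∞ := fun t => ∫⁻ x in B, dissipationDensity p β U GU t x ∂(riemannianMeasure N M)
    with hD
  set X := ∫⁻ t in Ioc t₁ t₂, D t with hX
  set Z := ∫⁻ t in Ioc t₁ t₂, (∫⁻ x in B, ‖U t x‖ₑ ^ (q + r - 1) ∂(riemannianMeasure N M)) with hZ
  have energy := h.lintegral_rpow_add_le hp hm hq0 hε hk hB (fun t ht => h.ae_nonneg ht) hr hβ ht₁ ht
  have hmem : ∀ t ∈ Ioc t₁ t₂, 0 < t := fun t ht => ht₁.trans ht.1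
  have hZX : Z ≤ ENNReal.ofReal (c / 2) * X := by
    rw [hX, ← lintegral_const_mul' _ _ ENNReal.ofReal_ne_top]
    refine setLIntegral_mono_ae' measurableSet_Ioc ?_
    filter_upwards [h.isSlice, h.ae_moment_eq (q * N / p)] with t h1 h2 htm
    refine ((h1 (hmem t htm)).lintegral_rpow_le_of_sobolev hp hm hpN hmp hq hSp hCp hB hS hP hr
      hβ).trans ?_
    refine mul_le_mul' (le_trans ?_ hη) le_rfl
    rw [h2 (hmem t htm)]
    refine mul_le_mul' (ENNReal.rpow_le_rpow (hsmall t ⟨htm.1.le, htm.2⟩) ?_) le_rfl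
    have : 0 < q - m * (p - 1) := by linarith
    positivity
  have hZ' : Z ≠ ⊤ := by
    have : Z = ∫⁻ t in Ioc t₁ t₂, moment N B u (q + r - 1) t := by
      refine setLIntegral_congr_fun_ae measurableSet_Ioc ?_
      filter_upwards [h.ae_moment_eq (q + r - 1)] with t h1 htm
      exact h1 (hmem t htm)
    rw [this]
    exact (hu _ (by linarith)).lintegral_moment_ne_top (by linarith) ht₁.le
  have hA1 : ENNReal.ofReal (1 / r) * moment N B u r t₁ ≠ ⊤ :=
    ENNReal.mul_ne_top ENNReal.ofReal_ne_top ((hu r hr).moment_ne_top hr ht₁.le)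
  have energy' : ENNReal.ofReal (1 / r) * moment N B u r t₂ + ENNReal.ofReal c * X ≤
      ENNReal.ofReal (1 / r) * moment N B u r t₁ + Z := energy
  -- Cancelling half of the dissipation requires it to be finite. The energy inequality itself gives
  -- this, since the source is finite by continuity of u in L^(q+r-1).
  have hX' : ENNReal.ofReal (c / 2) * X ≠ ⊤ := by
    have h1 : ENNReal.ofReal c * X ≠ ⊤ :=
      ((le_add_self.trans energy').trans_lt (ENNReal.add_lt_top.2 ⟨hA1.lt_top, hZ'.lt_top⟩)).ne
    refine ((mul_le_mul' (ENNReal.ofReal_le_ofReal ?_) le_rfl).trans_lt h1.lt_top).ne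
    linarith
  have hcc : ENNReal.ofReal c * X = ENNReal.ofReal (c / 2) * X + ENNReal.ofReal (c / 2) * X := by
    rw [← add_mul, ← ENNReal.ofReal_add (by positivity) (by positivity), add_halves]
  rw [hcc, ← add_assoc] at energy'
  have energy'' := (ENNReal.add_le_add_iff_right hX').1
    (energy'.trans (add_le_add le_rfl hZX))
  refine le_trans (add_le_add le_rfl ?_) energy''
  rw [ENNReal.ofReal_mul (by positivity), mul_assoc]
  refine mul_le_mul' le_rfl ?_
  rw [hX, ← lintegral_const_mul' _ _ ENNReal.ofReal_ne_top]
  refine setLIntegral_mono_ae' measurableSet_Ioc ?_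
  filter_upwards [h.isSlice, h.ae_moment_eq (m * (p - 1) + r - 1)] with t h1 h2 htm
  rw [← h2 (hmem t htm), ← hβ]
  have h3 := (h1 (hmem t htm)).lintegral_rpow_le_of_poincare hp hm hB hP hβ0
  calc _ ≤ ENNReal.ofReal (Cp ^ p) * (ENNReal.ofReal (1 / Cp) ^ p * D t) := mul_le_mul' le_rfl h3
    _ = D t := by
        rw [← mul_assoc, ← ENNReal.ofReal_rpow_of_pos hCp,
          ← ENNReal.mul_rpow_of_nonneg _ _ hp0.le, ← ENNReal.ofReal_mul hCp.le,
          mul_one_div_cancel hCp.ne', ENNReal.ofReal_one, ENNReal.one_rpow, one_mul]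

end Moments

/-! ### Decay of the s-th moment -/

section Decay

variable {p m q ε k K : ℝ} {B : Set M} {U u : ℝ → M → ℝ} {u₀ : M → ℝ}
  {GU GV : ℝ → ∀ x : M, TangentSpace (𝓡 N) x}

theorem le_of_ofReal_mul_add_le {c : ℝ} (hc : 0 < c) {a b d : ℝ≥0∞}
    (h : ENNReal.ofReal c * a + d ≤ ENNReal.ofReal c * b) : a ≤ b :=
  (ENNReal.mul_le_mul_iff_right (by simpa using hc) ENNReal.ofReal_ne_top).1
    (le_self_add.trans h)

theorem ContinuousInLp.moment_le_moment_zero {r : ℝ} (hr : 1 < r) (hu : ContinuousInLp N r B u)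
    (h : ∀ t₁ t₂, 0 < t₁ → t₁ ≤ t₂ → moment N B u r t₂ ≤ moment N B u r t₁) {t : ℝ} (ht : 0 ≤ t) :
    moment N B u r t ≤ moment N B u r 0 := by
  rcases ht.eq_or_lt with rfl | ht
  · exact le_rfl
  have h1 : Tendsto (moment N B u r) (𝓝[>] 0) (𝓝 (moment N B u r 0)) :=
    (hu.continuousOn_moment hr 0 self_mem_Ici).mono_left (nhdsWithin_mono _ Ioi_subset_Ici_self)
  refine ge_of_tendsto h1 ?_
  filter_upwards [Ioc_mem_nhdsGT ht] with τ hτ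
  exact h τ t hτ.1 hτ.2

theorem ContinuousInLp.continuousOn_toReal_moment {r : ℝ} (hr : 1 < r)
    (hu : ContinuousInLp N r B u) :
    ContinuousOn (fun t => (moment N B u r t).toReal) (Ici 0) := fun t ht =>
  (ENNReal.tendsto_toReal (hu.moment_ne_top hr ht)).comp (hu.continuousOn_moment hr t ht)

/-- Interpolation of s between s₀ and s + δ, raised to the power (s+δ-s₀)/(s-s₀), so that the
highest moment appears linearly. -/
theorem moment_rpow_le {s₀ s δ : ℝ} (hs₀ : 1 < s₀) (hs : s₀ < s) (hδ : 0 < δ) {t : ℝ}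
    (hm : AEStronglyMeasurable (u t) ((riemannianMeasure N M).restrict B)) :
    moment N B u s t ^ (1 + δ / (s - s₀)) ≤
      moment N B u s₀ t ^ (δ / (s - s₀)) * moment N B u (s + δ) t := by
  have h1 : 0 < s - s₀ := by linarith
  have h2 : 0 < s + δ - s₀ := by linarith
  have key := lintegral_rpow_interpolation hm.enorm (a := s₀) (b := s + δ)
    (θ := δ / (s + δ - s₀)) (η := (s - s₀) / (s + δ - s₀)) (by linarith) (by linarith)
    (by positivity) (by positivity) (by field_simp; ring)
  rw [show s₀ * (δ / (s + δ - s₀)) + (s + δ) * ((s - s₀) / (s + δ - s₀)) = s by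
    field_simp; ring] at key
  refine (ENNReal.rpow_le_rpow key (by positivity)).trans (le_of_eq ?_)
  rw [ENNReal.mul_rpow_of_nonneg _ _ (by positivity), ← ENNReal.rpow_mul, ← ENNReal.rpow_mul,
    show δ / (s + δ - s₀) * (1 + δ / (s - s₀)) = δ / (s - s₀) by field_simp; ring,
    show (s - s₀) / (s + δ - s₀) * (1 + δ / (s - s₀)) = 1 by field_simp; ring, ENNReal.rpow_one]
  rfl

/-- The time integral of the moment of order s + δ is bounded below by interpolation, using that the
s-th moment is at least its final value on the interval and that the s₀-th is at most its initial
value. This produces the hypothesis of `rpow_decay`. -/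
theorem toReal_moment_add_le {s₀ s δ c : ℝ} (hs₀ : 1 < s₀) (hs : s₀ < s) (hδ : 0 < δ) (hc : 0 < c)
    (hu : ∀ r, 1 < r → ContinuousInLp N r B u)
    (h₀ : ∀ t, 0 ≤ t → moment N B u s₀ t ≤ moment N B u s₀ 0)
    (hpos : 0 < (moment N B u s₀ 0).toReal)
    (h : ∀ t₁ t₂, 0 < t₁ → t₁ ≤ t₂ → ENNReal.ofReal (1 / s) * moment N B u s t₂ +
      ENNReal.ofReal c * ∫⁻ t in Ioc t₁ t₂, moment N B u (s + δ) t ≤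
        ENNReal.ofReal (1 / s) * moment N B u s t₁) {t₁ t₂ : ℝ} (ht₁ : 0 < t₁) (ht : t₁ ≤ t₂) :
    (moment N B u s t₂).toReal + s * c / (moment N B u s₀ 0).toReal ^ (δ / (s - s₀)) * (t₂ - t₁) *
      (moment N B u s t₂).toReal ^ (1 + δ / (s - s₀)) ≤ (moment N B u s t₁).toReal := by
  have hs1 : 1 < s := hs₀.trans hs
  have hs0 : 0 < s := by linarith
  have hss : 0 < s - s₀ := by linarith
  have ha : 0 < δ / (s - s₀) := by positivity
  set a := δ / (s - s₀) with had
  set A := (moment N B u s₀ 0).toReal with hA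
  have hAe : moment N B u s₀ 0 = ENNReal.ofReal A :=
    (ENNReal.ofReal_toReal ((hu s₀ hs₀).moment_ne_top hs₀ le_rfl)).symm
  set I := ∫⁻ t in Ioc t₁ t₂, moment N B u (s + δ) t with hI
  have hIt : I ≠ ⊤ := (hu _ (by linarith)).lintegral_moment_ne_top (by linarith) ht₁.le
  have hanti : ∀ τ₁ τ₂, 0 < τ₁ → τ₁ ≤ τ₂ → moment N B u s τ₂ ≤ moment N B u s τ₁ :=
    fun τ₁ τ₂ h1 h2 => le_of_ofReal_mul_add_le (by positivity) (h τ₁ τ₂ h1 h2)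
  have hI1 : ENNReal.ofReal (t₂ - t₁) * moment N B u s t₂ ^ (1 + a) ≤
      ENNReal.ofReal A ^ a * I := by
    rw [hI, ← lintegral_const_mul' _ _ (by finiteness), mul_comm,
      ← Real.volume_Ioc, ← setLIntegral_const]
    refine setLIntegral_mono' measurableSet_Ioc fun t htm => ?_
    have ht0 : 0 < t := ht₁.trans htm.1
    calc moment N B u s t₂ ^ (1 + a) ≤ moment N B u s t ^ (1 + a) :=
          ENNReal.rpow_le_rpow (hanti t t₂ ht0 htm.2) (by positivity)
      _ ≤ moment N B u s₀ t ^ a * moment N B u (s + δ) t :=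
          moment_rpow_le hs₀ hs hδ ((hu s hs1).1 t ht0.le).1
      _ ≤ _ := mul_le_mul' (ENNReal.rpow_le_rpow ((h₀ t ht0.le).trans hAe.le) ha.le) le_rfl
  have hI2 : (t₂ - t₁) * (moment N B u s t₂).toReal ^ (1 + a) ≤ A ^ a * I.toReal := by
    have := ENNReal.toReal_mono (by finiteness) hI1
    rwa [ENNReal.toReal_mul, ENNReal.toReal_mul, ENNReal.toReal_ofReal (by linarith),
      ← ENNReal.toReal_rpow, ← ENNReal.toReal_rpow, ENNReal.toReal_ofReal hpos.le] at this
  have m1 := (hu s hs1).moment_ne_top hs1 ht₁.le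
  have m2 := (hu s hs1).moment_ne_top hs1 (ht₁.le.trans ht)
  have hE : 1 / s * (moment N B u s t₂).toReal + c * I.toReal ≤
      1 / s * (moment N B u s t₁).toReal := by
    have := ENNReal.toReal_mono (by finiteness) (h t₁ t₂ ht₁ ht)
    rwa [ENNReal.toReal_add (by finiteness) (by finiteness), ENNReal.toReal_mul,
      ENNReal.toReal_mul, ENNReal.toReal_mul, ENNReal.toReal_ofReal (by positivity),
      ENNReal.toReal_ofReal hc.le] at this
  have hAa : 0 < A ^ a := by positivity
  have h3 : s * c / A ^ a * (t₂ - t₁) * (moment N B u s t₂).toReal ^ (1 + a) ≤ s * c * I.toReal := by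
    calc _ = s * c / A ^ a * ((t₂ - t₁) * (moment N B u s t₂).toReal ^ (1 + a)) := by ring
      _ ≤ s * c / A ^ a * (A ^ a * I.toReal) := by gcongr
      _ = _ := by field_simp
  have h4 := mul_le_mul_of_nonneg_left hE hs0.le
  have e1 : s * (1 / s * (moment N B u s t₂).toReal + c * I.toReal) =
      (moment N B u s t₂).toReal + s * c * I.toReal := by field_simp
  have e2 : s * (1 / s * (moment N B u s t₁).toReal) = (moment N B u s t₁).toReal := by
    field_simp
  rw [e1, e2] at h4
  linarith

/-- The constant of the smoothing estimate for `s₀ < s`. -/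
def smoothingConst (m p s₀ s Cp : ℝ) : ℝ :=
  ((2 ^ (1 + 1 / ((m * (p - 1) - 1) / (s - s₀))) / (s * (dissipationConst m p s / 2 * Cp ^ p))) ^
    (1 / ((m * (p - 1) - 1) / (s - s₀)))) ^ (1 / s)

theorem toReal_moment_le {s₀ s δ c : ℝ} (hs₀ : 1 < s₀) (hs : s₀ < s) (hδ : 0 < δ) (hc : 0 < c)
    (hu : ∀ r, 1 < r → ContinuousInLp N r B u)
    (h₀ : ∀ t, 0 ≤ t → moment N B u s₀ t ≤ moment N B u s₀ 0)
    (hpos : 0 < (moment N B u s₀ 0).toReal)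
    (h : ∀ t₁ t₂, 0 < t₁ → t₁ ≤ t₂ → ENNReal.ofReal (1 / s) * moment N B u s t₂ +
      ENNReal.ofReal c * ∫⁻ t in Ioc t₁ t₂, moment N B u (s + δ) t ≤
        ENNReal.ofReal (1 / s) * moment N B u s t₁) {t : ℝ} (ht : 0 < t) :
    (moment N B u s t).toReal ≤ (2 ^ (1 + 1 / (δ / (s - s₀))) / (s * c)) ^ (1 / (δ / (s - s₀))) *
      (moment N B u s₀ 0).toReal * t ^ (-(1 / (δ / (s - s₀)))) := by
  have hs1 : 1 < s := hs₀.trans hs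
  have hs0 : 0 < s := by linarith
  have hss : 0 < s - s₀ := by linarith
  have ha : 0 < δ / (s - s₀) := by positivity
  set a := δ / (s - s₀) with had
  set A := (moment N B u s₀ 0).toReal with hA
  have hAa : 0 < A ^ a := by positivity
  have hcont := (hu s hs1).continuousOn_toReal_moment hs1
  have key := rpow_decay (y := fun t => (moment N B u s t).toReal) (κ := s * c / A ^ a) ha
    (by positivity) (fun _ _ => ENNReal.toReal_nonneg) ?_ ht
  · refine key.trans (le_of_eq ?_)
    congr 1
    -- The coefficient κ carries A^(-a); the power 1/a in the decay estimate turns this into a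
    -- factor linear in the initial moment A.
    have e : (2 : ℝ) ^ (1 + 1 / a) / (s * c / A ^ a) = 2 ^ (1 + 1 / a) / (s * c) * A ^ a := by
      field_simp
    rw [e, Real.mul_rpow (by positivity) hAa.le, ← Real.rpow_mul hpos.le,
      mul_one_div_cancel ha.ne', Real.rpow_one]
  · intro t₁ t₂ ht₁ h12
    rcases ht₁.eq_or_lt with rfl | ht₁
    · rcases h12.eq_or_lt with rfl | h12
      · simp
      -- The inequality is available only for positive initial times; t₁ = 0 follows by continuity
      -- of the moment.
      have h1 : Tendsto (fun t => (moment N B u s t).toReal) (𝓝[>] 0)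
          (𝓝 (moment N B u s 0).toReal) :=
        (hcont 0 self_mem_Ici).mono_left (nhdsWithin_mono _ Ioi_subset_Ici_self)
      have h2 : Tendsto (fun t₁ => (moment N B u s t₂).toReal + s * c / A ^ a * (t₂ - t₁) *
          (moment N B u s t₂).toReal ^ (1 + a)) (𝓝[>] 0) (𝓝 ((moment N B u s t₂).toReal +
            s * c / A ^ a * (t₂ - 0) * (moment N B u s t₂).toReal ^ (1 + a))) :=
        (Continuous.tendsto (by fun_prop) 0).mono_left nhdsWithin_le_nhds
      refine le_of_tendsto_of_tendsto h2 h1 ?_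
      filter_upwards [Ioc_mem_nhdsGT h12] with τ hτ
      exact toReal_moment_add_le hs₀ hs hδ hc hu h₀ hpos h hτ.1 hτ.2
    · exact toReal_moment_add_le hs₀ hs hδ hc hu h₀ hpos h ht₁ h12

theorem eLpNorm_eq_moment_rpow {r : ℝ} (hr : 0 < r) (t : ℝ) :
    eLpNorm (u t) (ENNReal.ofReal r) ((riemannianMeasure N M).restrict B) =
      moment N B u r t ^ (1 / r) := by
  rw [moment_eq_eLpNorm_rpow hr, ← ENNReal.rpow_mul, mul_one_div_cancel hr.ne', ENNReal.rpow_one]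

theorem eLpNorm_le_of_moment_add_le {s₀ s Cp : ℝ} (hm : 0 < m) (hp : 1 < p)
    (hmp : 1 < m * (p - 1)) (hs₀ : 1 < s₀) (hs : s₀ < s) (hCp : 0 < Cp)
    (hu : ∀ r, 1 < r → ContinuousInLp N r B u)
    (h₀ : ∀ t, 0 ≤ t → moment N B u s₀ t ≤ moment N B u s₀ 0)
    (h : ∀ t₁ t₂, 0 < t₁ → t₁ ≤ t₂ → ENNReal.ofReal (1 / s) * moment N B u s t₂ +
      ENNReal.ofReal (dissipationConst m p s / 2 * Cp ^ p) *
        ∫⁻ t in Ioc t₁ t₂, moment N B u (m * (p - 1) + s - 1) t ≤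
        ENNReal.ofReal (1 / s) * moment N B u s t₁) {t : ℝ} (ht : 0 < t) :
    eLpNorm (u t) (ENNReal.ofReal s) ((riemannianMeasure N M).restrict B) ≤
      ENNReal.ofReal (smoothingConst m p s₀ s Cp *
        t ^ (-(s₀ / (m * (p - 1) - 1) * (1 / s₀ - 1 / s)))) *
      eLpNorm (u 0) (ENNReal.ofReal s₀) ((riemannianMeasure N M).restrict B) ^ (s₀ / s) := by
  have hs1 : 1 < s := hs₀.trans hs
  have hs0 : 0 < s := by linarith
  have hs00 : 0 < s₀ := by linarith
  have hss : 0 < s - s₀ := by linarith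
  have hδ : 0 < m * (p - 1) - 1 := by linarith
  have hc : 0 < dissipationConst m p s / 2 * Cp ^ p := by
    have := dissipationConst_pos hm hp hs1
    positivity
  have hfin := (hu s₀ hs₀).moment_ne_top hs₀ le_rfl
  -- A vanishing initial moment is treated apart, because the general case divides by a power of it;
  -- here u(t) vanishes almost everywhere.
  rcases (ENNReal.toReal_nonneg (a := moment N B u s₀ 0)).eq_or_lt with hz | hpos
  · have hz' : moment N B u s₀ 0 = 0 :=
      ((ENNReal.toReal_eq_zero_iff _).1 hz.symm).resolve_right hfin
    have h1 : eLpNorm (u t) (ENNReal.ofReal s₀) ((riemannianMeasure N M).restrict B) = 0 := by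
      rw [eLpNorm_eq_moment_rpow hs00, le_antisymm ((h₀ t ht.le).trans hz'.le) zero_le,
        ENNReal.zero_rpow_of_pos (by positivity)]
    rw [eLpNorm_eq_zero_iff ((hu s₀ hs₀).1 t ht.le).1 (by simpa using hs00)] at h1
    rw [eLpNorm_congr_ae h1, eLpNorm_zero]
    exact zero_le
  have hδs : m * (p - 1) + s - 1 = s + (m * (p - 1) - 1) := by ring
  rw [hδs] at h
  have key := toReal_moment_le hs₀ hs hδ hc hu h₀ hpos h ht
  set δ := m * (p - 1) - 1 with hδd
  set A := (moment N B u s₀ 0).toReal with hA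
  set c := dissipationConst m p s / 2 * Cp ^ p with hcd
  have e0 : eLpNorm (u 0) (ENNReal.ofReal s₀) ((riemannianMeasure N M).restrict B) ^ (s₀ / s) =
      ENNReal.ofReal (A ^ (1 / s)) := by
    rw [eLpNorm_eq_moment_rpow hs00, ← ENNReal.rpow_mul, ← ENNReal.ofReal_rpow_of_pos hpos, hA,
      ENNReal.ofReal_toReal hfin]
    congr 1
    field_simp
  have e1 : eLpNorm (u t) (ENNReal.ofReal s) ((riemannianMeasure N M).restrict B) =
      ENNReal.ofReal ((moment N B u s t).toReal ^ (1 / s)) := by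
    rw [eLpNorm_eq_moment_rpow hs0, ← ENNReal.ofReal_rpow_of_nonneg ENNReal.toReal_nonneg
      (by positivity), ENNReal.ofReal_toReal ((hu s hs1).moment_ne_top hs1 ht.le)]
  rw [e0, e1, ← ENNReal.ofReal_mul (by unfold smoothingConst; positivity)]
  refine ENNReal.ofReal_le_ofReal ?_
  refine (Real.rpow_le_rpow ENNReal.toReal_nonneg key (by positivity)).trans (le_of_eq ?_)
  rw [Real.mul_rpow (by positivity) (by positivity), Real.mul_rpow (by positivity) hpos.le,
    ← Real.rpow_mul ht.le, smoothingConst, ← hδd, ← hcd]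
  -- The decay exponent of the moment, divided by s, is the exponent γ_s of the statement.
  have e2 : -(1 / (δ / (s - s₀))) * (1 / s) = -(s₀ / δ * (1 / s₀ - 1 / s)) := by
    field_simp
  rw [e2]
  ring

end Decay

/-! ### The smallness threshold -/

section Smallness

/-- The bound on the `qN/p`-th moment below which the source is absorbed by the dissipation of the
moments of orders `qN/p`, `s₀` and `s`. -/
def smallMoment (N : ℕ) (m p q s₀ s Sp Cp : ℝ) : ℝ :=
  (min (dissipationConst m p (q * N / p))
    (min (dissipationConst m p s₀) (dissipationConst m p s)) / 2 / absorptionConst m p q Sp Cp) ^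
      (1 / (p * (q - m * (p - 1)) / (q * N)))

theorem absorptionConst_pos {m p q Sp Cp : ℝ} (hSp : 0 < Sp) (hCp : 0 < Cp) :
    0 < absorptionConst m p q Sp Cp := by
  unfold absorptionConst; positivity

theorem smallMoment_pos {N : ℕ} {m p q s₀ s Sp Cp : ℝ} (hm : 0 < m) (hp : 1 < p)
    (hq : 1 < q * N / p) (hs₀ : 1 < s₀) (hs : 1 < s) (hSp : 0 < Sp) (hCp : 0 < Cp) :
    0 < smallMoment N m p q s₀ s Sp Cp := by
  have h1 := dissipationConst_pos hm hp hq
  have h2 := dissipationConst_pos hm hp hs₀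
  have h3 := dissipationConst_pos hm hp hs
  have h4 := absorptionConst_pos (m := m) (p := p) (q := q) hSp hCp
  unfold smallMoment
  have := lt_min h1 (lt_min h2 h3)
  positivity

theorem smallMoment_rpow_mul_le {N : ℕ} {m p q s₀ s Sp Cp c : ℝ} (hm : 0 < m) (hp : 1 < p)
    (hN : (0 : ℝ) < N) (hq0 : 0 < q) (hqm : m * (p - 1) < q)
    (hq : 1 < q * N / p) (hs₀ : 1 < s₀) (hs : 1 < s) (hSp : 0 < Sp) (hCp : 0 < Cp)
    (hc : min (dissipationConst m p (q * N / p))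
      (min (dissipationConst m p s₀) (dissipationConst m p s)) ≤ c) :
    ENNReal.ofReal (smallMoment N m p q s₀ s Sp Cp) ^ (p * (q - m * (p - 1)) / (q * N)) *
      ENNReal.ofReal (absorptionConst m p q Sp Cp) ≤ ENNReal.ofReal (c / 2) := by
  have h4 := absorptionConst_pos (m := m) (p := p) (q := q) hSp hCp
  have h5 := lt_min (dissipationConst_pos hm hp hq)
    (lt_min (dissipationConst_pos hm hp hs₀) (dissipationConst_pos hm hp hs))
  have h6 : 0 < q - m * (p - 1) := by linarith
  have hθ : 0 < p * (q - m * (p - 1)) / (q * N) := by positivity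
  rw [ENNReal.ofReal_rpow_of_pos (smallMoment_pos hm hp hq hs₀ hs hSp hCp),
    ← ENNReal.ofReal_mul (by have := smallMoment_pos (N := N) hm hp hq hs₀ hs hSp hCp; positivity)]
  refine ENNReal.ofReal_le_ofReal ?_
  rw [smallMoment, ← Real.rpow_mul (by positivity), one_div_mul_cancel hθ.ne', Real.rpow_one,
    div_mul_cancel₀ _ h4.ne']
  linarith

end Smallness

/-! ### The smoothing estimate for weak evolutions -/

section Smoothing

variable {p m q ε k K : ℝ} {B : Set M} {U u : ℝ → M → ℝ} {u₀ : M → ℝ}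
  {GU GV : ℝ → ∀ x : M, TangentSpace (𝓡 N) x}

/-- The smoothing estimate in terms of a weak evolution with a small initial `qN/p`-th moment. -/
theorem IsWeakEvolution.smoothing {s₀ s Sp Cp : ℝ}
    (h : IsWeakEvolution p m q ε k K B U GU GV u) (hp : 1 < p) (hm : 1 < m) (hpN : p < N)
    (hmp : 1 < m * (p - 1)) (hq : m * (p - 1) < q) (hε : 0 < ε) (hk : 0 < k) (hSp : 0 < Sp)
    (hCp : 0 < Cp) (hB : MeasurableSet B) (hS : SobolevInequality N M p Sp)
    (hP : PoincareInequality N M p Cp) (hu : ∀ r, 1 < r → ContinuousInLp N r B u)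
    (hs₀ : 1 < s₀) (hs : s₀ ≤ s)
    (hsmall : moment N B u (q * N / p) 0 < ENNReal.ofReal (smallMoment N m p q s₀ s Sp Cp))
    {t : ℝ} (ht : 0 < t) :
    eLpNorm (u t) (ENNReal.ofReal s) ((riemannianMeasure N M).restrict B) ≤
      ENNReal.ofReal ((if s₀ = s then 1 else smoothingConst m p s₀ s Cp) *
        t ^ (-(s₀ / (m * (p - 1) - 1) * (1 / s₀ - 1 / s)))) *
      eLpNorm (u 0) (ENNReal.ofReal s₀) ((riemannianMeasure N M).restrict B) ^ (s₀ / s) := by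
  have hm0 : 0 < m := by linarith
  have hp0 : 0 < p := by linarith
  have hN : (0 : ℝ) < N := by linarith
  have hq0 : 1 < q := by linarith
  have hs1 : 1 < s := hs₀.trans_le hs
  have hr : 1 < q * N / p := by
    rw [lt_div_iff₀ hp0]
    nlinarith
  have he := smallMoment_pos (N := N) hm0 hp hr hs₀ hs1 hSp hCp
  -- The threshold uses the least of three dissipation constants because this inequality is applied
  -- with r = qN/p for the barrier, r = s₀ for monotonicity, and r = s for decay.
  have hstep : ∀ r, 1 < r → min (dissipationConst m p (q * N / p))
      (min (dissipationConst m p s₀) (dissipationConst m p s)) ≤ dissipationConst m p r →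
      ∀ t₁ t₂, 0 < t₁ → t₁ ≤ t₂ → (∀ t ∈ Icc t₁ t₂, moment N B u (q * N / p) t ≤
        ENNReal.ofReal (smallMoment N m p q s₀ s Sp Cp)) →
      ENNReal.ofReal (1 / r) * moment N B u r t₂ +
        ENNReal.ofReal (dissipationConst m p r / 2 * Cp ^ p) *
          ∫⁻ t in Ioc t₁ t₂, moment N B u (m * (p - 1) + r - 1) t ≤
        ENNReal.ofReal (1 / r) * moment N B u r t₁ := fun r hr' hc t₁ t₂ ht₁ h12 hsm =>
    h.moment_add_le hp hm hpN hmp hq hε hk hSp hCp hB hS hP hu hr'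
      (smallMoment_rpow_mul_le hm0 hp hN (by linarith) hq hr hs₀ hs1 hSp hCp hc) ht₁ h12 hsm
  have hfin : ∀ t, 0 ≤ t → moment N B u (q * N / p) t ≠ ⊤ := fun t ht =>
    (hu _ hr).moment_ne_top hr ht
  -- With r = qN/p the inequality controls the very moment whose smallness it assumes, so the
  -- barrier argument closes.
  have hall : ∀ t, 0 ≤ t → moment N B u (q * N / p) t ≤
      ENNReal.ofReal (smallMoment N m p q s₀ s Sp Cp) := fun t ht => by
    rw [ENNReal.le_ofReal_iff_toReal_le (hfin t ht) he.le]
    refine (lt_of_continuousOn_of_le ((hu _ hr).continuousOn_toReal_moment hr)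
      ((ENNReal.lt_ofReal_iff_toReal_lt (hfin 0 le_rfl)).1 hsmall) ?_ ht).le
    intro t₁ t₂ ht₁ h12 hsm
    refine ENNReal.toReal_mono (hfin t₁ ht₁.le) ?_
    refine le_of_ofReal_mul_add_le (by positivity)
      (hstep _ hr (min_le_left _ _) t₁ t₂ ht₁ h12 fun τ hτ => ?_)
    rw [← ENNReal.ofReal_toReal (hfin τ (ht₁.le.trans hτ.1))]
    exact ENNReal.ofReal_le_ofReal (hsm τ hτ)
  have h₀ : ∀ t, 0 ≤ t → moment N B u s₀ t ≤ moment N B u s₀ 0 := fun t ht =>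
    (hu s₀ hs₀).moment_le_moment_zero hs₀ (fun t₁ t₂ ht₁ h12 =>
      le_of_ofReal_mul_add_le (by positivity) (hstep s₀ hs₀
        ((min_le_right _ _).trans (min_le_left _ _)) t₁ t₂ ht₁ h12
        fun τ hτ => hall τ (ht₁.le.trans hτ.1))) ht
  -- For s = s₀ the decay exponent is zero and the claim is monotonicity of the moment.
  rcases hs.eq_or_lt with rfl | hs
  · rw [if_pos rfl, sub_self, mul_zero, neg_zero, Real.rpow_zero, mul_one, ENNReal.ofReal_one,
      one_mul, div_self (by linarith), ENNReal.rpow_one, eLpNorm_eq_moment_rpow (by linarith),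
      eLpNorm_eq_moment_rpow (by linarith)]
    exact ENNReal.rpow_le_rpow (h₀ t ht.le) (by positivity)
  · rw [if_neg hs.ne]
    exact eLpNorm_le_of_moment_add_le hm0 hp hmp hs₀ hs hCp hu h₀ (fun t₁ t₂ ht₁ h12 =>
      hstep s hs1 ((min_le_right _ _).trans (min_le_right _ _)) t₁ t₂ ht₁ h12
        fun τ hτ => hall τ (ht₁.le.trans hτ.1)) ht

end Smoothing

end Geometry

end Leibenson

end

/-! ### Choice of the constants and conclusion -/

theorem proposition3p8 (N : ℕ) (m p s₀ s Sp Cp : ℝ)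
    (hm : 1 < m) (hp : 1 < p) (hpN : p < N) (hmp : 1 < m * (p - 1))
    (hs₀ : 1 < s₀) (hs : s₀ ≤ s) (hSp : 0 < Sp) (hCp : 0 < Cp) :
    ∃ C : ℝ, 0 < C ∧ ∀ q : ℝ, m * (p - 1) < q → ∃ ε₁ : ℝ, 0 < ε₁ ∧
      ∀ (M : Type*) [MetricSpace M] [CompleteSpace M] [NoncompactSpace M]
        [SecondCountableTopology M] [Nonempty M]
        [ChartedSpace (EuclideanSpace ℝ (Fin N)) M] [IsManifold (𝓡 N) ∞ M]
        [RiemannianBundle (fun x : M => TangentSpace (𝓡 N) x)]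
        [IsContMDiffRiemannianBundle (𝓡 N) ∞ (EuclideanSpace ℝ (Fin N))
          (fun x : M => TangentSpace (𝓡 N) x)]
        [IsRiemannianManifold (𝓡 N) M]
        [MeasurableSpace M] [BorelSpace M],
      Leibenson.riemannianMeasure N M univ = ⊤ →
      Leibenson.SobolevInequality N M p Sp →
      Leibenson.PoincareInequality N M p Cp →
      ∀ (x₀ : M) (R ε k : ℝ), 0 < R → 0 < ε → 0 < k →
      ∀ (u₀ : M → ℝ) (u : ℝ → M → ℝ),
      MemLp u₀ ∞ ((Leibenson.riemannianMeasure N M).restrict (Metric.ball x₀ R)) →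
      (∀ᵐ x ∂((Leibenson.riemannianMeasure N M).restrict (Metric.ball x₀ R)), 0 ≤ u₀ x) →
      Leibenson.IsSolution N m p q ε k (Metric.ball x₀ R) u₀ u →
      (∀ r : ℝ, 1 < r → Leibenson.ContinuousInLp N r (Metric.ball x₀ R) u) →
      eLpNorm u₀ (ENNReal.ofReal (q * N / p))
        ((Leibenson.riemannianMeasure N M).restrict (Metric.ball x₀ R)) < ENNReal.ofReal ε₁ →
      ∀ t : ℝ, 0 < t →
        eLpNorm (u t) (ENNReal.ofReal s)
            ((Leibenson.riemannianMeasure N M).restrict (Metric.ball x₀ R)) ≤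
          ENNReal.ofReal (C * t ^ (-(s₀ / (m * (p - 1) - 1) * (1 / s₀ - 1 / s)))) *
            eLpNorm u₀ (ENNReal.ofReal s₀)
              ((Leibenson.riemannianMeasure N M).restrict (Metric.ball x₀ R)) ^ (s₀ / s) := by
  have hm0 : 0 < m := by linarith
  have hs1 : 1 < s := hs₀.trans_le hs
  -- The constant is fixed before q is introduced. The case s₀ = s is separate because the general
  -- constant divides by s - s₀.
  refine ⟨if s₀ = s then 1 else Leibenson.smoothingConst m p s₀ s Cp, ?_, fun q hq => ?_⟩
  · have := Leibenson.dissipationConst_pos hm0 hp hs1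
    split_ifs
    · exact one_pos
    · unfold Leibenson.smoothingConst
      have : 0 < s := by linarith
      positivity
  have hq0 : 0 < q := by linarith
  have hN : (0 : ℝ) < N := by linarith
  have hr : 1 < q * N / p := by
    rw [lt_div_iff₀ (by linarith)]
    nlinarith
  have hr0 : 0 < q * N / p := by linarith
  have he := Leibenson.smallMoment_pos (N := N) hm0 hp hr hs₀ hs1 hSp hCp
  -- The threshold is a bound on the integral of u₀^(qN/p); its (qN/p)-th root is the corresponding
  -- bound on the norm.
  refine ⟨Leibenson.smallMoment N m p q s₀ s Sp Cp ^ (1 / (q * N / p)), by positivity, ?_⟩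
  intro M _ _ _ _ _ _ _ _ _ _ _ _ _ hS hP x₀ R ε k _ hε hk u₀ u hu₀ _ hsol hu hsmall t ht
  obtain ⟨⟨K, U, GU, GV, h⟩, h0⟩ := hsol.exists_isWeakEvolution Metric.isOpen_ball hp
    (hmp.trans hq) hε hk (hu 2 one_lt_two) hu₀
  -- Since u(0) = u₀ almost everywhere, both norms of u₀ may be replaced by those of u(0): smallness
  -- is read at t = 0 and the estimate starts there. Only the qN/p norm is rewritten in the
  -- hypothesis, only the s₀ norm in the goal.
  rw [← eLpNorm_congr_ae h0] at hsmall ⊢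
  refine h.smoothing hp hm hpN hmp hq hε hk hSp hCp Metric.isOpen_ball.measurableSet hS hP hu hs₀ hs
    ?_ ht
  rw [Leibenson.moment_eq_eLpNorm_rpow hr0]
  refine (ENNReal.rpow_lt_rpow hsmall hr0).trans_le (le_of_eq ?_)
  rw [ENNReal.ofReal_rpow_of_pos (by positivity), ← Real.rpow_mul he.le,
    one_div_mul_cancel hr0.ne', Real.rpow_one]
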